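/- An \emph{e-surface} is a compact oriented smooth surface $\Sigma$, possibly with boundary, with one marked point chosen on each boundary circle; $A(\Sigma)=\pi_0(\partial\Sigma)$ is its set of boundary components. A \emph{morphism} $\Sigma\to\Sigma$ is an orientation-preserving homeomorphism mapping marked points to marked points, and the mapping class group $\Gamma(\Sigma)$ is the group of homotopy classes of morphisms, homotopies being taken through morphisms. An \emph{isotopy} of $\Sigma$ moves objects on $\Sigma$ by morphisms that are homotopic to the identity through morphisms. For $n\ge 0$ the \emph{standard sphere} $S_{0,n}$ is the Riemann sphere with the discs $|z-k|<1/3$, $k=1,\dots,n$, removed, with marked points $k-i/3$. Its \emph{standard marking} $m_0$ is the star-shaped graph in the lower half-plane with one vertex $*$ joined by straight edges to the marked points $k-i/3$, $k=1,\dots,n$; the edge ending at the first boundary circle is distinguished ($m_0=\emptyset$ for $n=0$). A \emph{cut system} on $\Sigma$ is a finite set $C$ of disjoint simple closed curves (cuts) in the interior of $\Sigma$ such that each connected component of $\Sigma\setminus C$, completed to a compact surface with boundary by adding a copy of each cut for each of its sides on which the component lies, is homeomorphic to some $S_{0,n}$. A \emph{marking} $M=(C,m)$ of $\Sigma$ consists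 of a cut system $C$ and a graph $m$ on $\Sigma$ with some distinguished edges that crosses each cut in exactly one point and whose restriction to each completed component $\Sigma_a$ of $\Sigma\setminus C$ is of the form $\psi_a^{-1}(m_0)$, with its distinguished edge, for a homeomorphism $\psi_a\colon\Sigma_a\to S_{0,n_a}$ taking marked points to marked points (the marked point on a cut being the point where $m$ crosses it). Markings are considered modulo isotopy of $\Sigma$, and $\Gamma(\Sigma)$ acts on the isotopy classes of markings by $\varphi(C,m)=(\varphi(C),\varphi(m))$. \textbf{Theorem (rigidity).} Let $\Sigma$ be a connected e-surface, $\alpha\in A(\Sigma)$ a boundary component, and $M=(C,m)$ a marking of $\Sigma$. If $\varphi\in\Gamma(\Sigma)$ satisfies $\varphi(M)=M$ (as isotopy classes of markings) and $\varphi(\alpha)=\alpha$, then $\varphi=\mathrm{id}$ in $\Gamma(\Sigma)$. -/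

import Mathlib

open scoped Manifold ContDiff

noncomputable section

namespace ESurf

/-- The connected components of a subset `A` of a topological space. -/
def componentsOf {X : Type*} [TopologicalSpace X] (A : Set X) : Set (Set X) :=
  {W | ∃ x ∈ A, W = connectedComponentIn A x}

theorem image_mem_componentsOf {X : Type*} [TopologicalSpace X] (f : X ≃ₜ X) {A W : Set X} (h : W ∈ componentsOf A) :
    f '' W ∈ componentsOf (f '' A) := by
  obtain ⟨x, hx, rfl⟩ := h
  exact ⟨f x, ⟨x, hx, rfl⟩, f.image_connectedComponentIn hx⟩

theorem image_compl_sUnion {X : Type*} [TopologicalSpace X] (f : X ≃ₜ X) (C : Set (Set X)) :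
    f '' (⋃₀ C)ᶜ = (⋃₀ (Set.image f '' C))ᶜ := by
  rw [Set.image_compl_eq f.bijective, Set.image_sUnion]

/-- A component of the complement of `f(C)` is the image of a component of the complement
of `C`. -/
theorem exists_of_mem_componentsOf {X : Type*} [TopologicalSpace X] (f : X ≃ₜ X) {C : Set (Set X)} {W : Set X}
    (h : W ∈ componentsOf (⋃₀ (Set.image f '' C))ᶜ) :
    ∃ V ∈ componentsOf (⋃₀ C)ᶜ, W = f '' V := by
  obtain ⟨y, hy, rfl⟩ := h
  rw [← image_compl_sUnion] at hy ⊢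
  obtain ⟨x, hx, rfl⟩ := hy
  exact ⟨_, ⟨x, hx, rfl⟩, (f.image_connectedComponentIn hx).symm⟩

theorem image_sep_inter_nonempty {X : Type*} [TopologicalSpace X] (f : X ≃ₜ X) (E : Set (Set X)) (W : Set X) :
    {e ∈ Set.image f '' E | (e ∩ f '' W).Nonempty} =
      Set.image f '' {e ∈ E | (e ∩ W).Nonempty} := by
  ext e
  constructor
  · rintro ⟨⟨d, hd, rfl⟩, h⟩
    rw [← Set.image_inter f.injective, Set.image_nonempty] at h
    exact ⟨d, ⟨hd, h⟩, rfl⟩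
  · rintro ⟨d, ⟨hd, h⟩, rfl⟩
    refine ⟨⟨d, hd, rfl⟩, ?_⟩
    rw [← Set.image_inter f.injective, Set.image_nonempty]
    exact h

/-- An extended surface: a compact oriented smooth surface, possibly with boundary, with one marked
point on each boundary circle.  The orientation is given by the atlas: all its coordinate changes
have positive Jacobian determinant. -/
class ESurface (S : Type*) [TopologicalSpace S] [ChartedSpace (EuclideanHalfSpace 2) S] : Type _
    extends CompactSpace S, T2Space S, IsManifold (𝓡∂ 2) ∞ S where
  oriented : ∀ e ∈ atlas (EuclideanHalfSpace 2) S, ∀ e' ∈ atlas (EuclideanHalfSpace 2) S,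
    ∀ z ∈ ((e.extend (𝓡∂ 2)).symm.trans (e'.extend (𝓡∂ 2))).source,
      0 < (fderivWithin ℝ (e'.extend (𝓡∂ 2) ∘ (e.extend (𝓡∂ 2)).symm)
        (Set.range (𝓡∂ 2)) z).det
  marked : Set S
  marked_subset : marked ⊆ (𝓡∂ 2).boundary S
  existsUnique_marked : ∀ α ∈ componentsOf ((𝓡∂ 2).boundary S), ∃! p, p ∈ α ∧ p ∈ marked

section Morphisms

variable {S : Type*} [TopologicalSpace S] [ChartedSpace (EuclideanHalfSpace 2) S]

variable (S) in
/-- The set `A(S)` of boundary components of `S`. -/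
def boundaryComponents : Set (Set S) := componentsOf ((𝓡∂ 2).boundary S)

/-- The preferred chart at `x`, as a complex-valued coordinate. -/
def complexChart (x y : S) : ℂ :=
  ⟨extChartAt (𝓡∂ 2) x y 0, extChartAt (𝓡∂ 2) x y 1⟩

/-- In the preferred chart at `x`, the loop `γ` winds `k` times around `x`: the difference to `x`
has a continuous logarithm along `γ`, which increases by `2πik`. -/
def HasWinding (x : S) (γ : C(unitInterval, S)) (k : ℤ) : Prop :=
  ∃ L : C(unitInterval, ℂ), (∀ t, Complex.exp (L t) = complexChart x (γ t) - complexChart x x) ∧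
    L 1 - L 0 = 2 * Real.pi * Complex.I * k

/-- A homeomorphism preserves the orientation if near every point `x` it preserves the winding
numbers around `x` of small loops, i.e. if it has local degree `1`, computed in oriented charts.
(At a boundary point the condition is void, all winding numbers being zero.) -/
def PreservesOrientation (f : S ≃ₜ S) : Prop :=
  ∀ x, ∃ U ∈ nhds x, ∀ γ : C(unitInterval, S), Set.range γ ⊆ U \ {x} → γ 0 = γ 1 →
    ∀ k, HasWinding x γ k ↔ HasWinding (f x) ((f : C(S, S)).comp γ) k

theorem PreservesOrientation.one : PreservesOrientation (1 : S ≃ₜ S) := fun _ =>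
  ⟨Set.univ, Filter.univ_mem, fun _ _ _ _ => Iff.rfl⟩

theorem PreservesOrientation.mul {f g : S ≃ₜ S} (hf : PreservesOrientation f)
    (hg : PreservesOrientation g) : PreservesOrientation (f * g) := by
  intro x
  obtain ⟨U, hU, hgU⟩ := hg x
  obtain ⟨V, hV, hfV⟩ := hf (g x)
  refine ⟨U ∩ g ⁻¹' V, Filter.inter_mem hU (g.continuous.continuousAt hV), ?_⟩
  intro γ hγ h01 k
  rw [hgU γ (fun y hy => ⟨(hγ hy).1.1, (hγ hy).2⟩) h01 k]
  refine hfV ((g : C(S, S)).comp γ) ?_ (congrArg g h01) k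
  rintro _ ⟨t, rfl⟩
  have ht := hγ ⟨t, rfl⟩
  exact ⟨ht.1.2, fun h => ht.2 (g.injective h)⟩

theorem PreservesOrientation.inv {f : S ≃ₜ S} (hf : PreservesOrientation f) :
    PreservesOrientation f⁻¹ := by
  intro x
  obtain ⟨U, hU, hfU⟩ := hf (f⁻¹ x)
  have hx : ∀ y, f (f⁻¹ y) = y := fun y => f.apply_symm_apply y
  refine ⟨(f⁻¹ : S ≃ₜ S) ⁻¹' U, (f⁻¹).continuous.continuousAt hU, ?_⟩
  intro γ hγ h01 k
  have := hfU (((f⁻¹ : S ≃ₜ S) : C(S, S)).comp γ) ?_ (congrArg (f⁻¹ : S ≃ₜ S) h01) k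
  · rw [this, hx]
    have h : (f : C(S, S)).comp (((f⁻¹ : S ≃ₜ S) : C(S, S)).comp γ) = γ := by
      ext t
      exact hx _
    rw [h]
  · rintro _ ⟨t, rfl⟩
    have ht := hγ ⟨t, rfl⟩
    exact ⟨ht.1, fun h => ht.2 ((f⁻¹).injective h)⟩

theorem HasWinding.unique {x : S} {γ : C(unitInterval, S)} {k l : ℤ} (hk : HasWinding x γ k)
    (hl : HasWinding x γ l) : k = l := by
  obtain ⟨L, hL, hL'⟩ := hk
  obtain ⟨K, hK, hK'⟩ := hl
  have h : ∀ t, ∃ n : ℤ, L t = K t + n * (2 * Real.pi * Complex.I) := fun t =>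
    Complex.exp_eq_exp_iff_exists_int.1 ((hL t).trans (hK t).symm)
  choose n hn using h
  have hpi : (2 * Real.pi * Complex.I : ℂ) ≠ 0 := Complex.two_pi_I_ne_zero
  have hn' : ∀ t, ((n t : ℤ) : ℝ) = ((L t - K t) / (2 * Real.pi * Complex.I)).re := by
    intro t
    rw [hn t, add_sub_cancel_left, mul_div_cancel_right₀ _ hpi, Complex.intCast_re]
  have hc : Continuous n := by
    rw [Int.isClosedEmbedding_coe_real.isEmbedding.continuous_iff]
    have : ((fun m : ℤ => (m : ℝ)) ∘ n) =
        fun t => ((L t - K t) / (2 * Real.pi * Complex.I)).re := funext hn'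
    rw [this]
    fun_prop
  have h01 : n 0 = n 1 := PreconnectedSpace.constant inferInstance hc
  have e1 := hn 1
  have e0 := hn 0
  rw [h01] at e0
  have : (2 * Real.pi * Complex.I) * ((k : ℂ) - l) = 0 := by
    linear_combination hK' - hL' + e1 - e0
  have := (mul_eq_zero.1 this).resolve_left hpi
  exact_mod_cast sub_eq_zero.1 this

theorem exists_hasWinding_one {x : S} (hx : x ∈ (𝓡∂ 2).interior S) {U : Set S} (hU : U ∈ nhds x) :
    ∃ γ : C(unitInterval, S), Set.range γ ⊆ U \ {x} ∧ γ 0 = γ 1 ∧ HasWinding x γ 1 := by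
  set e := extChartAt (𝓡∂ 2) x with he
  have hT : e.target ∈ nhds (e x) := by
    have h := extChartAt_target_mem_nhdsWithin (I := 𝓡∂ 2) x
    rwa [nhdsWithin_eq_nhds.2 (mem_interior_iff_mem_nhds.1 hx)] at h
  have hV : e.target ∩ e.symm ⁻¹' U ∈ nhds (e x) :=
    Filter.inter_mem hT (ContinuousAt.preimage_mem_nhds
      (continuousAt_extChartAt_symm (I := 𝓡∂ 2) x) (by rwa [he, extChartAt_to_inv]))
  obtain ⟨r, hr, hball⟩ := Metric.nhds_basis_closedBall.mem_iff.1 hV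
  let c : unitInterval → EuclideanSpace ℝ (Fin 2) := fun t =>
    e x + r • !₂[Real.cos (2 * Real.pi * t), Real.sin (2 * Real.pi * t)]
  have hc : Continuous c := by
    refine continuous_const.add (Continuous.const_smul ?_ r)
    refine (PiLp.continuous_toLp 2 _).comp (continuous_pi fun i => ?_)
    fin_cases i
    · exact Real.continuous_cos.comp (continuous_const.mul continuous_subtype_val)
    · exact Real.continuous_sin.comp (continuous_const.mul continuous_subtype_val)
  have hcb : ∀ t, c t ∈ Metric.closedBall (e x) r := by
    intro t
    simp [c, EuclideanSpace.norm_eq, Fin.sum_univ_two, norm_smul, abs_of_pos hr]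
  have hct : ∀ t, e (e.symm (c t)) = c t := fun t => e.right_inv (hball (hcb t)).1
  have hγ : Continuous fun t => e.symm (c t) :=
    (continuousOn_extChartAt_symm (I := 𝓡∂ 2) x).comp_continuous hc fun t => (hball (hcb t)).1
  have hw : ∀ t : unitInterval, complexChart x (e.symm (c t)) - complexChart x x =
      Complex.exp (Real.log r + 2 * Real.pi * Complex.I * (t : ℝ)) := by
    intro t
    rw [Complex.exp_add, ← Complex.ofReal_exp, Real.exp_log hr]
    have : (2 * Real.pi * Complex.I * (t : ℝ) : ℂ) = ((2 * Real.pi * t : ℝ) : ℂ) * Complex.I := by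
      push_cast; ring
    rw [this]
    unfold complexChart
    rw [← he, hct]
    apply Complex.ext
    · simp [c, Complex.exp_ofReal_mul_I_re, -Complex.ofReal_mul]
    · simp [c, Complex.exp_ofReal_mul_I_im, -Complex.ofReal_mul]
  refine ⟨⟨fun t => e.symm (c t), hγ⟩, ?_, ?_, ?_⟩
  · rintro _ ⟨t, rfl⟩
    refine ⟨(hball (hcb t)).2, fun h => ?_⟩
    have h' := hw t
    simp only [ContinuousMap.coe_mk, Set.mem_singleton_iff] at h
    rw [h, sub_self] at h'
    exact Complex.exp_ne_zero _ h'.symm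
  · simp [c]
  · refine ⟨⟨fun t => Real.log r + 2 * Real.pi * Complex.I * (t : ℝ), by fun_prop⟩, ?_, ?_⟩
    · intro t
      exact (hw t).symm
    · simp

theorem PreservesOrientation.mem_interior {f : S ≃ₜ S} (hf : PreservesOrientation f) {x : S}
    (hx : x ∈ (𝓡∂ 2).interior S) : f x ∈ (𝓡∂ 2).interior S := by
  by_contra hfx
  rw [← Set.mem_compl_iff, ModelWithCorners.compl_interior] at hfx
  obtain ⟨U, hU, hγU⟩ := hf x
  obtain ⟨γ, hγ, h01, h1⟩ := exists_hasWinding_one hx hU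
  have h1' := (hγU γ hγ h01 1).1 h1
  have h0 : HasWinding (f x) ((f : C(S, S)).comp γ) 0 := by
    obtain ⟨L, hL, -⟩ := h1'
    have hs : ∀ t, Complex.exp (L t) ∈ Complex.slitPlane := by
      intro t
      have hne := Complex.exp_ne_zero (L t)
      have hre : 0 ≤ (Complex.exp (L t)).re := by
        rw [hL]
        have h2 : extChartAt (𝓡∂ 2) (f x) (f x) 0 = 0 := by
          have h3 : extChartAt (𝓡∂ 2) (f x) (f x) ∈ frontier (Set.range (𝓡∂ 2)) := hfx
          rw [frontier_range_modelWithCornersEuclideanHalfSpace] at h3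
          exact h3.symm
        simp only [complexChart, Complex.sub_re, h2, sub_zero]
        exact (chartAt (EuclideanHalfSpace 2) (f x) _).2
      rcases hre.lt_or_eq with h | h
      · exact Or.inl h
      · exact Or.inr fun him => hne (Complex.ext h.symm him)
    refine ⟨⟨fun t => Complex.log (Complex.exp (L t)), ?_⟩, ?_, ?_⟩
    · exact Continuous.clog (by fun_prop) hs
    · intro t
      simp only [ContinuousMap.coe_mk]
      rw [Complex.exp_log (Complex.exp_ne_zero _), hL]
    · simp only [ContinuousMap.coe_mk, hL]
      simp [h01]
  exact one_ne_zero (h1'.unique h0)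

theorem PreservesOrientation.image_boundary {f : S ≃ₜ S} (hf : PreservesOrientation f) :
    f '' (𝓡∂ 2).boundary S = (𝓡∂ 2).boundary S := by
  have h : ∀ {g : S ≃ₜ S}, PreservesOrientation g →
      g '' (𝓡∂ 2).boundary S ⊆ (𝓡∂ 2).boundary S := by
    rintro g hg _ ⟨x, hx, rfl⟩
    rw [← ModelWithCorners.compl_interior] at hx ⊢
    intro hgx
    exact hx (by simpa using hg.inv.mem_interior hgx)
  refine (h hf).antisymm fun x hx => ⟨f⁻¹ x, h hf.inv ⟨x, hx, rfl⟩, f.apply_symm_apply x⟩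

variable (S) in
/-- The group of morphisms of an e-surface to itself: orientation-preserving homeomorphisms that
map marked points to marked points. -/
def Mor [ESurface S] : Subgroup (S ≃ₜ S) where
  carrier := {f | PreservesOrientation f ∧ f '' ESurface.marked = ESurface.marked}
  one_mem' := ⟨PreservesOrientation.one, Set.image_id _⟩
  mul_mem' := by
    rintro f g ⟨hf, hf'⟩ ⟨hg, hg'⟩
    refine ⟨hf.mul hg, ?_⟩
    change f ∘ g '' _ = _
    rw [Set.image_comp, hg', hf']
  inv_mem' := by
    rintro f ⟨hf, hf'⟩
    refine ⟨hf.inv, ?_⟩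
    conv_lhs => rw [← hf']
    rw [← Set.image_comp]
    convert Set.image_id _
    ext x
    exact f.symm_apply_apply x

variable [ESurface S]

/-- A self-map of an e-surface that is a morphism. -/
def IsMor (f : C(S, S)) : Prop := ∃ g : Mor S, (g : S ≃ₜ S) = f

theorem isotopic_comp_left (g : Mor S) {f f' : C(S, S)}
    (h : f.HomotopicWith f' IsMor) :
    (((g : S ≃ₜ S) : C(S, S)).comp f).HomotopicWith (((g : S ≃ₜ S) : C(S, S)).comp f') IsMor := by
  obtain ⟨F⟩ := h
  refine ⟨⟨⟨((g : S ≃ₜ S) : C(S, S)).comp F.toContinuousMap, ?_, ?_⟩, ?_⟩⟩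
  · intro x
    exact congrArg (g : S ≃ₜ S) (F.apply_zero x)
  · intro x
    exact congrArg (g : S ≃ₜ S) (F.apply_one x)
  · intro t
    obtain ⟨k, hk⟩ := F.prop t
    refine ⟨g * k, ?_⟩
    ext x
    exact congrArg (g : S ≃ₜ S) (DFunLike.congr_fun hk x)

theorem isotopic_comp_right (g : Mor S) {f f' : C(S, S)}
    (h : f.HomotopicWith f' IsMor) :
    (f.comp ((g : S ≃ₜ S) : C(S, S))).HomotopicWith (f'.comp ((g : S ≃ₜ S) : C(S, S))) IsMor := by
  obtain ⟨F⟩ := h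
  refine ⟨⟨⟨F.toContinuousMap.comp
    ((ContinuousMap.id unitInterval).prodMap ((g : S ≃ₜ S) : C(S, S))), ?_, ?_⟩, ?_⟩⟩
  · intro x
    exact F.apply_zero _
  · intro x
    exact F.apply_one _
  · intro t
    obtain ⟨k, hk⟩ := F.prop t
    refine ⟨k * g, ?_⟩
    ext x
    exact DFunLike.congr_fun hk ((g : S ≃ₜ S) x)

variable (S) in
/-- The subgroup of morphisms that are homotopic to the identity through morphisms. -/
def isotopicToId : Subgroup (Mor S) where
  carrier := {f | ((f : S ≃ₜ S) : C(S, S)).HomotopicWith (ContinuousMap.id S) IsMor}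
  one_mem' := ContinuousMap.HomotopicWith.refl _ ⟨1, rfl⟩
  mul_mem' := by
    intro f g hf hg
    exact (isotopic_comp_left f hg).trans hf
  inv_mem' := by
    intro f hf
    have h := isotopic_comp_left f⁻¹ hf
    have e : (((f⁻¹ : Mor S) : S ≃ₜ S) : C(S, S)).comp ((f : S ≃ₜ S) : C(S, S)) =
        ContinuousMap.id S := by
      ext x
      exact (f : S ≃ₜ S).symm_apply_apply x
    rw [e] at h
    exact h.symm

instance : (isotopicToId S).Normal where
  conj_mem := by
    intro f hf g
    have h := isotopic_comp_right g⁻¹ (isotopic_comp_left g hf)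
    have e : (((g : S ≃ₜ S) : C(S, S)).comp (ContinuousMap.id S)).comp
        (((g⁻¹ : Mor S) : S ≃ₜ S) : C(S, S)) = ContinuousMap.id S := by
      ext x
      exact (g : S ≃ₜ S).apply_symm_apply x
    rw [e] at h
    exact h

variable (S) in
/-- The mapping class group `Γ(S)`: homotopy classes of morphisms, where homotopies run through
morphisms. -/
abbrev MappingClassGroup : Type _ := Mor S ⧸ isotopicToId S

theorem Mor.image_mem_boundaryComponents (φ : Mor S) {α : Set S} (h : α ∈ boundaryComponents S) :
    (φ : S ≃ₜ S) '' α ∈ boundaryComponents S := by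
  have := image_mem_componentsOf (φ : S ≃ₜ S) h
  rwa [φ.2.1.image_boundary] at this

theorem Mor.image_mem_boundaryComponents_iff (φ : Mor S) {α : Set S} :
    (φ : S ≃ₜ S) '' α ∈ boundaryComponents S ↔ α ∈ boundaryComponents S := by
  refine ⟨fun h => ?_, Mor.image_mem_boundaryComponents φ⟩
  have := Mor.image_mem_boundaryComponents φ⁻¹ h
  rw [← Set.image_comp] at this
  convert this
  symm
  convert Set.image_id _
  ext x
  exact (φ : S ≃ₜ S).symm_apply_apply x

theorem image_eq_of_mem_isotopicToId {φ : Mor S} (hφ : φ ∈ isotopicToId S) {α : Set S}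
    (hα : α ∈ boundaryComponents S) : (φ : S ≃ₜ S) '' α = α := by
  obtain ⟨F⟩ := hφ
  obtain ⟨x, hx, rfl⟩ := hα
  have hF : ∀ t, F (t, x) ∈ (𝓡∂ 2).boundary S := by
    intro t
    obtain ⟨g, hg⟩ := F.prop t
    have h : (g : S ≃ₜ S) x = F (t, x) := DFunLike.congr_fun hg x
    rw [← h, ← g.2.1.image_boundary]
    exact ⟨x, hx, rfl⟩
  have hc : Continuous fun t => F (t, x) := F.continuous.comp (by fun_prop)
  have hφx : (φ : S ≃ₜ S) x ∈ connectedComponentIn ((𝓡∂ 2).boundary S) x :=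
    (isPreconnected_range hc).subset_connectedComponentIn ⟨1, F.apply_one x⟩
      (Set.range_subset_iff.2 hF) ⟨0, F.apply_zero x⟩
  rw [(φ : S ≃ₜ S).image_connectedComponentIn hx, φ.2.1.image_boundary,
    connectedComponentIn_eq hφx]

instance : MulAction (Mor S) (boundaryComponents S) where
  smul φ α := ⟨(φ : S ≃ₜ S) '' α, Mor.image_mem_boundaryComponents φ α.2⟩
  one_smul α := Subtype.ext (Set.image_id (α : Set S))
  mul_smul φ ψ α := Subtype.ext (Set.image_comp (φ : S ≃ₜ S) (ψ : S ≃ₜ S) (α : Set S))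

theorem smul_boundaryComponent_eq {φ ψ : Mor S} (h : (φ : MappingClassGroup S) = ψ)
    (α : boundaryComponents S) : φ • α = ψ • α := by
  have h' : (φ⁻¹ * ψ) • α = α :=
    Subtype.ext (image_eq_of_mem_isotopicToId (QuotientGroup.eq.1 h) α.2)
  rw [mul_smul, inv_smul_eq_iff] at h'
  exact h'.symm

/-- The action of the mapping class group on the set of boundary components, by
`α ↦ φ(α)` for any representative `φ`. -/
instance : MulAction (MappingClassGroup S) (boundaryComponents S) where
  smul φ α := Quotient.liftOn' φ (fun f => f • α) fun _ _ hf =>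
    smul_boundaryComponent_eq (Quotient.eq''.2 hf) α
  one_smul α := one_smul (Mor S) α
  mul_smul φ ψ α := by
    induction φ using Quotient.inductionOn'
    induction ψ using Quotient.inductionOn'
    exact mul_smul (α := Mor S) _ _ _

end Morphisms

section StandardSphere

/-- The standard sphere `S_{0,n}`: the Riemann sphere with the discs `|z - k| < 1/3`, `1 ≤ k ≤ n`,
removed.  The index `k : Fin n` stands for the number `k + 1`. -/
def StdSphere (n : ℕ) : Set (OnePoint ℂ) :=
  {z | ∀ w : ℂ, z = w → ∀ k : Fin n, 1 / 3 ≤ ‖w - (k + 1)‖}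

/-- The boundary circles of the standard sphere. -/
def stdCircle (n : ℕ) (k : Fin n) : Set (StdSphere n) :=
  {z | ∃ w : ℂ, (z : OnePoint ℂ) = w ∧ ‖w - (k + 1)‖ = 1 / 3}

/-- The marked points `k - i/3` of the standard sphere. -/
def stdMarked (n : ℕ) (k : Fin n) : StdSphere n :=
  ⟨((k + 1 - Complex.I / 3 : ℂ) : OnePoint ℂ), by
    intro w hw j
    rw [← OnePoint.coe_injective hw]
    refine le_trans ?_ (Complex.abs_im_le_norm _)
    norm_num⟩

/-- The edges of the standard marking `m₀`: segments in the lower half-plane from the vertex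
`* = (n + 1)/2 - i` to the marked points.  The edge with `k = 0`, to the first boundary component,
is the distinguished one.  For `n = 0` there are no edges. -/
def stdEdge (n : ℕ) (k : Fin n) : Set (StdSphere n) :=
  {z | ∃ w ∈ segment ℝ (((n : ℂ) + 1) / 2 - Complex.I) (k + 1 - Complex.I / 3),
    (z : OnePoint ℂ) = w}

end StandardSphere

section Markings

variable {S : Type*} [TopologicalSpace S] [ChartedSpace (EuclideanHalfSpace 2) S] [ESurface S]

/-- Let `W` be a connected component of the complement of the cuts in `C`.  The surface obtained
from `W` by adding a copy of a cut for every side of the cut on which `W` lies is identified with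
the standard sphere by a homeomorphism `ψ`; `χ` is the inverse of `ψ` followed by the map to `S`
that glues the copies of the cuts back.  So `χ` maps every boundary circle bijectively either to a
boundary component of `S` or to a cut, and apart from the circles over cuts it is a bijection
(by compactness, a homeomorphism) to `W`.  Marked points on the boundary of `S` correspond to
marked points of the standard sphere. -/
structure IsPiece (C : Set (Set S)) (W : Set S) (n : ℕ) (χ : StdSphere n → S) : Prop where
  continuous : Continuous χ
  mem_of_notMem_circle : ∀ z, (∀ k, z ∉ stdCircle n k) → χ z ∈ W
  injOn_circle : ∀ k, Set.InjOn χ (stdCircle n k)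
  image_circle : ∀ k, χ '' stdCircle n k ∈ boundaryComponents S ∨ χ '' stdCircle n k ∈ C
  injOn : Set.InjOn χ (χ ⁻¹' W)
  subset_range : W ⊆ Set.range χ
  marked : ∀ k, χ '' stdCircle n k ∈ boundaryComponents S → χ (stdMarked n k) ∈ ESurface.marked

/-- A cut system: finitely many disjoint simple closed curves in the interior of `S`, such that
every connected component of the complement is a surface of genus zero, i.e. a standard sphere.
The curves need not be smooth, since morphisms are homeomorphisms, under which the image of a
smooth curve need not be smooth. -/
structure IsCutSystem (C : Set (Set S)) : Prop where
  finite : C.Finite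
  circle : ∀ c ∈ C, Nonempty (c ≃ₜ Circle)
  interior : ∀ c ∈ C, c ⊆ (𝓡∂ 2).interior S
  disjoint : C.PairwiseDisjoint id
  genus_zero : ∀ W ∈ componentsOf (⋃₀ C)ᶜ, ∃ (n : ℕ) (χ : StdSphere n → S), IsPiece C W n χ

variable (S) in
/-- A marking `(C, m)` of `S`: a cut system `C` and a graph `m` that gives a marking without cuts
`ψ⁻¹(m₀)` of each component of the complement of `C`.  The graph is recorded by the set `edges` of
its edges as they appear in the components (an edge crossing a cut is divided by the cut into two
such edges), and `arrows` is the set of the distinguished ones. -/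
@[ext]
structure Marking where
  cuts : Set (Set S)
  edges : Set (Set S)
  arrows : Set (Set S)
  isCutSystem : IsCutSystem cuts
  marking_component : ∀ W ∈ componentsOf (⋃₀ cuts)ᶜ, ∃ (n : ℕ) (χ : StdSphere n → S),
    IsPiece cuts W n χ ∧
    {e ∈ edges | (e ∩ W).Nonempty} = {e | ∃ k, e = χ '' stdEdge n k} ∧
    {e ∈ arrows | (e ∩ W).Nonempty} = {e | ∃ k : Fin n, (k : ℕ) = 0 ∧ e = χ '' stdEdge n k}
  edge_meets : ∀ e ∈ edges ∪ arrows, ¬ e ⊆ ⋃₀ cuts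
  /-- The graph crosses every cut in one point, so the edges on both sides fit together. -/
  crossing : ∀ c ∈ cuts, ∃! p, p ∈ c ∧ p ∈ ⋃₀ edges

theorem IsPiece.image (φ : Mor S) {C : Set (Set S)} {W : Set S} {n : ℕ} {χ : StdSphere n → S}
    (h : IsPiece C W n χ) :
    IsPiece (Set.image (φ : S ≃ₜ S) '' C) ((φ : S ≃ₜ S) '' W) n ((φ : S ≃ₜ S) ∘ χ) where
  continuous := (φ : S ≃ₜ S).continuous.comp h.continuous
  mem_of_notMem_circle z hz := ⟨_, h.mem_of_notMem_circle z hz, rfl⟩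
  injOn_circle k := (φ : S ≃ₜ S).injective.comp_injOn (h.injOn_circle k)
  image_circle k := by
    rw [Set.image_comp]
    exact (h.image_circle k).imp (Mor.image_mem_boundaryComponents φ) fun hk => ⟨_, hk, rfl⟩
  injOn := by
    rw [Set.preimage_comp, Set.preimage_image_eq _ (φ : S ≃ₜ S).injective]
    exact (φ : S ≃ₜ S).injective.comp_injOn h.injOn
  subset_range := by
    rw [Set.range_comp]
    exact Set.image_mono h.subset_range
  marked k hk := by
    rw [Set.image_comp, Mor.image_mem_boundaryComponents_iff] at hk
    rw [← φ.2.2]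
    exact ⟨_, h.marked k hk, rfl⟩

theorem IsCutSystem.image (φ : Mor S) {C : Set (Set S)} (h : IsCutSystem C) :
    IsCutSystem (Set.image (φ : S ≃ₜ S) '' C) where
  finite := h.finite.image _
  circle := by
    rintro _ ⟨c, hc, rfl⟩
    exact ⟨((φ : S ≃ₜ S).image c).symm.trans (h.circle c hc).some⟩
  interior := by
    rintro _ ⟨c, hc, rfl⟩ _ ⟨x, hx, rfl⟩
    exact φ.2.1.mem_interior (h.interior c hc hx)
  disjoint := by
    rintro _ ⟨c, hc, rfl⟩ _ ⟨d, hd, rfl⟩ hcd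
    have : c ≠ d := fun e => hcd (by rw [e])
    exact (Set.disjoint_image_iff (φ : S ≃ₜ S).injective).2 (h.disjoint hc hd this)
  genus_zero := by
    intro W hW
    obtain ⟨V, hV, rfl⟩ := exists_of_mem_componentsOf _ hW
    obtain ⟨n, χ, hχ⟩ := h.genus_zero V hV
    exact ⟨n, _, hχ.image φ⟩

/-- The marking `φ(C, m) = (φ(C), φ(m))`. -/
def Marking.map (φ : Mor S) (M : Marking S) : Marking S where
  cuts := Set.image (φ : S ≃ₜ S) '' M.cuts
  edges := Set.image (φ : S ≃ₜ S) '' M.edges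
  arrows := Set.image (φ : S ≃ₜ S) '' M.arrows
  isCutSystem := M.isCutSystem.image φ
  marking_component := by
    intro W hW
    obtain ⟨V, hV, rfl⟩ := exists_of_mem_componentsOf _ hW
    obtain ⟨n, χ, hχ, he, ha⟩ := M.marking_component V hV
    refine ⟨n, _, hχ.image φ, ?_, ?_⟩
    · rw [image_sep_inter_nonempty, he]
      ext e
      constructor
      · rintro ⟨_, ⟨k, rfl⟩, rfl⟩
        exact ⟨k, (Set.image_comp _ _ _).symm⟩
      · rintro ⟨k, rfl⟩
        exact ⟨_, ⟨k, rfl⟩, (Set.image_comp _ _ _).symm⟩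
    · rw [image_sep_inter_nonempty, ha]
      ext e
      constructor
      · rintro ⟨_, ⟨k, hk, rfl⟩, rfl⟩
        exact ⟨k, hk, (Set.image_comp _ _ _).symm⟩
      · rintro ⟨k, hk, rfl⟩
        exact ⟨_, ⟨k, hk, rfl⟩, (Set.image_comp _ _ _).symm⟩
  edge_meets := by
    intro e he
    rw [← Set.image_union] at he
    obtain ⟨d, hd, rfl⟩ := he
    rw [← Set.image_sUnion, Set.image_subset_image_iff (φ : S ≃ₜ S).injective]
    exact M.edge_meets d hd
  crossing := by
    rintro _ ⟨c, hc, rfl⟩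
    obtain ⟨p, ⟨hpc, hpe⟩, hp⟩ := M.crossing c hc
    rw [← Set.image_sUnion]
    refine ⟨(φ : S ≃ₜ S) p, ⟨⟨p, hpc, rfl⟩, ⟨p, hpe, rfl⟩⟩, ?_⟩
    rintro _ ⟨⟨q, hq, rfl⟩, ⟨q', hq', hqq⟩⟩
    rw [(φ : S ≃ₜ S).injective hqq] at hq'
    rw [hp q ⟨hq, hq'⟩]

theorem image_image_one (E : Set (Set S)) : Set.image ((1 : Mor S) : S ≃ₜ S) '' E = E := by
  have : Set.image ((1 : Mor S) : S ≃ₜ S) = id := funext fun e => Set.image_id e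
  rw [this, Set.image_id]

theorem image_image_mul (φ ψ : Mor S) (E : Set (Set S)) :
    Set.image ((φ * ψ : Mor S) : S ≃ₜ S) '' E =
      Set.image (φ : S ≃ₜ S) '' (Set.image (ψ : S ≃ₜ S) '' E) := by
  have : Set.image ((φ * ψ : Mor S) : S ≃ₜ S) =
      Set.image (φ : S ≃ₜ S) ∘ Set.image (ψ : S ≃ₜ S) :=
    funext fun e => Set.image_comp (φ : S ≃ₜ S) (ψ : S ≃ₜ S) e
  rw [this, Set.image_comp]

instance : MulAction (Mor S) (Marking S) where
  smul := Marking.map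
  one_smul _ := Marking.ext (image_image_one _) (image_image_one _) (image_image_one _)
  mul_smul φ ψ _ :=
    Marking.ext (image_image_mul φ ψ _) (image_image_mul φ ψ _) (image_image_mul φ ψ _)

variable (S) in
/-- The set `M(S)` of markings modulo isotopy of `S`. -/
abbrev MarkingClass : Type _ := MulAction.orbitRel.Quotient (isotopicToId S) (Marking S)

/-- The isotopy class of a marking. -/
def Marking.toClass (M : Marking S) : MarkingClass S := Quotient.mk'' M

theorem toClass_smul_eq {φ ψ : Mor S} {M N : Marking S}
    (h : (φ : MappingClassGroup S) = ψ) (hM : M.toClass = N.toClass) :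
    (φ • M).toClass = (ψ • N).toClass := by
  obtain ⟨n, rfl⟩ := MulAction.orbitRel_apply.1 (Quotient.eq''.1 hM)
  refine Quotient.eq''.2 (MulAction.orbitRel_apply.2 ⟨⟨φ * n * ψ⁻¹, ?_⟩, ?_⟩)
  · rw [← QuotientGroup.eq_one_iff, QuotientGroup.mk_mul, QuotientGroup.mk_mul, h,
      (QuotientGroup.eq_one_iff (n : Mor S)).2 n.2, QuotientGroup.mk_inv]
    simp
  · change (φ * n * ψ⁻¹) • ψ • N = φ • (n : Mor S) • N
    rw [smul_smul, smul_smul, inv_mul_cancel_right]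

/-- The action of the mapping class group on the set of isotopy classes of markings. -/
instance : MulAction (MappingClassGroup S) (MarkingClass S) where
  smul φ M := Quotient.liftOn₂' φ M (fun f N => (f • N).toClass) fun f N f' N' hf hN =>
    toClass_smul_eq (Quotient.eq''.2 hf) (Quotient.eq''.2 hN)
  one_smul M := by
    induction M using Quotient.inductionOn'
    exact congrArg Marking.toClass (one_smul (Mor S) _)
  mul_smul φ ψ M := by
    induction M using Quotient.inductionOn'
    induction φ using Quotient.inductionOn'
    induction ψ using Quotient.inductionOn'
    exact congrArg Marking.toClass (mul_smul (α := Mor S) _ _ _)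

end Markings

end ESurf

end

open scoped Manifold ContDiff

noncomputable section

/-! Changing a representative of the mapping class by an isotopy, one may assume that a morphism `g`
preserves the marking itself; it still maps the given boundary component to itself. Cut along the
cuts and along the graph, the surface falls into polygons, one for each component of the complement
of the cuts: the sides of a polygon are the edges of the star, each occurring twice, and the circles
of the piece, each opened at its marked point (`exists_isPolygon`, `exists_cell`). A component
without circles would be a closed sphere and the whole surface; the given boundary component
excludes this.

If `g` preserves a component, it lifts to a homeomorphism of the closed polygon
(`exists_lift_disc_homeomorph`), and preservation of orientation means that the lift has degree one
on the boundary (`degree_eq_one_of_preservesOrientation`). A rotation of the sides is impossible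
because the distinguished edge is preserved, so the lift fixes all vertices (`Cell.exists_lift`). In
particular `g` preserves every cut next to the component and, as at most two components lie on the
sides of a cut (`eq_or_eq_of_mem_adjacent`), the component across it. The component next to the
given boundary circle is preserved; by connectedness all components are
(`image_eq_of_mem_components`).

The lifts must then be deformed to the identity in a way that is compatible with the gluing of the
sides. With a fixed coordinate on each cut, sides are glued by affine maps of slope `±1`. These
conjugate the lifts (`lift_eq_of_glues`), hence also the linear interpolations between the lifts and
the identity (`glued_of_combo`). Alexander's trick extends the interpolation to the inside of each
polygon (`exists_disc_isotopy`), and the result descends to the surface (`exists_isotopy_of_cells`).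
The marked points are vertices and stay fixed, and orientation is preserved because the local degree
is constant along the isotopy (`preservesOrientation_of_isotopy`).

All the topology used is that of winding numbers in the plane; invariance of domain
(`image_closedBall_mem_nhds`) follows from Borsuk's theorem on odd maps of the circle. -/

namespace ESurf

/-! ### Winding numbers of plane loops and invariance of domain. -/

section Winding

open Complex

/-- A nowhere vanishing continuous function on a real normed space has a continuous logarithm. -/
theorem exists_continuous_log {E : Type*} [NormedAddCommGroup E] [NormedSpace ℝ E] {f : E → ℂ}
    (hf : Continuous f) (h0 : ∀ x, f x ≠ 0) : ∃ L : E → ℂ, Continuous L ∧ ∀ x, exp (L x) = f x := by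
  obtain ⟨F, ⟨-, hF⟩, -⟩ := Complex.isCoveringMap_exp.existsUnique_continuousMap_lifts
    (⟨fun x => ⟨f x, h0 x⟩, by fun_prop⟩ : C(E, {z : ℂ // z ≠ 0})) 0 (log (f 0))
    (Subtype.ext (exp_log (h0 0)))
  exact ⟨F, F.continuous, fun x => congrArg Subtype.val (congrFun hF x)⟩

/-- Differences of two logarithms of one function have this form. The integer depends continuously
on the point, so it is constant on a connected space. -/
theorem exists_eq_two_pi_I_mul_int {X : Type*} [TopologicalSpace X] [PreconnectedSpace X] [Nonempty X]
    {d : X → ℂ} (hd : Continuous d) (h : ∀ x, ∃ n : ℤ, d x = 2 * Real.pi * I * n) :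
    ∃ n : ℤ, ∀ x, d x = 2 * Real.pi * I * n := by
  choose n hn using h
  have hpi : (2 * Real.pi * I : ℂ) ≠ 0 := two_pi_I_ne_zero
  have hn' : ((fun m : ℤ => (m : ℝ)) ∘ n) = fun x => (d x / (2 * Real.pi * I)).re := by
    ext x
    simp only [Function.comp]
    rw [hn x, mul_div_cancel_left₀ _ hpi, intCast_re]
  have hc : Continuous n := by
    rw [Int.isClosedEmbedding_coe_real.isEmbedding.continuous_iff, hn']
    fun_prop
  obtain ⟨x0⟩ := ‹Nonempty X›
  refine ⟨n x0, fun x => ?_⟩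
  rw [hn x, PreconnectedSpace.constant inferInstance hc (x := x) (y := x0)]

/-- The winding number around `0` of a loop in the plane. -/
def Winds (c : unitInterval → ℂ) (k : ℤ) : Prop :=
  ∃ L : C(unitInterval, ℂ), (∀ t, exp (L t) = c t) ∧ L 1 - L 0 = 2 * Real.pi * I * k

theorem exp_eq_exp_iff_two_pi_I {a b : ℂ} : exp a = exp b ↔ ∃ n : ℤ, a - b = 2 * Real.pi * I * n := by
  rw [exp_eq_exp_iff_exists_int]
  refine exists_congr fun n => ?_
  rw [sub_eq_iff_eq_add]
  constructor <;> intro h <;> rw [h] <;> ring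

theorem Winds.unique {c : unitInterval → ℂ} {k l : ℤ} (hk : Winds c k) (hl : Winds c l) : k = l := by
  obtain ⟨L, hL, hL'⟩ := hk
  obtain ⟨K, hK, hK'⟩ := hl
  obtain ⟨n, hn⟩ := exists_eq_two_pi_I_mul_int (d := fun t => L t - K t) (by fun_prop)
    (fun t => exp_eq_exp_iff_two_pi_I.1 ((hL t).trans (hK t).symm))
  have : (2 * Real.pi * I) * ((k : ℂ) - l) = 0 := by
    linear_combination hK' - hL' + hn 1 - hn 0
  have := (mul_eq_zero.1 this).resolve_left two_pi_I_ne_zero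
  exact_mod_cast sub_eq_zero.1 this

theorem exists_continuous_log_unitInterval {f : unitInterval → ℂ} (hf : Continuous f) (h0 : ∀ x, f x ≠ 0) :
    ∃ L : C(unitInterval, ℂ), ∀ x, exp (L x) = f x := by
  obtain ⟨L, hL, h⟩ := exists_continuous_log (E := ℝ)
    (f := fun x => f (Set.projIcc 0 1 zero_le_one x)) (by fun_prop) (fun x => h0 _)
  refine ⟨⟨fun x => L x, by fun_prop⟩, fun x => ?_⟩
  have := h x
  rwa [Set.projIcc_val] at this

theorem exists_winds {c : unitInterval → ℂ} (hc : Continuous c) (h0 : ∀ t, c t ≠ 0) (h01 : c 0 = c 1) :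
    ∃ k, Winds c k := by
  obtain ⟨L, hL⟩ := exists_continuous_log_unitInterval hc h0
  obtain ⟨n, hn⟩ := exp_eq_exp_iff_two_pi_I.1 ((hL 1).trans (h01.symm.trans (hL 0).symm))
  exact ⟨n, L, hL, hn⟩

/-- Homotopy invariance of the winding number. -/
theorem Winds.of_homotopy {H : unitInterval × unitInterval → ℂ} (hH : Continuous H) (h0 : ∀ p, H p ≠ 0)
    (h01 : ∀ s, H (s, 0) = H (s, 1)) (a b : unitInterval) {k : ℤ} (hk : Winds (fun t => H (a, t)) k) :
    Winds (fun t => H (b, t)) k := by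
  obtain ⟨L, hL, h⟩ := exists_continuous_log (E := ℝ × ℝ)
    (f := fun x => H (Set.projIcc 0 1 zero_le_one x.1, Set.projIcc 0 1 zero_le_one x.2))
    (by fun_prop) (fun x => h0 _)
  have h' : ∀ s t : unitInterval, exp (L (s, t)) = H (s, t) := fun s t => by
    have := h (s, t)
    rwa [Set.projIcc_val, Set.projIcc_val] at this
  -- The increment of the logarithm around the loop is continuous in the homotopy parameter and has
  -- values in `2πiℤ`.
  obtain ⟨n, hn⟩ := exists_eq_two_pi_I_mul_int (X := unitInterval)
    (d := fun s => L (s, (1 : unitInterval)) - L (s, (0 : unitInterval))) (by fun_prop)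
    (fun s => exp_eq_exp_iff_two_pi_I.1 (((h' s 1).trans (h01 s).symm).trans (h' s 0).symm))
  have hw : ∀ s, Winds (fun t => H (s, t)) n := fun s =>
    ⟨⟨fun t => L (s, t), by fun_prop⟩, fun t => h' s t, hn s⟩
  rw [hk.unique (hw a)]
  exact hw b

theorem Winds.mul {c d : unitInterval → ℂ} {k l : ℤ} (hc : Winds c k) (hd : Winds d l) :
    Winds (fun t => c t * d t) (k + l) := by
  obtain ⟨L, hL, hL'⟩ := hc
  obtain ⟨K, hK, hK'⟩ := hd
  refine ⟨L + K, fun t => ?_, ?_⟩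
  · simp [exp_add, hL, hK]
  · simp only [ContinuousMap.add_apply]
    push_cast
    linear_combination hL' + hK'

theorem Winds.of_slitPlane {c : unitInterval → ℂ} (hc : Continuous c) (h : ∀ t, c t ∈ slitPlane)
    (h01 : c 0 = c 1) : Winds c 0 := by
  refine ⟨⟨fun t => log (c t), hc.clog h⟩, fun t => ?_, ?_⟩
  · exact exp_log (slitPlane_ne_zero (h t))
  · simp [h01]

theorem Winds.const {w : ℂ} (hw : w ≠ 0) : Winds (fun _ => w) 0 :=
  ⟨⟨fun _ => log w, continuous_const⟩, fun _ => exp_log hw, by simp⟩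

/-- Multiplying a loop by a loop that stays close to `1` does not change the winding number. -/
theorem Winds.congr_of_slitPlane {c d : unitInterval → ℂ} {k : ℤ} (hc : Continuous c)
    (hd : Continuous d) (h0 : ∀ t, c t ≠ 0) (hcd : ∀ t, d t / c t ∈ slitPlane) (hc01 : c 0 = c 1)
    (hd01 : d 0 = d 1) : Winds c k ↔ Winds d k := by
  have h1 : Winds (fun t => d t / c t) 0 := Winds.of_slitPlane (hd.div hc h0) hcd (by rw [hc01, hd01])
  have key : ∀ k, Winds c k → Winds d k := fun k hk => by
    have := hk.mul h1
    simpa only [mul_div_cancel₀ _ (h0 _), add_zero] using this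
  refine ⟨key k, fun hk => ?_⟩
  obtain ⟨l, hl⟩ := exists_winds hc h0 hc01
  rwa [hk.unique (key l hl)]

/-- The standard parametrization of the unit circle by the unit interval. -/
def unitLoop (t : ℝ) : ℂ := exp (2 * Real.pi * I * t)

theorem continuous_unitLoop : Continuous unitLoop := by unfold unitLoop; fun_prop

theorem norm_unitLoop (t : ℝ) : ‖unitLoop t‖ = 1 := by
  have : (2 * Real.pi * I * t : ℂ) = ((2 * Real.pi * t : ℝ) : ℂ) * I := by push_cast; ring
  rw [unitLoop, this, norm_exp_ofReal_mul_I]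

theorem unitLoop_ne_zero (t : ℝ) : unitLoop t ≠ 0 := exp_ne_zero _

theorem unitLoop_zero : unitLoop 0 = 1 := by simp [unitLoop]

theorem unitLoop_add (s t : ℝ) : unitLoop (s + t) = unitLoop s * unitLoop t := by
  rw [unitLoop, unitLoop, unitLoop, ← exp_add]; push_cast; ring_nf

theorem unitLoop_int (n : ℤ) : unitLoop n = 1 := by
  rw [unitLoop, ← exp_int_mul_two_pi_mul_I n]; push_cast; ring_nf

theorem unitLoop_one : unitLoop 1 = 1 := by simpa using unitLoop_int 1

theorem unitLoop_add_half (t : ℝ) : unitLoop (t + 1 / 2) = -unitLoop t := by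
  rw [unitLoop_add]
  have : unitLoop (1 / 2) = -1 := by
    rw [unitLoop, ← exp_pi_mul_I]; push_cast; ring_nf
  rw [this]; ring

theorem unitLoop_eq_iff {s t : ℝ} : unitLoop s = unitLoop t ↔ ∃ n : ℤ, s = t + n := by
  rw [unitLoop, unitLoop, exp_eq_exp_iff_two_pi_I]
  refine exists_congr fun n => ?_
  rw [← mul_sub, mul_right_inj' two_pi_I_ne_zero, sub_eq_iff_eq_add, add_comm]
  norm_cast

theorem exists_unitLoop_eq {z : ℂ} (hz : ‖z‖ = 1) : ∃ t : ℝ, unitLoop t = z := by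
  refine ⟨arg z / (2 * Real.pi), ?_⟩
  have h := norm_mul_exp_arg_mul_I z
  rw [hz, ofReal_one, one_mul] at h
  refine Eq.trans ?_ h
  rw [unitLoop]
  congr 1
  have := Real.pi_ne_zero
  push_cast
  field_simp

theorem winds_unitLoop : Winds (fun t => unitLoop t) 1 :=
  ⟨⟨fun t => 2 * Real.pi * I * (t : ℝ), by fun_prop⟩, fun _ => rfl, by simp⟩

/-- Borsuk's argument: by injectivity the subtracted value can be moved from the centre to the
antipodal point without creating a zero, and a loop that changes sign under a half-turn has odd
winding number. Later only the consequence is used that the number is not zero. -/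
theorem odd_of_winds_of_injOn {f : ℂ → ℂ} {z : ℂ} {r : ℝ} (hr : 0 < r)
    (hf : ContinuousOn f (Metric.closedBall z r)) (hinj : Set.InjOn f (Metric.closedBall z r)) {k : ℤ}
    (hk : Winds (fun t => f (z + r * unitLoop t) - f z) k) : Odd k := by
  have hmem : ∀ (s t : ℝ), |s| ≤ 1 → z + s * (r * unitLoop t) ∈ Metric.closedBall z r := by
    intro s t hs
    rw [mem_closedBall_iff_norm, add_sub_cancel_left, norm_mul, norm_mul, norm_unitLoop, norm_real, norm_real,
      mul_one, Real.norm_eq_abs, Real.norm_eq_abs, abs_of_pos hr]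
    nlinarith
  have hmem1 : ∀ (t : ℝ), z + (r * unitLoop t) ∈ Metric.closedBall z r := fun t => by
    simpa using hmem 1 t (by simp)
  have hne : ∀ (s t : ℝ), 0 ≤ s → s ≤ 1 → f (z + r * unitLoop t) - f (z + (-s : ℝ) * (r * unitLoop t)) ≠ 0 := by
    intro s t hs hs1 h
    have h1 := hinj (hmem1 t) (hmem (-s) t (by rw [abs_neg, abs_of_nonneg hs]; exact hs1)) (sub_eq_zero.1 h)
    have h2 : (r * unitLoop t) * (1 + s) = 0 := by
      push_cast at h1; linear_combination h1
    rcases mul_eq_zero.1 h2 with h3 | h3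
    · rcases mul_eq_zero.1 h3 with h4 | h4
      · exact hr.ne' (by exact_mod_cast h4)
      · exact unitLoop_ne_zero _ h4
    · have : (1 + s : ℝ) = 0 := by exact_mod_cast h3
      linarith
  have hc := continuous_unitLoop
  have hc1 : Continuous fun t : ℝ => f (z + r * unitLoop t) :=
    hf.comp_continuous (by fun_prop) hmem1
  -- the antipodal difference
  have hg : Continuous fun t : ℝ => f (z + r * unitLoop t) - f (z + (-1 : ℝ) * (r * unitLoop t)) :=
    hc1.sub (hf.comp_continuous (by fun_prop) fun t => hmem (-1) t (by simp))
  obtain ⟨L, hL, hLe⟩ := exists_continuous_log hg (fun t => hne 1 t zero_le_one le_rfl)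
  -- Over a half-turn the logarithm grows by an odd multiple of `πi`, the same for all `t`; two
  -- half-turns give the odd number `2 * m + 1`.
  have hanti : ∀ t, ∃ n : ℤ, L (t + 1 / 2) - L t - Real.pi * I = 2 * Real.pi * I * n := by
    intro t
    have : exp (L (t + 1 / 2)) = exp (L t + Real.pi * I) := by
      rw [exp_add, hLe, hLe, exp_pi_mul_I, unitLoop_add_half]
      push_cast
      ring_nf
    obtain ⟨n, hn⟩ := exp_eq_exp_iff_two_pi_I.1 this
    exact ⟨n, by rw [← hn]; ring⟩
  obtain ⟨m, hm⟩ := exists_eq_two_pi_I_mul_int (X := ℝ)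
    (d := fun t => L (t + 1 / 2) - L t - Real.pi * I) (by fun_prop) hanti
  have h2 : Winds (fun t => f (z + r * unitLoop t) - f (z + (-1 : ℝ) * (r * unitLoop t))) (2 * m + 1) := by
    refine ⟨⟨fun t => L t, by fun_prop⟩, fun t => hLe t, ?_⟩
    have e0 := hm 0
    have e1 := hm (1 / 2)
    norm_num at e0 e1
    simp only [ContinuousMap.coe_mk, Set.Icc.coe_one, Set.Icc.coe_zero]
    push_cast
    linear_combination e0 + e1
  -- The subtracted value is taken at the centre for `p.1 = 0` and at the antipode for `p.1 = 1`.
  have h3 := Winds.of_homotopy (H := fun p => f (z + r * unitLoop p.2) -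
      f (z + (-p.1 : ℝ) * (r * unitLoop p.2))) ?_ ?_ ?_ 0 1 (k := k) ?_
  · have := h3.unique (k := k) (l := 2 * m + 1) (by simpa using h2)
    exact ⟨m, this⟩
  · refine (hc1.comp (by fun_prop)).sub (hf.comp_continuous (by fun_prop) fun p => hmem _ _ ?_)
    rw [abs_neg, abs_of_nonneg p.1.2.1]
    exact p.1.2.2
  · exact fun p => hne _ _ p.1.2.1 p.1.2.2
  · intro s
    simp [unitLoop_zero, unitLoop_one]
  · simpa using hk

/-- Invariance of domain in the plane. -/
theorem image_closedBall_mem_nhds {f : ℂ → ℂ} {z : ℂ} {r : ℝ} (hr : 0 < r)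
    (hf : ContinuousOn f (Metric.closedBall z r)) (hinj : Set.InjOn f (Metric.closedBall z r)) :
    f '' Metric.closedBall z r ∈ nhds (f z) := by
  have hmem : ∀ (s t : ℝ), |s| ≤ 1 → z + s * (r * unitLoop t) ∈ Metric.closedBall z r := by
    intro s t hs
    rw [mem_closedBall_iff_norm, add_sub_cancel_left, norm_mul, norm_mul, norm_unitLoop, norm_real, norm_real,
      mul_one, Real.norm_eq_abs, Real.norm_eq_abs, abs_of_pos hr]
    nlinarith
  have hmem1 : ∀ (t : ℝ), z + (r * unitLoop t) ∈ Metric.sphere z r := fun t => by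
    rw [mem_sphere_iff_norm, add_sub_cancel_left, norm_mul, norm_unitLoop, norm_real, mul_one,
      Real.norm_eq_abs, abs_of_pos hr]
  have hsub := Metric.sphere_subset_closedBall (x := z) (ε := r)
  have hz : z ∈ Metric.closedBall z r := Metric.mem_closedBall_self hr.le
  have hclosed : IsClosed (f '' Metric.sphere z r) :=
    ((isCompact_sphere z r).image_of_continuousOn (hf.mono hsub)).isClosed
  have hnot : f z ∉ f '' Metric.sphere z r := by
    rintro ⟨w, hw, hwz⟩
    rw [hinj (hsub hw) hz hwz, mem_sphere_iff_norm, sub_self, norm_zero] at hw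
    exact hr.ne hw
  obtain ⟨ε, hε, hball⟩ := Metric.isOpen_iff.1 hclosed.isOpen_compl _ hnot
  refine Filter.mem_of_superset (Metric.ball_mem_nhds _ hε) fun y hy => ?_
  by_contra hy'
  have hc := continuous_unitLoop
  have hc1 : Continuous fun t : ℝ => f (z + r * unitLoop t) :=
    hf.comp_continuous (by fun_prop) fun t => hsub (hmem1 t)
  -- If the image of the disc misses `y`, shrinking the circle to its centre shows that its image
  -- does not wind around `y`.
  have h1 : Winds (fun t => f (z + r * unitLoop t) - y) 0 := by
    have := Winds.of_homotopy (H := fun p => f (z + (p.1 : ℝ) * (r * unitLoop p.2)) - y) ?_ ?_ ?_ 0 1 (k := 0) ?_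
    · simpa using this
    · refine (hf.comp_continuous (by fun_prop) fun p => hmem _ _ ?_).sub continuous_const
      rw [abs_of_nonneg p.1.2.1]
      exact p.1.2.2
    · intro p h
      refine hy' ⟨_, hmem p.1 p.2 ?_, sub_eq_zero.1 h⟩
      rw [abs_of_nonneg p.1.2.1]
      exact p.1.2.2
    · intro s
      simp [unitLoop_zero, unitLoop_one]
    · simp only [Set.Icc.coe_zero, ofReal_zero, zero_mul, add_zero]
      exact Winds.const (sub_ne_zero.2 fun h => hy' ⟨z, hz, h⟩)
  -- Moving `y` to `f z` within a ball that avoids the image of the circle keeps the winding number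
  -- zero, but around `f z` it is odd.
  have h2 := Winds.of_homotopy (H := fun p => f (z + r * unitLoop p.2) - (y + (p.1 : ℝ) * (f z - y))) ?_ ?_ ?_
    0 1 (k := 0) (by simpa using h1)
  · have h3 := odd_of_winds_of_injOn hr hf hinj (k := 0) (by simpa using h2)
    simp at h3
  · exact (hc1.comp (by fun_prop)).sub (by fun_prop)
  · intro p h
    refine hball (?_ : y + (p.1 : ℝ) * (f z - y) ∈ _) ⟨_, hmem1 p.2, sub_eq_zero.1 h⟩
    have := (convex_ball (f z) ε).add_smul_sub_mem hy (Metric.mem_ball_self hε) p.1.2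
    simpa using this
  · intro s
    simp [unitLoop_zero, unitLoop_one]

end Winding

/-! ### Winding numbers in charts and the local degree along homotopies. -/

section LocalDegree

variable {S : Type*} [TopologicalSpace S] [ChartedSpace (EuclideanHalfSpace 2) S]

open Complex

/-- The real plane as the complex plane. -/
def toComplex : EuclideanSpace ℝ (Fin 2) →ₗ[ℝ] ℂ where
  toFun v := ⟨v 0, v 1⟩
  map_add' _ _ := by apply Complex.ext <;> simp
  map_smul' _ _ := by apply Complex.ext <;> simp

theorem norm_toComplex (v : EuclideanSpace ℝ (Fin 2)) : ‖toComplex v‖ = ‖v‖ := by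
  rw [EuclideanSpace.norm_eq, Complex.norm_eq_sqrt_sq_add_sq]
  simp [toComplex, Fin.sum_univ_two]

theorem continuous_toComplex : Continuous toComplex :=
  LinearMap.continuous_of_finiteDimensional _

theorem toComplex_injective : Function.Injective toComplex := by
  refine (injective_iff_map_eq_zero _).2 fun v hv => ?_
  rw [← norm_eq_zero, ← norm_toComplex, hv, norm_zero]

theorem continuousOn_complexChart (x : S) :
    ContinuousOn (complexChart x) (chartAt (EuclideanHalfSpace 2) x).source :=
  continuous_toComplex.comp_continuousOn (by
    have := continuousOn_extChartAt (I := 𝓡∂ 2) x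
    rwa [extChartAt_source] at this)

theorem injOn_complexChart (x : S) :
    Set.InjOn (complexChart x) (chartAt (EuclideanHalfSpace 2) x).source := fun y hy z hz h => by
  rw [← extChartAt_source (𝓡∂ 2)] at hy hz
  exact (extChartAt (𝓡∂ 2) x).injOn hy hz (toComplex_injective h)

/-- A real-linear map of the plane is `ζ ↦ a ζ + b ζ̄` and has determinant `|a|² - |b|²`; so a
positive determinant means that the complex-linear part dominates. -/
theorem exists_complex_form (A : EuclideanSpace ℝ (Fin 2) →L[ℝ] EuclideanSpace ℝ (Fin 2))
    (hA : 0 < A.det) : ∃ a b : ℂ, ‖b‖ < ‖a‖ ∧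
      ∀ v, toComplex (A v) = a * toComplex v + b * (starRingEnd ℂ) (toComplex v) := by
  set p := A (EuclideanSpace.single 0 1) with hp
  set q := A (EuclideanSpace.single 1 1) with hq
  have hdet : A.det = p 0 * q 1 - q 0 * p 1 := by
    rw [ContinuousLinearMap.det, ← LinearMap.det_toMatrix (EuclideanSpace.basisFun (Fin 2) ℝ).toBasis,
      Matrix.det_fin_two]
    simp [LinearMap.toMatrix_apply, hp, hq]
  have hAv : ∀ v, A v = v 0 • p + v 1 • q := by
    intro v
    rw [hp, hq, ← map_smul, ← map_smul, ← map_add]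
    congr 1
    ext i
    fin_cases i <;> simp
  refine ⟨⟨(p 0 + q 1) / 2, (p 1 - q 0) / 2⟩, ⟨(p 0 - q 1) / 2, (p 1 + q 0) / 2⟩, ?_, fun v => ?_⟩
  · rw [Complex.norm_eq_sqrt_sq_add_sq, Complex.norm_eq_sqrt_sq_add_sq]
    refine Real.sqrt_lt_sqrt (by positivity) ?_
    simp only
    nlinarith
  · rw [hAv]
    apply Complex.ext <;> simp [toComplex] <;> ring

theorem Winds.const_mul_iff {c : unitInterval → ℂ} {k : ℤ} {a : ℂ} (ha : a ≠ 0) :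
    Winds (fun t => a * c t) k ↔ Winds c k := by
  refine ⟨fun h => ?_, fun h => ?_⟩
  · have := (Winds.const (inv_ne_zero ha)).mul h
    simpa only [inv_mul_cancel_left₀ ha, zero_add] using this
  · simpa only [zero_add] using (Winds.const ha).mul h

theorem complexChart_re_nonneg (x y : S) : 0 ≤ (complexChart x y).re :=
  (chartAt (EuclideanHalfSpace 2) x y).2

/-- Invariance of domain for injective maps from a neighbourhood of a point in the plane. -/
theorem image_mem_nhds_of_injOn {F : ℂ → S} {z : ℂ} {U : Set ℂ} (hU : U ∈ nhds z)
    (hF : ContinuousOn F U) (hinj : Set.InjOn F U) :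
    F z ∈ (𝓡∂ 2).interior S ∧ F '' U ∈ nhds (F z) := by
  set y := F z with hy
  set e := chartAt (EuclideanHalfSpace 2) y with he
  have hsrc : F ⁻¹' e.source ∈ nhds z :=
    (hF.continuousAt hU).preimage_mem_nhds (e.open_source.mem_nhds (mem_chart_source _ y))
  obtain ⟨r, hr, hball⟩ := Metric.nhds_basis_closedBall.mem_iff.1 (Filter.inter_mem hU hsrc)
  have hBU : Metric.closedBall z r ⊆ U := fun w hw => (hball hw).1
  have hBe : ∀ w ∈ Metric.closedBall z r, F w ∈ e.source := fun w hw => (hball hw).2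
  have himg := image_closedBall_mem_nhds (f := fun w => complexChart y (F w)) hr
    ((continuousOn_complexChart y).comp (hF.mono hBU) hBe)
    ((injOn_complexChart y).comp (hinj.mono hBU) hBe)
  refine ⟨?_, ?_⟩
  -- The chart has values in the half-plane `0 ≤ re` and sends a boundary point to its edge, so the
  -- image of the disc could not be a neighbourhood.
  · by_contra h
    rw [← Set.mem_compl_iff, ModelWithCorners.compl_interior] at h
    have h2 : (complexChart y y).re = 0 := by
      have h3 : extChartAt (𝓡∂ 2) y y ∈ frontier (Set.range (𝓡∂ 2)) := h
      rw [frontier_range_modelWithCornersEuclideanHalfSpace] at h3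
      exact h3.symm
    obtain ⟨ε, hε, hεb⟩ := Metric.mem_nhds_iff.1 himg
    obtain ⟨w, -, hw⟩ := hεb (show complexChart y y - (ε / 2 : ℝ) ∈ _ by
      rw [mem_ball_iff_norm, ← hy, sub_sub_cancel_left, norm_neg, norm_real, Real.norm_eq_abs,
        abs_of_pos (half_pos hε)]
      exact half_lt_self hε)
    have h4 := complexChart_re_nonneg y (F w)
    simp only at hw
    rw [hw, sub_re, h2, ofReal_re] at h4
    linarith
  · have hcont : ContinuousAt (complexChart y) y :=
      (continuousOn_complexChart y).continuousAt (e.open_source.mem_nhds (mem_chart_source _ y))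
    filter_upwards [hcont.preimage_mem_nhds himg, e.open_source.mem_nhds (mem_chart_source _ y)]
      with w ⟨v, hv, hvw⟩ hw
    exact ⟨v, hBU hv, injOn_complexChart y (hBe v hv) hw hvw⟩

variable [ESurface S]

/-- At an interior point, winding numbers can be computed in any chart of the oriented atlas. -/
theorem exists_hasWinding_iff {x : S} (hx : x ∈ (𝓡∂ 2).interior S) {y : S}
    (hy : x ∈ (chartAt (EuclideanHalfSpace 2) y).source) :
    ∃ U ∈ nhds x, ∀ γ : C(unitInterval, S), Set.range γ ⊆ U \ {x} → γ 0 = γ 1 → ∀ k,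
      HasWinding x γ k ↔ Winds (fun t => complexChart y (γ t) - complexChart y x) k := by
  set e := chartAt (EuclideanHalfSpace 2) x with he
  set e' := chartAt (EuclideanHalfSpace 2) y with he'
  set T := e'.extend (𝓡∂ 2) ∘ (e.extend (𝓡∂ 2)).symm with hT
  set z := e.extend (𝓡∂ 2) x with hz
  have hxe : x ∈ e.source := mem_chart_source _ x
  have hsymm : (e.extend (𝓡∂ 2)).symm z = x := e.extend_left_inv hxe
  have hdet := ESurface.oriented e (chart_mem_atlas _ x) e' (chart_mem_atlas _ y) z (by
    rw [PartialEquiv.trans_source]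
    refine ⟨(e.extend (𝓡∂ 2)).map_source (by rwa [OpenPartialHomeomorph.extend_source]), ?_⟩
    rw [Set.mem_preimage, hsymm, OpenPartialHomeomorph.extend_source]
    exact hy)
  -- `fderivWithin` is zero where the map is not differentiable, and then the determinant would
  -- vanish; so the positive determinant includes differentiability.
  have hdiff : DifferentiableWithinAt ℝ T (Set.range (𝓡∂ 2)) z := by
    by_contra h
    rw [fderivWithin_zero_of_not_differentiableWithinAt h] at hdet
    simp [ContinuousLinearMap.det] at hdet
  have hnhds : Set.range (𝓡∂ 2) ∈ nhds z := mem_interior_iff_mem_nhds.1 hx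
  set A := fderivWithin ℝ T (Set.range (𝓡∂ 2)) z with hA
  have hfd : HasFDerivAt T A z := hdiff.hasFDerivWithinAt.hasFDerivAt hnhds
  obtain ⟨a, b, hab, hform⟩ := exists_complex_form A hdet
  have ha : a ≠ 0 := fun h => by
    rw [h, norm_zero] at hab
    exact absurd hab (not_lt.2 (norm_nonneg b))
  have hsmall := hfd.isLittleO.def (c := (‖a‖ - ‖b‖) / 2) (by linarith)
  have hev : ∀ᶠ w in nhds x, ‖T (e.extend (𝓡∂ 2) w) - T z - A (e.extend (𝓡∂ 2) w - z)‖ ≤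
      (‖a‖ - ‖b‖) / 2 * ‖e.extend (𝓡∂ 2) w - z‖ :=
    (e.continuousAt_extend hxe).eventually hsmall
  refine ⟨_, Filter.inter_mem hev (Filter.inter_mem (e.open_source.mem_nhds hxe)
    (e'.open_source.mem_nhds hy)), fun γ hγ h01 k => ?_⟩
  have hmem : ∀ t, γ t ∈ e.source := fun t => (hγ ⟨t, rfl⟩).1.2.1
  have hmem' : ∀ t, γ t ∈ e'.source := fun t => (hγ ⟨t, rfl⟩).1.2.2
  have hc : Continuous fun t => complexChart x (γ t) - complexChart x x :=
    ((continuousOn_complexChart x).comp_continuous γ.continuous hmem).sub continuous_const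
  have hd : Continuous fun t => complexChart y (γ t) - complexChart y x :=
    ((continuousOn_complexChart y).comp_continuous γ.continuous hmem').sub continuous_const
  have h0 : ∀ t, complexChart x (γ t) - complexChart x x ≠ 0 := fun t h =>
    (hγ ⟨t, rfl⟩).2 (injOn_complexChart x (hmem t) hxe (sub_eq_zero.1 h))
  -- The transition map sends `ζ` to `a ζ + b ζ̄` with an error of at most `(‖a‖ - ‖b‖) / 2 * ‖ζ‖`.
  -- So its distance from `a ζ` is less than `‖a ζ‖`, and the quotient by `a ζ` stays in the slit
  -- plane.
  rw [← Winds.congr_of_slitPlane (c := fun t => a * (complexChart x (γ t) - complexChart x x))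
    (continuous_const.mul hc) hd (fun t => mul_ne_zero ha (h0 t)) ?_ (by simp [h01]) (by simp [h01]),
    Winds.const_mul_iff ha]
  · rfl
  intro t
  set ζ := complexChart x (γ t) - complexChart x x with hζ
  have hζ' : ζ = toComplex (e.extend (𝓡∂ 2) (γ t) - z) := by rw [map_sub]; rfl
  set ξ := complexChart y (γ t) - complexChart y x with hξ
  have hξ' : ξ = toComplex (T (e.extend (𝓡∂ 2) (γ t)) - T z) := by
    rw [map_sub, hT, Function.comp, Function.comp, hsymm, e.extend_left_inv (hmem t)]
    rfl
  have hbound : ‖ξ - (a * ζ + b * (starRingEnd ℂ) ζ)‖ ≤ (‖a‖ - ‖b‖) / 2 * ‖ζ‖ := by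
    rw [hξ', hζ', ← hform, ← map_sub, norm_toComplex, norm_toComplex]
    exact (hγ ⟨t, rfl⟩).1.1
  have hζ0 : 0 < ‖ζ‖ := norm_pos_iff.2 (h0 t)
  have h1 : ‖ξ - a * ζ‖ < ‖a * ζ‖ := by
    have : ξ - a * ζ = (ξ - (a * ζ + b * (starRingEnd ℂ) ζ)) + b * (starRingEnd ℂ) ζ := by ring
    rw [this]
    refine (norm_add_le _ _).trans_lt ?_
    rw [norm_mul, norm_mul, RCLike.norm_conj]
    nlinarith
  have haζ : a * ζ ≠ 0 := mul_ne_zero ha (h0 t)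
  have h2 : ξ / (a * ζ) = 1 + (ξ - a * ζ) / (a * ζ) := by rw [sub_div ξ (a * ζ), div_self haζ]; ring
  rw [h2]
  refine mem_slitPlane_of_norm_lt_one ?_
  rwa [norm_div, div_lt_one (norm_pos_iff.2 haζ)]

/-- The local degree of a map that is injective at `x` does not change under homotopies through
such maps. -/
theorem exists_hasWinding_iff_of_homotopy {T : Type*} [TopologicalSpace T]
    {H : unitInterval × T → S} (hH : Continuous H) {x : T}
    (hne : ∀ t y, y ≠ x → H (t, y) ≠ H (t, x)) (hmem : ∀ t, H (t, x) ∈ (𝓡∂ 2).interior S)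
    (a b : unitInterval) :
    ∃ U ∈ nhds x, ∀ γ : C(unitInterval, T), Set.range γ ⊆ U \ {x} → γ 0 = γ 1 → ∀ k,
      HasWinding (H (a, x)) ⟨fun t => H (a, γ t), by fun_prop⟩ k ↔
      HasWinding (H (b, x)) ⟨fun t => H (b, γ t), by fun_prop⟩ k := by
  -- Equality of the winding numbers of small loops is an equivalence relation on the parameters; as
  -- the interval is connected, it suffices to compare nearby parameters.
  refine @PreconnectedSpace.induction₂ unitInterval _ _ (fun a b => ∃ U ∈ nhds x,
    ∀ γ : C(unitInterval, T), Set.range γ ⊆ U \ {x} → γ 0 = γ 1 → ∀ k,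
      HasWinding (H (a, x)) ⟨fun t => H (a, γ t), by fun_prop⟩ k ↔
      HasWinding (H (b, x)) ⟨fun t => H (b, γ t), by fun_prop⟩ k) ⟨?_⟩ ?_ ⟨?_⟩ a b
  · rintro a b ⟨U, hU, h⟩
    exact ⟨U, hU, fun γ hγ h01 k => (h γ hγ h01 k).symm⟩
  · intro a
    set y := H (a, x)
    have hsrc : H ⁻¹' (chartAt (EuclideanHalfSpace 2) y).source ∈ nhds (a, x) :=
      hH.continuousAt.preimage_mem_nhds
        ((chartAt (EuclideanHalfSpace 2) y).open_source.mem_nhds (mem_chart_source _ y))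
    obtain ⟨J, hJ, V, hV, hJV⟩ := mem_nhds_prod_iff.1 hsrc
    obtain ⟨ε, hε, hball⟩ := Metric.mem_nhds_iff.1 hJ
    -- For `b` close to `a` all points involved lie in the chart at `H (a, x)`, and the segment from
    -- `a` to `b` gives a homotopy of plane loops.
    filter_upwards [Metric.ball_mem_nhds a hε] with b hb
    obtain ⟨U, hU, hUw⟩ := exists_hasWinding_iff (hmem b) (y := y)
      (hJV (Set.mk_mem_prod (hball hb) (mem_of_mem_nhds hV)))
    have hHb : Continuous fun w => H (b, w) := by fun_prop
    refine ⟨V ∩ (fun w => H (b, w)) ⁻¹' U, Filter.inter_mem hV (hHb.continuousAt.preimage_mem_nhds hU),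
      fun γ hγ h01 k => ?_⟩
    have hγV : ∀ t, γ t ∈ V := fun t => (hγ ⟨t, rfl⟩).1.1
    rw [hUw ⟨fun t => H (b, γ t), by fun_prop⟩ ?_ (by simp [h01])]
    · let σ : unitInterval → unitInterval := fun s => ⟨AffineMap.lineMap (a : ℝ) (b : ℝ) (s : ℝ),
        Convex.lineMap_mem (convex_Icc (0 : ℝ) 1) a.2 b.2 s.2⟩
      have hσ : Continuous σ := by
        refine Continuous.subtype_mk ?_ _
        simp only [AffineMap.lineMap_apply]
        fun_prop
      have hσJ : ∀ s, σ s ∈ J := by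
        intro s
        refine hball ?_
        have := Convex.lineMap_mem (convex_ball (a : ℝ) ε) (Metric.mem_ball_self hε) hb s.2
        exact this
      have hσ0 : σ 0 = a := Subtype.ext (by simp [σ])
      have hσ1 : σ 1 = b := Subtype.ext (by simp [σ])
      have hs : ∀ s w, w ∈ V → H (σ s, w) ∈ (chartAt (EuclideanHalfSpace 2) y).source :=
        fun s w hw => hJV (Set.mk_mem_prod (hσJ s) hw)
      have key : ∀ c d : unitInterval,
          Winds (fun t => complexChart y (H (σ c, γ t)) - complexChart y (H (σ c, x))) k →
          Winds (fun t => complexChart y (H (σ d, γ t)) - complexChart y (H (σ d, x))) k := by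
        intro c d
        refine Winds.of_homotopy
          (H := fun p => complexChart y (H (σ p.1, γ p.2)) - complexChart y (H (σ p.1, x))) ?_ ?_ ?_ c d
        · refine ((continuousOn_complexChart y).comp_continuous (by fun_prop) fun p => hs _ _ (hγV _)).sub
            ((continuousOn_complexChart y).comp_continuous (by fun_prop) fun p =>
              hs _ _ (mem_of_mem_nhds hV))
        · intro p h
          exact hne (σ p.1) (γ p.2) (fun h' => (hγ ⟨p.2, rfl⟩).2 h')
            (injOn_complexChart y (hs _ _ (hγV _)) (hs _ _ (mem_of_mem_nhds hV)) (sub_eq_zero.1 h))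
        · intro s
          rw [h01]
      have := Iff.intro (key 0 1) (key 1 0)
      rw [hσ0, hσ1] at this
      exact this
    · rintro _ ⟨t, rfl⟩
      exact ⟨(hγ ⟨t, rfl⟩).1.2, hne _ _ fun h => (hγ ⟨t, rfl⟩).2 h⟩
  · rintro a b c ⟨U, hU, h⟩ ⟨V, hV, h'⟩
    refine ⟨U ∩ V, Filter.inter_mem hU hV, fun γ hγ h01 k => ?_⟩
    rw [h γ (fun w hw => ⟨(hγ hw).1.1, (hγ hw).2⟩) h01 k,
      h' γ (fun w hw => ⟨(hγ hw).1.2, (hγ hw).2⟩) h01 k]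

end LocalDegree

/-! ### Polar coordinates about the vertex of the standard star. -/

section PolarCoordinates

open Complex

/-- Half the width of the disc of radius `1/3` at height `ρ` above the vertex of the star. -/
def bump (ρ : ℝ) : ℝ := √(1 / 9 - (ρ - 1) ^ 2)

theorem bump_nonneg (ρ : ℝ) : 0 ≤ bump ρ := Real.sqrt_nonneg _

theorem bump_le (ρ : ℝ) : bump ρ ≤ 1 / 3 := by
  refine Real.sqrt_le_iff.2 ⟨by norm_num, ?_⟩
  nlinarith [sq_nonneg (ρ - 1)]

theorem continuous_bump : Continuous bump := by unfold bump; fun_prop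

theorem bump_of_le {ρ : ℝ} (h : ρ ≤ 2 / 3) : bump ρ = 0 :=
  Real.sqrt_eq_zero_of_nonpos (by nlinarith)

theorem bump_of_ge {ρ : ℝ} (h : 4 / 3 ≤ ρ) : bump ρ = 0 :=
  Real.sqrt_eq_zero_of_nonpos (by nlinarith)

theorem bump_sq {ρ : ℝ} (h : 2 / 3 ≤ ρ) (h' : ρ ≤ 4 / 3) : bump ρ ^ 2 = 1 / 9 - (ρ - 1) ^ 2 :=
  Real.sq_sqrt (by nlinarith)

theorem le_bump_sq (ρ : ℝ) : 1 / 9 - (ρ - 1) ^ 2 ≤ bump ρ ^ 2 := by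
  rcases le_total 0 (1 / 9 - (ρ - 1) ^ 2) with h | h
  · rw [bump, Real.sq_sqrt h]
  · exact h.trans (sq_nonneg _)

theorem bump_eq_zero {ρ : ℝ} (h : 2 / 3 ≤ ρ) (h' : ρ ≤ 4 / 3) (h0 : bump ρ = 0) :
    ρ = 2 / 3 ∨ ρ = 4 / 3 := by
  have := bump_sq h h'
  rw [h0] at this
  have h2 : (ρ - 2 / 3) * (ρ - 4 / 3) = 0 := by nlinarith
  rcases mul_eq_zero.1 h2 with h3 | h3
  · left; linarith
  · right; linarith

/-- A parametrization of the boundary of the triangle with vertices `(± (n/2 - 1/6), 1)`, `(0, -1)`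
by the interval `[-n/2, n/2]`: first coordinate. -/
def dirU (n : ℕ) (y : ℝ) : ℝ := max (min y ((3 * n - 1) * (n / 2 - y))) (-((3 * n - 1) * (n / 2 + y)))

/-- A parametrization of the boundary of the triangle with vertices `(± (n/2 - 1/6), 1)`, `(0, -1)`
by the interval `[-n/2, n/2]`: second coordinate. -/
def dirV (n : ℕ) (y : ℝ) : ℝ := min 1 (6 * n - 1 - 12 * |y|)

theorem continuous_dirU (n : ℕ) : Continuous (dirU n) := by unfold dirU; fun_prop

theorem continuous_dirV (n : ℕ) : Continuous (dirV n) := by unfold dirV; fun_prop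

theorem dirU_neg (n : ℕ) (hn : 1 ≤ n) {y : ℝ} (hy : |y| ≤ n / 2) : dirU n (-y) = -dirU n y := by
  have hn' : (1 : ℝ) ≤ n := by exact_mod_cast hn
  obtain ⟨h1, h2⟩ := abs_le.1 hy
  have h3 : 0 ≤ (3 * (n : ℝ) - 1) * (n / 2 - y) := mul_nonneg (by linarith) (by linarith)
  have h4 : 0 ≤ (3 * (n : ℝ) - 1) * (n / 2 + y) := mul_nonneg (by linarith) (by linarith)
  unfold dirU
  rw [sub_neg_eq_add, ← sub_eq_add_neg]
  rcases le_total 0 y with h | h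
  · rw [max_eq_left (a := min y _) ((neg_nonpos.2 h4).trans (le_min h h3)), min_eq_left (by linarith)]
    rcases le_total y ((3 * n - 1) * (n / 2 - y)) with h5 | h5
    · rw [min_eq_left h5, max_eq_left (by linarith)]
    · rw [min_eq_right h5, max_eq_right (by linarith)]
  · rw [max_eq_left (a := min (-y) _) ((neg_nonpos.2 h3).trans (le_min (by linarith) h4)),
      min_eq_left (a := y) (by linarith)]
    rcases le_total (-y) ((3 * n - 1) * (n / 2 + y)) with h5 | h5
    · rw [min_eq_left h5, max_eq_left (by linarith)]
    · rw [min_eq_right h5, max_eq_right (by linarith), neg_neg]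

theorem dirV_neg (n : ℕ) (y : ℝ) : dirV n (-y) = dirV n y := by
  unfold dirV; rw [abs_neg]

theorem dirU_of_nonneg {n : ℕ} (hn : 1 ≤ n) {y : ℝ} (h : 0 ≤ y) (hy : y ≤ n / 2) :
    dirU n y = min y ((3 * n - 1) * (n / 2 - y)) := by
  have hn' : (1 : ℝ) ≤ n := by exact_mod_cast hn
  have h3 : 0 ≤ (3 * (n : ℝ) - 1) * (n / 2 - y) := mul_nonneg (by linarith) (by linarith)
  have h4 : 0 ≤ (3 * (n : ℝ) - 1) * (n / 2 + y) := mul_nonneg (by linarith) (by linarith)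
  exact max_eq_left ((neg_nonpos.2 h4).trans (le_min h h3))

/-- On the top side of the triangle the parameter is the horizontal coordinate; the remaining `1/6`
at each end of the parameter interval runs along a slanted side down to `(0, -1)`. -/
theorem dirU_of_le {n : ℕ} (hn : 1 ≤ n) {y : ℝ} (hy : |y| ≤ n / 2 - 1 / 6) : dirU n y = y := by
  have hn' : (1 : ℝ) ≤ n := by exact_mod_cast hn
  have key : ∀ y : ℝ, 0 ≤ y → y ≤ n / 2 - 1 / 6 → dirU n y = y := fun y h hy => by
    rw [dirU_of_nonneg hn h (by linarith), min_eq_left]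
    nlinarith
  rcases le_total 0 y with h | h
  · exact key y h ((le_abs_self y).trans hy)
  · have := key (-y) (by linarith) ((neg_le_abs y).trans hy)
    rw [dirU_neg n hn (by linarith)] at this
    linarith

theorem dirV_of_le {n : ℕ} {y : ℝ} (hy : |y| ≤ n / 2 - 1 / 6) : dirV n y = 1 :=
  min_eq_left (by linarith)

theorem dirV_of_ge {n : ℕ} {y : ℝ} (hy : n / 2 - 1 / 6 ≤ |y|) : dirV n y = 6 * n - 1 - 12 * |y| :=
  min_eq_right (by linarith)

theorem abs_dirU_of_ge {n : ℕ} (hn : 1 ≤ n) {y : ℝ} (hy : n / 2 - 1 / 6 ≤ |y|) (hy' : |y| ≤ n / 2) :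
    |dirU n y| = (3 * n - 1) * (n / 2 - |y|) := by
  have hn' : (1 : ℝ) ≤ n := by exact_mod_cast hn
  have key : ∀ y : ℝ, n / 2 - 1 / 6 ≤ y → y ≤ n / 2 → |dirU n y| = (3 * n - 1) * (n / 2 - y) :=
    fun y h hy => by
      have h3 : 0 ≤ (3 * (n : ℝ) - 1) * (n / 2 - y) := mul_nonneg (by linarith) (by linarith)
      rw [dirU_of_nonneg hn (by linarith) hy, min_eq_right, abs_of_nonneg h3]
      nlinarith
  rcases le_total 0 y with h | h
  · rw [abs_of_nonneg h] at hy hy' ⊢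
    exact key y hy hy'
  · have := dirU_neg n hn hy'
    rw [abs_of_nonpos h] at hy hy' ⊢
    rw [← key (-y) hy hy', this, abs_neg]

theorem dirU_nonneg {n : ℕ} (hn : 1 ≤ n) {y : ℝ} (h : 0 ≤ y) (hy : y ≤ n / 2) : 0 ≤ dirU n y := by
  have hn' : (1 : ℝ) ≤ n := by exact_mod_cast hn
  rw [dirU_of_nonneg hn h hy]
  exact le_min h (mul_nonneg (by linarith) (by linarith))

/-- The gauge function of the triangle. -/
def triGauge (n : ℕ) (u v : ℝ) : ℝ := max v (2 * |u| / (n / 2 - 1 / 6) - v)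

/-- The top side lies on `v = 1`, the slanted sides on `2 * |u| / (n / 2 - 1 / 6) - v = 1`. -/
theorem triGauge_dir {n : ℕ} (hn : 1 ≤ n) {y : ℝ} (hy : |y| ≤ n / 2) :
    triGauge n (dirU n y) (dirV n y) = 1 := by
  have hn' : (1 : ℝ) ≤ n := by exact_mod_cast hn
  have ha : (0 : ℝ) < n / 2 - 1 / 6 := by linarith
  unfold triGauge
  rcases le_total |y| (n / 2 - 1 / 6) with h | h
  · rw [dirU_of_le hn h, dirV_of_le h, max_eq_left]
    rw [sub_le_iff_le_add, div_le_iff₀ ha]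
    linarith
  · rw [abs_dirU_of_ge hn h hy, dirV_of_ge h]
    have : 2 * ((3 * (n : ℝ) - 1) * (n / 2 - |y|)) / (n / 2 - 1 / 6) = 12 * (n / 2 - |y|) := by
      rw [div_eq_iff ha.ne']; ring
    rw [this, max_eq_right] <;> linarith

theorem triGauge_mul {n : ℕ} {ρ : ℝ} (hρ : 0 ≤ ρ) (u v : ℝ) :
    triGauge n (ρ * u) (ρ * v) = ρ * triGauge n u v := by
  unfold triGauge
  rw [mul_max_of_nonneg _ _ hρ, abs_mul, abs_of_nonneg hρ]
  congr 1
  ring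

theorem dir_injOn {n : ℕ} (hn : 1 ≤ n) {y y' : ℝ} (hy : |y| ≤ n / 2) (hy' : |y'| ≤ n / 2)
    (hu : dirU n y = dirU n y') (hv : dirV n y = dirV n y') :
    y = y' ∨ (|y| = n / 2 ∧ |y'| = n / 2) := by
  have hn' : (1 : ℝ) ≤ n := by exact_mod_cast hn
  have hcase : ∀ y : ℝ, dirV n y = 1 → |y| ≤ n / 2 - 1 / 6 := fun y h => by
    by_contra h'
    rw [dirV_of_ge (not_le.1 h').le] at h
    linarith
  rcases le_or_gt |y| (n / 2 - 1 / 6) with h | h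
  · have h' := hcase y' (by rw [← hv, dirV_of_le h])
    rw [dirU_of_le hn h, dirU_of_le hn h'] at hu
    exact Or.inl hu
  · rcases le_or_gt |y'| (n / 2 - 1 / 6) with h' | h'
    · exact absurd (hcase y (by rw [hv, dirV_of_le h'])) (not_le.2 h)
    rw [dirV_of_ge h.le, dirV_of_ge h'.le] at hv
    have habs : |y| = |y'| := by linarith
    rcases abs_eq_abs.1 habs with h1 | h1
    · exact Or.inl h1
    · right
      have h2 : dirU n y = 0 := by
        rw [h1, dirU_neg n hn hy'] at hu
        rw [h1, dirU_neg n hn hy']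
        linarith
      have h3 := abs_dirU_of_ge hn h.le hy
      rw [h2, abs_zero] at h3
      have h4 : n / 2 - |y| = 0 := by
        rcases mul_eq_zero.1 h3.symm with h5 | h5
        · linarith
        · exact h5
      constructor <;> linarith

theorem exists_dir_eq {n : ℕ} (hn : 1 ≤ n) {u v : ℝ} (h : triGauge n u v = 1) :
    ∃ y : ℝ, |y| ≤ n / 2 ∧ dirU n y = u ∧ dirV n y = v := by
  have hn' : (1 : ℝ) ≤ n := by exact_mod_cast hn
  have ha : (0 : ℝ) < n / 2 - 1 / 6 := by linarith
  have key : ∀ u : ℝ, 0 ≤ u → triGauge n u v = 1 → ∃ y : ℝ, |y| ≤ n / 2 ∧ dirU n y = u ∧ dirV n y = v := by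
    intro u hu h
    unfold triGauge at h
    rw [abs_of_nonneg hu] at h
    have h1 : v ≤ 1 := (le_max_left _ _).trans h.le
    have h2 : 2 * u / (n / 2 - 1 / 6) - v ≤ 1 := (le_max_right _ _).trans h.le
    rcases h1.lt_or_eq with h1' | h1'
    · have h3 : 2 * u / (n / 2 - 1 / 6) - v = 1 := by
        rcases max_choice v (2 * u / (n / 2 - 1 / 6) - v) with h4 | h4
        · rw [h4] at h; linarith
        · rw [← h4]; exact h
      have h4 : 2 * u / (n / 2 - 1 / 6) = 1 + v := by linarith
      rw [div_eq_iff ha.ne'] at h4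
      have h5 : 0 ≤ 1 + v := by
        by_contra h6
        nlinarith
      have h6 : |(n / 2 - 1 / 6 + (1 - v) / 12 : ℝ)| = n / 2 - 1 / 6 + (1 - v) / 12 :=
        abs_of_nonneg (by linarith)
      refine ⟨n / 2 - 1 / 6 + (1 - v) / 12, ?_, ?_, ?_⟩
      · rw [h6]; linarith
      · rw [← abs_of_nonneg (dirU_nonneg hn (by linarith) (by linarith)),
          abs_dirU_of_ge hn (by rw [h6]; linarith) (by rw [h6]; linarith), h6]
        linarith
      · rw [dirV_of_ge (by rw [h6]; linarith), h6]; ring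
    · rw [h1', sub_le_iff_le_add, div_le_iff₀ ha] at h2
      have h3 : |u| ≤ n / 2 - 1 / 6 := by rw [abs_of_nonneg hu]; linarith
      exact ⟨u, by linarith, dirU_of_le hn h3, by rw [dirV_of_le h3, h1']⟩
  rcases le_total 0 u with hu | hu
  · exact key u hu h
  · obtain ⟨y, h1, h2, h3⟩ := key (-u) (by linarith) (by rw [← h]; unfold triGauge; rw [abs_neg])
    refine ⟨-y, by rwa [abs_neg], ?_, by rw [dirV_neg, h3]⟩
    rw [dirU_neg n hn h1, h2, neg_neg]

/-- Polar coordinates about the vertex of the star, in which the edges of the star are rays and the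
boundary circles are `|y - y₀| = bump ρ`. -/
def polarPt (n : ℕ) (ρ y : ℝ) : ℂ :=
  ((n : ℂ) + 1) / 2 - I + ⟨ρ * dirU n y / max (ρ * dirV n y) (2 / 3), ρ * dirV n y⟩

theorem polarPt_re (n : ℕ) (ρ y : ℝ) :
    (polarPt n ρ y).re = ((n : ℝ) + 1) / 2 + ρ * dirU n y / max (ρ * dirV n y) (2 / 3) := by
  have : ((n : ℂ) + 1) / 2 = (((n + 1) / 2 : ℝ) : ℂ) := by push_cast; ring
  rw [polarPt, this]
  simp

theorem polarPt_im (n : ℕ) (ρ y : ℝ) : (polarPt n ρ y).im = -1 + ρ * dirV n y := by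
  have : ((n : ℂ) + 1) / 2 = (((n + 1) / 2 : ℝ) : ℂ) := by push_cast; ring
  rw [polarPt, this]
  simp

theorem max_two_thirds_pos (v : ℝ) : 0 < max v (2 / 3) := lt_max_of_lt_right (by norm_num)

theorem polarPt_zero (n : ℕ) (y : ℝ) : polarPt n 0 y = ((n : ℂ) + 1) / 2 - I := by
  rw [polarPt]
  simp only [zero_mul, zero_div]
  exact add_zero _

/-- The horizontal scaling depends on the height only, so the point determines the unscaled vector,
whose gauge is `ρ`. For `ρ > 0` the direction determines `y`, except that both ends of the interval
give the downward ray. -/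
theorem polarPt_injOn {n : ℕ} (hn : 1 ≤ n) {ρ ρ' y y' : ℝ} (hρ : 0 ≤ ρ) (hρ' : 0 ≤ ρ')
    (hy : |y| ≤ n / 2) (hy' : |y'| ≤ n / 2) (h : polarPt n ρ y = polarPt n ρ' y') :
    ρ = ρ' ∧ (0 < ρ → y = y' ∨ (|y| = n / 2 ∧ |y'| = n / 2)) := by
  have him := congrArg im h
  have hre := congrArg re h
  rw [polarPt_im, polarPt_im] at him
  rw [polarPt_re, polarPt_re] at hre
  have hv : ρ * dirV n y = ρ' * dirV n y' := by linarith
  rw [hv] at hre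
  have hu : ρ * dirU n y = ρ' * dirU n y' := by
    have := max_two_thirds_pos (ρ' * dirV n y')
    have h2 := add_left_cancel hre
    field_simp at h2
    linarith
  have hg : ρ = ρ' := by
    have h1 := triGauge_mul (n := n) hρ (dirU n y) (dirV n y)
    rw [hu, hv, triGauge_mul hρ', triGauge_dir hn hy, triGauge_dir hn hy'] at h1
    linarith
  refine ⟨hg, fun hpos => ?_⟩
  subst hg
  exact dir_injOn hn hy hy' (mul_left_cancel₀ hpos.ne' hu) (mul_left_cancel₀ hpos.ne' hv)

theorem exists_polarPt_eq {n : ℕ} (hn : 1 ≤ n) {w : ℂ} (hw : w ≠ ((n : ℂ) + 1) / 2 - I) :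
    ∃ ρ y : ℝ, 0 < ρ ∧ |y| ≤ n / 2 ∧ polarPt n ρ y = w := by
  have hn' : (1 : ℝ) ≤ n := by exact_mod_cast hn
  have ha : (0 : ℝ) < n / 2 - 1 / 6 := by linarith
  set v := w.im + 1 with hv
  set u := (w.re - ((n : ℝ) + 1) / 2) * max v (2 / 3) with hu
  have hm := max_two_thirds_pos v
  have hpos : 0 < triGauge n u v := by
    by_contra hneg
    have h1 : v ≤ 0 := (le_max_left _ _).trans (not_lt.1 hneg)
    have h2 : 2 * |u| / (n / 2 - 1 / 6) - v ≤ 0 := (le_max_right _ _).trans (not_lt.1 hneg)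
    have h3 : 0 ≤ 2 * |u| / (n / 2 - 1 / 6) := by positivity
    have h4 : v = 0 := by linarith
    have h5 : 2 * |u| / (n / 2 - 1 / 6) = 0 := by linarith
    rw [div_eq_zero_iff] at h5
    have h6 : |u| = 0 := by
      rcases h5 with h5 | h5 <;> linarith
    have h7 := (mul_eq_zero.1 (abs_eq_zero.1 h6)).resolve_right hm.ne'
    apply hw
    rw [← polarPt_zero n 0]
    apply Complex.ext
    · rw [polarPt_re, zero_mul, zero_div]; linarith
    · rw [polarPt_im]; linarith
  set ρ := triGauge n u v with hρ
  obtain ⟨y, hy, hyu, hyv⟩ := exists_dir_eq hn (u := ρ⁻¹ * u) (v := ρ⁻¹ * v) (by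
    rw [triGauge_mul (inv_nonneg.2 hpos.le), ← hρ, inv_mul_cancel₀ hpos.ne'])
  refine ⟨ρ, y, hpos, hy, ?_⟩
  apply Complex.ext
  · rw [polarPt_re, hyu, hyv, mul_inv_cancel_left₀ hpos.ne', mul_inv_cancel_left₀ hpos.ne', hu,
      mul_div_cancel_right₀ _ hm.ne']
    ring
  · rw [polarPt_im, hyv, mul_inv_cancel_left₀ hpos.ne', hv]; ring

/-- Up to the level of the marked points, `2/3` above the vertex, these rays are straight, so those
towards the marked points are the edges. Beyond that level they are vertical (`polarPt_of_ge`). -/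
theorem polarPt_of_le {n : ℕ} (hn : 1 ≤ n) {ρ y : ℝ} (hρ : ρ ≤ 2 / 3) (hy : |y| ≤ n / 2 - 1 / 6) :
    polarPt n ρ y = ((n : ℂ) + 1) / 2 - I + ((3 * ρ / 2 : ℝ) : ℂ) * (y + 2 / 3 * I) := by
  rw [polarPt, dirU_of_le hn hy, dirV_of_le hy, mul_one, max_eq_right hρ]
  congr 1
  apply Complex.ext
  · simp; ring
  · simp; ring

theorem polarPt_of_ge {n : ℕ} (hn : 1 ≤ n) {ρ y : ℝ} (hρ : 2 / 3 ≤ ρ) (hy : |y| ≤ n / 2 - 1 / 6) :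
    polarPt n ρ y = ⟨((n : ℝ) + 1) / 2 + y, ρ - 1⟩ := by
  apply Complex.ext
  · rw [polarPt_re, dirU_of_le hn hy, dirV_of_le hy, mul_one, max_eq_left hρ,
      mul_div_cancel_left₀ _ (by linarith)]
  · rw [polarPt_im, dirV_of_le hy]; simp; ring

/-- Points outside the top side of the triangle stay away from the boundary circles. -/
theorem le_norm_polarPt_sub_of_ge {n : ℕ} (hn : 1 ≤ n) {ρ y : ℝ} (hρ : 0 ≤ ρ) (hy : n / 2 - 1 / 6 ≤ |y|)
    (hy' : |y| ≤ n / 2) (k : Fin n) : 1 / 3 ≤ ‖polarPt n ρ y - (k + 1)‖ := by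
  have hn' : (1 : ℝ) ≤ n := by exact_mod_cast hn
  have him : (polarPt n ρ y - (k + 1)).im = -1 + ρ * dirV n y := by
    rw [sub_im, polarPt_im]; simp
  have hre : (polarPt n ρ y - (k + 1)).re =
      ((n : ℝ) + 1) / 2 - (k + 1) + ρ * dirU n y / max (ρ * dirV n y) (2 / 3) := by
    rw [sub_re, polarPt_re]; simp; ring
  -- Below the level of the marked points the imaginary part gives the distance. Above it the point
  -- is at least `n / 2 - 1 / 6` away from the axis, while the centres are within `(n - 1) / 2`.
  rcases le_total (ρ * dirV n y) (2 / 3) with h | h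
  · refine le_trans ?_ (abs_im_le_norm _)
    rw [him]
    exact le_trans (by linarith) (neg_le_abs _)
  · refine le_trans ?_ (abs_re_le_norm _)
    rw [hre, max_eq_left h]
    have hρ0 : ρ ≠ 0 := fun h0 => by rw [h0] at h; norm_num at h
    have hρ1 : 0 < ρ := lt_of_le_of_ne hρ hρ0.symm
    have hv : 0 < dirV n y := by
      by_contra h0
      nlinarith
    rw [mul_div_mul_left _ _ hρ0]
    have h1 : n / 2 - 1 / 6 ≤ |dirU n y / dirV n y| := by
      rw [abs_div, abs_of_pos hv, le_div_iff₀ hv, abs_dirU_of_ge hn hy hy', dirV_of_ge hy]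
      nlinarith
    have hk0 : (0 : ℝ) ≤ k := by positivity
    have hk1 : (k : ℝ) + 1 ≤ n := by exact_mod_cast k.2
    rcases abs_cases (dirU n y / dirV n y) with ⟨h2, -⟩ | ⟨h2, -⟩
    · exact le_trans (by linarith) (le_abs_self _)
    · exact le_trans (by linarith) (neg_le_abs _)

end PolarCoordinates

/-! ### The sphere cut open along the star, in explicit coordinates. -/

section PolygonPoints

open Complex

/-- The horizontal scaling factor at height `ρ` that makes room for the boundary circles; the
parameter `c` cuts off the singularity at `ρ = 0`. -/
def squeeze (c ρ : ℝ) : ℝ := (1 - 2 * bump ρ) / min (max (3 * ρ / 4) c) 1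

theorem continuous_squeeze {c : ℝ} (hc : 0 < c) : Continuous (squeeze c) := by
  unfold squeeze
  have := continuous_bump
  refine Continuous.div (by fun_prop) (by fun_prop) fun ρ => ?_
  exact (lt_min (lt_max_of_lt_right hc) one_pos).ne'

theorem squeeze_of_ge {c ρ : ℝ} (h : 4 / 3 ≤ ρ) : squeeze c ρ = 1 := by
  rw [squeeze, bump_of_ge h, min_eq_right (le_max_of_le_left (by linarith))]
  norm_num

theorem squeeze_eq {c c' ρ : ℝ} (h : c ≤ 3 * ρ / 4) (h' : c' ≤ 3 * ρ / 4) : squeeze c ρ = squeeze c' ρ := by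
  rw [squeeze, squeeze, max_eq_left h, max_eq_left h']

theorem squeeze_nonneg (ρ : ℝ) : 0 ≤ squeeze 0 ρ := by
  have := bump_le ρ
  refine div_nonneg (by linarith) (le_min (le_max_right _ _) zero_le_one)

theorem squeeze_zero_eq {ρ : ℝ} (hρ : 0 ≤ ρ) : squeeze 0 ρ = (1 - 2 * bump ρ) / min (3 * ρ / 4) 1 := by
  rw [squeeze, max_eq_left (by linarith)]

theorem squeeze_pos {ρ : ℝ} (hρ : 0 < ρ) : 0 < squeeze 0 ρ := by
  have := bump_le ρ
  rw [squeeze_zero_eq hρ.le]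
  exact div_pos (by linarith) (lt_min (by linarith) one_pos)

/-- At height `ρ` the gap between neighbouring circles has half-width `1 / 2 - bump ρ`. The
admissible `x` fill an interval of half-width `min (3 * ρ / 4) 1 / 2`, and `squeeze` is the quotient
of the two. -/
theorem abs_mul_squeeze_le {x ρ : ℝ} (hx : |x| ≤ 1 / 2) (hρ : 8 / 3 * |x| ≤ ρ) :
    |x * squeeze 0 ρ| ≤ 1 / 2 - bump ρ := by
  have h0 : 0 ≤ ρ := le_trans (by positivity) hρ
  have hb := bump_le ρ
  rcases h0.lt_or_eq with h | h
  · have hm : 0 < min (3 * ρ / 4) 1 := lt_min (by linarith) one_pos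
    rw [abs_mul, abs_of_nonneg (squeeze_nonneg ρ), squeeze_zero_eq h0, mul_div_assoc', div_le_iff₀ hm]
    have h2 : |x| ≤ min (3 * ρ / 4) 1 / 2 := by
      rw [le_div_iff₀ two_pos]
      exact le_min (by linarith) (by linarith)
    nlinarith
  · have : |x| = 0 := le_antisymm (by linarith) (abs_nonneg x)
    rw [abs_eq_zero.1 this, zero_mul, abs_zero]
    linarith

/-- The height of a point on the ray through the boundary point with coordinate `q`. -/
def depth (q s : ℝ) : ℝ := 8 / 3 * |Int.fract q - 1 / 2| + s

/-- The horizontal coordinate of a point on the ray through the boundary point with coordinate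
`q`. -/
def shift (q s : ℝ) : ℝ := q + (1 / 2 - Int.fract q) * (1 - squeeze 0 (depth q s))

theorem depth_nonneg {q s : ℝ} (hs : 0 ≤ s) : 0 ≤ depth q s := by unfold depth; positivity

theorem depth_eq {q s : ℝ} {j : ℤ} (h : (j : ℝ) ≤ q) (h' : q ≤ j + 1) :
    depth q s = 8 / 3 * |q - j - 1 / 2| + s := by
  unfold depth
  rcases h'.lt_or_eq with h1 | h1
  · rw [show Int.fract q = q - j from Int.fract_eq_iff.2 ⟨by linarith, by linarith, j, by ring⟩]
  · have : Int.fract q = 0 := by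
      rw [h1, show (j : ℝ) + 1 = ((j + 1 : ℤ) : ℝ) by push_cast; ring, Int.fract_intCast]
    rw [this, h1]
    norm_num

/-- The right end `q = j + 1`, where `Int.fract` jumps, is included: the depth there is at least `4
/ 3`, above the circles, and the scaling factor is `1`. -/
theorem shift_eq {q s : ℝ} (hs : 0 ≤ s) {j : ℤ} (h : (j : ℝ) ≤ q) (h' : q ≤ j + 1) :
    shift q s = j + 1 / 2 + (q - j - 1 / 2) * squeeze 0 (depth q s) := by
  unfold shift
  rcases h'.lt_or_eq with h1 | h1
  · rw [show Int.fract q = q - j from Int.fract_eq_iff.2 ⟨by linarith, by linarith, j, by ring⟩]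
    ring
  · have : 4 / 3 ≤ depth q s := by
      rw [depth_eq h h', h1, add_sub_cancel_left]
      norm_num
      exact hs
    rw [squeeze_of_ge this]
    ring

theorem abs_gap_le {q : ℝ} {j : ℤ} (h : (j : ℝ) ≤ q) (h' : q ≤ j + 1) : |q - j - 1 / 2| ≤ 1 / 2 := by
  rw [abs_le]; constructor <;> linarith

theorem abs_shift_sub_le {q s : ℝ} (hs : 0 ≤ s) {j : ℤ} (h : (j : ℝ) ≤ q) (h' : q ≤ j + 1) :
    |shift q s - (j + 1 / 2)| ≤ 1 / 2 - bump (depth q s) := by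
  rw [shift_eq hs h h', add_sub_cancel_left]
  refine abs_mul_squeeze_le (abs_gap_le h h') ?_
  rw [depth_eq h h']
  linarith

/-- The ends of the window are midpoints of gaps, and the scaling keeps every point on its side of
the midpoint. -/
theorem shift_mem_window {n : ℕ} {q s : ℝ} (hs : 0 ≤ s) (h : -(1 / 2) ≤ q) (h' : q ≤ n - 1 / 2) :
    |shift q s - (n - 1) / 2| ≤ n / 2 := by
  have h1 := Int.floor_le q
  have h2 := (Int.lt_floor_add_one q).le
  have h3 := abs_le.1 (abs_shift_sub_le hs h1 h2)
  have h4 := bump_nonneg (depth q s)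
  have h5 := squeeze_nonneg (depth q s)
  have h6 := shift_eq hs h1 h2
  set j := ⌊q⌋
  rw [abs_le]
  constructor
  · rcases le_or_gt 0 j with hj | hj
    · have : (0 : ℝ) ≤ j := by exact_mod_cast hj
      linarith
    · have hj1 : -1 ≤ j := by
        by_contra hlt
        have : (j : ℝ) ≤ -2 := by exact_mod_cast (by omega : j ≤ -2)
        linarith
      have hj2 : (j : ℝ) = -1 := by exact_mod_cast (by omega : j = -1)
      have : 0 ≤ (q - j - 1 / 2) * squeeze 0 (depth q s) := mul_nonneg (by rw [hj2]; linarith) h5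
      linarith
  · rcases lt_or_ge j (n - 1) with hj | hj
    · have : (j : ℝ) + 2 ≤ n := by exact_mod_cast (by omega : j + 2 ≤ n)
      linarith
    · have hj1 : j ≤ n - 1 := by
        by_contra hlt
        have : (n : ℝ) ≤ j := by exact_mod_cast (by omega : (n : ℤ) ≤ j)
        linarith
      have hj2 : (j : ℝ) + 1 = n := by exact_mod_cast (by omega : j + 1 = n)
      have : (q - j - 1 / 2) * squeeze 0 (depth q s) ≤ 0 :=
        mul_nonpos_of_nonpos_of_nonneg (by linarith) h5
      linarith

/-- The point at distance `s` from the boundary on the ray through the boundary point with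
coordinate `q`. -/
def polyPt (n : ℕ) (q s : ℝ) : ℂ := polarPt n (depth q s) (shift q s - (n - 1) / 2)

/-- Below the marked points and off the top side of the triangle polar coordinates avoid the circles
anyway; elsewhere the point lies in a gap, at horizontal distance at least `bump` from all centres.
-/
theorem le_norm_polyPt_sub {n : ℕ} (hn : 1 ≤ n) {q s : ℝ} (hs : 0 ≤ s) (h : -(1 / 2) ≤ q)
    (h' : q ≤ n - 1 / 2) (k : Fin n) : 1 / 3 ≤ ‖polyPt n q s - (k + 1)‖ := by
  have hw := shift_mem_window hs h h'
  have hρ := depth_nonneg (q := q) hs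
  rcases le_total |shift q s - (n - 1) / 2| (n / 2 - 1 / 6) with hy | hy
  · rcases le_total (depth q s) (2 / 3) with hd | hd
    · refine le_trans ?_ (abs_im_le_norm _)
      rw [polyPt, sub_im, polarPt_im, dirV_of_le hy]
      refine le_trans ?_ (neg_le_abs _)
      simp
      linarith
    · rw [polyPt, polarPt_of_ge hn hd hy]
      have h1 := Int.floor_le q
      have h2 := (Int.lt_floor_add_one q).le
      have h3 := abs_le.1 (abs_shift_sub_le hs h1 h2)
      have h4 := bump_nonneg (depth q s)
      have h5 : bump (depth q s) ≤ |shift q s - k| := by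
        rcases le_or_gt (k : ℤ) ⌊q⌋ with hj | hj
        · have : (k : ℝ) ≤ ⌊q⌋ := by exact_mod_cast hj
          exact le_trans (by linarith) (le_abs_self _)
        · have : (⌊q⌋ : ℝ) + 1 ≤ k := by exact_mod_cast hj
          exact le_trans (by linarith) (neg_le_abs _)
      have h6 := le_bump_sq (depth q s)
      have h7 : bump (depth q s) ^ 2 ≤ (shift q s - k) ^ 2 := by
        rw [← sq_abs (shift q s - k)]
        exact pow_le_pow_left₀ h4 h5 2
      have h8 : (⟨((n : ℝ) + 1) / 2 + (shift q s - (n - 1) / 2), depth q s - 1⟩ - (k + 1) : ℂ) =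
          ⟨shift q s - k, depth q s - 1⟩ := by
        apply Complex.ext
        · simp; ring
        · simp
      rw [h8, Complex.norm_eq_sqrt_sq_add_sq]
      refine Real.le_sqrt_of_sq_le ?_
      simp only
      linarith
  · exact le_norm_polarPt_sub_of_ge hn hρ hy hw k

/-- Polar coordinates give back the depth, and the horizontal position modulo `n`. Different gaps
can give the same position only above the circles, where nothing is squeezed and the position is `q`
itself. One point must be off the boundary, since the star is covered twice by `s = 0`. -/
theorem polyPt_injOn {n : ℕ} (hn : 1 ≤ n) {q s q' s' : ℝ} (hs : 0 < s) (hs' : 0 ≤ s')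
    (h1 : -(1 / 2) ≤ q) (h2 : q ≤ n - 1 / 2) (h1' : -(1 / 2) ≤ q') (h2' : q' ≤ n - 1 / 2)
    (h : polyPt n q s = polyPt n q' s') : s = s' ∧ ∃ m : ℤ, q = q' + m * n := by
  have hw := shift_mem_window hs.le h1 h2
  have hw' := shift_mem_window hs' h1' h2'
  obtain ⟨hd, hsh⟩ := polarPt_injOn hn (depth_nonneg hs.le) (depth_nonneg hs') hw hw' h
  have hdpos : 0 < depth q s := by unfold depth; positivity
  have hmain : ∃ m : ℤ, shift q s = shift q' s' + m * n := by
    rcases hsh hdpos with h3 | ⟨h3, h4⟩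
    · exact ⟨0, by push_cast; linarith⟩
    · rcases abs_cases (shift q s - (n - 1) / 2) with ⟨h5, -⟩ | ⟨h5, -⟩ <;>
      rcases abs_cases (shift q' s' - (n - 1) / 2) with ⟨h6, -⟩ | ⟨h6, -⟩
      · exact ⟨0, by push_cast; linarith⟩
      · exact ⟨1, by push_cast; linarith⟩
      · exact ⟨-1, by push_cast; linarith⟩
      · exact ⟨0, by push_cast; linarith⟩
  obtain ⟨m, hm⟩ := hmain
  set j := ⌊q⌋ with hj
  set j' := ⌊q'⌋ with hj'
  have b1 : (j : ℝ) ≤ q := Int.floor_le q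
  have b2 : q ≤ j + 1 := (Int.lt_floor_add_one q).le
  have b1' : (j' : ℝ) ≤ q' := Int.floor_le q'
  have b2' : q' ≤ j' + 1 := (Int.lt_floor_add_one q').le
  have e := shift_eq hs.le b1 b2
  have e' := shift_eq hs' b1' b2'
  have r := abs_shift_sub_le hs.le b1 b2
  have r' := abs_shift_sub_le hs' b1' b2'
  have d := depth_eq (s := s) b1 b2
  have d' := depth_eq (s := s') b1' b2'
  rw [← hd] at e' r' d'
  set ρ := depth q s with hρdef
  have hsq := squeeze_pos hdpos
  have hbn := bump_nonneg ρ
  set x := q - j - 1 / 2 with hx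
  set x' := q' - j' - 1 / 2 with hx'
  -- it suffices to compare the positions in the gaps
  have finish : x = x' → j = j' + m * n → s = s' ∧ ∃ m : ℤ, q = q' + m * n := by
    intro hxx hjj
    refine ⟨?_, m, ?_⟩
    · rw [hxx] at d; linarith
    · have : (j : ℝ) = j' + m * n := by exact_mod_cast hjj
      linarith
  rcases eq_or_ne j (j' + m * n) with hjj | hjj
  · refine finish ?_ hjj
    have : (j : ℝ) = j' + m * n := by exact_mod_cast hjj
    have h3 : x * squeeze 0 ρ = x' * squeeze 0 ρ := by linarith
    exact mul_right_cancel₀ hsq.ne' h3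
  · rw [abs_le] at r r'
    -- At a smaller depth, `s > 0` gives `8 / 3 * |x| < ρ` and the point would be strictly inside
    -- its gap.
    have hge : 4 / 3 ≤ ρ := by
      by_contra hlt
      have hxx : |x * squeeze 0 ρ| < 1 / 2 := by
        have hm0 : 0 < 3 * ρ / 4 := by linarith
        have hb := bump_le ρ
        rw [abs_mul, abs_of_pos hsq, squeeze_zero_eq hdpos.le, min_eq_left (by linarith), mul_div_assoc',
          div_lt_iff₀ hm0]
        nlinarith [abs_nonneg x]
      rw [abs_lt] at hxx
      rcases lt_or_gt_of_ne hjj with h3 | h3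
      · have : (j : ℝ) + 1 ≤ j' + m * n := by exact_mod_cast h3
        linarith
      · have : (j' : ℝ) + m * n + 1 ≤ j := by exact_mod_cast h3
        linarith
    rw [squeeze_of_ge hge] at e e'
    have hq : q = q' + m * n := by linarith
    refine ⟨?_, m, hq⟩
    have : depth q' s = depth q s := by
      rw [hq]
      unfold depth
      rw [show q' + m * n = q' + ((m * n : ℤ) : ℝ) by push_cast; ring, Int.fract_add_intCast]
    unfold depth at this hd hρdef
    linarith

/-- The coordinates can be solved for: `j` is the gap of the point, division by the scaling factor
gives the offset `x` of the ray, and `s` is what the depth exceeds `8 / 3 * |x|` by. -/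
theorem exists_polyPt_eq {n : ℕ} (hn : 1 ≤ n) {w : ℂ} (hw : ∀ k : Fin n, 1 / 3 ≤ ‖w - (k + 1)‖)
    (hw' : w ≠ ((n : ℂ) + 1) / 2 - I) :
    ∃ q s : ℝ, 0 ≤ s ∧ -(1 / 2) ≤ q ∧ q ≤ n - 1 / 2 ∧ polyPt n q s = w := by
  have hn' : (1 : ℝ) ≤ n := by exact_mod_cast hn
  obtain ⟨ρ, y, hρ, hy, rfl⟩ := exists_polarPt_eq hn hw'
  set p := y + (n - 1) / 2 with hp
  obtain ⟨hy1, hy2⟩ := abs_le.1 hy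
  set j := ⌊p⌋ with hj
  have b1 : (j : ℝ) ≤ p := Int.floor_le p
  have b2 : p < j + 1 := Int.lt_floor_add_one p
  have hbn := bump_nonneg ρ
  have hbl := bump_le ρ
  -- distance from the integers
  have hdist : ∀ k : ℤ, bump ρ ≤ |p - k| := by
    intro k
    rcases le_or_gt ρ (2 / 3) with hρ1 | hρ1
    · rw [bump_of_le hρ1]; positivity
    rcases le_or_gt |y| (n / 2 - 1 / 6) with hya | hya
    · obtain ⟨ha1, ha2⟩ := abs_le.1 hya
      rcases lt_or_ge k 0 with hk | hk
      · have : (k : ℝ) ≤ -1 := by exact_mod_cast (by omega : k ≤ -1)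
        exact le_trans (by linarith) (le_abs_self _)
      rcases lt_or_ge k n with hk' | hk'
      · lift k to ℕ using hk
        have hkn : k < n := by exact_mod_cast hk'
        have h3 := hw ⟨k, hkn⟩
        rw [polarPt_of_ge hn hρ1.le hya] at h3
        have h8 : (⟨((n : ℝ) + 1) / 2 + y, ρ - 1⟩ - (((⟨k, hkn⟩ : Fin n) : ℕ) + 1) : ℂ) = ⟨p - k, ρ - 1⟩ := by
          apply Complex.ext
          · simp [hp]; ring
          · simp
        rw [h8, Complex.norm_eq_sqrt_sq_add_sq, Real.le_sqrt' (by norm_num)] at h3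
        simp only at h3
        refine Real.sqrt_le_iff.2 ⟨abs_nonneg _, ?_⟩
        rw [sq_abs]
        push_cast
        linarith
      · have : (n : ℝ) ≤ k := by exact_mod_cast hk'
        exact le_trans (by linarith) (neg_le_abs _)
    · rcases abs_cases y with ⟨h5, -⟩ | ⟨h5, -⟩
      · rw [h5] at hya
        rcases lt_or_ge k n with hk' | hk'
        · have : (k : ℝ) + 1 ≤ n := by exact_mod_cast hk'
          exact le_trans (by linarith) (le_abs_self _)
        · have : (n : ℝ) ≤ k := by exact_mod_cast hk'
          exact le_trans (by linarith) (neg_le_abs _)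
      · rw [h5] at hya
        rcases lt_or_ge k 0 with hk | hk
        · have : (k : ℝ) ≤ -1 := by exact_mod_cast (by omega : k ≤ -1)
          exact le_trans (by linarith) (le_abs_self _)
        · have : (0 : ℝ) ≤ k := by exact_mod_cast hk
          exact le_trans (by linarith) (neg_le_abs _)
  have hd1 : j + bump ρ ≤ p := by
    have := hdist j
    rw [abs_of_nonneg (by linarith)] at this
    linarith
  have hd2 : p ≤ j + 1 - bump ρ := by
    have := hdist (j + 1)
    push_cast at this
    rw [abs_of_nonpos (by linarith)] at this
    linarith
  have hsq := squeeze_pos hρ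
  set x := (p - j - 1 / 2) / squeeze 0 ρ with hx
  have hxs : x * squeeze 0 ρ = p - j - 1 / 2 := div_mul_cancel₀ _ hsq.ne'
  have hm : 0 < min (3 * ρ / 4) 1 := lt_min (by linarith) one_pos
  have hxa : |x| ≤ min (3 * ρ / 4) 1 / 2 := by
    have h3 : |x| * squeeze 0 ρ ≤ 1 / 2 - bump ρ := by
      rw [← abs_of_pos hsq, ← abs_mul, hxs, abs_le]
      constructor <;> linarith
    rw [squeeze_zero_eq hρ.le, mul_div_assoc', div_le_iff₀ hm] at h3
    nlinarith
  have hxa1 : |x| ≤ 1 / 2 := hxa.trans (by linarith [min_le_right (3 * ρ / 4) 1])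
  have hxa2 : |x| ≤ 3 * ρ / 8 := hxa.trans (by linarith [min_le_left (3 * ρ / 4) 1])
  obtain ⟨hx1, hx2⟩ := abs_le.1 hxa1
  have c1 : (j : ℝ) ≤ j + 1 / 2 + x := by linarith
  have c2 : (j : ℝ) + 1 / 2 + x ≤ j + 1 := by linarith
  have hs : 0 ≤ ρ - 8 / 3 * |x| := by linarith
  have hdep : depth (j + 1 / 2 + x) (ρ - 8 / 3 * |x|) = ρ := by
    rw [depth_eq c1 c2, show (j : ℝ) + 1 / 2 + x - j - 1 / 2 = x by ring]; ring
  have hshift : shift (j + 1 / 2 + x) (ρ - 8 / 3 * |x|) = p := by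
    rw [shift_eq hs c1 c2, hdep, show (j : ℝ) + 1 / 2 + x - j - 1 / 2 = x by ring, hxs]; ring
  refine ⟨j + 1 / 2 + x, ρ - 8 / 3 * |x|, hs, ?_, ?_, ?_⟩
  · rcases le_or_gt 0 j with hj0 | hj0
    · have : (0 : ℝ) ≤ j := by exact_mod_cast hj0
      linarith
    · have hj1 : (j : ℝ) = -1 := by
        have : -1 ≤ j := by
          by_contra hlt
          have : (j : ℝ) ≤ -2 := by exact_mod_cast (by omega : j ≤ -2)
          linarith
        exact_mod_cast (by omega : j = -1)
      have : 0 ≤ x := div_nonneg (by rw [hj1]; linarith) hsq.le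
      linarith
  · rcases lt_or_ge j (n - 1) with hj0 | hj0
    · have : (j : ℝ) + 2 ≤ n := by exact_mod_cast (by omega : j + 2 ≤ n)
      linarith
    · have hj2 : (j : ℝ) + 1 = n := by
        have : j ≤ n - 1 := by
          by_contra hlt
          have : (n : ℝ) ≤ j := by exact_mod_cast (by omega : (n : ℤ) ≤ j)
          linarith
        exact_mod_cast (by omega : j + 1 = n)
      have : x ≤ 0 := div_nonpos_of_nonpos_of_nonneg (by linarith) hsq.le
      linarith
  · rw [polyPt, hdep, hshift, hp, add_sub_cancel_right]

/-- Boundary values near the `k`-th circle. -/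
theorem depth_rim {k : ℤ} {r : ℝ} (hr : |r| ≤ 2) : depth (k + r / 4) 0 = 4 / 3 - 2 / 3 * |r| := by
  rcases abs_cases r with ⟨h, h'⟩ | ⟨h, h'⟩
  · rw [h] at hr ⊢
    rw [depth_eq (j := k) (by linarith) (by linarith),
      abs_of_nonpos (by linarith : (k : ℝ) + r / 4 - k - 1 / 2 ≤ 0)]
    ring
  · rw [h] at hr ⊢
    rw [depth_eq (j := k - 1) (by push_cast; linarith) (by push_cast; linarith),
      abs_of_nonneg (by push_cast; linarith)]
    push_cast
    ring

theorem shift_rim_of_nonneg {k : ℤ} {r : ℝ} (h0 : 0 ≤ r) (hr : r < 2) :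
    shift (k + r / 4) 0 = k + bump (4 / 3 - 2 / 3 * r) := by
  have hd := depth_rim (k := k) (r := r) (by rw [abs_of_nonneg h0]; exact hr.le)
  rw [abs_of_nonneg h0] at hd
  rw [shift_eq le_rfl (j := k) (by linarith) (by linarith), hd, squeeze_zero_eq (by linarith),
    min_eq_left (by linarith)]
  have h1 : (3 * (4 / 3 - 2 / 3 * r) / 4) ≠ 0 := by
    intro h; linarith
  have h2 : (k : ℝ) + r / 4 - k - 1 / 2 = -(3 * (4 / 3 - 2 / 3 * r) / 4) / 2 := by ring
  rw [h2]
  generalize (3 * (4 / 3 - 2 / 3 * r) / 4) = D at h1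
  field_simp
  ring

theorem shift_rim_of_nonpos {k : ℤ} {r : ℝ} (h0 : r ≤ 0) (hr : -2 < r) :
    shift (k + r / 4) 0 = k - bump (4 / 3 + 2 / 3 * r) := by
  have hd := depth_rim (k := k) (r := r) (by rw [abs_of_nonpos h0]; linarith)
  rw [abs_of_nonpos h0] at hd
  rw [shift_eq le_rfl (j := k - 1) (by push_cast; linarith) (by push_cast; linarith), hd,
    squeeze_zero_eq (by linarith), min_eq_left (by linarith),
    show 4 / 3 - 2 / 3 * -r = 4 / 3 + 2 / 3 * r by ring]
  have h1 : (3 * (4 / 3 + 2 / 3 * r) / 4) ≠ 0 := by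
    intro h; linarith
  have h2 : (k : ℝ) + r / 4 - (k - 1 : ℤ) - 1 / 2 = (3 * (4 / 3 + 2 / 3 * r) / 4) / 2 := by
    push_cast; ring
  rw [h2]
  generalize (3 * (4 / 3 + 2 / 3 * r) / 4) = D at h1
  push_cast
  field_simp
  ring

/-- Up to depth `2/3` the circles do not narrow the gap, so both boundary arcs beside a circle run
along its edge. At `|r| = 2` the depth is zero and the shift does not matter. -/
theorem polyPt_edge {n : ℕ} (hn : 1 ≤ n) (k : Fin n) {r : ℝ} (h1 : 1 ≤ |r|) (h2 : |r| ≤ 2) :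
    polyPt n (k + r / 4) 0 = ((n : ℂ) + 1) / 2 - I +
      ((2 - |r| : ℝ) : ℂ) * ((k + 1 - I / 3) - (((n : ℂ) + 1) / 2 - I)) := by
  have hk0 : (0 : ℝ) ≤ k := by positivity
  have hk1 : (k : ℝ) + 1 ≤ n := by exact_mod_cast k.2
  have hd : depth (k + r / 4) 0 = 4 / 3 - 2 / 3 * |r| := by
    exact_mod_cast depth_rim (k := ((k : ℕ) : ℤ)) h2
  rcases h2.lt_or_eq with h3 | h3
  · have hb : bump (4 / 3 - 2 / 3 * |r|) = 0 := bump_of_le (by linarith)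
    have hs : shift (k + r / 4) 0 = k := by
      rcases abs_cases r with ⟨h, h'⟩ | ⟨h, h'⟩
      · have := shift_rim_of_nonneg (k := ((k : ℕ) : ℤ)) (r := r) h' (by linarith)
        rw [h] at hb
        rw [hb] at this
        push_cast at this
        linarith
      · have := shift_rim_of_nonpos (k := ((k : ℕ) : ℤ)) (r := r) h'.le (by linarith)
        rw [h, show 4 / 3 - 2 / 3 * -r = 4 / 3 + 2 / 3 * r by ring] at hb
        rw [hb] at this
        push_cast at this
        linarith
    rw [polyPt, hd, hs, polarPt_of_le hn (by linarith) (by rw [abs_le]; constructor <;> linarith)]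
    congr 1
    push_cast
    ring
  · rw [polyPt, hd, h3]
    norm_num
    exact polarPt_zero _ _

/-- The depth grows from `2/3` at the marked point, `|r| = 1`, to `4/3` at the top of the circle, `r
= 0`; the sign of `r` tells the side. -/
theorem polyPt_circle {n : ℕ} (hn : 1 ≤ n) (k : Fin n) {r : ℝ} (hr : |r| ≤ 1) :
    polyPt n (k + r / 4) 0 =
      ⟨k + 1 + SignType.sign r * bump (4 / 3 - 2 / 3 * |r|), 1 / 3 - 2 / 3 * |r|⟩ := by
  have hk0 : (0 : ℝ) ≤ k := by positivity
  have hk1 : (k : ℝ) + 1 ≤ n := by exact_mod_cast k.2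
  have hd : depth (k + r / 4) 0 = 4 / 3 - 2 / 3 * |r| := by
    exact_mod_cast depth_rim (k := ((k : ℕ) : ℤ)) (by linarith)
  have hs : shift (k + r / 4) 0 = k + SignType.sign r * bump (4 / 3 - 2 / 3 * |r|) := by
    rcases lt_trichotomy r 0 with h | h | h
    · have := shift_rim_of_nonpos (k := ((k : ℕ) : ℤ)) (r := r) h.le (by linarith [neg_le_abs r])
      rw [sign_neg h, abs_of_neg h, show 4 / 3 - 2 / 3 * -r = 4 / 3 + 2 / 3 * r by ring]
      push_cast at this
      rw [this]
      simp [sub_eq_add_neg]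
    · have := shift_rim_of_nonneg (k := ((k : ℕ) : ℤ)) (r := r) h.ge (by linarith)
      rw [h] at this ⊢
      push_cast at this
      rw [abs_zero, this]
      simp only [mul_zero, sub_zero]
      rw [bump_of_ge le_rfl]
      simp
    · have := shift_rim_of_nonneg (k := ((k : ℕ) : ℤ)) (r := r) h.le (by linarith [le_abs_self r])
      rw [sign_pos h, abs_of_pos h]
      push_cast at this
      rw [this]
      simp
  have hb := bump_le (4 / 3 - 2 / 3 * |r|)
  have hb' := bump_nonneg (4 / 3 - 2 / 3 * |r|)
  have hbs : |SignType.sign r * bump (4 / 3 - 2 / 3 * |r|)| ≤ 1 / 3 := by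
    rcases lt_trichotomy r 0 with h | h | h
    · rw [sign_neg h]; simp; rw [abs_of_nonneg hb']; simpa using hb
    · rw [h]; simp
    · rw [sign_pos h]; simp; rw [abs_of_nonneg hb']; simpa using hb
  rw [abs_le] at hbs
  rw [polyPt, hd, hs, polarPt_of_ge hn (by linarith) (by rw [abs_le]; constructor <;> linarith)]
  apply Complex.ext <;> simp <;> ring

end PolygonPoints

/-! ### Construction of the polygon map from the disc to the standard sphere. -/

section PolygonMap

open Complex

/-- The closed unit disc. -/
abbrev Disc : Type := Metric.closedBall (0 : ℂ) 1

theorem Disc.norm_le (z : Disc) : ‖(z : ℂ)‖ ≤ 1 := mem_closedBall_zero_iff.1 z.2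

/-- The boundary of the disc, parametrized with period `4 * n`. -/
def rim (n : ℕ) (τ : ℝ) : Disc :=
  ⟨unitLoop (τ / (4 * n)), mem_closedBall_zero_iff.2 (norm_unitLoop _).le⟩

theorem norm_rim (n : ℕ) (τ : ℝ) : ‖(rim n τ : ℂ)‖ = 1 := norm_unitLoop _

theorem continuous_rim (n : ℕ) : Continuous (rim n) :=
  Continuous.subtype_mk (continuous_unitLoop.comp (by fun_prop)) _

theorem rim_eq_iff {n : ℕ} (hn : 1 ≤ n) {τ σ : ℝ} : rim n τ = rim n σ ↔ ∃ m : ℤ, τ = σ + m * (4 * n) := by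
  have hn' : (0 : ℝ) < n := by exact_mod_cast hn
  rw [Subtype.ext_iff, rim, rim, unitLoop_eq_iff]
  refine exists_congr fun m => ?_
  field_simp

theorem rim_add_mul {n : ℕ} (hn : 1 ≤ n) (τ : ℝ) (m : ℤ) : rim n (τ + m * (4 * n)) = rim n τ :=
  (rim_eq_iff hn).2 ⟨m, rfl⟩

theorem exists_rim_eq {n : ℕ} (hn : 1 ≤ n) {z : Disc} (hz : ‖(z : ℂ)‖ = 1) : ∃ τ, rim n τ = z := by
  have hn' : (0 : ℝ) < n := by exact_mod_cast hn
  obtain ⟨t, ht⟩ := exists_unitLoop_eq hz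
  refine ⟨t * (4 * n), Subtype.ext ?_⟩
  simp only [rim]
  rw [mul_div_cancel_right₀ _ (by positivity), ht]

/-- A point of an edge of the standard star. -/
def edgePt (n : ℕ) (k : Fin n) (l : ℝ) : ℂ :=
  ((n : ℂ) + 1) / 2 - I + (l : ℂ) * ((k + 1 - I / 3) - (((n : ℂ) + 1) / 2 - I))

/-- A presentation of the standard sphere as a polygon with identifications on its boundary: the
disc is the sphere cut open along the star.  In the coordinate of period `4 * n` on the boundary of
the disc, the circle with index `k` corresponds to the interval `[4k - 1, 4k + 1]`, and the edge with
index `k` to `[4k - 2, 4k - 1]` and `[4k + 1, 4k + 2]`. -/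
structure IsPolygon (n : ℕ) (P : Disc → StdSphere n) : Prop where
  continuous : Continuous P
  surjective : Function.Surjective P
  eq_of_norm_lt : ∀ z w : Disc, ‖(z : ℂ)‖ < 1 → P z = P w → z = w
  edge : ∀ (k : Fin n) (r : ℝ), 1 ≤ |r| → |r| ≤ 2 →
    (P (rim n (4 * k + r)) : OnePoint ℂ) = (edgePt n k (2 - |r|) : ℂ)
  circle : ∀ (k : Fin n) (r : ℝ), |r| ≤ 1 → P (rim n (4 * k + r)) ∈ stdCircle n k
  circle_inj : ∀ (k : Fin n) (r s : ℝ), |r| ≤ 1 → |s| ≤ 1 →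
    P (rim n (4 * k + r)) = P (rim n (4 * k + s)) → r = s ∨ (|r| = 1 ∧ |s| = 1)
  circle_surj : ∀ (k : Fin n) (z : StdSphere n), z ∈ stdCircle n k →
    ∃ r : ℝ, |r| ≤ 1 ∧ P (rim n (4 * k + r)) = z

theorem tendsto_onePoint_infty {X : Type*} {l : Filter X} {f : X → OnePoint ℂ}
    (h : ∀ R : ℝ, ∀ᶠ x in l, ∀ w : ℂ, f x = w → R < ‖w‖) : Filter.Tendsto f l (nhds OnePoint.infty) := by
  rw [Filter.tendsto_def]
  intro s hs
  obtain ⟨t, hts, ht, hinf⟩ := mem_nhds_iff.1 hs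
  obtain ⟨-, hc⟩ := (OnePoint.isOpen_iff_of_mem hinf).1 ht
  obtain ⟨R, hR⟩ := hc.isBounded.exists_norm_le
  filter_upwards [h R] with x hx
  refine hts ?_
  by_contra hxt
  cases hfx : f x using OnePoint.rec with
  | infty => exact hxt (hfx ▸ hinf)
  | coe w => exact absurd (hR w (by rw [hfx] at hxt; exact hxt)) (not_le.2 (hx w hfx))

/-- A bound on the point bounds the unscaled vector and thereby its gauge, which is the radius. This
gives continuity at infinity. -/
theorem exists_forall_lt_norm_polarPt {n : ℕ} (hn : 1 ≤ n) (R : ℝ) :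
    ∃ T : ℝ, 0 ≤ T ∧ ∀ ρ y : ℝ, T < ρ → |y| ≤ n / 2 → R < ‖polarPt n ρ y‖ := by
  have hn' : (1 : ℝ) ≤ n := by exact_mod_cast hn
  have ha : (0 : ℝ) < n / 2 - 1 / 6 := by linarith
  set B := |R| + ((n : ℝ) + 1) / 2 with hB
  have hB0 : 0 ≤ B := by positivity
  have hT : 0 ≤ B + 2 * (B * (B + 1)) / (n / 2 - 1 / 6) := by positivity
  refine ⟨B + 2 * (B * (B + 1)) / (n / 2 - 1 / 6), hT, fun ρ y hρ hy => ?_⟩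
  by_contra hle
  have hle' : ‖polarPt n ρ y‖ ≤ |R| := (not_lt.1 hle).trans (le_abs_self R)
  have hρ0 : 0 ≤ ρ := hT.trans hρ.le
  have h1 := (abs_re_le_norm _).trans hle'
  have h2 := (abs_im_le_norm _).trans hle'
  rw [polarPt_re] at h1
  rw [polarPt_im] at h2
  set v := ρ * dirV n y with hv
  set m := max v (2 / 3) with hm
  have hmpos : 0 < m := max_two_thirds_pos v
  set U := ρ * dirU n y / m with hU
  have hu : ρ * dirU n y = U * m := (div_mul_cancel₀ _ hmpos.ne').symm
  rw [abs_le] at h1 h2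
  have hUB : |U| ≤ B := abs_le.2 ⟨by linarith, by linarith⟩
  have hvB : |v| ≤ B := abs_le.2 ⟨by linarith, by linarith⟩
  have hmB : m ≤ B + 1 := max_le ((le_abs_self v).trans (by linarith)) (by linarith)
  have hg := triGauge_mul (n := n) hρ0 (dirU n y) (dirV n y)
  rw [triGauge_dir hn hy, mul_one, ← hv, hu] at hg
  have : triGauge n (U * m) v ≤ B + 2 * (B * (B + 1)) / (n / 2 - 1 / 6) := by
    unfold triGauge
    refine max_le ?_ ?_
    · have : 0 ≤ 2 * (B * (B + 1)) / (n / 2 - 1 / 6) := by positivity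
      linarith [le_abs_self v]
    · have h3 : |U * m| ≤ B * (B + 1) := by
        rw [abs_mul, abs_of_pos hmpos]
        exact mul_le_mul hUB hmB hmpos.le hB0
      have h4 : 2 * |U * m| / (n / 2 - 1 / 6) ≤ 2 * (B * (B + 1)) / (n / 2 - 1 / 6) := by gcongr
      linarith [neg_le_abs v]
  linarith

theorem continuous_depth : Continuous fun p : ℝ × ℝ => depth p.1 p.2 := by
  unfold depth
  have h : Continuous fun q : ℝ => |Int.fract q - 1 / 2| :=
    ContinuousOn.comp_fract'' (f := fun x : ℝ => |x - 1 / 2|) (by fun_prop) (by norm_num)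
  have := h.comp (continuous_fst (X := ℝ) (Y := ℝ))
  simp only [Function.comp_def] at this
  fun_prop

/-- At positive depth `squeeze 0` agrees nearby with the continuous function `squeeze c` for a small
`c > 0`. At the jumps of `Int.fract` the factor `1 - squeeze c` vanishes. -/
theorem continuousAt_shift {p : ℝ × ℝ} (hp : 0 < depth p.1 p.2) (hs : 0 ≤ p.2) :
    ContinuousWithinAt (fun p : ℝ × ℝ => shift p.1 p.2) {p | 0 ≤ p.2} p := by
  set c := 3 * depth p.1 p.2 / 8 with hc
  have hc0 : 0 < c := by positivity
  have hsq := continuous_squeeze hc0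
  have h1 : Continuous fun p : {s : ℝ // 0 ≤ s} × ℝ => (1 / 2 - Int.fract p.2) *
      (1 - squeeze c (8 / 3 * |Int.fract p.2 - 1 / 2| + p.1)) := by
    refine ContinuousOn.comp_fract' (f := fun (s : {s : ℝ // 0 ≤ s}) (x : ℝ) =>
      (1 / 2 - x) * (1 - squeeze c (8 / 3 * |x - 1 / 2| + s))) ?_ ?_
    · exact Continuous.continuousOn (by unfold Function.uncurry; fun_prop)
    · intro s
      have e0 : (4 : ℝ) / 3 ≤ 8 / 3 * |0 - 1 / 2| + s := by norm_num; exact s.2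
      have e1 : (4 : ℝ) / 3 ≤ 8 / 3 * |1 - 1 / 2| + s := by norm_num; exact s.2
      rw [squeeze_of_ge e0, squeeze_of_ge e1]
      ring
  have h2 : ContinuousOn (fun p : ℝ × ℝ => p.1 + (1 / 2 - Int.fract p.1) *
      (1 - squeeze c (depth p.1 p.2))) {p | 0 ≤ p.2} := by
    refine continuousOn_fst.add ?_
    rw [continuousOn_iff_continuous_domRestrict]
    exact h1.comp (f := fun p : {p : ℝ × ℝ | 0 ≤ p.2} => ((⟨p.1.2, p.2⟩ : {s : ℝ // 0 ≤ s}), p.1.1)) (by fun_prop)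
  refine (h2 p hs).congr_of_eventuallyEq ?_ ?_
  · have : ∀ᶠ p' in nhds p, depth p.1 p.2 / 2 < depth p'.1 p'.2 :=
      continuous_depth.continuousAt.eventually (lt_mem_nhds (by linarith))
    filter_upwards [nhdsWithin_le_nhds this] with p' hp'
    rw [shift, squeeze_eq (c := 0) (c' := c) (by linarith) (by linarith)]
  · rw [shift, squeeze_eq (c := 0) (c' := c) (by linarith) (by linarith)]

/-- The strip of polar coordinates on the disc. -/
abbrev PolarStrip (n : ℕ) : Type := Set.Icc (0 : ℝ) 1 × Set.Icc (-(1 / 2) : ℝ) (n - 1 / 2)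

theorem continuousAt_polyPt {n : ℕ} (p : ℝ × ℝ) (hs : 0 ≤ p.2) :
    ContinuousWithinAt (fun p : ℝ × ℝ => polyPt n p.1 p.2)
      {p | 0 ≤ p.2 ∧ p.1 ∈ Set.Icc (-(1 / 2) : ℝ) (n - 1 / 2)} p := by
  set A := {p : ℝ × ℝ | 0 ≤ p.2 ∧ p.1 ∈ Set.Icc (-(1 / 2) : ℝ) (n - 1 / 2)}
  have hdepth : ContinuousWithinAt (fun p : ℝ × ℝ => depth p.1 p.2) A p :=
    continuous_depth.continuousWithinAt
  have key : ∀ f : ℝ → ℝ, Continuous f → ContinuousWithinAt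
      (fun p : ℝ × ℝ => depth p.1 p.2 * f (shift p.1 p.2 - (n - 1) / 2)) A p := by
    intro f hf
    rcases (depth_nonneg (q := p.1) hs).lt_or_eq with h | h
    · have h1 := (continuousAt_shift h hs).mono (s := A) fun x hx => hx.1
      exact hdepth.mul (hf.continuousAt.comp_continuousWithinAt (h1.sub continuousWithinAt_const))
    -- At depth zero the shift need not be continuous, but `f` is bounded on the window and the
    -- factor `depth` tends to zero.
    · obtain ⟨C, hC⟩ := (isCompact_Icc (a := -((n : ℝ) / 2)) (b := (n : ℝ) / 2)).exists_bound_of_continuousOn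
        hf.continuousOn
      have h0 : Filter.Tendsto (fun p : ℝ × ℝ => C * depth p.1 p.2) (nhdsWithin p A) (nhds 0) := by
        have := hdepth.tendsto.const_mul C
        rwa [← h, mul_zero] at this
      rw [ContinuousWithinAt, ← h, zero_mul]
      refine squeeze_zero_norm' ?_ h0
      filter_upwards [self_mem_nhdsWithin] with x hx
      rw [norm_mul, Real.norm_of_nonneg (depth_nonneg hx.1), mul_comm]
      refine mul_le_mul_of_nonneg_right (hC _ ?_) (depth_nonneg hx.1)
      exact abs_le.1 (shift_mem_window hx.1 hx.2.1 hx.2.2)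
  have hu := key _ (continuous_dirU n)
  have hv := key _ (continuous_dirV n)
  unfold polyPt polarPt
  refine continuousWithinAt_const.add ?_
  have hmk : Continuous fun p : ℝ × ℝ => (⟨p.1, p.2⟩ : ℂ) := by
    have : (fun p : ℝ × ℝ => (⟨p.1, p.2⟩ : ℂ)) = equivRealProdCLM.symm := by
      ext p; rfl
    rw [this]
    exact ContinuousLinearEquiv.continuous _
  refine hmk.continuousAt.comp_continuousWithinAt (ContinuousWithinAt.prodMk
    (hu.div (hv.max continuousWithinAt_const) ?_) hv)
  exact (max_two_thirds_pos _).ne'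

/-- The polygon map in polar coordinates. -/
def polyFun (n : ℕ) (hn : 1 ≤ n) (p : PolarStrip n) : StdSphere n :=
  if (p.1 : ℝ) = 0 then ⟨OnePoint.infty, fun w hw => (OnePoint.infty_ne_coe w hw).elim⟩
  -- The distance `s = (1 - a) / a` runs from `0` on the unit circle to infinity at the centre.
  else ⟨(polyPt n p.2 ((1 - p.1) / p.1) : ℂ), fun w hw k => by
    rw [← OnePoint.coe_injective hw]
    exact le_norm_polyPt_sub hn (div_nonneg (by linarith [p.1.2.2]) p.1.2.1) p.2.2.1 p.2.2.2 k⟩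

theorem polyFun_zero {n : ℕ} (hn : 1 ≤ n) {p : PolarStrip n} (h : (p.1 : ℝ) = 0) :
    (polyFun n hn p : OnePoint ℂ) = OnePoint.infty := by
  rw [polyFun, if_pos h]

theorem polyFun_ne_zero {n : ℕ} (hn : 1 ≤ n) {p : PolarStrip n} (h : (p.1 : ℝ) ≠ 0) :
    (polyFun n hn p : OnePoint ℂ) = (polyPt n p.2 ((1 - p.1) / p.1) : ℂ) := by
  rw [polyFun, if_neg h]

theorem continuous_polyFun (n : ℕ) (hn : 1 ≤ n) : Continuous (polyFun n hn) := by
  refine Topology.IsInducing.subtypeVal.continuous_iff.2 (continuous_iff_continuousAt.2 fun p => ?_)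
  by_cases h : (p.1 : ℝ) = 0
  · rw [ContinuousAt, Function.comp_apply, polyFun_zero hn h]
    refine tendsto_onePoint_infty fun R => ?_
    obtain ⟨T, hT0, hT⟩ := exists_forall_lt_norm_polarPt hn R
    have h1 : ∀ᶠ x : PolarStrip n in nhds p, (x.1 : ℝ) < 1 / (T + 1) := by
      have : Continuous fun x : PolarStrip n => (x.1 : ℝ) := by fun_prop
      refine this.continuousAt.eventually (gt_mem_nhds ?_)
      simp only [h]
      positivity
    filter_upwards [h1] with x hx w hw
    rw [Function.comp_apply] at hw
    by_cases h0 : (x.1 : ℝ) = 0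
    · rw [polyFun_zero hn h0] at hw
      exact (OnePoint.infty_ne_coe w hw).elim
    · rw [polyFun_ne_zero hn h0] at hw
      rw [← OnePoint.coe_injective hw]
      have hpos : 0 < (x.1 : ℝ) := lt_of_le_of_ne x.1.2.1 (Ne.symm h0)
      have hs : T < (1 - x.1) / x.1 := by
        rw [lt_div_iff₀ hpos]
        rw [lt_div_iff₀ (by linarith)] at hx
        linarith
      refine hT _ _ (hs.trans_le ?_) (shift_mem_window (hT0.trans hs.le) x.2.2.1 x.2.2.2)
      unfold depth
      have := abs_nonneg (Int.fract (x.2 : ℝ) - 1 / 2)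
      linarith
  · have hev : Subtype.val ∘ polyFun n hn =ᶠ[nhds p]
        fun x => ((polyPt n x.2 ((1 - x.1) / x.1) : ℂ) : OnePoint ℂ) := by
      have : Continuous fun x : PolarStrip n => (x.1 : ℝ) := by fun_prop
      filter_upwards [this.continuousAt.eventually_ne h] with x hx
      exact polyFun_ne_zero hn hx
    refine ContinuousAt.congr ?_ hev.symm
    refine OnePoint.continuous_coe.continuousAt.comp ?_
    have hs : ∀ x : PolarStrip n, 0 ≤ (1 - x.1 : ℝ) / x.1 := fun x =>
      div_nonneg (by linarith [x.1.2.2]) x.1.2.1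
    have h1 := continuousAt_polyPt (n := n) (p.2, (1 - p.1) / p.1) (hs p)
    rw [← continuousWithinAt_univ]
    refine h1.comp (t := _) (f := fun x : PolarStrip n => ((x.2 : ℝ), (1 - x.1 : ℝ) / x.1)) ?_
      (fun x _ => ⟨hs x, x.2.2⟩)
    refine ContinuousAt.continuousWithinAt (ContinuousAt.prodMk (by fun_prop) ?_)
    exact ContinuousAt.div (by fun_prop) (by fun_prop) h

/-- Polar coordinates on the disc. -/
def polarDisc (n : ℕ) (p : PolarStrip n) : Disc :=
  ⟨(p.1 : ℝ) * unitLoop (p.2 / n), by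
    rw [mem_closedBall_zero_iff, norm_mul, norm_unitLoop, norm_real, Real.norm_of_nonneg p.1.2.1, mul_one]
    exact p.1.2.2⟩

theorem norm_polarDisc {n : ℕ} (p : PolarStrip n) : ‖(polarDisc n p : ℂ)‖ = p.1 := by
  rw [polarDisc, norm_mul, norm_unitLoop, norm_real, Real.norm_of_nonneg p.1.2.1, mul_one]

theorem continuous_polarDisc (n : ℕ) : Continuous (polarDisc n) := by
  have := continuous_unitLoop
  unfold polarDisc
  fun_prop

theorem surjective_polarDisc {n : ℕ} (hn : 1 ≤ n) : Function.Surjective (polarDisc n) := by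
  have hn' : (0 : ℝ) < n := by exact_mod_cast hn
  intro z
  by_cases hz : (z : ℂ) = 0
  · refine ⟨(⟨0, by simp⟩, ⟨0, by norm_num, by have : (1 : ℝ) ≤ n := by exact_mod_cast hn
                                               linarith⟩), Subtype.ext ?_⟩
    simp [polarDisc, hz]
  · obtain ⟨t, ht⟩ := exists_unitLoop_eq (z := z / ‖(z : ℂ)‖) (by
      rw [norm_div, norm_real, norm_norm, div_self (norm_ne_zero_iff.2 hz)])
    set m := ⌊t + 1 / (2 * n)⌋
    have h1 := Int.floor_le (t + 1 / (2 * (n : ℝ)))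
    have h2 := Int.lt_floor_add_one (t + 1 / (2 * (n : ℝ)))
    have h3 : 1 / (2 * (n : ℝ)) * n = 1 / 2 := by field_simp
    refine ⟨(⟨‖(z : ℂ)‖, norm_nonneg _, z.norm_le⟩, ⟨(t - m) * n, ?_, ?_⟩), Subtype.ext ?_⟩
    · nlinarith
    · nlinarith
    · simp only [polarDisc]
      rw [mul_div_cancel_right₀ _ hn'.ne', unitLoop_eq_iff.2 ⟨-m, by push_cast; ring⟩, ht]
      exact mul_div_cancel₀ _ (by exact_mod_cast norm_ne_zero_iff.2 hz)

theorem polarDisc_eq_iff {n : ℕ} (hn : 1 ≤ n) {p p' : PolarStrip n} :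
    polarDisc n p = polarDisc n p' ↔ (p.1 : ℝ) = p'.1 ∧
      ((p.1 : ℝ) = 0 ∨ ∃ m : ℤ, (p.2 : ℝ) = p'.2 + m * n) := by
  have hn' : (0 : ℝ) < n := by exact_mod_cast hn
  have hq : ∀ a b : ℝ, unitLoop (a / n) = unitLoop (b / n) ↔ ∃ m : ℤ, a = b + m * n := fun a b => by
    rw [unitLoop_eq_iff]
    refine exists_congr fun m => ?_
    field_simp
  constructor
  · intro h
    have h1 : (p.1 : ℝ) = p'.1 := by rw [← norm_polarDisc, h, norm_polarDisc]
    refine ⟨h1, or_iff_not_imp_left.2 fun h0 => (hq _ _).1 ?_⟩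
    have h2 := congrArg Subtype.val h
    simp only [polarDisc] at h2
    rw [← h1] at h2
    exact mul_left_cancel₀ (by exact_mod_cast h0) h2
  · rintro ⟨h1, h2⟩
    refine Subtype.ext ?_
    simp only [polarDisc]
    rw [← h1]
    rcases h2 with h2 | h2
    · rw [h2]; simp
    · rw [(hq _ _).2 h2]

/-- Apart from the centre only the two ends of the strip are identified in the disc, and both give
the ray straight down from the vertex. -/
theorem polyFun_eq_of_polarDisc_eq {n : ℕ} (hn : 1 ≤ n) {p p' : PolarStrip n}
    (h : polarDisc n p = polarDisc n p') : polyFun n hn p = polyFun n hn p' := by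
  have hn' : (1 : ℝ) ≤ n := by exact_mod_cast hn
  obtain ⟨h1, h2⟩ := (polarDisc_eq_iff hn).1 h
  refine Subtype.ext ?_
  by_cases h0 : (p.1 : ℝ) = 0
  · rw [polyFun_zero hn h0, polyFun_zero hn (h1 ▸ h0)]
  rw [polyFun_ne_zero hn h0, polyFun_ne_zero hn (h1 ▸ h0), ← h1]
  obtain ⟨m, hm⟩ := h2.resolve_left h0
  set s := (1 - p.1 : ℝ) / p.1
  have hs : 0 ≤ s := div_nonneg (by linarith [p.1.2.2]) p.1.2.1
  obtain ⟨b1, b2⟩ := p.2.2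
  obtain ⟨b1', b2'⟩ := p'.2.2
  -- the two ends of the strip
  have hends : polyPt n (-(1 / 2)) s = polyPt n (n - 1 / 2) s := by
    have f1 : Int.fract (-(1 / 2) : ℝ) = 1 / 2 := Int.fract_eq_iff.2 ⟨by norm_num, by norm_num, -1, by norm_num⟩
    have f2 : Int.fract ((n : ℝ) - 1 / 2) = 1 / 2 :=
      Int.fract_eq_iff.2 ⟨by norm_num, by norm_num, (n : ℤ) - 1, by push_cast; ring⟩
    have e1 : shift (-(1 / 2)) s = -(1 / 2) := by rw [shift, f1]; ring
    have e2 : shift (n - 1 / 2) s = n - 1 / 2 := by rw [shift, f2]; ring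
    have d1 : depth (-(1 / 2)) s = depth (n - 1 / 2) s := by rw [depth, depth, f1, f2]
    have hu : dirU n (n / 2) = 0 := by
      rw [dirU_of_nonneg hn (by positivity) le_rfl, sub_self, mul_zero, min_eq_right (by positivity)]
    have hu' : dirU n (-(n / 2)) = 0 := by
      rw [dirU_neg n hn (by rw [abs_of_nonneg (by positivity)]), hu, neg_zero]
    rw [polyPt, polyPt, e1, e2, d1, show (-(1 / 2) - ((n : ℝ) - 1) / 2) = -(n / 2) by ring,
      show (n - 1 / 2 - ((n : ℝ) - 1) / 2) = n / 2 by ring, polarPt, polarPt, hu, hu', dirV_neg]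
  rcases lt_trichotomy m 0 with hm0 | hm0 | hm0
  · have : (m : ℝ) ≤ -1 := by exact_mod_cast (by omega : m ≤ -1)
    have : (m : ℝ) * n ≤ -n := by nlinarith
    rw [show (p.2 : ℝ) = -(1 / 2) by linarith, show (p'.2 : ℝ) = n - 1 / 2 by linarith, hends]
  · rw [hm0] at hm
    rw [hm]; simp
  · have : (1 : ℝ) ≤ m := by exact_mod_cast hm0
    have : (n : ℝ) ≤ m * n := by nlinarith
    rw [show (p'.2 : ℝ) = -(1 / 2) by linarith, show (p.2 : ℝ) = n - 1 / 2 by linarith, hends]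

theorem exists_isPolygon {n : ℕ} (hn : 1 ≤ n) : ∃ P : Disc → StdSphere n, IsPolygon n P := by
  have hn' : (1 : ℝ) ≤ n := by exact_mod_cast hn
  -- The value does not depend on the choice of polar coordinates, and continuity can be checked in
  -- them, since they are a quotient map.
  set P : Disc → StdSphere n := fun z => polyFun n hn (Function.surjInv (surjective_polarDisc hn) z) with hP
  have hPp : ∀ p, P (polarDisc n p) = polyFun n hn p := fun p =>
    polyFun_eq_of_polarDisc_eq hn (Function.surjInv_eq (surjective_polarDisc hn) _)
  have hquot : Topology.IsQuotientMap (polarDisc n) :=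
    (continuous_polarDisc n).isClosedMap.isQuotientMap (continuous_polarDisc n) (surjective_polarDisc hn)
  have hrim : ∀ (k : Fin n) (r : ℝ), |r| ≤ 2 →
      (P (rim n (4 * k + r)) : OnePoint ℂ) = (polyPt n (k + r / 4) 0 : ℂ) := by
    intro k r hr
    rw [abs_le] at hr
    have hk0 : (0 : ℝ) ≤ k := by positivity
    have hk1 : (k : ℝ) + 1 ≤ n := by exact_mod_cast k.2
    let p : PolarStrip n := (⟨1, by simp⟩, ⟨k + r / 4, by linarith, by linarith⟩)
    have : rim n (4 * k + r) = polarDisc n p := Subtype.ext (by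
      simp only [rim, polarDisc, p]
      rw [ofReal_one, one_mul]
      congr 1
      field_simp)
    rw [this, hPp, polyFun_ne_zero hn (by simp [p])]
    simp [p]
  have hcirc : ∀ (k : Fin n) (r : ℝ), |r| ≤ 1 → (P (rim n (4 * k + r)) : OnePoint ℂ) =
      ((⟨k + 1 + SignType.sign r * bump (4 / 3 - 2 / 3 * |r|), 1 / 3 - 2 / 3 * |r|⟩ : ℂ) : OnePoint ℂ) := by
    intro k r hr
    rw [hrim k r (by linarith), polyPt_circle hn k hr]
  refine ⟨P, ⟨?_, ?_, ?_, ?_, ?_, ?_, ?_⟩⟩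
  · rw [hquot.continuous_iff]
    have : P ∘ polarDisc n = polyFun n hn := funext hPp
    rw [this]
    exact continuous_polyFun n hn
  · intro z
    suffices ∃ p, polyFun n hn p = z by
      obtain ⟨p, hp⟩ := this
      exact ⟨polarDisc n p, (hPp p).trans hp⟩
    obtain ⟨z, hz⟩ := z
    cases z using OnePoint.rec with
    | infty =>
      refine ⟨(⟨0, by simp⟩, ⟨0, by norm_num, by linarith⟩), Subtype.ext ?_⟩
      rw [polyFun_zero hn rfl]
    | coe w =>
      by_cases hw : w = ((n : ℂ) + 1) / 2 - I
      · refine ⟨(⟨1, by simp⟩, ⟨-(1 / 2), le_rfl, by linarith⟩), Subtype.ext ?_⟩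
        rw [polyFun_ne_zero hn (by simp)]
        have f1 : Int.fract (-(1 / 2) : ℝ) = 1 / 2 :=
          Int.fract_eq_iff.2 ⟨by norm_num, by norm_num, -1, by norm_num⟩
        have : depth (-(1 / 2)) ((1 - 1) / 1) = 0 := by rw [depth, f1]; norm_num
        simp only [polyPt]
        rw [this, polarPt_zero, hw]
      · obtain ⟨q, s, hs, hq1, hq2, hqs⟩ := exists_polyPt_eq hn (hz w rfl) hw
        have hpos : 0 < 1 / (1 + s) := by positivity
        refine ⟨(⟨1 / (1 + s), hpos.le, by rw [div_le_one (by positivity)]; linarith⟩, ⟨q, hq1, hq2⟩),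
          Subtype.ext ?_⟩
        rw [polyFun_ne_zero hn hpos.ne']
        simp only
        rw [show (1 - 1 / (1 + s)) / (1 / (1 + s)) = s by field_simp; ring, hqs]
  · intro z w hz hzw
    obtain ⟨p, rfl⟩ := surjective_polarDisc hn z
    obtain ⟨p', rfl⟩ := surjective_polarDisc hn w
    rw [norm_polarDisc] at hz
    rw [hPp, hPp] at hzw
    have hzw' := congrArg Subtype.val hzw
    rw [polarDisc_eq_iff hn]
    by_cases h0 : (p.1 : ℝ) = 0
    · by_cases h0' : (p'.1 : ℝ) = 0
      · exact ⟨by rw [h0, h0'], Or.inl h0⟩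
      · rw [polyFun_zero hn h0, polyFun_ne_zero hn h0'] at hzw'
        exact (OnePoint.infty_ne_coe _ hzw').elim
    · by_cases h0' : (p'.1 : ℝ) = 0
      · rw [polyFun_zero hn h0', polyFun_ne_zero hn h0] at hzw'
        exact (OnePoint.coe_ne_infty _ hzw').elim
      · rw [polyFun_ne_zero hn h0, polyFun_ne_zero hn h0'] at hzw'
        have hpos : 0 < (p.1 : ℝ) := lt_of_le_of_ne p.1.2.1 (Ne.symm h0)
        have hpos' : 0 < (p'.1 : ℝ) := lt_of_le_of_ne p'.1.2.1 (Ne.symm h0')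
        obtain ⟨h1, h2⟩ := polyPt_injOn hn (div_pos (by linarith) hpos)
          (div_nonneg (by linarith [p'.1.2.2]) hpos'.le) p.2.2.1 p.2.2.2 p'.2.2.1 p'.2.2.2
          (OnePoint.coe_injective hzw')
        refine ⟨?_, Or.inr h2⟩
        rw [div_eq_div_iff h0 h0'] at h1
        linarith
  · intro k r h1 h2
    rw [hrim k r h2, polyPt_edge hn k h1 h2, edgePt]
  · intro k r hr
    refine ⟨_, hcirc k r hr, ?_⟩
    have hb := bump_sq (ρ := 4 / 3 - 2 / 3 * |r|) (by linarith) (by linarith [abs_nonneg r])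
    have hs : ((SignType.sign r : ℝ) * bump (4 / 3 - 2 / 3 * |r|)) ^ 2 = bump (4 / 3 - 2 / 3 * |r|) ^ 2 := by
      rcases lt_trichotomy r 0 with h | h | h
      · rw [sign_neg h]; simp
      · rw [h]; simp [bump_of_ge]
      · rw [sign_pos h]; simp
    rw [Complex.norm_eq_sqrt_sq_add_sq, Real.sqrt_eq_iff_mul_self_eq (by positivity) (by norm_num)]
    simp only [sub_re, add_re, natCast_re, one_re, sub_im, add_im, natCast_im, one_im]
    rw [add_sub_cancel_left, hs, hb]
    ring
  · intro k r s hr hs h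
    have h' := congrArg Subtype.val h
    rw [hcirc k r hr, hcirc k s hs] at h'
    have h1 := congrArg re (OnePoint.coe_injective h')
    have h2 := congrArg im (OnePoint.coe_injective h')
    simp only at h1 h2
    have habs : |r| = |s| := by linarith
    rw [habs] at h1
    rcases abs_eq_abs.1 habs with h3 | h3
    · exact Or.inl h3
    · rw [h3, Left.sign_neg] at h1
      have h4 : (SignType.sign s : ℝ) * bump (4 / 3 - 2 / 3 * |s|) = 0 := by
        push_cast at h1; linarith
      rcases mul_eq_zero.1 h4 with h5 | h5
      · have h6 : s = 0 := by
          rcases lt_trichotomy s 0 with h | h | h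
          · rw [sign_neg h] at h5; simp at h5
          · exact h
          · rw [sign_pos h] at h5; simp at h5
        left; rw [h3, h6, neg_zero]
      · rcases bump_eq_zero (by linarith) (by linarith [abs_nonneg s]) h5 with h6 | h6
        · right; constructor <;> linarith
        · have h7 : |s| = 0 := by linarith
          rw [abs_eq_zero] at h7
          left; rw [h3, h7, neg_zero]
  · rintro k z ⟨w, hw, hwn⟩
    rw [Complex.norm_eq_sqrt_sq_add_sq, Real.sqrt_eq_iff_mul_self_eq (by positivity) (by norm_num)] at hwn
    simp only [sub_re, add_re, natCast_re, one_re, sub_im, add_im, natCast_im, one_im, add_zero, sub_zero] at hwn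
    set a := w.re - (k + 1) with ha
    have hb1 : w.im ≤ 1 / 3 := by nlinarith
    have hb2 : -(1 / 3) ≤ w.im := by nlinarith
    -- The solution of `w.im = 1 / 3 - 2 / 3 * b`, the height in the parametrization of the circle.
    set b := 3 / 2 * (1 / 3 - w.im) with hb
    have hb0 : 0 ≤ b := by linarith
    have hb1 : b ≤ 1 := by linarith
    have hbump : bump (4 / 3 - 2 / 3 * b) = |a| := by
      rw [bump, ← Real.sqrt_sq_eq_abs]
      congr 1
      rw [hb]
      nlinarith
    rcases lt_trichotomy a 0 with h | h | h
    · have hbpos : 0 < b := by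
        rcases hb0.lt_or_eq with h3 | h3
        · exact h3
        · rw [← h3, bump_of_ge (by norm_num)] at hbump
          exact absurd (abs_eq_zero.1 hbump.symm) h.ne
      refine ⟨-b, by rw [abs_neg, abs_of_nonneg hb0]; exact hb1, Subtype.ext ?_⟩
      rw [hcirc k _ (by rw [abs_neg, abs_of_nonneg hb0]; exact hb1), abs_neg, abs_of_nonneg hb0, hbump, hw,
        Left.sign_neg, sign_pos hbpos, abs_of_neg h]
      congr 1
      apply Complex.ext
      · simp; linarith
      · simp; linarith
    · refine ⟨b, by rw [abs_of_nonneg hb0]; exact hb1, Subtype.ext ?_⟩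
      rw [hcirc k _ (by rw [abs_of_nonneg hb0]; exact hb1), abs_of_nonneg hb0, hbump, hw, h]
      congr 1
      apply Complex.ext
      · simp; linarith
      · simp; linarith
    · have hbpos : 0 < b := by
        rcases hb0.lt_or_eq with h3 | h3
        · exact h3
        · rw [← h3, bump_of_ge (by norm_num)] at hbump
          exact absurd (abs_eq_zero.1 hbump.symm) h.ne'
      refine ⟨b, by rw [abs_of_nonneg hb0]; exact hb1, Subtype.ext ?_⟩
      rw [hcirc k _ (by rw [abs_of_nonneg hb0]; exact hb1), abs_of_nonneg hb0, hbump, hw,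
        sign_pos hbpos, abs_of_pos h]
      congr 1
      apply Complex.ext
      · simp; linarith
      · simp; linarith

end PolygonMap

/-! ### Lifting maps to the closed disc and its boundary to the line. -/

section DiscLifting

open Complex

theorem dense_norm_lt_one : Dense {z : Disc | ‖(z : ℂ)‖ < 1} := by
  intro z
  rw [mem_closure_iff_seq_limit]
  refine ⟨fun n => ⟨((1 - 1 / ((n : ℝ) + 1) : ℝ) : ℂ) * z, ?_⟩, fun n => ?_, ?_⟩
  · have h1 : 1 / ((n : ℝ) + 1) ≤ 1 := by
      rw [div_le_one (by positivity)]; linarith [n.cast_nonneg (α := ℝ)]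
    have h2 : 0 < 1 / ((n : ℝ) + 1) := by positivity
    rw [mem_closedBall_zero_iff, norm_mul, norm_real, Real.norm_of_nonneg (by linarith)]
    nlinarith [z.norm_le, norm_nonneg (z : ℂ)]
  · have h1 : 1 / ((n : ℝ) + 1) ≤ 1 := by
      rw [div_le_one (by positivity)]; linarith [n.cast_nonneg (α := ℝ)]
    have h2 : 0 < 1 / ((n : ℝ) + 1) := by positivity
    change ‖_‖ < 1
    rw [norm_mul, norm_real, Real.norm_of_nonneg (by linarith)]
    nlinarith [z.norm_le, norm_nonneg (z : ℂ)]
  · rw [tendsto_subtype_rng]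
    have h := tendsto_one_div_add_atTop_nhds_zero_nat (𝕜 := ℝ)
    have h2 : Filter.Tendsto (fun n : ℕ => ((1 - 1 / ((n : ℝ) + 1) : ℝ) : ℂ) * z) Filter.atTop
        (nhds (((1 - 0 : ℝ) : ℂ) * z)) :=
      ((continuous_ofReal.tendsto _).comp (h.const_sub 1)).mul_const _
    simpa using h2

theorem isPreconnected_inter_ball (x : Disc) (ε : ℝ) :
    IsPreconnected ({z : Disc | ‖(z : ℂ)‖ < 1} ∩ Metric.ball x ε) := by
  rw [← Topology.IsInducing.subtypeVal.isPreconnected_image]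
  have h1 : Subtype.val '' ({z : Disc | ‖(z : ℂ)‖ < 1} ∩ Metric.ball x ε) =
      Metric.ball (0 : ℂ) 1 ∩ Metric.ball (x : ℂ) ε := by
    ext z
    constructor
    · rintro ⟨w, ⟨h1, h2⟩, rfl⟩
      exact ⟨mem_ball_zero_iff.2 h1, h2⟩
    · rintro ⟨h1, h2⟩
      exact ⟨⟨z, Metric.ball_subset_closedBall h1⟩, ⟨mem_ball_zero_iff.1 h1, h2⟩, rfl⟩
  rw [h1]
  exact ((convex_ball (0 : ℂ) 1).inter (convex_ball (x : ℂ) ε)).isPreconnected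

/-- A self-map of a space can be lifted to a cell if it maps the open cell to itself. -/
theorem exists_lift_disc {S : Type*} [TopologicalSpace S] [T2Space S] {Q : Disc → S} (hQ : Continuous Q)
    (hfin : ∀ x, (Q ⁻¹' {x}).Finite) (hinj : ∀ z w : Disc, ‖(z : ℂ)‖ < 1 → Q z = Q w → z = w)
    {g : S → S} (hgc : Continuous g)
    (hg : ∀ z : Disc, ‖(z : ℂ)‖ < 1 → ∃ w : Disc, ‖(w : ℂ)‖ < 1 ∧ Q w = g (Q z)) :
    ∃ G : Disc → Disc, Continuous G ∧ (∀ z, Q (G z) = g (Q z)) ∧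
      ∀ z : Disc, ‖(z : ℂ)‖ < 1 → ‖(G z : ℂ)‖ < 1 := by
  classical
  choose! G₀ hG₀ hQG using hg
  set A := {z : Disc | ‖(z : ℂ)‖ < 1} with hA
  -- As `Q` is a closed map, `G₀ z` is close to the fibre over `g (Q x)` when `z` is close to `x`.
  have key : ∀ x : Disc, ∀ V : Set Disc, IsOpen V → Q ⁻¹' {g (Q x)} ⊆ V →
      ∀ᶠ z in nhdsWithin x A, G₀ z ∈ V := by
    intro x V hV hsub
    have hclosed : IsClosed (Q '' Vᶜ) := hQ.isClosedMap _ hV.isClosed_compl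
    have hmem : g (Q x) ∈ (Q '' Vᶜ)ᶜ := by
      rintro ⟨w, hw, hwx⟩
      exact hw (hsub hwx)
    have hev : ∀ᶠ z in nhds x, g (Q z) ∈ (Q '' Vᶜ)ᶜ :=
      (hgc.comp hQ).continuousAt.eventually (hclosed.isOpen_compl.mem_nhds hmem)
    filter_upwards [nhdsWithin_le_nhds hev, self_mem_nhdsWithin] with z hz hzA
    by_contra hzV
    exact hz ⟨G₀ z, hzV, hQG z hzA⟩
  have hcont : ContinuousOn G₀ A := by
    intro x hx
    rw [ContinuousWithinAt, tendsto_nhds]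
    intro V hV hxV
    refine key x V hV fun w hw => ?_
    rwa [← hinj (G₀ x) w (hG₀ x hx) ((hQG x hx).trans hw.symm)]
  -- The points of the finite fibre have disjoint neighbourhoods, and the part of the open disc near
  -- `x` is connected. So its image stays near a single point of the fibre, which is the limit.
  have hlim : ∀ x, ∃ y, Filter.Tendsto G₀ (nhdsWithin x A) (nhds y) := by
    intro x
    obtain ⟨U, hU, hUd⟩ := (hfin (g (Q x))).t2_separation
    set E := Q ⁻¹' {g (Q x)} with hE
    have hev := key x (⋃ f ∈ E, U f) (isOpen_biUnion fun f _ => (hU f).2)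
      fun f hf => Set.mem_biUnion hf (hU f).1
    obtain ⟨ε, hε, hball⟩ := Metric.mem_nhdsWithin_iff.1 hev
    have hpre : IsPreconnected (G₀ '' (A ∩ Metric.ball x ε)) :=
      (isPreconnected_inter_ball x ε).image _ (hcont.mono Set.inter_subset_left)
    obtain ⟨z₀, hz₀ball, hz₀⟩ := dense_norm_lt_one.exists_dist_lt x hε
    have hz₀A : z₀ ∈ A ∩ Metric.ball x ε := ⟨hz₀ball, by rwa [Metric.mem_ball, dist_comm]⟩
    obtain ⟨f, hf, hz₀f⟩ := Set.mem_iUnion₂.1 (hball ⟨hz₀A.2, hz₀A.1⟩)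
    have hdisj : Disjoint (U f) (⋃ f' ∈ E \ {f}, U f') := by
      rw [Set.disjoint_iUnion₂_right]
      intro f' hf'
      exact hUd hf hf'.1 fun h => hf'.2 h.symm
    have hsub : G₀ '' (A ∩ Metric.ball x ε) ⊆ U f := by
      refine IsPreconnected.subset_left_of_subset_union (hU f).2
        (isOpen_biUnion fun f _ => (hU f).2) hdisj ?_ ⟨_, ⟨z₀, hz₀A, rfl⟩, hz₀f⟩ hpre
      rintro _ ⟨z, hz, rfl⟩
      obtain ⟨f', hf', hzf'⟩ := Set.mem_iUnion₂.1 (hball ⟨hz.2, hz.1⟩)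
      by_cases h : f' = f
      · exact Or.inl (h ▸ hzf')
      · exact Or.inr (Set.mem_biUnion ⟨hf', h⟩ hzf')
    refine ⟨f, ?_⟩
    rw [tendsto_nhds]
    intro N hN hfN
    have hev' := key x ((N ∩ U f) ∪ ⋃ f' ∈ E \ {f}, U f')
      ((hN.inter (hU f).2).union (isOpen_biUnion fun f _ => (hU f).2)) (by
        intro f' hf'
        by_cases h : f' = f
        · rw [h]; exact Or.inl ⟨hfN, (hU f).1⟩
        · exact Or.inr (Set.mem_biUnion ⟨hf', h⟩ (hU f').1))
    filter_upwards [hev', self_mem_nhdsWithin, nhdsWithin_le_nhds (Metric.ball_mem_nhds x hε)]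
      with z hz hzA hzb
    rcases hz with hz | hz
    · exact hz.1
    · exact (Set.disjoint_left.1 hdisj (hsub ⟨z, ⟨hzA, hzb⟩, rfl⟩) hz).elim
  have hGc : Continuous (extendFrom A G₀) := continuous_extendFrom dense_norm_lt_one hlim
  have hGA : ∀ z ∈ A, extendFrom A G₀ z = G₀ z := extendFrom_extends hcont
  refine ⟨extendFrom A G₀, hGc, fun z => ?_, fun z hz => by rw [hGA z hz]; exact hG₀ z hz⟩
  refine congrFun (Continuous.ext_on dense_norm_lt_one (hQ.comp hGc) (hgc.comp hQ) ?_) z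
  intro w hw
  simp only [Function.comp]
  rw [hGA w hw, hQG w hw]

/-- A homeomorphism that preserves an open cell can be lifted to the closed disc. -/
theorem exists_lift_disc_homeomorph {S : Type*} [TopologicalSpace S] [T2Space S] {Q : Disc → S}
    (hQ : Continuous Q) (hfin : ∀ x, (Q ⁻¹' {x}).Finite)
    (hinj : ∀ z w : Disc, ‖(z : ℂ)‖ < 1 → Q z = Q w → z = w) (g : S ≃ₜ S)
    (hg : ∀ z : Disc, ‖(z : ℂ)‖ < 1 → ∃ w : Disc, ‖(w : ℂ)‖ < 1 ∧ Q w = g (Q z))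
    (hg' : ∀ z : Disc, ‖(z : ℂ)‖ < 1 → ∃ w : Disc, ‖(w : ℂ)‖ < 1 ∧ Q w = g.symm (Q z)) :
    ∃ G : Disc ≃ₜ Disc, (∀ z, Q (G z) = g (Q z)) ∧
      ∀ z : Disc, ‖(G z : ℂ)‖ < 1 ↔ ‖(z : ℂ)‖ < 1 := by
  obtain ⟨G, hGc, hG, hGn⟩ := exists_lift_disc hQ hfin hinj g.continuous hg
  obtain ⟨K, hKc, hK, hKn⟩ := exists_lift_disc hQ hfin hinj g.symm.continuous hg'
  -- The two lifts are inverse to each other on the open disc, where `Q` is injective, hence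
  -- everywhere by density.
  have hKG : ∀ z, K (G z) = z := by
    refine congrFun (Continuous.ext_on dense_norm_lt_one (hKc.comp hGc) continuous_id ?_)
    intro w hw
    refine (hinj w _ hw ?_).symm
    change Q w = Q (K (G w))
    rw [hK, hG, g.symm_apply_apply]
  have hGK : ∀ z, G (K z) = z := by
    refine congrFun (Continuous.ext_on dense_norm_lt_one (hGc.comp hKc) continuous_id ?_)
    intro w hw
    refine (hinj w _ hw ?_).symm
    change Q w = Q (G (K w))
    rw [hG, hK, g.apply_symm_apply]
  refine ⟨⟨⟨G, K, hKG, hGK⟩, hGc, hKc⟩, hG, fun z => ⟨fun h => ?_, hGn z⟩⟩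
  have : ‖(K (G z) : ℂ)‖ < 1 := hKn _ h
  rwa [hKG] at this

theorem norm_eq_one_of_norm_lt_iff {G : Disc ≃ₜ Disc} (hG : ∀ z : Disc, ‖(G z : ℂ)‖ < 1 ↔ ‖(z : ℂ)‖ < 1)
    (z : Disc) (hz : ‖(z : ℂ)‖ = 1) : ‖(G z : ℂ)‖ = 1 := by
  refine le_antisymm (G z).norm_le (not_lt.1 fun h => ?_)
  rw [hG, hz] at h
  exact lt_irrefl _ h

/-- A homeomorphism of the disc, restricted to the boundary, lifts to a map of the line. -/
theorem exists_lift_rim {n : ℕ} (hn : 1 ≤ n) {G : Disc ≃ₜ Disc}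
    (hG : ∀ z : Disc, ‖(G z : ℂ)‖ < 1 ↔ ‖(z : ℂ)‖ < 1) :
    ∃ (F : ℝ → ℝ) (d : ℤ), Continuous F ∧ (∀ τ, G (rim n τ) = rim n (F τ)) ∧
      ∀ τ, F (τ + 4 * n) = F τ + d * (4 * n) := by
  have hn' : (0 : ℝ) < n := by exact_mod_cast hn
  have hGr : ∀ τ, ‖(G (rim n τ) : ℂ)‖ = 1 := fun τ => norm_eq_one_of_norm_lt_iff hG _ (norm_rim n τ)
  have hc := continuous_rim n
  obtain ⟨L, hL, hLe⟩ := exists_continuous_log (E := ℝ) (f := fun τ => (G (rim n τ) : ℂ)) (by fun_prop)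
    (fun τ h => by have := hGr τ; rw [h, norm_zero] at this; exact zero_ne_one this)
  have hre : ∀ τ, (L τ).re = 0 := fun τ => by
    have := hGr τ
    rw [← hLe, norm_exp, Real.exp_eq_one_iff] at this
    exact this
  have hLF : ∀ τ, L τ = (L τ).im * I := fun τ => by
    apply Complex.ext <;> simp [hre]
  have hF : ∀ τ, G (rim n τ) = rim n ((L τ).im * (4 * n) / (2 * Real.pi)) := by
    intro τ
    refine Subtype.ext ?_
    rw [← hLe, hLF]
    simp only [rim, unitLoop]
    congr 1
    have := Real.pi_ne_zero
    have hnC : (n : ℂ) ≠ 0 := by exact_mod_cast hn'.ne'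
    push_cast
    field_simp
    simp only [mul_im, I_re, I_im, mul_zero, mul_one, ofReal_re, ofReal_im, add_zero]
  have hstep : ∀ τ, ∃ m : ℤ, L (τ + 4 * n) - L τ = 2 * Real.pi * I * m := by
    intro τ
    refine exp_eq_exp_iff_two_pi_I.1 ?_
    rw [hLe, hLe]
    congr 2
    have := rim_add_mul hn τ 1
    simpa using this
  obtain ⟨d, hd⟩ := exists_eq_two_pi_I_mul_int (X := ℝ) (d := fun τ => L (τ + 4 * n) - L τ)
    (by fun_prop) hstep
  refine ⟨fun τ => (L τ).im * (4 * n) / (2 * Real.pi), d, by fun_prop, hF, fun τ => ?_⟩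
  have h1 := congrArg im (hd τ)
  simp at h1
  have h2 : (L (τ + 4 * n)).im = (L τ).im + 2 * Real.pi * d := by linarith
  have := Real.pi_ne_zero
  simp only [h2]
  field_simp

/-- The winding number of the image of a loop under a map that is defined on a punctured disc. -/
theorem Winds.comp {ψ : ℂ → ℂ} {η ε : ℝ} (hη : 0 < η)
    (hψ : ContinuousOn ψ {y | y ≠ 0 ∧ ‖y‖ ≤ η}) (h0 : ∀ y, y ≠ 0 → ‖y‖ ≤ η → ψ y ≠ 0)
    (hε : 0 < ε) (hεη : ε ≤ η) {k d : ℤ} (hk : Winds (fun t => ψ (ε * unitLoop t)) k)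
    {c : unitInterval → ℂ} (hc : ∀ t, ‖c t‖ ≤ η) (hd : Winds c d) :
    Winds (fun t => ψ (c t)) (k * d) := by
  -- The half-plane `re ≤ log η` covers the punctured disc by `exp`. Truncating the real part gives
  -- a function on the whole plane, where `ψ ∘ pr` has a logarithm.
  let pr : ℂ → ℂ := fun ζ => exp ((min ζ.re (Real.log η) : ℝ) + ζ.im * I)
  have hprn : ∀ ζ, ‖pr ζ‖ ≤ η := by
    intro ζ
    simp only [pr, norm_exp]
    rw [← Real.le_log_iff_exp_le hη]
    simp
  have hpr : ∀ ζ : ℂ, ζ.re ≤ Real.log η → pr ζ = exp ζ := by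
    intro ζ h
    simp only [pr]
    rw [min_eq_left h, re_add_im]
  have hprp : ∀ ζ, pr (ζ + 2 * Real.pi * I) = pr ζ := by
    intro ζ
    simp only [pr]
    have h : ((min (ζ + 2 * Real.pi * I).re (Real.log η) : ℝ) : ℂ) + (ζ + 2 * Real.pi * I).im * I =
        ((min ζ.re (Real.log η) : ℝ) + ζ.im * I) + 2 * Real.pi * I := by
      simp
      ring
    rw [h]
    exact exp_periodic _
  obtain ⟨L, hL, hLe⟩ := exists_continuous_log (E := ℂ) (f := fun ζ => ψ (pr ζ))
    (hψ.comp_continuous (by fun_prop) fun ζ => ⟨exp_ne_zero _, hprn ζ⟩)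
    (fun ζ => h0 _ (exp_ne_zero _) (hprn ζ))
  obtain ⟨k', hk'⟩ := exists_eq_two_pi_I_mul_int (X := ℂ) (d := fun ζ => L (ζ + 2 * Real.pi * I) - L ζ)
    (by fun_prop) (fun ζ => exp_eq_exp_iff_two_pi_I.1 (by rw [hLe, hLe, hprp]))
  have hkk : k = k' := by
    refine hk.unique ⟨⟨fun t => L ((Real.log ε : ℝ) + 2 * Real.pi * I * (t : ℝ)), by fun_prop⟩, fun t => ?_, ?_⟩
    · simp only [ContinuousMap.coe_mk]
      rw [hLe, hpr]
      · rw [exp_add, ← ofReal_exp, Real.exp_log hε]; rfl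
      · simp
        exact Real.log_le_log hε hεη
    · simpa using hk' (Real.log ε : ℝ)
  -- The logarithm is `k' * ζ` plus a periodic function, so a loop that winds `d` times changes it
  -- by `2πi * k' * d`.
  have hper : Function.Periodic (fun ζ => L ζ - k' * ζ) (2 * Real.pi * I) := by
    intro ζ
    have := hk' ζ
    simp only at this ⊢
    linear_combination this
  obtain ⟨M, hM, hM'⟩ := hd
  have hMre : ∀ t, (M t).re ≤ Real.log η := fun t => by
    have := hc t
    rw [← hM, norm_exp] at this
    rwa [← Real.le_log_iff_exp_le hη] at this
  refine ⟨⟨fun t => L (M t), by fun_prop⟩, fun t => ?_, ?_⟩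
  · simp only [ContinuousMap.coe_mk]
    rw [hLe, hpr _ (hMre t), hM]
  · simp only [ContinuousMap.coe_mk]
    have h1 : M 1 = M 0 + d * (2 * Real.pi * I) := by linear_combination hM'
    have h2 := hper.int_mul d (M 0)
    rw [← h1] at h2
    rw [hkk]
    push_cast
    linear_combination h2 + k' * hM'

end DiscLifting

/-! ### Orientation and the degree of a lift on the boundary of the disc. -/

section DiscOrientation

open Complex

/-- The radial retraction of the plane to the disc. -/
def discProj (z : ℂ) : Disc :=
  ⟨z / (max 1 ‖z‖ : ℝ), by
    have h : 0 < max 1 ‖z‖ := lt_max_of_lt_left one_pos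
    rw [mem_closedBall_zero_iff, norm_div, norm_real, Real.norm_of_nonneg h.le, div_le_one h]
    exact le_max_right _ _⟩

theorem continuous_discProj : Continuous discProj := by
  refine Continuous.subtype_mk (Continuous.div (by fun_prop) (by fun_prop) fun z => ?_) _
  exact ofReal_ne_zero.2 (lt_max_of_lt_left one_pos).ne'

theorem coe_discProj {z : ℂ} (hz : ‖z‖ ≤ 1) : (discProj z : ℂ) = z := by
  simp [discProj, max_eq_left hz]

theorem discProj_coe (z : Disc) : discProj z = z := Subtype.ext (coe_discProj z.norm_le)

theorem discProj_of_one_le {z : ℂ} (hz : 1 ≤ ‖z‖) : (discProj z : ℂ) = z / ‖z‖ := by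
  simp [discProj, max_eq_right hz]

theorem rim_mul {n : ℕ} (hn : 1 ≤ n) (t : ℝ) : (rim n (4 * n * t) : ℂ) = unitLoop t := by
  have hn' : (n : ℝ) ≠ 0 := by exact_mod_cast (Nat.one_le_iff_ne_zero.1 hn)
  simp only [rim]
  congr 1
  field_simp

variable {S : Type*} [TopologicalSpace S] [ChartedSpace (EuclideanHalfSpace 2) S]

theorem mem_interior_of_cell {Q : Disc → S} (hQ : Continuous Q)
    (hinj : ∀ z w : Disc, ‖(z : ℂ)‖ < 1 → Q z = Q w → z = w) {z : Disc} (hz : ‖(z : ℂ)‖ < 1) :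
    Q z ∈ (𝓡∂ 2).interior S := by
  have h := (image_mem_nhds_of_injOn (F := fun w => Q (discProj w)) (z := (z : ℂ))
    (U := Metric.ball 0 1) (Metric.isOpen_ball.mem_nhds (mem_ball_zero_iff.2 hz))
    (hQ.comp continuous_discProj).continuousOn (fun a ha b hb hab => ?_)).1
  · simpa only [discProj_coe] using h
  · rw [mem_ball_zero_iff] at ha hb
    have := hinj _ _ (by rwa [coe_discProj ha.le]) hab
    rw [← coe_discProj ha.le, this, coe_discProj hb.le]

variable [ESurface S]

/-- The lift of an orientation-preserving homeomorphism to a cell has degree `1` on the boundary. -/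
theorem degree_eq_one_of_preservesOrientation {Q : Disc → S} (hQ : Continuous Q)
    (hinj : ∀ z w : Disc, ‖(z : ℂ)‖ < 1 → Q z = Q w → z = w) {g : S ≃ₜ S}
    (hg : PreservesOrientation g) {G : Disc ≃ₜ Disc} (hGQ : ∀ z, Q (G z) = g (Q z))
    (hGn : ∀ z : Disc, ‖(G z : ℂ)‖ < 1 ↔ ‖(z : ℂ)‖ < 1) {n : ℕ} (hn : 1 ≤ n) {F : ℝ → ℝ} {d : ℤ}
    (hF : Continuous F) (hGF : ∀ τ, G (rim n τ) = rim n (F τ))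
    (hFd : ∀ τ, F (τ + 4 * n) = F τ + d * (4 * n)) : d = 1 := by
  have hn' : (0 : ℝ) < n := by exact_mod_cast hn
  have hGc := G.continuous
  have hpc := continuous_discProj
  have huc := continuous_unitLoop
  set c₀ : ℂ := (G (discProj 0) : ℂ) with hc₀
  have hc₀1 : ‖c₀‖ < 1 := (hGn _).2 (by rw [coe_discProj] <;> simp)
  have hdc₀ : discProj c₀ = G (discProj 0) := discProj_coe _
  have hnu : ∀ (r t : ℝ), ‖(r : ℂ) * unitLoop t‖ = |r| := fun r t => by
    rw [norm_mul, norm_unitLoop, norm_real, mul_one, Real.norm_eq_abs]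
  -- the boundary
  have w1 : Winds (fun t => (G (discProj (unitLoop t)) : ℂ)) d := by
    refine ⟨⟨fun t => 2 * Real.pi * I * (F (4 * n * t) / (4 * n) : ℝ), by fun_prop⟩, fun t => ?_, ?_⟩
    · have h : discProj (unitLoop t) = rim n (4 * n * t) :=
        Subtype.ext (by rw [coe_discProj (norm_unitLoop _).le, rim_mul hn])
      change cexp _ = (G (discProj (unitLoop t)) : ℂ)
      rw [h, hGF]
      rfl
    · have h := hFd 0
      rw [zero_add] at h
      have h2 : (F (4 * n) / (4 * n) : ℝ) = F 0 / (4 * n) + d := by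
        rw [h]; field_simp
      simp only [ContinuousMap.coe_mk, Set.Icc.coe_one, mul_one, h2, Set.Icc.coe_zero, mul_zero]
      push_cast
      ring
  -- The point `c₀` is inside the disc, so the boundary loop also winds `d` times around it. By
  -- injectivity of `G` the circle can then be shrunk without its image meeting `c₀`.
  have w2 : Winds (fun t => (G (discProj (unitLoop t)) : ℂ) - c₀) d := by
    have := Winds.of_homotopy (H := fun p => (G (discProj (unitLoop p.2)) : ℂ) - (p.1 : ℝ) * c₀)
      (by fun_prop) (fun p h => ?_) (fun s => by simp [unitLoop_zero, unitLoop_one]) 0 1 (k := d)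
      (by simpa using w1)
    · simpa using this
    · have h1 : ‖(G (discProj (unitLoop p.2)) : ℂ)‖ = 1 :=
        norm_eq_one_of_norm_lt_iff hGn _ (by rw [coe_discProj] <;> simp [norm_unitLoop])
      rw [sub_eq_zero.1 h, norm_mul, norm_real, Real.norm_of_nonneg p.1.2.1] at h1
      nlinarith [p.1.2.2, p.1.2.1, norm_nonneg c₀]
  have w3 : ∀ ε : ℝ, 0 < ε → ε ≤ 1 →
      Winds (fun t => (G (discProj (ε * unitLoop t)) : ℂ) - c₀) d := by
    intro ε hε hε1
    have hs : ∀ s : unitInterval, 0 < 1 - (s : ℝ) * (1 - ε) ∧ 1 - (s : ℝ) * (1 - ε) ≤ 1 := by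
      intro s
      have := s.2.1
      have := s.2.2
      constructor <;> nlinarith
    have := Winds.of_homotopy
      (H := fun p => (G (discProj ((1 - (p.1 : ℝ) * (1 - ε) : ℝ) * unitLoop p.2)) : ℂ) - c₀)
      (by fun_prop) (fun p h => ?_) (fun s => by simp [unitLoop_zero, unitLoop_one]) 0 1 (k := d)
      (by simpa using w2)
    · simpa using this
    · have h1 := congrArg (Subtype.val) (G.injective (Subtype.ext (sub_eq_zero.1 h)))
      rw [coe_discProj (by rw [hnu, abs_of_pos (hs _).1]; exact (hs _).2),
        coe_discProj (by simp)] at h1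
      have h2 := hnu (1 - (p.1 : ℝ) * (1 - ε)) p.2
      rw [h1, norm_zero, abs_of_pos (hs _).1] at h2
      exact (hs _).1.ne h2
  -- translation of the cell
  have hT : ∀ (s : unitInterval) (y : {y : ℂ // ‖y‖ < 1 - ‖c₀‖}), ‖(s : ℝ) * c₀ + y‖ < 1 := by
    intro s y
    have h1 := norm_add_le ((s : ℝ) * c₀) y
    rw [norm_mul, norm_real, Real.norm_of_nonneg s.2.1] at h1
    have := y.2
    nlinarith [s.2.2, s.2.1, norm_nonneg c₀]
  let x₀ : {y : ℂ // ‖y‖ < 1 - ‖c₀‖} := ⟨0, by rw [norm_zero]; linarith⟩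
  -- Translating the neighbourhood of `c₀` to the origin is a homotopy of injective maps, so `Q` has
  -- the same local degree at both points, whatever its sign.
  obtain ⟨U₀, hU₀, htr⟩ := exists_hasWinding_iff_of_homotopy
    (H := fun p : unitInterval × {y : ℂ // ‖y‖ < 1 - ‖c₀‖} => Q (discProj ((p.1 : ℝ) * c₀ + p.2))) (by fun_prop) (x := x₀)
    (by
      intro s y hy h
      refine hy (Subtype.ext ?_)
      have h1 := congrArg Subtype.val
        (hinj _ _ (by rw [coe_discProj (hT s y).le]; exact hT s y) h)
      rw [coe_discProj (hT s y).le, coe_discProj (hT s x₀).le] at h1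
      exact add_left_cancel h1)
    (fun s => mem_interior_of_cell hQ hinj (by rw [coe_discProj (hT s x₀).le]; exact hT s x₀)) 1 0
  obtain ⟨U₁, hU₁, hgw⟩ := hg (Q (discProj 0))
  set c := Q (discProj c₀) with hc
  have hgc : g (Q (discProj 0)) = c := by rw [hc, hdc₀, hGQ]
  have hqc : Continuous fun y => Q (discProj (c₀ + y)) := by fun_prop
  have hsrc : (fun y => Q (discProj (c₀ + y))) ⁻¹' (chartAt (EuclideanHalfSpace 2) c).source ∈ nhds 0 :=
    hqc.continuousAt.preimage_mem_nhds
      ((chartAt (EuclideanHalfSpace 2) c).open_source.mem_nhds (by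
        simp only [add_zero]; exact mem_chart_source _ c))
  obtain ⟨η₀, hη₀, hηb⟩ := Metric.nhds_basis_closedBall.mem_iff.1 hsrc
  set η := min η₀ ((1 - ‖c₀‖) / 2) with hηdef
  have hη : 0 < η := lt_min hη₀ (by linarith)
  have hηT : ∀ y : ℂ, ‖y‖ ≤ η → ‖c₀ + y‖ < 1 := fun y hy => by
    have h1 := norm_add_le c₀ y
    have h2 : η ≤ (1 - ‖c₀‖) / 2 := min_le_right _ _
    linarith
  have hηs : ∀ y : ℂ, ‖y‖ ≤ η → Q (discProj (c₀ + y)) ∈ (chartAt (EuclideanHalfSpace 2) c).source :=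
    fun y hy => hηb (mem_closedBall_zero_iff.2 (hy.trans (min_le_left _ _)))
  let q : ℂ → ℂ := fun y => complexChart c (Q (discProj (c₀ + y)))
  have hq0 : q 0 = complexChart c c := by simp only [q, add_zero, hc]
  have hqcont : ContinuousOn q (Metric.closedBall 0 η) :=
    (continuousOn_complexChart c).comp hqc.continuousOn fun y hy => hηs y (mem_closedBall_zero_iff.1 hy)
  have hqinj : Set.InjOn q (Metric.closedBall 0 η) := by
    intro a ha b hb hab
    rw [mem_closedBall_zero_iff] at ha hb
    have h1 := injOn_complexChart c (hηs a ha) (hηs b hb) hab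
    have h2 := congrArg Subtype.val
      (hinj _ _ (by rw [coe_discProj (hηT a ha).le]; exact hηT a ha) h1)
    rw [coe_discProj (hηT a ha).le, coe_discProj (hηT b hb).le] at h2
    exact add_left_cancel h2
  have hψ0 : ∀ y, y ≠ 0 → ‖y‖ ≤ η → q y - q 0 ≠ 0 := fun y hy hyη h =>
    hy (hqinj (mem_closedBall_zero_iff.2 hyη) (by simp [hη.le]) (sub_eq_zero.1 h))
  have hmemη : ∀ t, (η : ℂ) * unitLoop t ∈ Metric.closedBall (0 : ℂ) η := fun t => by
    rw [mem_closedBall_zero_iff, hnu, abs_of_pos hη]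
  -- `k` is the local degree of `Q` at `c₀` in the chart at `c`; it is odd and so can be cancelled.
  obtain ⟨k, hk⟩ := exists_winds (c := fun t => q (η * unitLoop t) - q 0)
    ((hqcont.comp_continuous (f := fun t : unitInterval => (η : ℂ) * unitLoop t) (by fun_prop)
      fun t => hmemη t).sub continuous_const)
    (fun t => hψ0 _ (mul_ne_zero (ofReal_ne_zero.2 hη.ne') (unitLoop_ne_zero _))
      (mem_closedBall_zero_iff.1 (hmemη t))) (by simp [unitLoop_zero, unitLoop_one])
  have hodd : Odd k := odd_of_winds_of_injOn (z := 0) hη hqcont hqinj (by simpa only [zero_add] using hk)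
  have hcomp : ∀ {e : unitInterval → ℂ} {m : ℤ}, (∀ t, ‖e t‖ ≤ η) → Winds e m →
      Winds (fun t => q (e t) - q 0) (k * m) := by
    intro e m he hm
    exact Winds.comp (ψ := fun y => q y - q 0) hη
      ((hqcont.mono fun y hy => mem_closedBall_zero_iff.2 hy.2).sub continuousOn_const) hψ0 hη le_rfl hk he hm
  -- a small circle
  have hsmall : ∀ᶠ y : ℂ in nhds 0, (∀ h : ‖y‖ < 1 - ‖c₀‖, (⟨y, h⟩ : {y : ℂ // ‖y‖ < 1 - ‖c₀‖}) ∈ U₀) ∧ Q (discProj y) ∈ U₁ ∧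
      ‖(G (discProj y) : ℂ) - c₀‖ ≤ η ∧ ‖y‖ ≤ η := by
    refine Filter.Eventually.and ?_ (Filter.Eventually.and ?_ (Filter.Eventually.and ?_ ?_))
    · rw [nhds_subtype_eq_comap, Filter.mem_comap] at hU₀
      obtain ⟨V, hV, hVU⟩ := hU₀
      filter_upwards [hV] with y hy h
      exact hVU hy
    · exact (hQ.comp hpc).continuousAt.eventually hU₁
    · have h : Continuous fun y => ‖(G (discProj y) : ℂ) - c₀‖ := by fun_prop
      have h2 := h.tendsto 0
      simp only [← hc₀, sub_self, norm_zero] at h2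
      exact h2.eventually_le_const hη
    · have h2 := (continuous_norm (E := ℂ)).tendsto 0
      rw [norm_zero] at h2
      exact h2.eventually_le_const hη
  obtain ⟨ε, hε, hεb⟩ := Metric.nhds_basis_closedBall.mem_iff.1 hsmall
  have hεm : ∀ t, (ε : ℂ) * unitLoop t ∈ Metric.closedBall (0 : ℂ) ε := fun t => by
    rw [mem_closedBall_zero_iff, hnu, abs_of_pos hε]
  have hεT : ∀ t, ‖(ε : ℂ) * unitLoop t‖ < 1 - ‖c₀‖ := fun t => by
    have h1 := (hεb (hεm t)).2.2.2
    have h2 : η ≤ (1 - ‖c₀‖) / 2 := min_le_right _ _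
    linarith
  have hε1 : ε < 1 := by
    have := hεT 0
    rw [hnu, abs_of_pos hε] at this
    linarith [norm_nonneg c₀]
  have hεne : ∀ t, (ε : ℂ) * unitLoop t ≠ 0 := fun t =>
    mul_ne_zero (ofReal_ne_zero.2 hε.ne') (unitLoop_ne_zero _)
  have v0 : HasWinding c ⟨fun t => Q (discProj (c₀ + ε * unitLoop t)), by fun_prop⟩ k := by
    have h := hcomp (fun t => (hεb (hεm t)).2.2.2)
      ((Winds.const_mul_iff (ofReal_ne_zero.2 hε.ne')).2 winds_unitLoop)
    rw [mul_one, hq0] at h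
    exact h
  have v1 : HasWinding (Q (discProj 0)) ⟨fun t => Q (discProj (ε * unitLoop t)), by fun_prop⟩ k := by
    have h := (htr ⟨fun t => ⟨ε * unitLoop t, hεT t⟩, by fun_prop⟩ ?_
      (Subtype.ext (by simp [unitLoop_zero, unitLoop_one])) k).1 ?_
    · simpa [x₀] using h
    · rintro _ ⟨t, rfl⟩
      exact ⟨(hεb (hεm t)).1 _, fun h => hεne t (congrArg Subtype.val h)⟩
    · simpa [x₀] using v0
  have v2 := (hgw _ ?_ (by simp [unitLoop_zero, unitLoop_one]) k).1 v1
  -- In `g ∘ Q = Q ∘ G` the left side gives `k`, as `g` preserves orientation, and the right side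
  -- gives `k * d`. Hence `d = 1`.
  · have v3 : Winds (fun t => q (G (discProj (ε * unitLoop t)) - c₀) - q 0) k := by
      rw [hgc] at v2
      obtain ⟨L, hL, hL'⟩ := v2
      refine ⟨L, fun t => ?_, hL'⟩
      rw [hL, hq0]
      simp only [q, add_sub_cancel, discProj_coe, hGQ]
      rfl
    have v4 := hcomp (fun t => (hεb (hεm t)).2.2.1) (w3 ε hε hε1.le)
    have h := v4.unique v3
    have hk0 : k ≠ 0 := fun h0 => by rw [h0] at hodd; exact (by decide : ¬ Odd (0 : ℤ)) hodd
    exact mul_left_cancel₀ hk0 (h.trans (mul_one k).symm)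
  · rintro _ ⟨t, rfl⟩
    refine ⟨(hεb (hεm t)).2.1, fun h => hεne t ?_⟩
    have h1 : ‖(ε : ℂ) * unitLoop t‖ < 1 := by rw [hnu, abs_of_pos hε]; exact hε1
    have h2 := congrArg Subtype.val (hinj _ _ (by rwa [coe_discProj h1.le]) h)
    rwa [coe_discProj h1.le, coe_discProj (by simp)] at h2

/-- The lift to the line of the boundary values of a homeomorphism of degree `1` is increasing. -/
theorem strictMono_of_degree_one {G : Disc ≃ₜ Disc} {n : ℕ} (hn : 1 ≤ n) {F : ℝ → ℝ}
    (hF : Continuous F) (hGF : ∀ τ, G (rim n τ) = rim n (F τ))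
    (hFd : ∀ τ, F (τ + 4 * n) = F τ + 4 * n) : StrictMono F := by
  have hn' : (0 : ℝ) < n := by exact_mod_cast hn
  have hFm : ∀ (m : ℤ) (τ : ℝ), F (τ + m * (4 * n)) = F τ + m * (4 * n) := by
    have hper : Function.Periodic (fun τ => F τ - τ) (4 * n) := fun τ => by
      simp only [hFd]; ring
    intro m τ
    have : F (τ + m * (4 * n)) - (τ + m * (4 * n)) = F τ - τ := hper.int_mul m τ
    linarith
  have hinj : Function.Injective F := by
    intro a b hab
    have h : rim n a = rim n b := G.injective (by rw [hGF, hGF, hab])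
    obtain ⟨m, hm⟩ := (rim_eq_iff hn).1 h
    rw [hm, hFm] at hab
    have : (m : ℝ) * (4 * n) = 0 := by linarith
    linarith
  rcases hF.strictMono_of_inj hinj with h | h
  · exact h
  · have h1 := h (show (0 : ℝ) < 0 + 4 * n by positivity)
    rw [hFd] at h1
    linarith

end DiscOrientation

/-! ### Radial extension, Alexander's trick and isotopies of the disc. -/

section DiscIsotopy

open Complex

/-- A continuous map of the line of degree `1` is surjective. -/
theorem surjective_of_add_eq {F : ℝ → ℝ} (hF : Continuous F) {N : ℝ} (hN : 0 < N)
    (hFd : ∀ τ, F (τ + N) = F τ + N) : Function.Surjective F := by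
  have hFm : ∀ (m : ℤ), F (m * N) = F 0 + m * N := by
    have hper : Function.Periodic (fun τ => F τ - τ) N := fun τ => by
      simp only [hFd]; ring
    intro m
    have : F (0 + m * N) - (0 + m * N) = F 0 - 0 := hper.int_mul m 0
    rw [zero_add] at this
    linarith
  intro y
  set m := ⌊(y - F 0) / N⌋
  have h1 : (m : ℝ) * N ≤ y - F 0 := (le_div_iff₀ hN).1 (Int.floor_le _)
  have h2 : y - F 0 < (m + 1 : ℝ) * N := (div_lt_iff₀ hN).1 (Int.lt_floor_add_one _)
  have h3 := intermediate_value_Icc (a := (m : ℝ) * N) (b := ((m + 1 : ℤ) : ℝ) * N)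
    (by push_cast; nlinarith) hF.continuousOn
  rw [hFm, hFm] at h3
  obtain ⟨x, -, hx⟩ := h3 (show y ∈ _ by push_cast; constructor <;> linarith)
  exact ⟨x, hx⟩

theorem add_int_mul_of_add_eq {F : ℝ → ℝ} {N : ℝ} (hFd : ∀ τ, F (τ + N) = F τ + N) (τ : ℝ) (m : ℤ) :
    F (τ + m * N) = F τ + m * N := by
  have hper : Function.Periodic (fun τ => F τ - τ) N := fun τ => by
    simp only [hFd]; ring
  have : F (τ + m * N) - (τ + m * N) = F τ - τ := hper.int_mul m τ
  linarith

/-- The homogeneous function on the plane given by a periodic function on the line. -/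
def angularPart (n : ℕ) (D : ℝ → ℝ) (z : ℂ) : ℝ := D (arg z / (2 * Real.pi) * (4 * n))

theorem angularPart_eq {n : ℕ} {D : ℝ → ℝ} (hD : Function.Periodic D (4 * n)) (z : ℂ)
    {r τ : ℝ} (hr : 0 < r) (h : z = r * unitLoop (τ / (4 * n))) (hn : 1 ≤ n) : angularPart n D z = D τ := by
  have hn' : (0 : ℝ) < n := by exact_mod_cast hn
  have hπ := Real.pi_ne_zero
  have h1 : unitLoop (arg z / (2 * Real.pi)) = unitLoop (τ / (4 * n)) := by
    have h2 := norm_mul_exp_arg_mul_I z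
    have h3 : ‖z‖ = r := by
      rw [h, norm_mul, norm_unitLoop, norm_real, mul_one, Real.norm_of_nonneg hr.le]
    rw [h3] at h2
    have h4 : (r : ℂ) * unitLoop (arg z / (2 * Real.pi)) = r * unitLoop (τ / (4 * n)) := by
      rw [← h]
      refine Eq.trans ?_ h2
      congr 1
      unfold unitLoop
      congr 1
      push_cast
      field_simp
    exact mul_left_cancel₀ (ofReal_ne_zero.2 hr.ne') h4
  obtain ⟨m, hm⟩ := unitLoop_eq_iff.1 h1
  rw [angularPart, hm, add_mul, div_mul_cancel₀ _ (by positivity)]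
  exact hD.int_mul m τ

/-- `arg` is continuous only as an angle; a periodic `D` descends to angles. -/
theorem continuousAt_angularPart {n : ℕ} {D : ℝ → ℝ} (hDc : Continuous D) (hD : Function.Periodic D (4 * n))
    {z : ℂ} (hz : z ≠ 0) : ContinuousAt (angularPart n D) z := by
  have hπ := Real.pi_ne_zero
  have hper : Function.Periodic (fun θ => D (θ / (2 * Real.pi) * (4 * n))) (2 * Real.pi) := by
    intro θ
    have : (θ + 2 * Real.pi) / (2 * Real.pi) * (4 * n) = θ / (2 * Real.pi) * (4 * n) + 4 * n := by
      field_simp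
    simp only [this]
    exact hD _
  have hc : Continuous (hper.lift : Real.Angle → ℝ) := by
    refine Continuous.quotient_lift (by fun_prop) _
  have h : angularPart n D = fun z => hper.lift (arg z : Real.Angle) := by
    ext w
    exact (hper.lift_coe (arg w)).symm
  rw [h]
  exact ContinuousAt.comp (f := fun z => (arg z : Real.Angle)) hc.continuousAt (continuousAt_arg_coe_angle hz)

/-- The rotation of a point of the disc by an amount that depends on its angle. -/
def twist (n : ℕ) (D : ℝ → ℝ) (s : ℝ) (z : Disc) : Disc :=
  ⟨z * unitLoop (s * angularPart n D z / (4 * n)), by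
    rw [mem_closedBall_zero_iff, norm_mul, norm_unitLoop, mul_one]; exact z.norm_le⟩

theorem norm_twist (n : ℕ) (D : ℝ → ℝ) (s : ℝ) (z : Disc) : ‖(twist n D s z : ℂ)‖ = ‖(z : ℂ)‖ := by
  simp only [twist]
  rw [norm_mul, norm_unitLoop, mul_one]

theorem continuous_twist {n : ℕ} {D : ℝ → ℝ} (hDc : Continuous D) (hD : Function.Periodic D (4 * n)) :
    Continuous fun p : ℝ × Disc => twist n D p.1 p.2 := by
  rw [continuous_induced_rng, continuous_iff_continuousAt]
  rintro ⟨s, z⟩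
  -- The angle is undefined at the centre, but there preservation of the norm gives continuity.
  by_cases hz : (z : ℂ) = 0
  · have h0 : (twist n D s z : ℂ) = 0 := by rw [← norm_eq_zero, norm_twist, hz, norm_zero]
    change Filter.Tendsto (fun p : ℝ × Disc => (twist n D p.1 p.2 : ℂ)) _ (nhds (twist n D s z : ℂ))
    rw [h0, tendsto_zero_iff_norm_tendsto_zero]
    simp only [norm_twist]
    have : Continuous fun p : ℝ × Disc => ‖(p.2 : ℂ)‖ := by fun_prop
    have h1 := this.tendsto (s, z)
    simpa [hz] using h1
  · have h1 : ContinuousAt (fun p : ℝ × Disc => angularPart n D p.2) (s, z) :=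
      ContinuousAt.comp (f := fun p : ℝ × Disc => (p.2 : ℂ)) (continuousAt_angularPart hDc hD hz)
        (by fun_prop)
    have h2 : ContinuousAt (fun p : ℝ × Disc => unitLoop (p.1 * angularPart n D p.2 / (4 * n))) (s, z) :=
      continuous_unitLoop.continuousAt.comp (f := fun p : ℝ × Disc => p.1 * angularPart n D p.2 / (4 * n))
        ((continuousAt_fst.mul h1).div_const _)
    exact ContinuousAt.mul (by fun_prop) h2

theorem exists_polar {n : ℕ} (hn : 1 ≤ n) (z : Disc) : ∃ τ, (z : ℂ) = ‖(z : ℂ)‖ * rim n τ := by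
  by_cases hz : (z : ℂ) = 0
  · exact ⟨0, by simp [hz]⟩
  · have h0 : (‖(z : ℂ)‖ : ℂ) ≠ 0 := by simpa using hz
    obtain ⟨t, ht⟩ := exists_unitLoop_eq (z := (z : ℂ) / ‖(z : ℂ)‖) (by
      rw [norm_div, norm_real, norm_norm, div_self (by simpa using hz)])
    refine ⟨4 * n * t, ?_⟩
    rw [rim_mul hn, ht, mul_div_cancel₀ _ h0]

theorem coe_twist {n : ℕ} (hn : 1 ≤ n) {D : ℝ → ℝ} (hD : Function.Periodic D (4 * n)) (s : ℝ) {z : Disc}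
    {τ : ℝ} (h : (z : ℂ) = ‖(z : ℂ)‖ * rim n τ) :
    (twist n D s z : ℂ) = ‖(z : ℂ)‖ * rim n (τ + s * D τ) := by
  by_cases hz : (z : ℂ) = 0
  · simp [twist, hz]
  · simp only [twist]
    rw [angularPart_eq hD z (norm_pos_iff.2 hz) h hn]
    conv_lhs => rw [h]
    simp only [rim]
    rw [mul_assoc, ← unitLoop_add]
    congr 2
    ring

theorem twist_rim {n : ℕ} (hn : 1 ≤ n) {D : ℝ → ℝ} (hD : Function.Periodic D (4 * n)) (s τ : ℝ) :
    twist n D s (rim n τ) = rim n (τ + s * D τ) := by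
  refine Subtype.ext ?_
  rw [coe_twist hn hD s (τ := τ) (by simp [norm_rim]), norm_rim, ofReal_one, one_mul]

theorem twist_zero (n : ℕ) (D : ℝ → ℝ) (z : Disc) : twist n D 0 z = z :=
  Subtype.ext (by simp [twist, unitLoop_zero])

/-- Each circle about the centre is mapped to itself by the degree-one map `τ ↦ τ + s * D τ`, which
is increasing. -/
theorem bijective_twist {n : ℕ} (hn : 1 ≤ n) {D : ℝ → ℝ} (hDc : Continuous D)
    (hD : Function.Periodic D (4 * n)) {s : ℝ} (hs : StrictMono fun τ => τ + s * D τ) :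
    Function.Bijective (twist n D s) := by
  have hn' : (0 : ℝ) < n := by exact_mod_cast hn
  have hstep : ∀ τ, (τ + 4 * n) + s * D (τ + 4 * n) = (τ + s * D τ) + 4 * n := fun τ => by
    rw [hD]; ring
  constructor
  · intro z w h
    have hzw : ‖(z : ℂ)‖ = ‖(w : ℂ)‖ := by rw [← norm_twist n D s, h, norm_twist]
    obtain ⟨τ, hτ⟩ := exists_polar hn z
    obtain ⟨σ, hσ⟩ := exists_polar hn w
    by_cases hz : (z : ℂ) = 0
    · rw [hz, norm_zero, eq_comm, norm_eq_zero] at hzw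
      exact Subtype.ext (hz.trans hzw.symm)
    · have h0 : (‖(z : ℂ)‖ : ℂ) ≠ 0 := by simpa using hz
      have h1 := congrArg Subtype.val h
      rw [coe_twist hn hD s hτ, coe_twist hn hD s hσ, ← hzw] at h1
      obtain ⟨m, hm⟩ := (rim_eq_iff hn).1 (Subtype.ext (mul_left_cancel₀ h0 h1))
      have h2 : τ = σ + m * (4 * n) := hs.injective (by
        have := add_int_mul_of_add_eq (F := fun τ => τ + s * D τ) hstep σ m
        exact hm.trans this.symm)
      refine Subtype.ext ?_
      rw [hτ, hσ, ← hzw, h2, rim_add_mul hn]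
  · intro w
    obtain ⟨σ, hσ⟩ := exists_polar hn w
    obtain ⟨τ, hτ⟩ := surjective_of_add_eq (F := fun τ => τ + s * D τ) (by fun_prop) (by positivity) hstep σ
    have hle : ‖(‖(w : ℂ)‖ : ℂ) * rim n τ‖ = ‖(w : ℂ)‖ := by
      rw [norm_mul, norm_rim, mul_one, norm_real, norm_norm]
    refine ⟨⟨‖(w : ℂ)‖ * rim n τ, mem_closedBall_zero_iff.2 (hle.trans_le w.norm_le)⟩, Subtype.ext ?_⟩
    rw [coe_twist hn hD s (τ := τ) (by simp only [hle])]
    simp only [hle]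
    rw [hσ, ← hτ]
    simp [norm_rim]

/-- An increasing map of the line of degree `1` gives a homeomorphism of the disc. -/
theorem exists_homeomorph_disc {n : ℕ} (hn : 1 ≤ n) {F : ℝ → ℝ} (hF : Continuous F) (hmono : StrictMono F)
    (hFd : ∀ τ, F (τ + 4 * n) = F τ + 4 * n) :
    ∃ E : Disc ≃ₜ Disc, (∀ z, E z = twist n (fun τ => F τ - τ) 1 z) ∧ (∀ z, ‖(E z : ℂ)‖ = ‖(z : ℂ)‖) ∧
      ∀ τ, E (rim n τ) = rim n (F τ) := by
  have hD : Function.Periodic (fun τ => F τ - τ) (4 * n) := fun τ => by simp only [hFd]; ring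
  have hb := bijective_twist hn (D := fun τ => F τ - τ) (by fun_prop) hD (s := 1) (by simpa using hmono)
  have hc : Continuous (twist n (fun τ => F τ - τ) 1) :=
    (continuous_twist (D := fun τ => F τ - τ) (by fun_prop) hD).comp (f := fun z => ((1 : ℝ), z)) (by fun_prop)
  refine ⟨Continuous.homeoOfEquivCompactToT2 (f := Equiv.ofBijective _ hb) hc, fun z => rfl, fun z => norm_twist _ _ _ z,
    fun τ => ?_⟩
  change twist n (fun τ => F τ - τ) 1 (rim n τ) = _
  rw [twist_rim hn hD]
  simp

/-- The map of Alexander's isotopy. -/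
def alexander (E : Disc → Disc) (t : ℝ) (z : ℂ) : ℂ :=
  z + (1 - t : ℝ) * ((E (discProj (z / (1 - t : ℝ))) : ℂ) - discProj (z / (1 - t : ℝ)))

/-- Outside radius `1 - t` the projection lands on the unit circle, where `E` is the identity. For
`t = 1` the quotient by zero is harmless, as the displacement has the factor `1 - t = 0`. -/
theorem alexander_eq_self {E : Disc → Disc} (hE : ∀ z : Disc, ‖(z : ℂ)‖ = 1 → E z = z) {t : ℝ} (ht : t ≤ 1)
    {z : ℂ} (hz : 1 - t ≤ ‖z‖) : alexander E t z = z := by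
  rcases ht.eq_or_lt with rfl | ht
  · simp [alexander]
  · have h1 : 1 ≤ ‖z / (1 - t : ℝ)‖ := by
      rw [norm_div, norm_real, Real.norm_of_nonneg (by linarith), le_div_iff₀ (by linarith)]
      linarith
    have h2 : ‖(discProj (z / (1 - t : ℝ)) : ℂ)‖ = 1 := by
      rw [discProj_of_one_le h1, norm_div, norm_real, norm_norm, div_self (by linarith)]
    rw [alexander, hE _ h2]
    simp

theorem alexander_eq {E : Disc → Disc} {t : ℝ} (ht : t < 1)
    {z : ℂ} (hz : ‖z‖ ≤ 1 - t) :
    alexander E t z = (1 - t : ℝ) * E (discProj (z / (1 - t : ℝ))) := by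
  have h0 : ((1 - t : ℝ) : ℂ) ≠ 0 := ofReal_ne_zero.2 (by linarith)
  have h1 : ‖z / (1 - t : ℝ)‖ ≤ 1 := by
    rw [norm_div, norm_real, Real.norm_of_nonneg (by linarith), div_le_one (by linarith)]
    linarith
  rw [alexander, mul_sub, coe_discProj h1, mul_div_cancel₀ _ h0]
  ring

theorem norm_alexander_le {E : Disc → Disc} (hE : ∀ z : Disc, ‖(z : ℂ)‖ = 1 → E z = z) {t : ℝ}
    (ht0 : 0 ≤ t) (ht : t ≤ 1) {z : ℂ} (hz : ‖z‖ ≤ 1) : ‖alexander E t z‖ ≤ 1 := by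
  rcases le_total (1 - t) ‖z‖ with h | h
  · rwa [alexander_eq_self hE ht h]
  · rcases ht.eq_or_lt with rfl | ht
    · rwa [alexander_eq_self hE le_rfl (by simp)]
    · rw [alexander_eq ht h, norm_mul, norm_real, Real.norm_of_nonneg (by linarith)]
      have := (E (discProj (z / (1 - t : ℝ)))).norm_le
      nlinarith [norm_nonneg (E (discProj (z / (1 - t : ℝ))) : ℂ)]

theorem alexander_alexander {E K : Disc → Disc} (hE : ∀ z : Disc, ‖(z : ℂ)‖ = 1 → E z = z)
    (hK : ∀ z : Disc, ‖(z : ℂ)‖ = 1 → K z = z) (hKE : ∀ z, K (E z) = z) {t : ℝ}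
    (ht : t ≤ 1) (z : ℂ) : alexander K t (alexander E t z) = z := by
  rcases le_total (1 - t) ‖z‖ with h | h
  · rw [alexander_eq_self hE ht h, alexander_eq_self hK ht h]
  · rcases ht.eq_or_lt with rfl | ht
    · rw [alexander_eq_self hE le_rfl (by simp), alexander_eq_self hK le_rfl (by simp)]
    · have h0 : ((1 - t : ℝ) : ℂ) ≠ 0 := ofReal_ne_zero.2 (by linarith)
      have h1 : ‖z / (1 - t : ℝ)‖ ≤ 1 := by
        rw [norm_div, norm_real, Real.norm_of_nonneg (by linarith), div_le_one (by linarith)]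
        linarith
      rw [alexander_eq ht h, alexander_eq ht, mul_div_cancel_left₀ _ h0, discProj_coe, hKE,
        coe_discProj h1, mul_div_cancel₀ _ h0]
      rw [norm_mul, norm_real, Real.norm_of_nonneg (by linarith)]
      have := (E (discProj (z / (1 - t : ℝ)))).norm_le
      nlinarith [norm_nonneg (E (discProj (z / (1 - t : ℝ))) : ℂ)]

theorem continuous_alexander {E : Disc → Disc} (hE : Continuous E) :
    Continuous fun p : unitInterval × Disc => alexander E p.1 p.2 := by
  have hpc := continuous_discProj
  simp only [alexander]
  refine Continuous.add (by fun_prop) ?_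
  rw [continuous_iff_continuousAt]
  rintro ⟨t, z⟩
  by_cases ht : (t : ℝ) = 1
  -- The displacement has norm at most `2 * (1 - t)`, which gives continuity at `t = 1`.
  · have h1 : Filter.Tendsto (fun p : unitInterval × Disc => (1 - (p.1 : ℝ)) * 2) (nhds (t, z)) (nhds 0) := by
      have : Continuous fun p : unitInterval × Disc => (1 - (p.1 : ℝ)) * 2 := by fun_prop
      simpa [ht] using this.tendsto (t, z)
    rw [ContinuousAt]
    simp only [ht, sub_self, ofReal_zero, zero_mul]
    refine squeeze_zero_norm (fun p => ?_) h1
    rw [norm_mul, norm_real, Real.norm_of_nonneg (by linarith [p.1.2.2])]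
    refine mul_le_mul_of_nonneg_left ?_ (by linarith [p.1.2.2])
    refine (norm_sub_le _ _).trans ?_
    linarith [(E (discProj (p.2 / (1 - p.1 : ℝ)))).norm_le, (discProj (p.2 / (1 - p.1 : ℝ))).norm_le]
  · have h0 : ((1 - (t : ℝ) : ℝ) : ℂ) ≠ 0 := ofReal_ne_zero.2 (sub_ne_zero.2 (Ne.symm ht))
    have h1 : ContinuousAt (fun p : unitInterval × Disc => discProj ((p.2 : ℂ) / (1 - (p.1 : ℝ) : ℝ))) (t, z) := by
      refine ContinuousAt.comp (g := discProj) hpc.continuousAt ?_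
      exact ContinuousAt.div (by fun_prop) (by fun_prop) h0
    refine ContinuousAt.mul (by fun_prop) (ContinuousAt.sub ?_ ?_)
    · exact ContinuousAt.comp (g := fun w => (E w : ℂ)) (by fun_prop) h1
    · exact ContinuousAt.comp (g := fun w : Disc => (w : ℂ)) (by fun_prop) h1

/-- An isotopy from a homeomorphism of the disc with increasing boundary values to the identity,
which is linear on the boundary. -/
theorem exists_disc_isotopy {n : ℕ} (hn : 1 ≤ n) {G : Disc ≃ₜ Disc} {F : ℝ → ℝ} (hF : Continuous F)
    (hmono : StrictMono F) (hFd : ∀ τ, F (τ + 4 * n) = F τ + 4 * n)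
    (hGF : ∀ τ, G (rim n τ) = rim n (F τ)) :
    ∃ K : unitInterval × Disc → Disc, Continuous K ∧ (∀ z, K (0, z) = G z) ∧ (∀ z, K (1, z) = z) ∧
      (∀ t, Function.Bijective fun z => K (t, z)) ∧
      (∀ t z, ‖(K (t, z) : ℂ)‖ < 1 ↔ ‖(z : ℂ)‖ < 1) ∧
      ∀ (t : unitInterval) τ, K (t, rim n τ) = rim n ((1 - t) * F τ + t * τ) := by
  have hD : Function.Periodic (fun τ => F τ - τ) (4 * n) := fun τ => by simp only [hFd]; ring
  have hDc : Continuous fun τ => F τ - τ := by fun_prop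
  -- `B` extends the boundary values radially, and `E = B⁻¹ G` is the identity on the circle.
  -- Alexander's trick contracts `E` while the angular displacement of `B` decreases linearly.
  obtain ⟨B, hB1, hBn, hB⟩ := exists_homeomorph_disc hn hF hmono hFd
  obtain ⟨E, hBE⟩ : ∃ E : Disc ≃ₜ Disc, ∀ z, B (E z) = G z :=
    ⟨G.trans B.symm, fun z => B.apply_symm_apply _⟩
  have hE : ∀ z : Disc, ‖(z : ℂ)‖ = 1 → E z = z := by
    intro z hz
    obtain ⟨τ, rfl⟩ := exists_rim_eq hn hz
    exact B.injective (by rw [hBE, hGF, hB])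
  have hE' : ∀ z : Disc, ‖(z : ℂ)‖ = 1 → E.symm z = z := fun z hz =>
    E.injective (by rw [E.apply_symm_apply, hE z hz])
  let a : unitInterval × Disc → Disc := fun p => discProj (alexander E p.1 p.2)
  have ha : ∀ p, (a p : ℂ) = alexander E p.1 p.2 := fun p =>
    coe_discProj (norm_alexander_le hE p.1.2.1 p.1.2.2 p.2.norm_le)
  have hac : Continuous a := continuous_discProj.comp (continuous_alexander E.continuous)
  have hab : ∀ t, Function.Bijective fun z => a (t, z) := by
    intro t
    refine Function.bijective_iff_has_inverse.2 ⟨fun z => discProj (alexander E.symm t z), ?_, ?_⟩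
    · intro z
      simp only [ha]
      rw [alexander_alexander hE hE' E.symm_apply_apply t.2.2, discProj_coe]
    · intro z
      refine Subtype.ext ?_
      simp only [ha]
      rw [coe_discProj (norm_alexander_le hE' t.2.1 t.2.2 z.norm_le),
        alexander_alexander hE' hE E.apply_symm_apply t.2.2]
  have har : ∀ t (z : Disc), ‖(z : ℂ)‖ = 1 → a (t, z) = z := by
    intro t z hz
    refine Subtype.ext ?_
    rw [ha, alexander_eq_self hE t.2.2 (by rw [hz]; linarith [t.2.1])]
  have han : ∀ t z, ‖(a (t, z) : ℂ)‖ < 1 ↔ ‖(z : ℂ)‖ < 1 := by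
    intro t z
    rw [← not_le, ← not_le, not_iff_not]
    have e : ∀ w : Disc, 1 ≤ ‖(w : ℂ)‖ ↔ ‖(w : ℂ)‖ = 1 := fun w =>
      ⟨fun h => le_antisymm w.norm_le h, fun h => h.ge⟩
    rw [e, e]
    refine ⟨fun h => ?_, fun h => by rw [har t z h, h]⟩
    have h1 : a (t, z) = z := (hab t).1 (har t _ h)
    rwa [h1] at h
  refine ⟨fun p => twist n (fun τ => F τ - τ) (1 - p.1) (a p), ?_, fun z => ?_, fun z => ?_, fun t => ?_,
    fun t z => by rw [norm_twist, han], fun t τ => ?_⟩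
  · exact (continuous_twist hDc hD).comp (f := fun p : unitInterval × Disc => (1 - (p.1 : ℝ), a p))
      (by fun_prop)
  · have h1 : a (0, z) = E z := by
      refine Subtype.ext ?_
      rw [ha, alexander_eq (by simp) (by simpa using z.norm_le)]
      simp [discProj_coe]
    simp only [Set.Icc.coe_zero, sub_zero]
    rw [h1, ← hB1, hBE]
  · have h1 : a (1, z) = z := by
      refine Subtype.ext ?_
      rw [ha, alexander_eq_self hE (by simp) (by simp)]
    simp only [Set.Icc.coe_one, sub_self]
    rw [h1, twist_zero]
  · have hs : StrictMono fun τ => τ + (1 - (t : ℝ)) * (F τ - τ) := ?_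
    · exact (bijective_twist hn hDc hD hs).comp (hab t)
    intro x y hxy
    have h1 := hmono hxy
    have := t.2.1
    have := t.2.2
    simp only
    rcases (t.2.1).eq_or_lt with h | h
    · rw [← h]; linarith
    · nlinarith
  · simp only [har t _ (norm_rim n τ)]
    rw [twist_rim hn hD]
    congr 1
    ring

end DiscIsotopy

/-! ### Coordinates on the standard sphere, its star and its point at infinity. -/

section StandardSpherePoints

open Complex

/-- The finite points of the Riemann sphere that belong to the standard sphere. -/
def stdDomain (n : ℕ) : Set ℂ := {w | ∀ k : Fin n, 1 / 3 ≤ ‖w - (k + 1)‖}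

open Classical in
/-- The point of the standard sphere with a given coordinate. -/
def stdPt (n : ℕ) (w : ℂ) : StdSphere n :=
  if h : w ∈ stdDomain n then ⟨w, fun v hv k => by rw [← OnePoint.coe_injective hv]; exact h k⟩
  else ⟨OnePoint.infty, fun v hv => (OnePoint.infty_ne_coe v hv).elim⟩

theorem coe_stdPt {n : ℕ} {w : ℂ} (h : w ∈ stdDomain n) : (stdPt n w : OnePoint ℂ) = w := by
  simp [stdPt, h]

theorem stdPt_eq {n : ℕ} {w : ℂ} {z : StdSphere n} (h : (z : OnePoint ℂ) = w) : stdPt n w = z :=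
  Subtype.ext (by rw [coe_stdPt (fun k => z.2 w h k), h])

theorem continuousOn_stdPt (n : ℕ) : ContinuousOn (stdPt n) (stdDomain n) := by
  rw [Topology.IsInducing.subtypeVal.continuousOn_iff]
  exact OnePoint.continuous_coe.continuousOn.congr fun w hw => coe_stdPt hw

theorem stdPt_injOn (n : ℕ) : Set.InjOn (stdPt n) (stdDomain n) := by
  intro a ha b hb h
  have := congrArg Subtype.val h
  rw [coe_stdPt ha, coe_stdPt hb] at this
  exact OnePoint.coe_injective this

theorem stdPt_mem_circle_iff {n : ℕ} {w : ℂ} (h : w ∈ stdDomain n) (k : Fin n) :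
    stdPt n w ∈ stdCircle n k ↔ ‖w - (k + 1)‖ = 1 / 3 := by
  constructor
  · rintro ⟨v, hv, hk⟩
    rw [coe_stdPt h] at hv
    rwa [OnePoint.coe_injective hv]
  · exact fun hk => ⟨w, coe_stdPt h, hk⟩

theorem norm_natCast_sub_natCast {j k : ℕ} (h : j ≠ k) : 1 ≤ ‖((j : ℂ) + 1) - (k + 1)‖ := by
  have h1 : ((j : ℂ) + 1) - (k + 1) = (((j : ℤ) - (k : ℤ) : ℤ) : ℝ) := by push_cast; ring
  rw [h1, norm_real, Real.norm_eq_abs, ← Int.cast_abs]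
  have h2 : (1 : ℤ) ≤ |(j : ℤ) - k| := Int.one_le_abs (sub_ne_zero.2 (by exact_mod_cast h))
  have h3 := (Int.cast_le (R := ℝ)).2 h2
  rwa [Int.cast_one] at h3

/-- The annulus around a boundary circle. -/
theorem lt_norm_sub_of_norm_sub_lt {j k : ℕ} (h : j ≠ k) {w : ℂ} (hw : ‖w - (k + 1)‖ < 2 / 3) :
    1 / 3 < ‖w - (j + 1)‖ := by
  have h1 := norm_natCast_sub_natCast h
  have h2 := norm_sub_le_norm_sub_add_norm_sub ((j : ℂ) + 1) w (k + 1)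
  rw [norm_sub_rev ((j : ℂ) + 1) w] at h2
  linarith

theorem stdCircle_eq_of_mem {n : ℕ} {j k : Fin n} {z : StdSphere n} (hj : z ∈ stdCircle n j)
    (hk : z ∈ stdCircle n k) : j = k := by
  obtain ⟨w, hw, hwj⟩ := hj
  obtain ⟨v, hv, hvk⟩ := hk
  rw [hw] at hv
  rw [← OnePoint.coe_injective hv] at hvk
  by_contra h
  have := lt_norm_sub_of_norm_sub_lt (j := j) (k := k) (fun h' => h (Fin.ext h')) (w := w) (by rw [hvk]; norm_num)
  linarith

theorem stdMarked_mem_circle (n : ℕ) (k : Fin n) : stdMarked n k ∈ stdCircle n k := by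
  refine ⟨_, rfl, ?_⟩
  rw [sub_sub_cancel_left, norm_neg, norm_div, norm_I]
  norm_num

theorem edgePt_eq (n : ℕ) (k : Fin n) (l : ℝ) : edgePt n k l =
    (((n + 1) / 2 + l * ((k + 1) - (n + 1) / 2) : ℝ) : ℂ) + ((-1 + 2 / 3 * l : ℝ) : ℂ) * I := by
  simp only [edgePt]; push_cast; ring

theorem edgePt_re (n : ℕ) (k : Fin n) (l : ℝ) :
    (edgePt n k l).re = (n + 1) / 2 + l * ((k + 1) - (n + 1) / 2) := by
  rw [edgePt_eq, add_re, re_ofReal_mul, ofReal_re, I_re, mul_zero, add_zero]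

theorem edgePt_im (n : ℕ) (k : Fin n) (l : ℝ) : (edgePt n k l).im = -1 + 2 / 3 * l := by
  rw [edgePt_eq, add_im, im_ofReal_mul, ofReal_im, I_im, mul_one, zero_add]

/-- Before its end the edge stays below the level `-1/3`, hence under all the discs. -/
theorem lt_norm_edgePt_sub {n : ℕ} (k j : Fin n) {l : ℝ} (hl : l < 1) : 1 / 3 < ‖edgePt n k l - (j + 1)‖ := by
  refine lt_of_lt_of_le ?_ (abs_im_le_norm _)
  have : (edgePt n k l - (j + 1)).im = -1 + 2 / 3 * l := by
    rw [sub_im, edgePt_im]; simp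
  rw [this, lt_abs]
  right
  linarith

theorem edgePt_one (n : ℕ) (k : Fin n) : edgePt n k 1 = k + 1 - I / 3 := by
  simp [edgePt]

theorem edgePt_mem_stdDomain {n : ℕ} (k : Fin n) {l : ℝ} (hl : l ≤ 1) : edgePt n k l ∈ stdDomain n := by
  intro j
  rcases hl.lt_or_eq with h | rfl
  · exact (lt_norm_edgePt_sub k j h).le
  · refine le_trans ?_ (abs_im_le_norm _)
    rw [edgePt_one]
    norm_num

/-- The height determines the parameter; only the common vertex `l = 0` lies on several edges. -/
theorem edgePt_inj {n : ℕ} {k j : Fin n} {l m : ℝ} (h : edgePt n k l = edgePt n j m) :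
    l = m ∧ (l = 0 ∨ k = j) := by
  have h1 := congrArg im h
  have h2 := congrArg re h
  rw [edgePt_im, edgePt_im] at h1
  rw [edgePt_re, edgePt_re] at h2
  have hlm : l = m := by linarith
  refine ⟨hlm, ?_⟩
  subst hlm
  by_cases hl : l = 0
  · exact Or.inl hl
  · right
    have h3 : l * ((k : ℝ) - j) = 0 := by linarith
    have h4 := (mul_eq_zero.1 h3).resolve_left hl
    exact Fin.ext (by exact_mod_cast sub_eq_zero.1 h4)

theorem continuous_edgePt (n : ℕ) (k : Fin n) : Continuous (edgePt n k) := by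
  unfold edgePt; fun_prop

/-- A parametrization of the edges of the standard star. -/
def starPt (n : ℕ) (k : Fin n) (l : ℝ) : StdSphere n := stdPt n (edgePt n k l)

theorem starPt_one (n : ℕ) (k : Fin n) : starPt n k 1 = stdMarked n k := by
  refine stdPt_eq ?_
  rw [edgePt_one]
  rfl

theorem coe_starPt {n : ℕ} (k : Fin n) {l : ℝ} (hl : l ≤ 1) : (starPt n k l : OnePoint ℂ) = (edgePt n k l : ℂ) :=
  coe_stdPt (edgePt_mem_stdDomain k hl)

theorem continuousOn_starPt (n : ℕ) (k : Fin n) : ContinuousOn (starPt n k) (Set.Iic 1) :=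
  (continuousOn_stdPt n).comp (continuous_edgePt n k).continuousOn fun _ hl => edgePt_mem_stdDomain k hl

theorem starPt_inj {n : ℕ} {k j : Fin n} {l m : ℝ} (hl : l ≤ 1) (hm : m ≤ 1) (h : starPt n k l = starPt n j m) :
    l = m ∧ (l = 0 ∨ k = j) :=
  edgePt_inj (stdPt_injOn n (edgePt_mem_stdDomain k hl) (edgePt_mem_stdDomain j hm) h)

theorem starPt_zero {n : ℕ} (k j : Fin n) : starPt n k 0 = starPt n j 0 := by
  simp [starPt, edgePt]

theorem starPt_notMem_circle {n : ℕ} (k j : Fin n) {l : ℝ} (hl : l < 1) : starPt n k l ∉ stdCircle n j := by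
  rw [starPt, stdPt_mem_circle_iff (edgePt_mem_stdDomain k hl.le)]
  exact (lt_norm_edgePt_sub k j hl).ne'

theorem mem_stdEdge_iff {n : ℕ} (k : Fin n) (z : StdSphere n) :
    z ∈ stdEdge n k ↔ ∃ l : ℝ, 0 ≤ l ∧ l ≤ 1 ∧ z = starPt n k l := by
  constructor
  · rintro ⟨w, hw, hz⟩
    rw [segment_eq_image'] at hw
    obtain ⟨l, hl, rfl⟩ := hw
    exact ⟨l, hl.1, hl.2, (stdPt_eq (hz.trans (by simp [edgePt]))).symm⟩
  · rintro ⟨l, h0, h1, rfl⟩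
    refine ⟨edgePt n k l, ?_, coe_starPt k h1⟩
    rw [segment_eq_image']
    exact ⟨l, ⟨h0, h1⟩, by simp [edgePt]⟩

/-- The coordinate at infinity of the standard sphere. -/
def stdInv (n : ℕ) (w : ℂ) : StdSphere n :=
  if w = 0 then ⟨OnePoint.infty, fun v hv => (OnePoint.infty_ne_coe v hv).elim⟩ else stdPt n w⁻¹

/-- All the discs lie in `‖z‖ < n + 1`, so radius `1 / (n + 1)` is small enough for a coordinate
disc about infinity. -/
theorem inv_mem_stdDomain {n : ℕ} {w : ℂ} (hw : w ≠ 0) (h : ‖w‖ < 1 / (n + 1)) (k : Fin n) :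
    1 / 3 < ‖w⁻¹ - (k + 1)‖ := by
  have h1 : (n : ℝ) + 1 < ‖w⁻¹‖ := by
    rw [norm_inv, lt_inv_comm₀ (by positivity) (norm_pos_iff.2 hw)]
    simpa using h
  have h2 := norm_sub_norm_le w⁻¹ (k + 1)
  have h3 : ‖((k : ℂ) + 1)‖ = k + 1 := by
    have : ((k : ℂ) + 1) = ((k + 1 : ℝ) : ℂ) := by push_cast; ring
    rw [this, norm_real, Real.norm_of_nonneg (by positivity)]
  have h4 : ((k : ℕ) : ℝ) + 1 ≤ n := by exact_mod_cast k.2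
  linarith

theorem stdInv_notMem_circle {n : ℕ} {w : ℂ} (h : ‖w‖ < 1 / (n + 1)) (k : Fin n) : stdInv n w ∉ stdCircle n k := by
  by_cases hw : w = 0
  · rw [stdInv, if_pos hw]
    rintro ⟨v, hv, -⟩
    exact OnePoint.infty_ne_coe v hv
  · rw [stdInv, if_neg hw, stdPt_mem_circle_iff fun k => (inv_mem_stdDomain hw h k).le]
    exact (inv_mem_stdDomain hw h k).ne'

theorem stdInv_injOn (n : ℕ) : Set.InjOn (stdInv n) (Metric.ball 0 (1 / (n + 1))) := by
  have key : ∀ v w : ℂ, ‖w‖ < 1 / (n + 1) → v = 0 → w ≠ 0 → stdInv n v ≠ stdInv n w := by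
    intro v w hw hv hw0 h
    rw [stdInv, if_pos hv, stdInv, if_neg hw0] at h
    have := congrArg Subtype.val h
    rw [coe_stdPt fun k => (inv_mem_stdDomain hw0 hw k).le] at this
    exact OnePoint.infty_ne_coe _ this
  intro v hv w hw h
  rw [mem_ball_zero_iff] at hv hw
  by_cases hv0 : v = 0
  · by_cases hw0 : w = 0
    · rw [hv0, hw0]
    · exact (key v w hw hv0 hw0 h).elim
  · by_cases hw0 : w = 0
    · exact (key w v hv hw0 hv0 h.symm).elim
    · rw [stdInv, if_neg hv0, stdInv, if_neg hw0] at h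
      exact inv_injective (stdPt_injOn n (fun k => (inv_mem_stdDomain hv0 hv k).le)
        (fun k => (inv_mem_stdDomain hw0 hw k).le) h)

theorem continuousOn_stdInv (n : ℕ) : ContinuousOn (stdInv n) (Metric.ball 0 (1 / (n + 1))) := by
  intro w hw
  by_cases hw0 : w = 0
  · subst hw0
    refine ContinuousAt.continuousWithinAt ?_
    rw [ContinuousAt, Topology.IsInducing.subtypeVal.tendsto_nhds_iff]
    have h0 : (stdInv n 0 : OnePoint ℂ) = OnePoint.infty := by simp [stdInv]
    rw [h0]
    refine tendsto_onePoint_infty fun R => ?_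
    have h1 : ∀ᶠ v : ℂ in nhds 0, ‖v‖ < 1 / (|R| + 1) := by
      have := (continuous_norm (E := ℂ)).tendsto 0
      rw [norm_zero] at this
      exact this.eventually_lt_const (by positivity)
    filter_upwards [h1, Metric.ball_mem_nhds (0 : ℂ) (show (0 : ℝ) < 1 / (n + 1) by positivity)] with v hv hvb u hu
    rw [mem_ball_zero_iff] at hvb
    by_cases hv0 : v = 0
    · simp only [Function.comp, stdInv, if_pos hv0] at hu
      exact (OnePoint.infty_ne_coe _ hu).elim
    · simp only [Function.comp, stdInv, if_neg hv0] at hu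
      rw [coe_stdPt fun k => (inv_mem_stdDomain hv0 hvb k).le] at hu
      rw [← OnePoint.coe_injective hu, norm_inv]
      have h2 : |R| + 1 < ‖v‖⁻¹ := by
        rw [lt_inv_comm₀ (by positivity) (norm_pos_iff.2 hv0)]
        simpa using hv
      linarith [le_abs_self R]
  · rw [mem_ball_zero_iff] at hw
    have h1 : ContinuousOn (fun v : ℂ => stdPt n v⁻¹) (Metric.ball 0 (1 / (n + 1)) \ {0}) := by
      refine (continuousOn_stdPt n).comp (continuousOn_inv₀.mono fun v hv => hv.2) fun v hv => ?_
      exact fun k => (inv_mem_stdDomain hv.2 (mem_ball_zero_iff.1 hv.1) k).le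
    have h2 : Metric.ball (0 : ℂ) (1 / (n + 1)) \ {0} ∈ nhds w :=
      (Metric.isOpen_ball.sdiff isClosed_singleton).mem_nhds ⟨mem_ball_zero_iff.2 hw, hw0⟩
    refine ((h1.continuousAt h2).congr ?_).continuousWithinAt
    filter_upwards [h2] with v hv
    rw [stdInv, if_neg (show ¬ v = 0 from hv.2)]

end StandardSpherePoints

/-! ### Components of the complement of the cuts and their parametrizations. -/

section Pieces

open Complex

variable {S : Type*} [TopologicalSpace S] [ChartedSpace (EuclideanHalfSpace 2) S]

theorem IsPolygon.notMem_circle {n : ℕ} {P : Disc → StdSphere n} (hP : IsPolygon n P) {z : Disc}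
    (hz : ‖(z : ℂ)‖ < 1) (k : Fin n) : P z ∉ stdCircle n k := by
  intro h
  obtain ⟨r, -, hr⟩ := hP.circle_surj k _ h
  have := hP.eq_of_norm_lt z _ hz hr.symm
  rw [this, norm_rim] at hz
  exact lt_irrefl _ hz

theorem mem_boundary_iff_notMem_interior {x : S} : x ∈ (𝓡∂ 2).boundary S ↔ x ∉ (𝓡∂ 2).interior S := by
  rw [← Set.mem_compl_iff, ModelWithCorners.compl_interior]

/-- A connected set stays connected when a point of its closure is added, so components are
relatively closed. -/
theorem mem_componentsOf_of_mem_closure {X : Type*} [TopologicalSpace X] {A W : Set X} (hW : W ∈ componentsOf A)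
    {x : X} (hx : x ∈ closure W) (hxA : x ∈ A) : x ∈ W := by
  obtain ⟨y, hy, rfl⟩ := hW
  have h1 : IsPreconnected (insert x (connectedComponentIn A y)) :=
    isPreconnected_connectedComponentIn.subset_closure (Set.subset_insert _ _)
      (Set.insert_subset hx subset_closure)
  exact h1.subset_connectedComponentIn (Set.mem_insert_of_mem _ (mem_connectedComponentIn hy))
    (Set.insert_subset hxA (connectedComponentIn_subset _ _)) (Set.mem_insert _ _)

theorem eq_of_mem_componentsOf {X : Type*} [TopologicalSpace X] {A W V : Set X} (hW : W ∈ componentsOf A)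
    (hV : V ∈ componentsOf A) {x : X} (hxW : x ∈ W) (hxV : x ∈ V) : W = V := by
  obtain ⟨y, hy, rfl⟩ := hW
  obtain ⟨z, hz, rfl⟩ := hV
  rw [connectedComponentIn_eq hxW, connectedComponentIn_eq hxV]

theorem subset_of_mem_componentsOf {X : Type*} [TopologicalSpace X] {A W : Set X} (hW : W ∈ componentsOf A) : W ⊆ A := by
  obtain ⟨y, hy, rfl⟩ := hW
  exact connectedComponentIn_subset _ _

theorem nonempty_of_mem_componentsOf {X : Type*} [TopologicalSpace X] {A W : Set X} (hW : W ∈ componentsOf A) :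
    W.Nonempty := by
  obtain ⟨y, hy, rfl⟩ := hW
  exact ⟨y, mem_connectedComponentIn hy⟩

theorem notMem_of_mem_cut {X : Type*} [TopologicalSpace X] {C : Set (Set X)} {W : Set X} (hW : W ∈ componentsOf (⋃₀ C)ᶜ) {c : Set X}
    (hc : c ∈ C) {x : X} (hx : x ∈ c) : x ∉ W :=
  fun h => subset_of_mem_componentsOf hW h ⟨c, hc, hx⟩

theorem boundary_subset_of_mem_boundaryComponents {β : Set S} (hβ : β ∈ boundaryComponents S) :
    β ⊆ (𝓡∂ 2).boundary S :=
  subset_of_mem_componentsOf hβ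

variable [ESurface S] {C : Set (Set S)} {W : Set S} {n : ℕ} {χ : StdSphere n → S}

theorem IsPiece.eq_of_notMem_circle (h : IsPiece C W n χ) {z w : StdSphere n} (hz : ∀ k, z ∉ stdCircle n k)
    (hw : ∀ k, w ∉ stdCircle n k) (hzw : χ z = χ w) : z = w :=
  h.injOn (h.mem_of_notMem_circle z hz) (h.mem_of_notMem_circle w hw) hzw

/-- Away from the circles `χ` is continuous and injective in a plane coordinate, which is `stdInv`
at infinity; so invariance of domain applies. -/
theorem IsPiece.mem_interior (h : IsPiece C W n χ) {z : StdSphere n} (hz : ∀ k, z ∉ stdCircle n k) :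
    χ z ∈ (𝓡∂ 2).interior S := by
  cases hzc : (z : OnePoint ℂ) using OnePoint.rec with
  | infty =>
    have h1 := (image_mem_nhds_of_injOn (F := χ ∘ stdInv n) (z := 0)
      (Metric.ball_mem_nhds (0 : ℂ) (show (0 : ℝ) < 1 / (n + 1) by positivity))
      (h.continuous.comp_continuousOn (continuousOn_stdInv n)) (fun a ha b hb hab => ?_)).1
    · have h2 : stdInv n 0 = z := Subtype.ext (by simp [stdInv, hzc])
      rwa [Function.comp, h2] at h1
    · exact stdInv_injOn n ha hb (h.eq_of_notMem_circle (stdInv_notMem_circle (mem_ball_zero_iff.1 ha))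
        (stdInv_notMem_circle (mem_ball_zero_iff.1 hb)) hab)
  | coe w =>
    have hopen : IsOpen {v : ℂ | ∀ k : Fin n, 1 / 3 < ‖v - (k + 1)‖} := by
      simp only [Set.ofPred_forall]
      exact isOpen_iInter_of_finite fun k => isOpen_lt continuous_const (by fun_prop)
    have hsub : {v : ℂ | ∀ k : Fin n, 1 / 3 < ‖v - (k + 1)‖} ⊆ stdDomain n := fun v hv k => (hv k).le
    have hnot : ∀ v ∈ {v : ℂ | ∀ k : Fin n, 1 / 3 < ‖v - (k + 1)‖}, ∀ k, stdPt n v ∉ stdCircle n k :=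
      fun v hv k hk => (hv k).ne' ((stdPt_mem_circle_iff (hsub hv) k).1 hk)
    have hw : w ∈ {v : ℂ | ∀ k : Fin n, 1 / 3 < ‖v - (k + 1)‖} := fun k =>
      lt_of_le_of_ne (z.2 w hzc k) fun he => hz k ⟨w, hzc, he.symm⟩
    have h1 := (image_mem_nhds_of_injOn (F := χ ∘ stdPt n) (hopen.mem_nhds hw)
      (h.continuous.comp_continuousOn ((continuousOn_stdPt n).mono hsub)) (fun a ha b hb hab =>
        stdPt_injOn n (hsub ha) (hsub hb) (h.eq_of_notMem_circle (hnot a ha) (hnot b hb) hab))).1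
    rwa [Function.comp, stdPt_eq hzc] at h1

/-- The open polygon is dense in the disc, and its image avoids the circles. -/
theorem IsPiece.mem_closure (h : IsPiece C W n χ) (z : StdSphere n) : χ z ∈ closure W := by
  rcases Nat.eq_zero_or_pos n with rfl | hn
  · exact subset_closure (h.mem_of_notMem_circle z fun k => k.elim0)
  · obtain ⟨P, hP⟩ := exists_isPolygon hn
    obtain ⟨u, rfl⟩ := hP.surjective z
    refine map_mem_closure (f := χ ∘ P) (h.continuous.comp hP.continuous) (dense_norm_lt_one u) fun v hv => ?_
    exact h.mem_of_notMem_circle _ fun k => hP.notMem_circle hv k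

theorem IsPiece.mem_of_notMem_cuts (h : IsPiece C W n χ) (hW : W ∈ componentsOf (⋃₀ C)ᶜ) {z : StdSphere n}
    (hz : χ z ∉ ⋃₀ C) : χ z ∈ W :=
  mem_componentsOf_of_mem_closure hW (h.mem_closure z) hz

theorem IsCutSystem.isClosed (hC : IsCutSystem C) {c : Set S} (hc : c ∈ C) : IsClosed c := by
  obtain ⟨κ⟩ := hC.circle c hc
  have : CompactSpace c := κ.symm.compactSpace
  exact (isCompact_iff_compactSpace.2 this).isClosed

theorem IsCutSystem.isClosed_sUnion (hC : IsCutSystem C) : IsClosed (⋃₀ C) := by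
  rw [Set.sUnion_eq_biUnion]
  exact hC.finite.isClosed_biUnion fun _ hc => hC.isClosed hc

theorem IsCutSystem.isOpen_component (hC : IsCutSystem C) (hW : W ∈ componentsOf (⋃₀ C)ᶜ) : IsOpen W := by
  have : LocallyConnectedSpace S := ChartedSpace.locallyConnectedSpace (EuclideanHalfSpace 2) S
  obtain ⟨x, hx, rfl⟩ := hW
  exact hC.isClosed_sUnion.isOpen_compl.connectedComponentIn

theorem IsCutSystem.notMem_of_mem_boundary (hC : IsCutSystem C) {x : S} (hx : x ∈ (𝓡∂ 2).boundary S) :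
    x ∉ ⋃₀ C := by
  rintro ⟨c, hc, hxc⟩
  exact mem_boundary_iff_notMem_interior.1 hx (hC.interior c hc hxc)

/-- The circle over a boundary component belongs to the component of the complement of the cuts. -/
theorem IsPiece.mem_of_boundary (h : IsPiece C W n χ) (hC : IsCutSystem C) (hW : W ∈ componentsOf (⋃₀ C)ᶜ)
    {k : Fin n} (hk : χ '' stdCircle n k ∈ boundaryComponents S) {z : StdSphere n} (hz : z ∈ stdCircle n k) :
    χ z ∈ (𝓡∂ 2).boundary S ∧ χ z ∈ W := by
  have h1 := boundary_subset_of_mem_boundaryComponents hk ⟨z, hz, rfl⟩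
  exact ⟨h1, h.mem_of_notMem_cuts hW (hC.notMem_of_mem_boundary h1)⟩

instance (n : ℕ) : CompactSpace (StdSphere n) := by
  rcases Nat.eq_zero_or_pos n with rfl | hn
  · have : StdSphere 0 = Set.univ := Set.eq_univ_of_forall fun z w _ k => k.elim0
    rw [this]
    exact isCompact_iff_compactSpace.1 isCompact_univ
  · obtain ⟨P, hP⟩ := exists_isPolygon hn
    exact hP.surjective.compactSpace hP.continuous

/-- A piece without cuts is the whole surface. -/
theorem IsPiece.eq_univ [ConnectedSpace S] (h : IsPiece C W n χ) (hC : IsCutSystem C)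
    (hW : W ∈ componentsOf (⋃₀ C)ᶜ) (hcut : ∀ k, χ '' stdCircle n k ∉ C) : W = Set.univ := by
  have h1 : W = Set.range χ := by
    refine h.subset_range.antisymm ?_
    rintro _ ⟨z, rfl⟩
    by_cases hz : ∀ k, z ∉ stdCircle n k
    · exact h.mem_of_notMem_circle z hz
    · push Not at hz
      obtain ⟨k, hk⟩ := hz
      exact (h.mem_of_boundary hC hW ((h.image_circle k).resolve_right (hcut k)) hk).2
  have hcl : IsClosed W := by
    rw [h1]
    exact (isCompact_range h.continuous).isClosed
  exact IsClopen.eq_univ ⟨hcl, hC.isOpen_component hW⟩ (nonempty_of_mem_componentsOf hW)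

/-- A piece without circles is the whole surface and consists of interior points. So a boundary
point excludes the closed sphere, whose star has no edge to cut along. -/
theorem IsPiece.one_le [ConnectedSpace S] (h : IsPiece C W n χ) (hC : IsCutSystem C)
    (hW : W ∈ componentsOf (⋃₀ C)ᶜ) {x : S} (hx : x ∈ (𝓡∂ 2).boundary S) : 1 ≤ n := by
  rw [Nat.one_le_iff_ne_zero]
  rintro rfl
  have h1 := h.eq_univ hC hW fun k => k.elim0
  obtain ⟨z, rfl⟩ := h.subset_range (h1.symm ▸ Set.mem_univ x)
  exact mem_boundary_iff_notMem_interior.1 hx (h.mem_interior fun k => k.elim0)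

/-- A parametrization of a neighbourhood of an interior point. -/
theorem exists_parametrization {S : Type*} [TopologicalSpace S] [ChartedSpace (EuclideanHalfSpace 2) S] {x : S}
    (hx : x ∈ (𝓡∂ 2).interior S) {U : Set S} (hU : U ∈ nhds x) :
    ∃ (F : ℂ → S) (z : ℂ) (r : ℝ), 0 < r ∧ ContinuousOn F (Metric.closedBall z r) ∧
      Set.InjOn F (Metric.closedBall z r) ∧ F z = x ∧ ∀ w ∈ Metric.closedBall z r, F w ∈ U := by
  set e := extChartAt (𝓡∂ 2) x with he
  have hT : e.target ∈ nhds (e x) := by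
    have h := extChartAt_target_mem_nhdsWithin (I := 𝓡∂ 2) x
    rwa [nhdsWithin_eq_nhds.2 (mem_interior_iff_mem_nhds.1 hx)] at h
  have hV : e.target ∩ e.symm ⁻¹' U ∈ nhds (e x) :=
    Filter.inter_mem hT (ContinuousAt.preimage_mem_nhds
      (continuousAt_extChartAt_symm (I := 𝓡∂ 2) x) (by rwa [he, extChartAt_to_inv]))
  obtain ⟨r, hr, hball⟩ := Metric.nhds_basis_closedBall.mem_iff.1 hV
  let ℓ : ℂ ≃ₗᵢ[ℝ] EuclideanSpace ℝ (Fin 2) := Complex.orthonormalBasisOneI.repr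
  have hℓ : ∀ w ∈ Metric.closedBall (ℓ.symm (e x)) r, ℓ w ∈ Metric.closedBall (e x) r := by
    intro w hw
    rw [mem_closedBall_iff_norm] at hw ⊢
    rwa [← ℓ.norm_map, map_sub, ℓ.apply_symm_apply] at hw
  refine ⟨fun w => e.symm (ℓ w), ℓ.symm (e x), r, hr, ?_, ?_, ?_, fun w hw => (hball (hℓ w hw)).2⟩
  · exact (continuousOn_extChartAt_symm (I := 𝓡∂ 2) x).comp ℓ.continuous.continuousOn
      fun w hw => (hball (hℓ w hw)).1
  · intro a ha b hb hab
    exact ℓ.injective (e.symm.injOn (hball (hℓ a ha)).1 (hball (hℓ b hb)).1 hab)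
  · simp only [ℓ.apply_symm_apply]
    exact extChartAt_to_inv (I := 𝓡∂ 2) x

/-- A coordinate on a cut with values in the unit circle. -/
theorem IsCutSystem.exists_coord (hC : IsCutSystem C) {c : Set S} (hc : c ∈ C) {p : S} (hp : p ∈ c) :
    ∃ κ : S → ℂ, ContinuousOn κ c ∧ Set.InjOn κ c ∧ (∀ x ∈ c, ‖κ x‖ = 1) ∧ κ p = -1 := by
  classical
  obtain ⟨κ₀⟩ := hC.circle c hc
  let κ₁ : S → ℂ := fun x => if h : x ∈ c then (κ₀ ⟨x, h⟩ : ℂ) else 0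
  have h1 : ∀ x (h : x ∈ c), κ₁ x = κ₀ ⟨x, h⟩ := fun x h => dif_pos h
  have hp0 : κ₁ p ≠ 0 := by rw [h1 p hp]; exact Circle.coe_ne_zero _
  refine ⟨fun x => -(κ₁ x / κ₁ p), ?_, ?_, ?_, ?_⟩
  · refine (ContinuousOn.div_const ?_ _).neg
    rw [continuousOn_iff_continuous_domRestrict]
    have : c.domRestrict κ₁ = fun x => (κ₀ x : ℂ) := funext fun x => h1 x x.2
    rw [this]
    fun_prop
  · intro x hx y hy hxy
    have h2 : κ₁ x = κ₁ y := by
      have := neg_injective hxy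
      field_simp at this
      exact this
    rw [h1 x hx, h1 y hy] at h2
    exact congrArg Subtype.val (κ₀.injective (Circle.ext h2))
  · intro x hx
    rw [norm_neg, norm_div, h1 x hx, h1 p hp, Circle.norm_coe, Circle.norm_coe, div_one]
  · simp only [div_self hp0]

/-- The cuts have no interior points. -/
theorem interior_sUnion_cuts (hC : IsCutSystem C) : interior (⋃₀ C) = ∅ := by
  by_contra hne
  obtain ⟨p, hp⟩ := Set.nonempty_iff_ne_empty.2 hne
  obtain ⟨c, hc, hpc⟩ := interior_subset hp
  have hcl : IsClosed (⋃₀ (C \ {c})) := by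
    rw [Set.sUnion_eq_biUnion]
    exact (hC.finite.subset Set.sdiff_subset).isClosed_biUnion fun d hd => hC.isClosed hd.1
  have hpn : p ∉ ⋃₀ (C \ {c}) := by
    rintro ⟨d, hd, hpd⟩
    exact Set.disjoint_left.1 (hC.disjoint hc hd.1 fun h => hd.2 h.symm) hpc hpd
  -- The other cuts are closed and miss `p`, so a neighbourhood of `p` would lie in one cut. Then a
  -- disc would embed in a circle, against invariance of domain.
  have hN : c ∈ nhds p := by
    filter_upwards [isOpen_interior.mem_nhds hp, hcl.isOpen_compl.mem_nhds hpn] with x hx hx'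
    obtain ⟨d, hd, hxd⟩ := interior_subset hx
    by_cases hdc : d = c
    · exact hdc ▸ hxd
    · exact (hx' ⟨d, ⟨hd, hdc⟩, hxd⟩).elim
  obtain ⟨F, z, r, hr, hF, hinj, -, hFc⟩ := exists_parametrization (hC.interior c hc hpc) hN
  obtain ⟨κ, hκ, hκi, hκn, -⟩ := hC.exists_coord hc hpc
  have h1 := image_closedBall_mem_nhds (f := fun w => κ (F w)) hr (hκ.comp hF hFc) (hκi.comp hinj hFc)
  have h2 : (fun w => κ (F w)) '' Metric.closedBall z r ⊆ Metric.sphere 0 1 := by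
    rintro _ ⟨w, hw, rfl⟩
    exact mem_sphere_zero_iff_norm.2 (hκn _ (hFc w hw))
  have h3 := mem_interior_iff_mem_nhds.2 (Filter.mem_of_superset h1 h2)
  rw [interior_sphere _ one_ne_zero] at h3
  exact h3

end Pieces

/-! ### The two sides of a cut. -/

section CutNeighbourhoods

open Complex

variable {S : Type*} [TopologicalSpace S] [ChartedSpace (EuclideanHalfSpace 2) S] [ESurface S]
  {C : Set (Set S)}

/-- The collar of a boundary circle. -/
def collar (n : ℕ) (k : Fin n) (u : ℂ) : StdSphere n := stdPt n (k + 1 + u / 3)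

theorem collar_norm (k : ℕ) (u : ℂ) : ‖(k + 1 + u / 3 : ℂ) - (k + 1)‖ = ‖u‖ / 3 := by
  rw [add_sub_cancel_left, norm_div]
  norm_num

theorem collar_mem_stdDomain {n : ℕ} (k : Fin n) {u : ℂ} (h1 : 1 ≤ ‖u‖) (h2 : ‖u‖ < 2) :
    (k + 1 + u / 3 : ℂ) ∈ stdDomain n := by
  intro j
  by_cases hj : (j : ℕ) = k
  · rw [hj, collar_norm]; linarith
  · exact (lt_norm_sub_of_norm_sub_lt hj (by rw [collar_norm]; linarith)).le

theorem collar_notMem_circle {n : ℕ} (k j : Fin n) {u : ℂ} (h1 : 1 < ‖u‖) (h2 : ‖u‖ < 2) :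
    collar n k u ∉ stdCircle n j := by
  rw [collar, stdPt_mem_circle_iff (collar_mem_stdDomain k h1.le h2)]
  by_cases hj : (j : ℕ) = k
  · rw [hj, collar_norm]; intro h; linarith
  · exact (lt_norm_sub_of_norm_sub_lt hj (by rw [collar_norm]; linarith)).ne'

theorem collar_mem_circle {n : ℕ} (k : Fin n) {u : ℂ} (h1 : ‖u‖ = 1) : collar n k u ∈ stdCircle n k := by
  rw [collar, stdPt_mem_circle_iff (collar_mem_stdDomain k h1.ge (by linarith)), collar_norm, h1]

theorem exists_collar_eq {n : ℕ} (k : Fin n) {z : StdSphere n} (hz : z ∈ stdCircle n k) :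
    ∃ u : ℂ, ‖u‖ = 1 ∧ collar n k u = z := by
  obtain ⟨w, hw, hk⟩ := hz
  refine ⟨3 * (w - (k + 1)), ?_, ?_⟩
  · rw [norm_mul, hk]; norm_num
  · refine stdPt_eq ?_
    rw [hw]
    congr 1
    ring

theorem collar_inj {n : ℕ} {k : Fin n} {u v : ℂ} (hu : 1 ≤ ‖u‖) (hu2 : ‖u‖ < 2) (hv : 1 ≤ ‖v‖) (hv2 : ‖v‖ < 2)
    (h : collar n k u = collar n k v) : u = v := by
  have := stdPt_injOn n (collar_mem_stdDomain k hu hu2) (collar_mem_stdDomain k hv hv2) h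
  have h2 := add_left_cancel this
  have h3 : u / 3 * 3 = v / 3 * 3 := by rw [h2]
  simpa using h3

theorem continuousOn_collar (n : ℕ) (k : Fin n) : ContinuousOn (collar n k) {u | 1 ≤ ‖u‖ ∧ ‖u‖ < 2} :=
  (continuousOn_stdPt n).comp (by fun_prop) fun _ hu => collar_mem_stdDomain k hu.1 hu.2

/-- Two different pieces on the sides of a cut fill up a neighbourhood of the cut. -/
theorem union_mem_nhds_of_cut {W₁ W₂ : Set S} {n₁ n₂ : ℕ} {χ₁ : StdSphere n₁ → S} {χ₂ : StdSphere n₂ → S}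
    (hW₁ : W₁ ∈ componentsOf (⋃₀ C)ᶜ) (hW₂ : W₂ ∈ componentsOf (⋃₀ C)ᶜ) (h₁ : IsPiece C W₁ n₁ χ₁)
    (h₂ : IsPiece C W₂ n₂ χ₂) (hne : W₁ ≠ W₂) {c : Set S} (hc : c ∈ C) {k₁ : Fin n₁} {k₂ : Fin n₂}
    (hk₁ : χ₁ '' stdCircle n₁ k₁ = c) (hk₂ : χ₂ '' stdCircle n₂ k₂ = c) {p : S} (hp : p ∈ c) :
    W₁ ∪ W₂ ∪ c ∈ nhds p := by
  have hd12 : ∀ x, x ∈ W₁ → x ∉ W₂ := fun x h1 h2 => hne (eq_of_mem_componentsOf hW₁ hW₂ h1 h2)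
  -- The function `ζ` chosen here identifies the two boundary circles that lie over the cut.
  have hex : ∀ u : ℂ, ‖u‖ = 1 → ∃ v : ℂ, ‖v‖ = 1 ∧ χ₂ (collar n₂ k₂ v) = χ₁ (collar n₁ k₁ u) := by
    intro u hu
    have h3 : χ₁ (collar n₁ k₁ u) ∈ c := hk₁ ▸ ⟨_, collar_mem_circle k₁ hu, rfl⟩
    rw [← hk₂] at h3
    obtain ⟨z, hz, hzu⟩ := h3
    obtain ⟨v, hv, rfl⟩ := exists_collar_eq k₂ hz
    exact ⟨v, hv, hzu⟩
  choose! ζ hζn hζ using hex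
  have hζinj : ∀ u v : ℂ, ‖u‖ = 1 → ‖v‖ = 1 → ζ u = ζ v → u = v := by
    intro u v hu hv h
    have h3 := h₁.injOn_circle k₁ (collar_mem_circle k₁ hu) (collar_mem_circle k₁ hv)
      (by rw [← hζ u hu, ← hζ v hv, h])
    exact collar_inj hu.ge (by linarith) hv.ge (by linarith) h3
  have hζc : ContinuousOn ζ (Metric.sphere 0 1) := by
    have hm : ∀ u : Metric.sphere (0 : ℂ) 1, ‖(u : ℂ)‖ = 1 := fun u => mem_sphere_zero_iff_norm.1 u.2
    have hcc : ∀ (n : ℕ) (k : Fin n), Continuous fun u : Metric.sphere (0 : ℂ) 1 => collar n k u := fun n k =>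
      (continuousOn_collar n k).comp_continuous (by fun_prop) fun u => ⟨(hm u).ge, by rw [hm u]; norm_num⟩
    have hemb : Topology.IsClosedEmbedding fun u : Metric.sphere (0 : ℂ) 1 => χ₂ (collar n₂ k₂ u) := by
      refine Continuous.isClosedEmbedding (h₂.continuous.comp (hcc _ _)) fun u v huv => ?_
      have h3 := h₂.injOn_circle k₂ (collar_mem_circle k₂ (hm u)) (collar_mem_circle k₂ (hm v)) huv
      exact Subtype.ext (collar_inj (hm u).ge (by rw [hm u]; norm_num) (hm v).ge (by rw [hm v]; norm_num) h3)
    have h4 : Continuous fun u : Metric.sphere (0 : ℂ) 1 =>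
        (⟨ζ u, mem_sphere_zero_iff_norm.2 (hζn u (hm u))⟩ : Metric.sphere (0 : ℂ) 1) := by
      rw [hemb.isEmbedding.continuous_iff]
      have : ((fun u : Metric.sphere (0 : ℂ) 1 => χ₂ (collar n₂ k₂ u)) ∘ fun u : Metric.sphere (0 : ℂ) 1 =>
          (⟨ζ u, mem_sphere_zero_iff_norm.2 (hζn u (hm u))⟩ : Metric.sphere (0 : ℂ) 1)) =
          fun u : Metric.sphere (0 : ℂ) 1 => χ₁ (collar n₁ k₁ u) := funext fun u => hζ u (hm u)
      rw [this]
      exact h₁.continuous.comp (hcc _ _)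
    rw [continuousOn_iff_continuous_domRestrict]
    exact continuous_subtype_val.comp h4
  let f₁ : ℂ → S := fun z => χ₁ (collar n₁ k₁ z)
  -- The collar of the second piece is turned inside out, so that both collars together parametrize
  -- an annulus around the cut.
  let f₂ : ℂ → S := fun z => χ₂ (collar n₂ k₂ (ζ (z / ‖z‖) / ‖z‖))
  let F : ℂ → S := fun z => if 1 ≤ ‖z‖ then f₁ z else f₂ z
  have hF1 : ∀ z, 1 ≤ ‖z‖ → F z = f₁ z := fun z hz => if_pos hz
  have hu1 : ∀ z : ℂ, z ≠ 0 → ‖z / ‖z‖‖ = 1 := fun z hz => by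
    rw [norm_div, norm_real, norm_norm, div_self (norm_ne_zero_iff.2 hz)]
  have hF2 : ∀ z, ‖z‖ ≤ 1 → F z = f₂ z := by
    intro z hz
    rcases hz.lt_or_eq with h | h
    · exact if_neg (not_le.2 h)
    · rw [hF1 z h.ge]
      simp only [f₁, f₂, h, ofReal_one, div_one]
      exact (hζ z h).symm
  have hn2 : ∀ z : ℂ, z ≠ 0 → ‖ζ (z / ‖z‖) / ‖z‖‖ = ‖z‖⁻¹ := fun z hz => by
    rw [norm_div, hζn _ (hu1 z hz), norm_real, norm_norm, one_div]
  have hpos : ∀ z : ℂ, 1 / 2 < ‖z‖ → z ≠ 0 := fun z hz h => by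
    rw [h, norm_zero] at hz; norm_num at hz
  have hn2' : ∀ z : ℂ, 1 / 2 < ‖z‖ → ‖ζ (z / ‖z‖) / ‖z‖‖ < 2 := fun z hz => by
    rw [hn2 z (hpos z hz), inv_lt_comm₀ (by linarith) (by norm_num)]
    linarith
  have hn2'' : ∀ z : ℂ, 1 / 2 < ‖z‖ → ‖z‖ ≤ 1 → 1 ≤ ‖ζ (z / ‖z‖) / ‖z‖‖ := fun z hz hz1 => by
    rw [hn2 z (hpos z hz)]
    exact (one_le_inv₀ (by linarith)).2 hz1
  have m1 : ∀ z : ℂ, 1 < ‖z‖ → ‖z‖ < 2 → F z ∈ W₁ := fun z h1 h2 => by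
    rw [hF1 z h1.le]
    exact h₁.mem_of_notMem_circle _ fun j => collar_notMem_circle k₁ j h1 h2
  have m0 : ∀ z : ℂ, ‖z‖ = 1 → F z ∈ c := fun z h1 => by
    rw [hF1 z h1.ge, ← hk₁]
    exact ⟨_, collar_mem_circle k₁ h1, rfl⟩
  have c2 : ∀ z : ℂ, ‖z‖ < 1 → 1 / 2 < ‖z‖ → ∀ j, collar n₂ k₂ (ζ (z / ‖z‖) / ‖z‖) ∉ stdCircle n₂ j :=
    fun z h1 h2 j => collar_notMem_circle k₂ j (by
      rw [hn2 z (hpos z h2)]; exact (one_lt_inv₀ (by linarith)).2 h1) (hn2' z h2)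
  have m2 : ∀ z : ℂ, ‖z‖ < 1 → 1 / 2 < ‖z‖ → F z ∈ W₂ := fun z h1 h2 => by
    rw [hF2 z h1.le]
    exact h₂.mem_of_notMem_circle _ (c2 z h1 h2)
  set U : Set ℂ := {z | 1 ≤ ‖z‖ ∧ ‖z‖ ≤ 3 / 2} ∪ {z | 2 / 3 ≤ ‖z‖ ∧ ‖z‖ ≤ 1} with hU
  have hUle : ∀ z ∈ U, 1 / 2 < ‖z‖ ∧ ‖z‖ < 2 := by
    rintro z (hz | hz)
    · exact ⟨by linarith [hz.1], by linarith [hz.2]⟩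
    · exact ⟨by linarith [hz.1], by linarith [hz.2]⟩
  have hFc : ContinuousOn F U := by
    have cl : ∀ a b : ℝ, IsClosed {z : ℂ | a ≤ ‖z‖ ∧ ‖z‖ ≤ b} := fun a b =>
      (isClosed_le continuous_const continuous_norm).inter (isClosed_le continuous_norm continuous_const)
    refine ContinuousOn.union_of_isClosed ?_ ?_ (cl _ _) (cl _ _)
    · refine ContinuousOn.congr ?_ fun z hz => hF1 z hz.1
      exact h₁.continuous.comp_continuousOn ((continuousOn_collar n₁ k₁).mono fun z hz =>
        ⟨hz.1, by linarith [hz.2]⟩)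
    · refine ContinuousOn.congr ?_ fun z hz => hF2 z hz.2
      have hz0 : ∀ z ∈ {z : ℂ | 2 / 3 ≤ ‖z‖ ∧ ‖z‖ ≤ 1}, (‖z‖ : ℂ) ≠ 0 := fun z hz =>
        ofReal_ne_zero.2 (by linarith [hz.1])
      refine h₂.continuous.comp_continuousOn ((continuousOn_collar n₂ k₂).comp ?_ fun z hz =>
        ⟨hn2'' z (by linarith [hz.1]) hz.2, hn2' z (by linarith [hz.1])⟩)
      refine ContinuousOn.div ?_ (by fun_prop) hz0
      refine hζc.comp (ContinuousOn.div (by fun_prop) (by fun_prop) hz0) fun z hz => ?_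
      exact mem_sphere_zero_iff_norm.2 (hu1 z (hpos z (by linarith [hz.1])))
  -- The inner half of the annulus goes to `W₂`, the unit circle to the cut and the outer half to
  -- `W₁`; these are disjoint as the components are different.
  have hFi : Set.InjOn F U := by
    have key : ∀ a ∈ U, ∀ b ∈ U, ‖a‖ ≤ ‖b‖ → F a = F b → a = b := by
      intro a ha b hb hle hab
      obtain ⟨ha1, ha2⟩ := hUle a ha
      obtain ⟨hb1, hb2⟩ := hUle b hb
      rcases lt_trichotomy ‖a‖ 1 with ha3 | ha3 | ha3
      · have hFa := m2 a ha3 ha1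
        rcases lt_trichotomy ‖b‖ 1 with hb3 | hb3 | hb3
        · rw [hF2 a ha3.le, hF2 b hb3.le] at hab
          have e1 := collar_inj (hn2'' a ha1 ha3.le) (hn2' a ha1) (hn2'' b hb1 hb3.le) (hn2' b hb1)
            (h₂.eq_of_notMem_circle (c2 a ha3 ha1) (c2 b hb3 hb1) hab)
          have e2 : ‖a‖ = ‖b‖ := by
            have := congrArg norm e1
            rw [hn2 a (hpos a ha1), hn2 b (hpos b hb1)] at this
            exact inv_injective this
          have hb0 : (‖b‖ : ℂ) ≠ 0 := ofReal_ne_zero.2 (by linarith)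
          rw [e2] at e1
          have e3 : ζ (a / ‖b‖) = ζ (b / ‖b‖) := by
            have := congrArg (· * (‖b‖ : ℂ)) e1
            simpa only [div_mul_cancel₀ _ hb0] using this
          have e4 := hζinj _ _ (by rw [← e2]; exact hu1 a (hpos a ha1)) (hu1 b (hpos b hb1)) e3
          have := congrArg (· * (‖b‖ : ℂ)) e4
          simpa only [div_mul_cancel₀ _ hb0] using this
        · exact (notMem_of_mem_cut hW₂ hc (hab ▸ m0 b hb3) hFa).elim
        · exact (hd12 _ (hab ▸ m1 b hb3 hb2) hFa).elim
      · have hFa := m0 a ha3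
        rcases hle.lt_or_eq with hb3 | hb3
        · exact (notMem_of_mem_cut hW₁ hc hFa (hab ▸ m1 b (by linarith) hb2)).elim
        · have hb4 : ‖b‖ = 1 := by linarith
          rw [hF1 a ha3.ge, hF1 b hb4.ge] at hab
          exact collar_inj ha3.ge ha2 hb4.ge hb2
            (h₁.injOn_circle k₁ (collar_mem_circle k₁ ha3) (collar_mem_circle k₁ hb4) hab)
      · have hb3 : 1 < ‖b‖ := by linarith
        rw [hF1 a ha3.le, hF1 b hb3.le] at hab
        exact collar_inj ha3.le ha2 hb3.le hb2
          (h₁.eq_of_notMem_circle (fun j => collar_notMem_circle k₁ j ha3 ha2)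
            (fun j => collar_notMem_circle k₁ j hb3 hb2) hab)
    intro a ha b hb hab
    rcases le_total ‖a‖ ‖b‖ with h | h
    · exact key a ha b hb h hab
    · exact (key b hb a ha h hab.symm).symm
  obtain ⟨u, hu, hup⟩ : ∃ u : ℂ, ‖u‖ = 1 ∧ F u = p := by
    rw [← hk₁] at hp
    obtain ⟨z, hz, rfl⟩ := hp
    obtain ⟨u, hu, rfl⟩ := exists_collar_eq k₁ hz
    exact ⟨u, hu, hF1 u hu.ge⟩
  have hUn : U ∈ nhds u := by
    have h3 : {z : ℂ | 2 / 3 < ‖z‖} ∩ {z : ℂ | ‖z‖ < 3 / 2} ∈ nhds u :=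
      ((isOpen_lt continuous_const continuous_norm).inter (isOpen_lt continuous_norm continuous_const)).mem_nhds
        ⟨by change 2 / 3 < ‖u‖; rw [hu]; norm_num, by change ‖u‖ < 3 / 2; rw [hu]; norm_num⟩
    filter_upwards [h3] with z hz
    rcases le_total 1 ‖z‖ with h | h
    · exact Or.inl ⟨h, le_of_lt hz.2⟩
    · exact Or.inr ⟨le_of_lt hz.1, h⟩
  have hnh := (image_mem_nhds_of_injOn hUn hFc hFi).2
  rw [hup] at hnh
  refine Filter.mem_of_superset hnh ?_
  rintro _ ⟨z, hz, rfl⟩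
  obtain ⟨h1, h2⟩ := hUle z hz
  rcases lt_trichotomy ‖z‖ 1 with h | h | h
  · exact Or.inl (Or.inr (m2 z h h1))
  · exact Or.inr (m0 z h)
  · exact Or.inl (Or.inl (m1 z h h2))

/-- The components on the sides of a cut. -/
def adjacent (C : Set (Set S)) (c : Set S) : Set (Set S) :=
  {W | W ∈ componentsOf (⋃₀ C)ᶜ ∧ ∃ (n : ℕ) (χ : StdSphere n → S) (k : Fin n), IsPiece C W n χ ∧
    χ '' stdCircle n k = c}

/-- At most two components are on the sides of a cut. -/
theorem eq_or_eq_of_mem_adjacent {c : Set S} (hc : c ∈ C) {W₁ W₂ W₃ : Set S} (h₁ : W₁ ∈ adjacent C c)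
    (h₂ : W₂ ∈ adjacent C c) (h₃ : W₃ ∈ adjacent C c) (hne : W₁ ≠ W₂) : W₃ = W₁ ∨ W₃ = W₂ := by
  obtain ⟨hW₁, n₁, χ₁, k₁, hp₁, hk₁⟩ := h₁
  obtain ⟨hW₂, n₂, χ₂, k₂, hp₂, hk₂⟩ := h₂
  obtain ⟨hW₃, n₃, χ₃, k₃, hp₃, hk₃⟩ := h₃
  have hmem : χ₃ (stdMarked n₃ k₃) ∈ c := hk₃ ▸ ⟨_, stdMarked_mem_circle n₃ k₃, rfl⟩
  -- The third component accumulates at the cut, but a neighbourhood there is filled by the other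
  -- two and the cut.
  have hn := union_mem_nhds_of_cut hW₁ hW₂ hp₁ hp₂ hne hc hk₁ hk₂ hmem
  obtain ⟨x, hx, hx3⟩ := mem_closure_iff_nhds.1 (hp₃.mem_closure (stdMarked n₃ k₃)) _ hn
  rcases hx with (hx | hx) | hx
  · exact Or.inl (eq_of_mem_componentsOf hW₃ hW₁ hx3 hx)
  · exact Or.inr (eq_of_mem_componentsOf hW₃ hW₂ hx3 hx)
  · exact (notMem_of_mem_cut hW₃ hc hx hx3).elim

/-- A component other than the whole surface lies on a side of some cut, and each of the finitely
many cuts has at most two components on its sides. -/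
theorem IsCutSystem.finite_components [ConnectedSpace S] (hC : IsCutSystem C) :
    (componentsOf (⋃₀ C)ᶜ).Finite := by
  by_cases hex : ∃ W ∈ componentsOf (⋃₀ C)ᶜ, W = Set.univ
  · obtain ⟨W, hW, rfl⟩ := hex
    refine (Set.finite_singleton Set.univ).subset fun V hV => ?_
    obtain ⟨x, hx⟩ := nonempty_of_mem_componentsOf hV
    exact eq_of_mem_componentsOf hV hW hx (Set.mem_univ x)
  · push Not at hex
    refine (hC.finite.biUnion (t := fun c => adjacent C c) fun c hc => ?_).subset fun W hW => ?_
    · by_cases hs : (adjacent C c).Subsingleton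
      · exact hs.finite
      · obtain ⟨W₁, h₁, W₂, h₂, hne⟩ := Set.not_subsingleton_iff.1 hs
        exact (Set.toFinite {W₁, W₂}).subset fun W₃ h₃ => eq_or_eq_of_mem_adjacent hc h₁ h₂ h₃ hne
    · obtain ⟨n, χ, h⟩ := hC.genus_zero W hW
      obtain ⟨k, hk⟩ : ∃ k, χ '' stdCircle n k ∈ C := by
        by_contra hno
        push Not at hno
        exact hex W hW (h.eq_univ hC hW hno)
      exact Set.mem_biUnion hk ⟨hW, n, χ, k, h, rfl⟩

/-- Closed sets that contain the components of the complement of the cuts cover the surface. -/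
theorem IsCutSystem.iUnion_eq_univ [ConnectedSpace S] (hC : IsCutSystem C) {R : Set S → Set S}
    (hR : ∀ W ∈ componentsOf (⋃₀ C)ᶜ, IsClosed (R W) ∧ W ⊆ R W) :
    ⋃ W ∈ componentsOf (⋃₀ C)ᶜ, R W = Set.univ := by
  have h1 : IsClosed (⋃ W ∈ componentsOf (⋃₀ C)ᶜ, R W) :=
    hC.finite_components.isClosed_biUnion fun W hW => (hR W hW).1
  have h2 : Dense (⋃₀ C)ᶜ := interior_eq_empty_iff_dense_compl.1 (interior_sUnion_cuts hC)
  have h3 : (⋃₀ C)ᶜ ⊆ ⋃ W ∈ componentsOf (⋃₀ C)ᶜ, R W := fun x hx =>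
    Set.mem_biUnion (show connectedComponentIn (⋃₀ C)ᶜ x ∈ _ from ⟨x, hx, rfl⟩)
      ((hR _ ⟨x, hx, rfl⟩).2 (mem_connectedComponentIn hx))
  exact Set.univ_subset_iff.1 (h2.closure_eq ▸ closure_minimal h3 h1)

end CutNeighbourhoods

/-! ### Constant-speed parametrization of the sides over cuts. -/

section ArcNormalization

open Complex

/-- The order on a line on which an increasing map of `[-1, 1]` is extended by the identity. -/
theorem exists_extension {h : ℝ → ℝ} (hc : ContinuousOn h (Set.Icc (-1) 1))
    (hm : StrictMonoOn h (Set.Icc (-1) 1)) (h0 : h (-1) = -1) (h1 : h 1 = 1) :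
    ∃ w : ℝ → ℝ, Continuous w ∧ StrictMono w ∧ (∀ r, 1 ≤ |r| → w r = r) ∧ ∀ r, |r| ≤ 1 → h (w r) = r := by
  let p : ℝ → ℝ := fun r => max (-1) (min r 1)
  have hp : ∀ r, p r ∈ Set.Icc (-1 : ℝ) 1 := fun r =>
    ⟨le_max_left _ _, max_le (by norm_num) (min_le_right _ _)⟩
  have hpid : ∀ r, |r| ≤ 1 → p r = r := fun r hr => by
    rw [abs_le] at hr
    simp only [p, min_eq_left hr.2, max_eq_right hr.1]
  have hp1 : ∀ r, 1 ≤ r → p r = 1 := fun r hr => by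
    simp only [p, min_eq_right hr]; norm_num
  have hp2 : ∀ r, r ≤ -1 → p r = -1 := fun r hr => by
    simp only [p]
    rw [max_eq_left]
    exact (min_le_left _ _).trans hr
  -- This extends `h` by the identity; the wanted `w` is its inverse.
  let v : ℝ → ℝ := fun r => h (p r) + (r - p r)
  have hv1 : ∀ r, 1 ≤ |r| → v r = r := fun r hr => by
    rcases le_abs.1 hr with h' | h'
    · simp only [v, hp1 r h', h1]; ring
    · simp only [v, hp2 r (by linarith), h0]; ring
  have hvh : ∀ r, |r| ≤ 1 → v r = h r := fun r hr => by
    simp only [v, hpid r hr]; ring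
  have hpc : Continuous p := by fun_prop
  have hvc : Continuous v := (hc.comp_continuous hpc hp).add (continuous_id.sub hpc)
  have hpm : Monotone p := fun a b hab => max_le_max le_rfl (min_le_min hab le_rfl)
  have hqm : ∀ a b, a ≤ b → p b - p a ≤ b - a := by
    intro a b hab
    simp only [p]
    rcases le_total a 1 with h1 | h1 <;> rcases le_total b 1 with h2 | h2 <;>
      simp only [min_eq_left, min_eq_right, h1, h2] <;>
      rcases le_total (-1) a with h3 | h3 <;> rcases le_total (-1) b with h4 | h4 <;>
      first
      | (simp only [max_eq_left, max_eq_right, h3, h4]; linarith)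
      | (norm_num; linarith)
      | (simp only [max_eq_left, max_eq_right, h3, h4]; norm_num; linarith)
  have hvm : StrictMono v := by
    intro a b hab
    have h2 := hqm a b hab.le
    rcases (hpm hab.le).lt_or_eq with h3 | h3
    · have := hm (hp a) (hp b) h3
      simp only [v]; linarith
    · simp only [v, h3]; linarith
  have hvs : Function.Surjective v := by
    refine hvc.surjective ?_ ?_
    · refine Filter.tendsto_atTop_mono' _ ?_ Filter.tendsto_id
      filter_upwards [Filter.eventually_ge_atTop 1] with r hr
      rw [hv1 r (hr.trans (le_abs_self r))]
      rfl
    · refine Filter.tendsto_atBot_mono' _ ?_ Filter.tendsto_id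
      filter_upwards [Filter.eventually_le_atBot (-1)] with r hr
      rw [hv1 r (le_abs.2 (Or.inr (by linarith)))]
      rfl
  let e := hvm.orderIsoOfSurjective v hvs
  have he : ∀ r, v (e.symm r) = r := fun r => e.apply_symm_apply r
  refine ⟨e.symm, e.symm.continuous, e.symm.strictMono, fun r hr => ?_, fun r hr => ?_⟩
  · exact hvm.injective (by rw [he, hv1 r hr])
  · rw [abs_le] at hr
    rw [← hvh, he]
    rw [abs_le]
    constructor
    · rw [← hvm.le_iff_le, he, hv1 _ (by norm_num)]; exact hr.1
    · rw [← hvm.le_iff_le, he, hv1 _ (by norm_num)]; exact hr.2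

/-- An arc that closes up to a circle can be reparametrized to have constant speed. -/
theorem exists_arc_reparametrization {u : ℝ → ℂ} (hu : ContinuousOn u (Set.Icc (-1) 1))
    (hn : ∀ r, |r| ≤ 1 → ‖u r‖ = 1) (hu0 : u (-1) = -1) (hu1 : u 1 = -1)
    (hinj : ∀ r s, |r| ≤ 1 → |s| ≤ 1 → u r = u s → r = s ∨ (|r| = 1 ∧ |s| = 1)) :
    ∃ (w : ℝ → ℝ) (ε : ℝ), (ε = 1 ∨ ε = -1) ∧ Continuous w ∧ StrictMono w ∧ (∀ r, 1 ≤ |r| → w r = r) ∧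
      ∀ r, |r| ≤ 1 → u (w r) = unitLoop (ε * r / 2) := by
  have hπ := Real.pi_ne_zero
  have hm1 : unitLoop (-1 / 2) = -1 := by
    have := unitLoop_add_half (-1 / 2)
    rw [show (-1 / 2 : ℝ) + 1 / 2 = 0 by norm_num, unitLoop_zero] at this
    rw [this, neg_neg]
  have hodd : ∀ x, unitLoop (x / 2) = -1 → ∃ m : ℤ, x = -1 + 2 * m := by
    intro x hx
    rw [← hm1] at hx
    obtain ⟨m, hm⟩ := unitLoop_eq_iff.1 hx
    exact ⟨m, by linarith⟩
  have hodd' : ∀ m : ℤ, unitLoop ((-1 + 2 * m) / 2) = -1 := by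
    intro m
    rw [← hm1, unitLoop_eq_iff]
    exact ⟨m, by ring⟩
  obtain ⟨L, hL, hLe⟩ := exists_continuous_log (E := ℝ) (f := fun x => u (Set.projIcc (-1) 1 (by norm_num) x))
    (hu.comp_continuous (by fun_prop) fun x => (Set.projIcc (-1 : ℝ) 1 (by norm_num) x).2)
    (fun x h => by
      have h2 := hn _ (abs_le.2 (Set.projIcc (-1 : ℝ) 1 (by norm_num) x).2)
      rw [h, norm_zero] at h2
      exact zero_ne_one h2)
  have hLu : ∀ r, |r| ≤ 1 → unitLoop ((L r).im / Real.pi / 2) = u r := by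
    intro r hr
    have h2 := hLe r
    simp only [Set.projIcc_of_mem (by norm_num : (-1 : ℝ) ≤ 1) (abs_le.1 hr)] at h2
    have h3 : (L r).re = 0 := by
      have := hn r hr
      rwa [← h2, norm_exp, Real.exp_eq_one_iff] at this
    rw [← h2, unitLoop]
    congr 1
    apply Complex.ext
    · simp [h3]
    · push_cast
      field_simp
      simp
  -- The lift `f` is normalized to start at `-1`, in units in which a full turn is `2`.
  obtain ⟨m₀, hm₀⟩ := hodd _ ((hLu (-1) (by norm_num)).trans hu0)
  let f : ℝ → ℝ := fun r => (L r).im / Real.pi - 2 * m₀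
  have hf : Continuous f := by fun_prop
  have hfu : ∀ r, |r| ≤ 1 → unitLoop (f r / 2) = u r := by
    intro r hr
    rw [← hLu r hr, unitLoop_eq_iff]
    exact ⟨-m₀, by simp only [f]; push_cast; ring⟩
  have hf0 : f (-1) = -1 := by simp only [f]; linarith
  have hfinj : ∀ r s, |r| ≤ 1 → |s| ≤ 1 → f r = f s → r = s ∨ (|r| = 1 ∧ |s| = 1) := fun r s hr hs h =>
    hinj r s hr hs (by rw [← hfu r hr, ← hfu s hs, h])
  have habs : ∀ r : ℝ, -1 < r → r < 1 → |r| < 1 := fun r h1 h2 => abs_lt.2 ⟨h1, h2⟩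
  -- A lift that returned to its initial value would take some value on both halves of the interval,
  -- against injectivity.
  have hf1 : f 1 ≠ f (-1) := by
    intro h
    have hne : f 0 ≠ f (-1) := fun h2 => by
      rcases hfinj 0 (-1) (by norm_num) (by norm_num) h2 with h3 | h3 <;> norm_num at h3
    have key : ∃ y a b, a ∈ Set.Ioo (-1 : ℝ) 0 ∧ b ∈ Set.Ioo (0 : ℝ) 1 ∧ f a = y ∧ f b = y := by
      rcases lt_or_gt_of_ne hne with h2 | h2
      · obtain ⟨a, ha, hay⟩ := intermediate_value_Ioo' (show (-1 : ℝ) ≤ 0 by norm_num) hf.continuousOn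
          (show (f 0 + f (-1)) / 2 ∈ _ from ⟨by linarith, by linarith⟩)
        obtain ⟨b, hb, hby⟩ := intermediate_value_Ioo (show (0 : ℝ) ≤ 1 by norm_num) hf.continuousOn
          (show (f 0 + f (-1)) / 2 ∈ _ from ⟨by linarith, by linarith⟩)
        exact ⟨_, a, b, ha, hb, hay, hby⟩
      · obtain ⟨a, ha, hay⟩ := intermediate_value_Ioo (show (-1 : ℝ) ≤ 0 by norm_num) hf.continuousOn
          (show (f 0 + f (-1)) / 2 ∈ _ from ⟨by linarith, by linarith⟩)
        obtain ⟨b, hb, hby⟩ := intermediate_value_Ioo' (show (0 : ℝ) ≤ 1 by norm_num) hf.continuousOn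
          (show (f 0 + f (-1)) / 2 ∈ _ from ⟨by linarith, by linarith⟩)
        exact ⟨_, a, b, ha, hb, hay, hby⟩
    obtain ⟨y, a, b, ha, hb, hay, hby⟩ := key
    have ha' := habs a ha.1 (by linarith [ha.2])
    rcases hfinj a b ha'.le (habs b (by linarith [hb.1]) hb.2).le (hay.trans hby.symm) with h3 | h3
    · linarith [ha.2, hb.1]
    · linarith [h3.1]
  have hfI : Set.InjOn f (Set.Icc (-1) 1) := by
    intro r hr s hs h
    rcases hfinj r s (abs_le.2 hr) (abs_le.2 hs) h with h2 | ⟨h2, h3⟩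
    · exact h2
    · rcases (abs_eq (by norm_num)).1 h2 with rfl | rfl <;> rcases (abs_eq (by norm_num)).1 h3 with rfl | rfl
      · rfl
      · exact (hf1 h).elim
      · exact (hf1 h.symm).elim
      · rfl
  have final : ∀ (h : ℝ → ℝ) (ε : ℝ), Continuous h → StrictMonoOn h (Set.Icc (-1) 1) → h (-1) = -1 →
      (ε = 1 ∨ ε = -1) → (∀ r, |r| ≤ 1 → unitLoop (ε * h r / 2) = u r) →
      ∃ (w : ℝ → ℝ) (ε : ℝ), (ε = 1 ∨ ε = -1) ∧ Continuous w ∧ StrictMono w ∧ (∀ r, 1 ≤ |r| → w r = r) ∧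
        ∀ r, |r| ≤ 1 → u (w r) = unitLoop (ε * r / 2) := by
    intro h ε hc hm h0 hε hh
    have hval : ∀ r, |r| ≤ 1 → u r = -1 → ∃ m : ℤ, h r = -1 + 2 * m := by
      intro r hr hur
      obtain ⟨m, hm⟩ := hodd (ε * h r) ((hh r hr).trans hur)
      rcases hε with rfl | rfl
      · exact ⟨m, by linarith⟩
      · exact ⟨1 - m, by push_cast; linarith⟩
    obtain ⟨m, hm1⟩ := hval 1 (by norm_num) hu1
    have hlt := hm (Set.left_mem_Icc.2 (by norm_num)) (Set.right_mem_Icc.2 (by norm_num))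
      (show (-1 : ℝ) < 1 by norm_num)
    rw [h0, hm1] at hlt
    have hmpos : 0 < m := by
      have : (0 : ℝ) < m := by linarith
      exact_mod_cast this
    -- The final value is the odd number `-1 + 2 * m`; for `m ≥ 2` the arc would pass through `-1`
    -- before its end.
    have hm_one : m = 1 := by
      by_contra hne
      have h2 : (2 : ℤ) ≤ m := by omega
      have h3 : (2 : ℝ) ≤ m := by exact_mod_cast h2
      obtain ⟨r, hr, hr1⟩ := intermediate_value_Ioo (show (-1 : ℝ) ≤ 1 by norm_num) hc.continuousOn
        (show (1 : ℝ) ∈ _ from ⟨by rw [h0]; norm_num, by rw [hm1]; linarith⟩)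
      have hr' := habs r hr.1 hr.2
      have hur : u r = u (-1) := by
        rw [← hh r hr'.le, hr1, hu0]
        rcases hε with rfl | rfl
        · have := hodd' 1
          norm_num at this ⊢
          exact this
        · have := hodd' 0
          norm_num at this ⊢
          exact this
      rcases hinj r (-1) hr'.le (by norm_num) hur with h4 | h4
      · linarith [hr.1]
      · linarith [h4.1]
    have h1 : h 1 = 1 := by rw [hm1, hm_one]; norm_num
    obtain ⟨w, hwc, hwm, hw1, hw⟩ := exists_extension hc.continuousOn hm h0 h1
    refine ⟨w, ε, hε, hwc, hwm, hw1, fun r hr => ?_⟩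
    have hwr : |w r| ≤ 1 := by
      rw [abs_le] at hr ⊢
      have e1 := hw1 1 (by norm_num)
      have e2 := hw1 (-1) (by norm_num)
      exact ⟨e2 ▸ hwm.monotone hr.1, e1 ▸ hwm.monotone hr.2⟩
    rw [← hh _ hwr, hw r hr]
  -- The sign `ε` records the direction of the arc; a decreasing lift is reflected at `-1`.
  rcases hf.continuousOn.strictMonoOn_of_injOn_Icc' (by norm_num) hfI with hmono | hanti
  · exact final f 1 hf hmono hf0 (Or.inl rfl) fun r hr => by rw [one_mul, hfu r hr]
  · refine final (fun r => -2 - f r) (-1) (by fun_prop) ?_ ?_ (Or.inr rfl) fun r hr => ?_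
    · intro a ha b hb hab
      have := hanti ha hb hab
      simp only
      linarith
    · simp only [hf0]; norm_num
    · rw [← hfu r hr, unitLoop_eq_iff]
      exact ⟨1, by push_cast; ring⟩

/-- Maps of the intervals `[4k - 2, 4k + 2]` that fix the endpoints fit together to a map of the line. -/
theorem exists_piecewise {n : ℕ} (hn : 1 ≤ n) (w : Fin n → ℝ → ℝ) (hwc : ∀ k, Continuous (w k))
    (hwm : ∀ k, StrictMono (w k)) (hw1 : ∀ k r, 1 ≤ |r| → w k r = r) :
    ∃ N : ℝ → ℝ, Continuous N ∧ StrictMono N ∧ (∀ τ, N (τ + 4 * n) = N τ + 4 * n) ∧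
      ∀ (k : Fin n) (r : ℝ), |r| ≤ 2 → N (4 * k + r) = 4 * k + w k r := by
  have hn' : (0 : ℤ) < n := by exact_mod_cast hn
  let fl : ℝ → ℤ := fun τ => ⌊τ / 4 + 1 / 2⌋
  let ix : ℤ → Fin n := fun m => ⟨(m % n).toNat, by
    have h1 := Int.emod_nonneg m hn'.ne'
    have h2 := Int.emod_lt_of_pos m hn'
    omega⟩
  have hfl : ∀ τ m, fl τ = m ↔ -2 ≤ τ - 4 * m ∧ τ - 4 * m < 2 := by
    intro τ m
    simp only [fl]
    rw [Int.floor_eq_iff]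
    constructor
    · rintro ⟨h1, h2⟩; constructor <;> linarith
    · rintro ⟨h1, h2⟩; constructor <;> linarith
  have hwl : ∀ k r, -2 ≤ r → -2 ≤ w k r := fun k r hr => by
    have := (hwm k).monotone hr
    rwa [hw1 k (-2) (by norm_num)] at this
  have hwl' : ∀ k r, r < 2 → w k r < 2 := fun k r hr => by
    have := hwm k hr
    rwa [hw1 k 2 (by norm_num)] at this
  let N : ℝ → ℝ := fun τ => 4 * (fl τ) + w (ix (fl τ)) (τ - 4 * fl τ)
  have hNm : ∀ (τ : ℝ) (m : ℤ), -2 ≤ τ - 4 * m → τ - 4 * m < 2 → N τ = 4 * m + w (ix m) (τ - 4 * m) := by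
    intro τ m h1 h2
    simp only [N]
    rw [(hfl τ m).2 ⟨h1, h2⟩]
  have hflN : ∀ τ, fl (N τ) = fl τ := by
    intro τ
    rw [hfl]
    obtain ⟨h1, h2⟩ := (hfl τ _).1 rfl
    simp only [N, add_sub_cancel_left]
    exact ⟨hwl _ _ h1, hwl' _ _ h2⟩
  have hmono : StrictMono N := by
    intro a b hab
    have hle : fl a ≤ fl b := Int.floor_le_floor (by linarith)
    rcases hle.lt_or_eq with h | h
    · by_contra hcon
      push Not at hcon
      have : fl (N b) ≤ fl (N a) := Int.floor_le_floor (by linarith)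
      rw [hflN, hflN] at this
      omega
    · simp only [N, h]
      have := hwm (ix (fl b)) (show a - 4 * fl b < b - 4 * fl b by linarith)
      linarith
  -- An increasing surjection of the line is continuous, so the junctions need no separate argument.
  have hsurj : Function.Surjective N := by
    intro y
    obtain ⟨h1, h2⟩ := (hfl y _).1 rfl
    set m := fl y with hm
    have h3 := intermediate_value_Icc (show (-2 : ℝ) ≤ 2 by norm_num) (hwc (ix m)).continuousOn
    rw [hw1 _ (-2) (by norm_num), hw1 _ 2 (by norm_num)] at h3
    obtain ⟨r, hr, hry⟩ := h3 ⟨h1, h2.le⟩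
    have hr2 : r < 2 := by
      rcases hr.2.lt_or_eq with h | h
      · exact h
      · rw [h, hw1 _ 2 (by norm_num)] at hry; linarith
    refine ⟨4 * m + r, ?_⟩
    rw [hNm _ m (by linarith [hr.1]) (by linarith), add_sub_cancel_left, hry]
    ring
  refine ⟨N, hmono.monotone.continuous_of_surjective hsurj, hmono, fun τ => ?_, fun k r hr => ?_⟩
  · obtain ⟨h1, h2⟩ := (hfl τ _).1 rfl
    rw [hNm (τ + 4 * n) (fl τ + n) (by push_cast; linarith) (by push_cast; linarith)]
    have hix : ix (fl τ + n) = ix (fl τ) := by simp [ix]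
    rw [hix]
    simp only [N]
    push_cast
    rw [show τ + 4 * (n : ℝ) - 4 * ((fl τ : ℝ) + n) = τ - 4 * fl τ by ring]
    ring
  · rw [abs_le] at hr
    rcases hr.2.lt_or_eq with h | h
    · rw [hNm _ (k : ℕ) (by push_cast; linarith) (by push_cast; linarith)]
      have hix : ix ((k : ℕ) : ℤ) = k := by
        refine Fin.ext ?_
        simp only [ix]
        rw [Int.emod_eq_of_lt (by positivity) (by exact_mod_cast k.2)]
        simp
      rw [hix]
      push_cast
      rw [add_sub_cancel_left]
    · rw [hNm _ ((k : ℕ) + 1) (by push_cast; linarith) (by push_cast; linarith), hw1, h, hw1]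
      · push_cast; ring
      · norm_num
      · push_cast
        rw [show 4 * ((k : ℕ) : ℝ) + r - 4 * (((k : ℕ) : ℝ) + 1) = r - 4 by ring, h]
        norm_num

theorem IsPolygon.apply_rim_eq_starPt {n : ℕ} {P : Disc → StdSphere n} (hP : IsPolygon n P) (k : Fin n) {r : ℝ}
    (h1 : 1 ≤ |r|) (h2 : |r| ≤ 2) : P (rim n (4 * k + r)) = starPt n k (2 - |r|) :=
  Subtype.ext (by rw [hP.edge k r h1 h2, coe_starPt k (by linarith)])

theorem IsPolygon.apply_rim_eq_stdMarked {n : ℕ} {P : Disc → StdSphere n} (hP : IsPolygon n P) (k : Fin n) {r : ℝ}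
    (h1 : |r| = 1) : P (rim n (4 * k + r)) = stdMarked n k := by
  rw [hP.apply_rim_eq_starPt k h1.ge (by rw [h1]; norm_num), h1, ← starPt_one]
  norm_num

/-- A polygon map can be chosen to be compatible with given coordinates on the boundary circles. -/
theorem exists_isPolygon_of_coord {n : ℕ} (hn : 1 ≤ n) (K : Set (Fin n)) (κ : Fin n → StdSphere n → ℂ)
    (hκc : ∀ k ∈ K, ContinuousOn (κ k) (stdCircle n k)) (hκi : ∀ k ∈ K, Set.InjOn (κ k) (stdCircle n k))
    (hκn : ∀ k ∈ K, ∀ z ∈ stdCircle n k, ‖κ k z‖ = 1) (hκm : ∀ k ∈ K, κ k (stdMarked n k) = -1) :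
    ∃ P, IsPolygon n P ∧ ∀ k ∈ K, ∃ ε : ℝ, (ε = 1 ∨ ε = -1) ∧
      ∀ r : ℝ, |r| ≤ 1 → κ k (P (rim n (4 * k + r))) = unitLoop (ε * r / 2) := by
  classical
  obtain ⟨P, hP⟩ := exists_isPolygon hn
  have hrc := continuous_rim n
  have hPc := hP.continuous
  -- Arcs over circles in `K` get constant speed in the given coordinate; other arcs and the edges
  -- are not changed. Two sides over one cut will then be glued by an affine map.
  have hex : ∀ k : Fin n, ∃ w : ℝ → ℝ, Continuous w ∧ StrictMono w ∧ (∀ r, 1 ≤ |r| → w r = r) ∧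
      (k ∈ K → ∃ ε : ℝ, (ε = 1 ∨ ε = -1) ∧
        ∀ r, |r| ≤ 1 → κ k (P (rim n (4 * k + w r))) = unitLoop (ε * r / 2)) := by
    intro k
    by_cases hk : k ∈ K
    · obtain ⟨w, ε, hε, h1, h2, h3, h4⟩ := exists_arc_reparametrization
        (u := fun r => κ k (P (rim n (4 * k + r))))
        ((hκc k hk).comp (f := fun r : ℝ => P (rim n (4 * k + r))) (by fun_prop)
          fun r hr => hP.circle k r (abs_le.2 hr))
        (fun r hr => hκn k hk _ (hP.circle k r hr))
        (by rw [hP.apply_rim_eq_stdMarked k (by norm_num), hκm k hk])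
        (by rw [hP.apply_rim_eq_stdMarked k (by norm_num), hκm k hk])
        (fun r s hr hs h => hP.circle_inj k r s hr hs (hκi k hk (hP.circle k r hr) (hP.circle k s hs) h))
      exact ⟨w, h1, h2, h3, fun _ => ⟨ε, hε, h4⟩⟩
    · exact ⟨id, continuous_id, strictMono_id, fun _ _ => rfl, fun h => (hk h).elim⟩
  choose w hwc hwm hw1 hwκ using hex
  obtain ⟨N, hNc, hNm, hNd, hN⟩ := exists_piecewise hn w hwc hwm hw1
  obtain ⟨E, -, hEn, hE⟩ := exists_homeomorph_disc hn hNc hNm hNd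
  have hw_le : ∀ k r, |r| ≤ 1 → |w k r| ≤ 1 := fun k r hr => by
    rw [abs_le] at hr ⊢
    have e1 := hw1 k 1 (by norm_num)
    have e2 := hw1 k (-1) (by norm_num)
    exact ⟨e2 ▸ (hwm k).monotone hr.1, e1 ▸ (hwm k).monotone hr.2⟩
  have hw_one : ∀ k r, |w k r| = 1 → |r| = 1 := fun k r h => by
    have h2 : w k (w k r) = w k r := hw1 k _ h.ge
    rwa [(hwm k).injective h2] at h
  have hPE : ∀ (k : Fin n) (r : ℝ), |r| ≤ 2 → P (E (rim n (4 * k + r))) = P (rim n (4 * k + w k r)) :=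
    fun k r hr => by rw [hE, hN k r hr]
  refine ⟨P ∘ E, ⟨hP.continuous.comp E.continuous, hP.surjective.comp E.surjective, fun z v hz h => ?_,
    fun k r h1 h2 => ?_, fun k r hr => ?_, fun k r s hr hs h => ?_, fun k z hz => ?_⟩, fun k hk => ?_⟩
  · exact E.injective (hP.eq_of_norm_lt _ _ (by rwa [hEn]) h)
  · rw [Function.comp, hPE k r h2, hw1 k r h1, hP.edge k r h1 h2]
  · rw [Function.comp, hPE k r (by linarith)]
    exact hP.circle k _ (hw_le k r hr)
  · rw [Function.comp, hPE k r (by linarith), Function.comp, hPE k s (by linarith)] at h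
    rcases hP.circle_inj k _ _ (hw_le k r hr) (hw_le k s hs) h with h2 | h2
    · exact Or.inl ((hwm k).injective h2)
    · exact Or.inr ⟨hw_one k r h2.1, hw_one k s h2.2⟩
  · obtain ⟨r, hr, rfl⟩ := hP.circle_surj k z hz
    have h3 := intermediate_value_Icc (show (-1 : ℝ) ≤ 1 by norm_num) (hwc k).continuousOn
    rw [hw1 _ (-1) (by norm_num), hw1 _ 1 (by norm_num)] at h3
    obtain ⟨s, hs, hsr⟩ := h3 (abs_le.1 hr)
    refine ⟨s, abs_le.2 hs, ?_⟩
    rw [Function.comp, hPE k s (by linarith [abs_le.2 hs]), hsr]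
  · obtain ⟨ε, hε, h⟩ := hwκ k hk
    exact ⟨ε, hε, fun r hr => by rw [Function.comp, hPE k r (by linarith), h r hr]⟩

end ArcNormalization

/-! ### Vertices of the polygons and affine identifications of sides. -/

section Vertices

/-- The parameters of the vertices of a polygon. -/
def IsVertex (τ : ℝ) : Prop := ∃ m : ℤ, τ = m ∧ ¬ (4 : ℤ) ∣ m

/-- The parameters `4 * k ± 1` give the marked point of a circle and `4 * k ± 2` the centre of the
star; a multiple of `4` is the middle of a circular side and no vertex. -/
theorem isVertex_four_mul_add (k : ℤ) {r : ℝ} (h : |r| = 1 ∨ |r| = 2) : IsVertex (4 * k + r) := by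
  rcases h with h | h
  · rcases (abs_eq (by norm_num)).1 h with rfl | rfl
    · exact ⟨4 * k + 1, by push_cast; ring, by omega⟩
    · exact ⟨4 * k - 1, by push_cast; ring, by omega⟩
  · rcases (abs_eq (by norm_num)).1 h with rfl | rfl
    · exact ⟨4 * k + 2, by push_cast; ring, by omega⟩
    · exact ⟨4 * k - 2, by push_cast; ring, by omega⟩

theorem IsVertex.add {τ : ℝ} (h : IsVertex τ) (m : ℤ) (n : ℕ) : IsVertex (τ + m * (4 * n)) := by
  obtain ⟨l, rfl, hl⟩ := h
  refine ⟨l + m * (4 * n), by push_cast; ring, fun hd => hl ?_⟩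
  have : (4 : ℤ) ∣ m * (4 * n) := ⟨m * n, by ring⟩
  exact (Int.dvd_add_left this).1 hd

/-- Every parameter can be moved by a period to an interval `[4k - 2, 4k + 2]`. -/
theorem exists_eq_four_mul_add {n : ℕ} (hn : 1 ≤ n) (τ : ℝ) :
    ∃ (k : Fin n) (r : ℝ) (m : ℤ), |r| ≤ 2 ∧ τ = (4 * k + r) + m * (4 * n) := by
  have hn' : (0 : ℤ) < n := by exact_mod_cast hn
  set l := ⌊τ / 4 + 1 / 2⌋ with hl
  have h1 := Int.floor_le (τ / 4 + 1 / 2)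
  have h2 := Int.lt_floor_add_one (τ / 4 + 1 / 2)
  rw [← hl] at h1 h2
  have h3 := Int.emod_nonneg l hn'.ne'
  have h4 := Int.emod_lt_of_pos l hn'
  refine ⟨⟨(l % n).toNat, by omega⟩, τ - 4 * l, l / n, ?_, ?_⟩
  · rw [abs_le]; constructor <;> linarith
  · have h5 : (((l % n).toNat : ℕ) : ℤ) = l % n := Int.toNat_of_nonneg h3
    have h6 : (((l % n).toNat : ℕ) : ℝ) = ((l % n : ℤ) : ℝ) := by exact_mod_cast h5
    have h7 : ((l : ℤ) : ℝ) = ((l % n : ℤ) : ℝ) + (n : ℝ) * ((l / n : ℤ) : ℝ) := by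
      exact_mod_cast (Int.emod_add_mul_ediv l n).symm
    simp only [h6]
    linarith

/-- The identifications on the boundaries of two cells along an arc. -/
def GluesArc {S : Type*} (R R' : ℝ → S) (τ σ : ℝ) : Prop :=
  ∃ p q a ε : ℝ, (ε = 1 ∨ ε = -1) ∧ p < τ ∧ τ < q ∧ σ = ε * τ + a ∧ IsVertex p ∧ IsVertex q ∧
    IsVertex (ε * p + a) ∧ IsVertex (ε * q + a) ∧ (∀ r, p < r → r < q → R r = R' (ε * r + a)) ∧
    Set.InjOn R (Set.Ioo p q)

/-- In `GluesArc` the map `r ↦ ε * r + a` of slope `±1` takes a side to a side and its ends to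
vertices; periods are absorbed by the constant term. -/
theorem GluesArc.shift {S : Type*} {R R' : ℝ → S} {τ σ : ℝ} (h : GluesArc R R' τ σ) {n n' : ℕ} (m m' : ℤ)
    (hR : ∀ τ (m : ℤ), R (τ + m * (4 * n)) = R τ) (hR' : ∀ τ (m : ℤ), R' (τ + m * (4 * n')) = R' τ) :
    GluesArc R R' (τ + m * (4 * n)) (σ + m' * (4 * n')) := by
  obtain ⟨p, q, a, ε, hε, hp, hq, hσ, vp, vq, vp', vq', hg, hi⟩ := h
  have hRm : ∀ r, R (r - m * (4 * n)) = R r := fun r => by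
    have := hR r (-m)
    rw [← this]; congr 1; push_cast; ring
  refine ⟨p + m * (4 * n), q + m * (4 * n), a - ε * (m * (4 * n)) + m' * (4 * n'), ε, hε, by linarith, by linarith,
    by rw [hσ]; ring, vp.add m n, vq.add m n, ?_, ?_, fun r h1 h2 => ?_, fun r hr s hs h => ?_⟩
  · convert vp'.add m' n' using 1; ring
  · convert vq'.add m' n' using 1; ring
  · rw [← hRm, hg _ (by linarith) (by linarith), ← hR' _ m']
    congr 1; ring
  · have h2 := hi (show r - m * (4 * n) ∈ _ from ⟨by linarith [hr.1], by linarith [hr.2]⟩)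
      (show s - m * (4 * n) ∈ _ from ⟨by linarith [hs.1], by linarith [hs.2]⟩) (by rw [hRm, hRm, h])
    linarith

end Vertices

/-! ### The surface as a union of polygons glued along their sides. -/

section Cells

open Complex

variable {S : Type*} [TopologicalSpace S] [ChartedSpace (EuclideanHalfSpace 2) S] [ESurface S]

/-- Coordinates on the cuts of a marking, which take the value `-1` where the graph crosses the cut. -/
def IsCutCoord (M : Marking S) (κ : Set S → S → ℂ) : Prop :=
  ∀ c ∈ M.cuts, ContinuousOn (κ c) c ∧ Set.InjOn (κ c) c ∧ (∀ x ∈ c, ‖κ c x‖ = 1) ∧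
    ∀ x ∈ c, x ∈ ⋃₀ M.edges → κ c x = -1

theorem exists_isCutCoord (M : Marking S) : ∃ κ : Set S → S → ℂ, IsCutCoord M κ := by
  have h : ∀ c : Set S, ∃ κ : S → ℂ, c ∈ M.cuts → ContinuousOn κ c ∧ Set.InjOn κ c ∧ (∀ x ∈ c, ‖κ x‖ = 1) ∧
      ∀ x ∈ c, x ∈ ⋃₀ M.edges → κ x = -1 := by
    intro c
    by_cases hc : c ∈ M.cuts
    · obtain ⟨p, ⟨hp, -⟩, hu⟩ := M.crossing c hc
      obtain ⟨κ, h1, h2, h3, h4⟩ := M.isCutSystem.exists_coord hc hp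
      exact ⟨κ, fun _ => ⟨h1, h2, h3, fun x hx hxe => by rw [hu x ⟨hx, hxe⟩, h4]⟩⟩
    · exact ⟨fun _ => 0, fun h => (hc h).elim⟩
  choose κ hκ using h
  exact ⟨κ, fun c hc => hκ c hc⟩

/-- A presentation of a component of the complement of the cuts as a polygon, whose sides are the
edges of the graph and the boundary circles. -/
structure Cell (M : Marking S) (κ : Set S → S → ℂ) (W : Set S) where
  n : ℕ
  χ : StdSphere n → S
  P : Disc → StdSphere n
  one_le : 1 ≤ n
  isPiece : IsPiece M.cuts W n χ
  edges_eq : {e ∈ M.edges | (e ∩ W).Nonempty} = {e | ∃ k, e = χ '' stdEdge n k}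
  arrows_eq : {e ∈ M.arrows | (e ∩ W).Nonempty} = {e | ∃ k : Fin n, (k : ℕ) = 0 ∧ e = χ '' stdEdge n k}
  isPolygon : IsPolygon n P
  coord : ∀ k, χ '' stdCircle n k ∈ M.cuts → ∃ ε : ℝ, (ε = 1 ∨ ε = -1) ∧
    ∀ r : ℝ, |r| ≤ 1 → κ (χ '' stdCircle n k) (χ (P (rim n (4 * k + r)))) = unitLoop (ε * r / 2)

theorem exists_cell [ConnectedSpace S] {M : Marking S} {κ : Set S → S → ℂ} (hκ : IsCutCoord M κ) {W : Set S}
    (hW : W ∈ componentsOf (⋃₀ M.cuts)ᶜ) {b : S} (hb : b ∈ (𝓡∂ 2).boundary S) : Nonempty (Cell M κ W) := by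
  obtain ⟨n, χ, h, he, ha⟩ := M.marking_component W hW
  have hn := h.one_le M.isCutSystem hW hb
  -- Each marked point of the piece is the end of an edge. Over a cut it is thus the crossing point,
  -- where the coordinate is `-1`, as the normalization of the arcs requires.
  have hmk : ∀ k, χ (stdMarked n k) ∈ ⋃₀ M.edges := by
    intro k
    refine ⟨χ '' stdEdge n k, ?_, stdMarked n k, ?_, rfl⟩
    · have : χ '' stdEdge n k ∈ {e | ∃ k, e = χ '' stdEdge n k} := ⟨k, rfl⟩
      rw [← he] at this
      exact this.1
    · exact (mem_stdEdge_iff k _).2 ⟨1, by norm_num, le_rfl, (starPt_one n k).symm⟩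
  obtain ⟨P, hP, hPκ⟩ := exists_isPolygon_of_coord hn {k | χ '' stdCircle n k ∈ M.cuts}
    (fun k z => κ (χ '' stdCircle n k) (χ z))
    (fun k hk => (hκ _ hk).1.comp h.continuous.continuousOn fun z hz => ⟨z, hz, rfl⟩)
    (fun k hk => (hκ _ hk).2.1.comp (h.injOn_circle k) fun z hz => ⟨z, hz, rfl⟩)
    (fun k hk z hz => (hκ _ hk).2.2.1 _ ⟨z, hz, rfl⟩)
    (fun k hk => (hκ _ hk).2.2.2 _ ⟨_, stdMarked_mem_circle n k, rfl⟩ (hmk k))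
  exact ⟨⟨n, χ, P, hn, h, he, ha, hP, hPκ⟩⟩

variable {M : Marking S} {κ : Set S → S → ℂ} {W : Set S}

/-- The map from the disc to the surface. -/
def Cell.Q (X : Cell M κ W) (z : Disc) : S := X.χ (X.P z)

/-- The parametrization of the boundary of a cell. -/
def Cell.R (X : Cell M κ W) (τ : ℝ) : S := X.Q (rim X.n τ)

theorem Cell.continuous_Q (X : Cell M κ W) : Continuous X.Q := X.isPiece.continuous.comp X.isPolygon.continuous

theorem Cell.R_add (X : Cell M κ W) (τ : ℝ) (m : ℤ) : X.R (τ + m * (4 * X.n)) = X.R τ := by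
  rw [Cell.R, rim_add_mul X.one_le, Cell.R]

theorem Cell.R_star (X : Cell M κ W) (k : Fin X.n) {r : ℝ} (h1 : 1 ≤ |r|) (h2 : |r| ≤ 2) :
    X.R (4 * k + r) = X.χ (starPt X.n k (2 - |r|)) := by
  rw [Cell.R, Cell.Q, X.isPolygon.apply_rim_eq_starPt k h1 h2]

theorem Cell.R_mem_circle (X : Cell M κ W) (k : Fin X.n) {r : ℝ} (h : |r| ≤ 1) :
    X.R (4 * k + r) ∈ X.χ '' stdCircle X.n k :=
  ⟨_, X.isPolygon.circle k r h, rfl⟩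

theorem Cell.R_circle_inj (X : Cell M κ W) (k : Fin X.n) {r s : ℝ} (hr : |r| ≤ 1) (hs : |s| ≤ 1)
    (h : X.R (4 * k + r) = X.R (4 * k + s)) : r = s ∨ (|r| = 1 ∧ |s| = 1) :=
  X.isPolygon.circle_inj k r s hr hs
    (X.isPiece.injOn_circle k (X.isPolygon.circle k r hr) (X.isPolygon.circle k s hs) h)

theorem Cell.star_mem (X : Cell M κ W) (k : Fin X.n) {l : ℝ} (hl : l < 1) : X.χ (starPt X.n k l) ∈ W :=
  X.isPiece.mem_of_notMem_circle _ fun j => starPt_notMem_circle k j hl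

theorem Cell.star_mem_interior (X : Cell M κ W) (k : Fin X.n) {l : ℝ} (hl : l < 1) :
    X.χ (starPt X.n k l) ∈ (𝓡∂ 2).interior S :=
  X.isPiece.mem_interior fun j => starPt_notMem_circle k j hl

/-- The union of the cuts and the boundary. -/
def cutsBoundary (M : Marking S) : Set S := ⋃₀ M.cuts ∪ (𝓡∂ 2).boundary S

theorem Cell.star_notMem_cutsBoundary (X : Cell M κ W) (hW : W ∈ componentsOf (⋃₀ M.cuts)ᶜ) (k : Fin X.n) {l : ℝ}
    (hl : l < 1) : X.χ (starPt X.n k l) ∉ cutsBoundary M := by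
  rintro (h | h)
  · exact subset_of_mem_componentsOf hW (X.star_mem k hl) h
  · exact mem_boundary_iff_notMem_interior.1 h (X.star_mem_interior k hl)

theorem Cell.circle_mem_cutsBoundary (X : Cell M κ W) {k : Fin X.n} {z : StdSphere X.n} (hz : z ∈ stdCircle X.n k) :
    X.χ z ∈ cutsBoundary M := by
  rcases X.isPiece.image_circle k with h | h
  · exact Or.inr (boundary_subset_of_mem_boundaryComponents h ⟨z, hz, rfl⟩)
  · exact Or.inl ⟨_, h, z, hz, rfl⟩

/-- Sides over circles are thereby distinguished from edges by a property of points of `S` that is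
invariant under morphisms preserving the marking. -/
theorem Cell.R_mem_cutsBoundary_iff (X : Cell M κ W) (hW : W ∈ componentsOf (⋃₀ M.cuts)ᶜ) (k : Fin X.n) {r : ℝ}
    (hr : |r| ≤ 2) : X.R (4 * k + r) ∈ cutsBoundary M ↔ |r| ≤ 1 := by
  constructor
  · intro h
    by_contra hcon
    push Not at hcon
    rw [X.R_star k hcon.le hr] at h
    exact X.star_notMem_cutsBoundary hW k (by linarith) h
  · exact fun h => X.circle_mem_cutsBoundary (X.isPolygon.circle k r h)

theorem Cell.mem_of_norm_lt (X : Cell M κ W) {z : Disc} (hz : ‖(z : ℂ)‖ < 1) : X.Q z ∈ W :=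
  X.isPiece.mem_of_notMem_circle _ fun k => X.isPolygon.notMem_circle hz k

theorem Cell.eq_of_norm_lt (X : Cell M κ W) {z w : Disc} (hz : ‖(z : ℂ)‖ < 1)
    (h : X.Q z = X.Q w) : z = w := by
  refine X.isPolygon.eq_of_norm_lt z w hz (X.isPiece.injOn (X.mem_of_norm_lt hz) ?_ h)
  change X.Q w ∈ W
  rw [← h]
  exact X.mem_of_norm_lt hz

theorem Cell.mem_interior_of_norm_lt (X : Cell M κ W) {z : Disc} (hz : ‖(z : ℂ)‖ < 1) :
    X.Q z ∈ (𝓡∂ 2).interior S :=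
  X.isPiece.mem_interior fun k => X.isPolygon.notMem_circle hz k

variable (X : ∀ i : componentsOf (⋃₀ M.cuts)ᶜ, Cell M κ i)

/-- Points of the star off the circles lie in the component, where `χ` is injective; what remains
are the coincidences on the standard star. -/
theorem glue_star {i j : componentsOf (⋃₀ M.cuts)ᶜ} (k : Fin (X i).n) (l : Fin (X j).n) {r s : ℝ} (hr : 1 < |r|)
    (hr2 : |r| ≤ 2) (hs : 1 < |s|) (hs2 : |s| ≤ 2) (h : (X i).R (4 * k + r) = (X j).R (4 * l + s)) :
    i = j ∧ |r| = |s| ∧ (|r| = 2 ∨ (k : ℕ) = l) := by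
  rw [(X i).R_star k hr.le hr2, (X j).R_star l hs.le hs2] at h
  have h1 := (X i).star_mem k (l := 2 - |r|) (by linarith)
  have h2 := (X j).star_mem l (l := 2 - |s|) (by linarith)
  have hij : i = j := Subtype.ext (eq_of_mem_componentsOf i.2 j.2 h1 (h ▸ h2))
  subst hij
  have h3 := (X i).isPiece.injOn h1 h2 h
  obtain ⟨h4, h5⟩ := starPt_inj (by linarith) (by linarith) h3
  refine ⟨rfl, by linarith, h5.imp (fun h => by linarith) fun h => by rw [h]⟩

/-- The identifications on the boundaries of the cells, for parameters in the basic intervals. -/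
theorem glue_of_abs_le (hκ : IsCutCoord M κ) {i j : componentsOf (⋃₀ M.cuts)ᶜ} (k : Fin (X i).n) (l : Fin (X j).n)
    {r s : ℝ} (hr2 : |r| ≤ 2) (hs2 : |s| ≤ 2) (h : (X i).R (4 * k + r) = (X j).R (4 * l + s)) :
    (IsVertex (4 * k + r) ∧ IsVertex (4 * l + s)) ∨ GluesArc (X i).R (X j).R (4 * k + r) (4 * l + s) := by
  have vX : ∀ {i : componentsOf (⋃₀ M.cuts)ᶜ} (k : Fin (X i).n) {r : ℝ}, |r| = 1 ∨ |r| = 2 →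
      IsVertex (4 * k + r) := fun k r h => by
    have := isVertex_four_mul_add ((k : ℕ) : ℤ) h
    exact_mod_cast this
  have hiff : |r| ≤ 1 ↔ |s| ≤ 1 := by
    rw [← (X i).R_mem_cutsBoundary_iff i.2 k hr2, ← (X j).R_mem_cutsBoundary_iff j.2 l hs2, h]
  by_cases hr1 : |r| ≤ 1
  · have hs1 := hiff.1 hr1
    have injarc : Set.InjOn (X i).R (Set.Ioo (4 * k - 1 : ℝ) (4 * k + 1)) := by
      intro a ha b hb hab
      have ha' : |a - 4 * k| < 1 := abs_lt.2 ⟨by linarith [ha.1], by linarith [ha.2]⟩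
      have hb' : |b - 4 * k| < 1 := abs_lt.2 ⟨by linarith [hb.1], by linarith [hb.2]⟩
      rcases (X i).R_circle_inj k ha'.le hb'.le (by rw [add_sub_cancel, add_sub_cancel, hab]) with h2 | h2
      · linarith
      · linarith [h2.1]
    have vk1 : IsVertex (4 * k - 1) := by rw [sub_eq_add_neg]; exact vX k (by norm_num)
    have vk2 : IsVertex (4 * k + 1) := vX k (by norm_num)
    have vl1 : IsVertex (4 * l - 1) := by rw [sub_eq_add_neg]; exact vX l (by norm_num)
    have vl2 : IsVertex (4 * l + 1) := vX l (by norm_num)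
    -- A side over a boundary component of `S` is glued to itself only, by the identity apart from
    -- its ends. Sides over a cut are compared by the coordinate on the cut.
    rcases (X i).isPiece.image_circle k with hb | hc
    · obtain ⟨hb1, hb2⟩ := (X i).isPiece.mem_of_boundary M.isCutSystem i.2 hb ((X i).isPolygon.circle k r hr1)
      have hxj : (X j).R (4 * l + s) ∈ (j : Set S) := by
        refine (X j).isPiece.mem_of_notMem_cuts j.2 (M.isCutSystem.notMem_of_mem_boundary ?_)
        change (X j).R (4 * l + s) ∈ _
        rw [← h]
        exact hb1
      have hij : i = j := Subtype.ext (eq_of_mem_componentsOf i.2 j.2 hb2 (show (X i).R _ ∈ _ from h ▸ hxj))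
      subst hij
      have hPP := (X i).isPiece.injOn hb2 hxj h
      have hkl : k = l := stdCircle_eq_of_mem ((X i).isPolygon.circle k r hr1)
        (hPP ▸ (X i).isPolygon.circle l s hs1)
      subst hkl
      rcases (X i).R_circle_inj k hr1 hs1 h with h2 | h2
      · subst h2
        rcases hr1.lt_or_eq with h3 | h3
        · rw [abs_lt] at h3
          right
          exact ⟨4 * k - 1, 4 * k + 1, 0, 1, Or.inl rfl, by linarith, by linarith, by ring, vk1, vk2,
            by simpa using vk1, by simpa using vk2, fun t _ _ => by simp, injarc⟩
        · exact Or.inl ⟨vX k (Or.inl h3), vX k (Or.inl h3)⟩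
      · exact Or.inl ⟨vX k (Or.inl h2.1), vX k (Or.inl h2.2)⟩
    · have hxc := (X i).R_mem_circle k hr1
      have hlc : (X j).χ '' stdCircle (X j).n l ∈ M.cuts := by
        refine ((X j).isPiece.image_circle l).resolve_left fun hb => ?_
        have h2 := boundary_subset_of_mem_boundaryComponents hb ((X j).R_mem_circle l hs1)
        rw [← h] at h2
        exact M.isCutSystem.notMem_of_mem_boundary h2 ⟨_, hc, hxc⟩
      have hcc : (X i).χ '' stdCircle (X i).n k = (X j).χ '' stdCircle (X j).n l := by
        by_contra hne
        refine Set.disjoint_left.1 (M.isCutSystem.disjoint hc hlc hne) hxc ?_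
        rw [h]
        exact (X j).R_mem_circle l hs1
      obtain ⟨ε, hε, hεr⟩ := (X i).coord k hc
      obtain ⟨δ, hδ, hδr⟩ := (X j).coord l hlc
      have hu : unitLoop (ε * r / 2) = unitLoop (δ * s / 2) := by
        rw [← hεr r hr1, ← hδr s hs1, ← hcc]
        exact congrArg _ h
      obtain ⟨m, hm⟩ := unitLoop_eq_iff.1 hu
      have hεr1 : |ε * r| = |r| := by rcases hε with rfl | rfl <;> simp
      have hδs1 : |δ * s| = |s| := by rcases hδ with rfl | rfl <;> simp
      have hm2 : ε * r = δ * s + 2 * m := by linarith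
      have b1 := abs_le.1 (hεr1.trans_le hr1)
      have b2 := abs_le.1 (hδs1.trans_le hs1)
      -- The coordinates agree modulo a full turn and lie in `[-1, 1]`, so a nonzero difference
      -- occurs only at the ends.
      have hm3 : m = 0 ∨ (|r| = 1 ∧ |s| = 1) := by
        rcases lt_trichotomy m 0 with h3 | h3 | h3
        · right
          have h4 : (m : ℝ) ≤ -1 := by exact_mod_cast (by omega : m ≤ -1)
          rw [← hεr1, ← hδs1, show ε * r = -1 by linarith, show δ * s = 1 by linarith]
          norm_num
        · exact Or.inl h3
        · right
          have h4 : (1 : ℝ) ≤ m := by exact_mod_cast (by omega : 1 ≤ m)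
          rw [← hεr1, ← hδs1, show ε * r = 1 by linarith, show δ * s = -1 by linarith]
          norm_num
      rcases hm3 with rfl | h3
      · rw [Int.cast_zero, mul_zero, add_zero] at hm2
        have hsr : s = (δ * ε) * r := by
          rcases hδ with rfl | rfl <;> linarith
        have habs : |r| = |s| := by rw [← hεr1, ← hδs1, hm2]
        rcases hr1.lt_or_eq with h3 | h3
        · rw [abs_lt] at h3
          right
          have hδε : δ * ε = 1 ∨ δ * ε = -1 := by
            rcases hδ with rfl | rfl <;> rcases hε with rfl | rfl <;> norm_num
          refine ⟨4 * k - 1, 4 * k + 1, 4 * l - (δ * ε) * (4 * k), δ * ε, hδε, by linarith, by linarith,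
            by rw [hsr]; ring, vk1, vk2, ?_, ?_, fun t h1 h2 => ?_, injarc⟩
          · rcases hδε with h4 | h4 <;> rw [h4]
            · convert vl1 using 1; ring
            · convert vl2 using 1; ring
          · rcases hδε with h4 | h4 <;> rw [h4]
            · convert vl2 using 1; ring
            · convert vl1 using 1; ring
          · have ht : |t - 4 * k| ≤ 1 := abs_le.2 ⟨by linarith, by linarith⟩
            have ht' : |(δ * ε) * (t - 4 * k)| ≤ 1 := by
              rcases hδε with h4 | h4 <;> rw [h4]
              · rwa [one_mul]
              · rwa [neg_one_mul, abs_neg]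
            have e1 := hεr _ ht
            have e2 := hδr _ ht'
            rw [← hcc] at e2
            have e3 : unitLoop (δ * ((δ * ε) * (t - 4 * k)) / 2) = unitLoop (ε * (t - 4 * k) / 2) := by
              congr 2
              rcases hδ with rfl | rfl <;> ring
            have m1 := (X i).R_mem_circle k ht
            have m2 := (X j).R_mem_circle l ht'
            rw [← hcc] at m2
            have e4 := (hκ _ hc).2.1 m1 m2 (show κ _ ((X i).χ _) = κ _ ((X j).χ _) by rw [e1, e2, e3])
            rw [add_sub_cancel] at e4
            rw [e4]
            congr 1
            ring
        · exact Or.inl ⟨vX k (Or.inl h3), vX l (Or.inl (habs ▸ h3))⟩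
      · exact Or.inl ⟨vX k (Or.inl h3.1), vX l (Or.inl h3.2)⟩
  · have hs1 := hr1
    rw [hiff] at hs1
    push Not at hr1 hs1
    obtain ⟨hij, habs, h4⟩ := glue_star X k l hr1 hr2 hs1 hs2 h
    subst hij
    by_cases hr3 : |r| = 2
    · exact Or.inl ⟨vX k (Or.inr hr3), vX l (Or.inr (habs ▸ hr3))⟩
    · have hkl : k = l := Fin.ext (h4.resolve_left hr3)
      subst hkl
      right
      have hrlt : |r| < 2 := lt_of_le_of_ne hr2 hr3
      -- A side along an edge is glued to itself by the identity and to the opposite side of the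
      -- edge by the reflection `4 * k + t ↦ 4 * k - t`.
      have main : ∀ p q : ℝ, (p = 1 ∧ q = 2 ∨ p = -2 ∧ q = -1) → p < r → r < q →
          GluesArc (X i).R (X i).R (4 * k + r) (4 * k + s) := by
        intro p q hpq hp hq
        have hin : ∀ t, p < t → t < q → 1 ≤ |t| ∧ |t| ≤ 2 := by
          intro t h1 h2
          rcases hpq with ⟨rfl, rfl⟩ | ⟨rfl, rfl⟩
          · rw [abs_of_pos (by linarith)]; constructor <;> linarith
          · rw [abs_of_neg (by linarith)]; constructor <;> linarith
        have hval : ∀ t, p < t → t < q → (X i).R (4 * k + -t) = (X i).R (4 * k + t) := by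
          intro t h1 h2
          obtain ⟨h3, h4⟩ := hin t h1 h2
          rw [(X i).R_star k h3 h4, (X i).R_star k (by rwa [abs_neg]) (by rwa [abs_neg]), abs_neg]
        have hinj : Set.InjOn (X i).R (Set.Ioo (4 * k + p) (4 * k + q)) := by
          intro a ha b hb hab
          have ha' := hin (a - 4 * k) (by linarith [ha.1]) (by linarith [ha.2])
          have hb' := hin (b - 4 * k) (by linarith [hb.1]) (by linarith [hb.2])
          have hne : ∀ t, p < t → t < q → 1 < |t| := by
            intro t h1 h2
            rcases hpq with ⟨rfl, rfl⟩ | ⟨rfl, rfl⟩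
            · rw [abs_of_pos (by linarith)]; linarith
            · rw [abs_of_neg (by linarith)]; linarith
          obtain ⟨-, h5, -⟩ := glue_star X (i := i) (j := i) k k
            (hne (a - 4 * k) (by linarith [ha.1]) (by linarith [ha.2])) ha'.2
            (hne (b - 4 * k) (by linarith [hb.1]) (by linarith [hb.2])) hb'.2
            (by rw [add_sub_cancel, add_sub_cancel, hab])
          rcases hpq with ⟨rfl, rfl⟩ | ⟨rfl, rfl⟩
          · rw [abs_of_pos (by linarith [ha.1]), abs_of_pos (by linarith [hb.1])] at h5; linarith
          · rw [abs_of_neg (by linarith [ha.2]), abs_of_neg (by linarith [hb.2])] at h5; linarith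
        have vp : |p| = 1 ∨ |p| = 2 := by rcases hpq with ⟨rfl, rfl⟩ | ⟨rfl, rfl⟩ <;> norm_num
        have vq : |q| = 1 ∨ |q| = 2 := by rcases hpq with ⟨rfl, rfl⟩ | ⟨rfl, rfl⟩ <;> norm_num
        rcases abs_eq_abs.1 habs with h5 | h5
        · subst h5
          exact ⟨4 * k + p, 4 * k + q, 0, 1, Or.inl rfl, by linarith, by linarith, by ring, vX k vp, vX k vq,
            by simpa using vX k vp, by simpa using vX k vq, fun t _ _ => by simp, hinj⟩
        · refine ⟨4 * k + p, 4 * k + q, 8 * k, -1, Or.inr rfl, by linarith, by linarith, by rw [h5]; ring,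
            vX k vp, vX k vq, ?_, ?_, fun t h1 h2 => ?_, hinj⟩
          · convert vX k (r := -p) (by rwa [abs_neg]) using 1; ring
          · convert vX k (r := -q) (by rwa [abs_neg]) using 1; ring
          · have := hval (t - 4 * k) (by linarith) (by linarith)
            rw [add_sub_cancel] at this
            rw [← this]
            congr 1; ring
      rcases le_or_gt 0 r with h0 | h0
      · rw [abs_of_nonneg h0] at hr1 hrlt
        exact main 1 2 (Or.inl ⟨rfl, rfl⟩) hr1 hrlt
      · rw [abs_of_neg h0] at hr1 hrlt
        exact main (-2) (-1) (Or.inr ⟨rfl, rfl⟩) (by linarith) (by linarith)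

/-- The identifications on the boundaries of the cells. -/
theorem glue (hκ : IsCutCoord M κ) {i j : componentsOf (⋃₀ M.cuts)ᶜ} {τ σ : ℝ} (h : (X i).R τ = (X j).R σ) :
    (IsVertex τ ∧ IsVertex σ) ∨ GluesArc (X i).R (X j).R τ σ := by
  obtain ⟨k, r, m, hr, rfl⟩ := exists_eq_four_mul_add (X i).one_le τ
  obtain ⟨l, s, m', hs, rfl⟩ := exists_eq_four_mul_add (X j).one_le σ
  rw [(X i).R_add, (X j).R_add] at h
  rcases glue_of_abs_le X hκ k l hr hs h with ⟨h1, h2⟩ | h1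
  · exact Or.inl ⟨h1.add m _, h2.add m' _⟩
  · exact Or.inr (h1.shift m m' (X i).R_add (X j).R_add)

end Cells

/-! ### Lifts of a marking-preserving morphism fix the vertices. -/

section CellMaps

open Complex

variable {S : Type*} [TopologicalSpace S] [ChartedSpace (EuclideanHalfSpace 2) S] [ESurface S]
  {M : Marking S} {κ : Set S → S → ℂ} {W : Set S}

theorem mem_sUnion_iff_of_image_eq {X : Type*} [TopologicalSpace X] {g : X ≃ₜ X} {E : Set (Set X)}
    (h : Set.image g '' E = E) (x : X) : g x ∈ ⋃₀ E ↔ x ∈ ⋃₀ E := by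
  have h1 : g '' ⋃₀ E = ⋃₀ E := by rw [Set.image_sUnion, h]
  conv_lhs => rw [← h1]
  exact g.injective.mem_set_image

theorem Cell.exists_fin (X : Cell M κ W) (k : ℤ) :
    ∃ (j : Fin X.n) (m : ℤ), k = j + m * X.n ∧ ∀ r, X.R (4 * k + r) = X.R (4 * j + r) := by
  have hn' : (0 : ℤ) < X.n := by exact_mod_cast X.one_le
  have h3 := Int.emod_nonneg k hn'.ne'
  have h4 := Int.emod_lt_of_pos k hn'
  have h5 : (((k % X.n).toNat : ℕ) : ℤ) = k % X.n := Int.toNat_of_nonneg h3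
  have h6 : k = (((k % X.n).toNat : ℕ) : ℤ) + k / X.n * X.n := by
    rw [h5, mul_comm]; exact (Int.emod_add_mul_ediv k X.n).symm
  refine ⟨⟨(k % X.n).toNat, by omega⟩, k / X.n, h6, fun r => ?_⟩
  refine Eq.trans ?_ (X.R_add _ (k / X.n))
  congr 1
  have h7 : (k : ℝ) = (((k % X.n).toNat : ℕ) : ℝ) + ((k / X.n : ℤ) : ℝ) * X.n := by exact_mod_cast h6
  simp only
  linarith

theorem Cell.R_star_inj (X : Cell M κ W) (k l : Fin X.n) {r s : ℝ} (hr : 1 < |r|) (hr2 : |r| ≤ 2) (hs : 1 < |s|)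
    (hs2 : |s| ≤ 2) (h : X.R (4 * k + r) = X.R (4 * l + s)) : |r| = |s| ∧ (|r| = 2 ∨ k = l) := by
  rw [X.R_star k hr.le hr2, X.R_star l hs.le hs2] at h
  have h3 := X.isPiece.injOn (X.star_mem k (l := 2 - |r|) (by linarith))
    (X.star_mem l (l := 2 - |s|) (by linarith)) h
  obtain ⟨h4, h5⟩ := starPt_inj (by linarith) (by linarith) h3
  exact ⟨by linarith, h5.imp_left fun h => by linarith⟩

/-- Lifting to the closed disc needs finite fibres. The open disc is embedded, and on each of the
finitely many arcs a value is taken finitely often. -/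
theorem Cell.finite_fibre (X : Cell M κ W) (x : S) : (X.Q ⁻¹' {x}).Finite := by
  have hA : ∀ k : Fin X.n, {r : ℝ | |r| ≤ 1 ∧ X.R (4 * k + r) = x}.Finite := by
    intro k
    by_cases hne : {r : ℝ | |r| ≤ 1 ∧ X.R (4 * k + r) = x}.Nonempty
    · obtain ⟨r₀, h1, h2⟩ := hne
      refine (Set.toFinite {r₀, 1, -1}).subset fun r hr => ?_
      rcases X.R_circle_inj k hr.1 h1 (hr.2.trans h2.symm) with h | h
      · exact Or.inl h
      · rcases (abs_eq (by norm_num)).1 h.1 with h3 | h3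
        · exact Or.inr (Or.inl h3)
        · exact Or.inr (Or.inr h3)
    · rw [Set.not_nonempty_iff_eq_empty.1 hne]
      exact Set.finite_empty
  have hB : ∀ k : Fin X.n, {r : ℝ | (1 < |r| ∧ |r| ≤ 2) ∧ X.R (4 * k + r) = x}.Finite := by
    intro k
    by_cases hne : {r : ℝ | (1 < |r| ∧ |r| ≤ 2) ∧ X.R (4 * k + r) = x}.Nonempty
    · obtain ⟨r₀, h1, h2⟩ := hne
      refine (Set.toFinite {r₀, -r₀}).subset fun r hr => ?_
      exact abs_eq_abs.1 (X.R_star_inj k k hr.1.1 hr.1.2 h1.1 h1.2 (hr.2.trans h2.symm)).1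
    · rw [Set.not_nonempty_iff_eq_empty.1 hne]
      exact Set.finite_empty
  have hC : {z : Disc | ‖(z : ℂ)‖ < 1 ∧ X.Q z = x}.Subsingleton := fun z hz w hw =>
    X.eq_of_norm_lt hz.1 (hz.2.trans hw.2.symm)
  refine (hC.finite.union (Set.finite_iUnion fun k : Fin X.n => ((hA k).union (hB k)).image
    fun r => rim X.n (4 * k + r))).subset fun z hz => ?_
  rcases z.norm_le.lt_or_eq with h | h
  · exact Or.inl ⟨h, hz⟩
  · obtain ⟨τ, rfl⟩ := exists_rim_eq X.one_le h
    obtain ⟨k, r, m, hr, rfl⟩ := exists_eq_four_mul_add X.one_le τ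
    rw [rim_add_mul X.one_le] at hz ⊢
    refine Or.inr (Set.mem_iUnion.2 ⟨k, r, ?_, rfl⟩)
    rcases le_or_gt |r| 1 with h1 | h1
    · exact Or.inl ⟨h1, hz⟩
    · exact Or.inr ⟨⟨h1, hr⟩, hz⟩

theorem Cell.edge_mem (X : Cell M κ W) (k : Fin X.n) : X.χ '' stdEdge X.n k ∈ M.edges := by
  have : X.χ '' stdEdge X.n k ∈ {e | ∃ k, e = X.χ '' stdEdge X.n k} := ⟨k, rfl⟩
  rw [← X.edges_eq] at this
  exact this.1

theorem Cell.star_mem_edges (X : Cell M κ W) (k : Fin X.n) {l : ℝ} (h0 : 0 ≤ l) (h1 : l ≤ 1) :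
    X.χ (starPt X.n k l) ∈ ⋃₀ M.edges :=
  ⟨_, X.edge_mem k, _, (mem_stdEdge_iff k _).2 ⟨l, h0, h1, rfl⟩, rfl⟩

/-- The image of the open disc. -/
theorem Cell.exists_norm_lt_iff (X : Cell M κ W) (hW : W ∈ componentsOf (⋃₀ M.cuts)ᶜ) (x : S) :
    (∃ z : Disc, ‖(z : ℂ)‖ < 1 ∧ X.Q z = x) ↔ x ∈ W ∧ x ∉ ⋃₀ M.edges ∧ x ∉ (𝓡∂ 2).boundary S := by
  constructor
  · rintro ⟨z, hz, rfl⟩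
    refine ⟨X.mem_of_norm_lt hz, ?_, fun h =>
      mem_boundary_iff_notMem_interior.1 h (X.mem_interior_of_norm_lt hz)⟩
    rintro ⟨e, he, hze⟩
    have h1 : e ∈ {e ∈ M.edges | (e ∩ W).Nonempty} := ⟨he, _, hze, X.mem_of_norm_lt hz⟩
    rw [X.edges_eq] at h1
    obtain ⟨k, rfl⟩ := h1
    obtain ⟨y, hy, hyz⟩ := hze
    obtain ⟨l, h0, h1, rfl⟩ := (mem_stdEdge_iff k y).1 hy
    have h2 : X.R (4 * k + (2 - l)) = X.χ (starPt X.n k l) := by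
      rw [X.R_star k (by rw [abs_of_nonneg] <;> linarith) (by rw [abs_of_nonneg] <;> linarith),
        abs_of_nonneg (by linarith)]
      congr 2
      ring
    have h3 := X.eq_of_norm_lt hz (hyz.symm.trans h2.symm)
    rw [h3, norm_rim] at hz
    exact lt_irrefl _ hz
  · rintro ⟨h1, h2, h3⟩
    obtain ⟨y, rfl⟩ := X.isPiece.subset_range h1
    obtain ⟨z, rfl⟩ := X.isPolygon.surjective y
    rcases z.norm_le.lt_or_eq with h | h
    · exact ⟨z, h, rfl⟩
    · obtain ⟨τ, rfl⟩ := exists_rim_eq X.one_le h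
      obtain ⟨k, r, m, hr, rfl⟩ := exists_eq_four_mul_add X.one_le τ
      rw [rim_add_mul X.one_le] at *
      rcases le_or_gt |r| 1 with h4 | h4
      · rcases X.circle_mem_cutsBoundary (X.isPolygon.circle k r h4) with h5 | h5
        · exact (subset_of_mem_componentsOf hW h1 h5).elim
        · exact (h3 h5).elim
      · refine (h2 ?_).elim
        have h5 : X.χ (X.P (rim X.n (4 * k + r))) = _ := X.R_star k h4.le hr
        rw [h5]
        exact X.star_mem_edges k (by linarith) (by linarith)

/-- The centre of the star. -/
theorem Cell.R_eq_star_iff (X : Cell M κ W) (hW : W ∈ componentsOf (⋃₀ M.cuts)ᶜ) (k₀ : Fin X.n) (τ : ℝ) :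
    X.R τ = X.χ (starPt X.n k₀ 0) ↔ ∃ m : ℤ, τ = 4 * m + 2 := by
  have h2 : X.R (4 * k₀ + 2) = X.χ (starPt X.n k₀ 0) := by
    rw [X.R_star k₀ (by norm_num) (by norm_num)]
    norm_num
  constructor
  · intro h
    obtain ⟨k, r, m, hr, rfl⟩ := exists_eq_four_mul_add X.one_le τ
    rw [X.R_add] at h
    have h1 : 1 < |r| := by
      by_contra hcon
      push Not at hcon
      rw [← X.R_mem_cutsBoundary_iff hW k hr, h] at hcon
      exact X.star_notMem_cutsBoundary hW k₀ (by norm_num) hcon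
    have h3 := (X.R_star_inj k k₀ h1 hr (s := 2) (by norm_num) (by norm_num) (h.trans h2.symm)).1
    rw [abs_of_pos (show (0 : ℝ) < 2 by norm_num)] at h3
    rcases (abs_eq (by norm_num)).1 h3 with h4 | h4
    · exact ⟨k + m * X.n, by rw [h4]; push_cast; ring⟩
    · exact ⟨k - 1 + m * X.n, by rw [h4]; push_cast; ring⟩
  · rintro ⟨m, rfl⟩
    obtain ⟨j, -, -, hj⟩ := X.exists_fin m
    rw [hj, X.R_star j (by norm_num) (by norm_num)]
    norm_num
    rw [starPt_zero]

/-- An increasing bijection of the integers is a translation. -/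
theorem eq_add_of_strictMono_of_surjective {π : ℤ → ℤ} (hm : StrictMono π) (hs : Function.Surjective π) (m : ℤ) :
    π m = m + π 0 := by
  have h1 : ∀ m, π (m + 1) = π m + 1 := by
    intro m
    have h2 : π m < π (m + 1) := hm (by omega)
    obtain ⟨j, hj⟩ := hs (π m + 1)
    have h3 : m < j := hm.lt_iff_lt.1 (by omega)
    have h4 : π (m + 1) ≤ π j := hm.monotone (by omega)
    omega
  induction m using Int.induction_on with
  | zero => omega
  | succ i ih => rw [h1, ih]; ring
  | pred i ih =>
    have := h1 (-i - 1)
    rw [sub_add_cancel, ih] at this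
    omega

variable {g : Mor S}

theorem marked_cuts (hg : g • M = M) : Set.image (g : S ≃ₜ S) '' M.cuts = M.cuts := congrArg Marking.cuts hg

theorem marked_edges (hg : g • M = M) : Set.image (g : S ≃ₜ S) '' M.edges = M.edges := congrArg Marking.edges hg

theorem marked_arrows (hg : g • M = M) : Set.image (g : S ≃ₜ S) '' M.arrows = M.arrows := congrArg Marking.arrows hg

theorem mem_boundary_iff (g : Mor S) (x : S) : (g : S ≃ₜ S) x ∈ (𝓡∂ 2).boundary S ↔ x ∈ (𝓡∂ 2).boundary S := by
  conv_lhs => rw [← g.2.1.image_boundary]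
  exact (g : S ≃ₜ S).injective.mem_set_image

theorem mem_cutsBoundary_iff (hg : g • M = M) (x : S) : (g : S ≃ₜ S) x ∈ cutsBoundary M ↔ x ∈ cutsBoundary M :=
  or_congr (mem_sUnion_iff_of_image_eq (marked_cuts hg) x) (mem_boundary_iff g x)

/-- A morphism that preserves a marking and a component fixes the centre of the star of the component. -/
theorem Cell.map_star (X : Cell M κ W) (hW : W ∈ componentsOf (⋃₀ M.cuts)ᶜ) (hg : g • M = M)
    (hgW : (g : S ≃ₜ S) '' W = W) {k₀ : Fin X.n} (hk₀ : (k₀ : ℕ) = 0) :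
    (g : S ≃ₜ S) '' (X.χ '' stdEdge X.n k₀) = X.χ '' stdEdge X.n k₀ ∧
      (g : S ≃ₜ S) (X.χ (starPt X.n k₀ 0)) = X.χ (starPt X.n k₀ 0) := by
  set e₀ := X.χ '' stdEdge X.n k₀ with he₀
  have h1 : (g : S ≃ₜ S) '' e₀ = e₀ := by
    have h2 : e₀ ∈ {e ∈ M.arrows | (e ∩ W).Nonempty} := by
      rw [X.arrows_eq]; exact ⟨k₀, hk₀, rfl⟩
    have h3 : (g : S ≃ₜ S) '' e₀ ∈ {e ∈ M.arrows | (e ∩ W).Nonempty} := by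
      refine ⟨?_, ?_⟩
      · rw [← marked_arrows hg]; exact ⟨_, h2.1, rfl⟩
      · rw [← hgW, ← Set.image_inter (g : S ≃ₜ S).injective]
        exact h2.2.image _
    rw [X.arrows_eq] at h3
    obtain ⟨k, hk, hke⟩ := h3
    rw [hke, he₀]
    have : k = k₀ := Fin.ext (hk.trans hk₀.symm)
    rw [this]
  refine ⟨h1, ?_⟩
  -- The distinguished edge is an arc from the centre of the star to its only point on the cuts and
  -- the boundary. A homeomorphism of the arc that fixes this end also fixes the other.
  let ψ : unitInterval → S := fun t => X.χ (starPt X.n k₀ t)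
  have hψc : Continuous ψ := X.isPiece.continuous.comp
    ((continuousOn_starPt X.n k₀).comp_continuous continuous_subtype_val fun t => t.2.2)
  have hlt : ∀ t : unitInterval, t ≠ 1 → (t : ℝ) < 1 := fun t ht =>
    lt_of_le_of_ne t.2.2 fun h => ht (Subtype.ext h)
  have hψb : ∀ t, ψ t ∈ cutsBoundary M ↔ t = 1 := by
    intro t
    constructor
    · intro h
      by_contra hne
      exact X.star_notMem_cutsBoundary hW k₀ (hlt t hne) h
    · rintro rfl
      have : starPt X.n k₀ ((1 : unitInterval) : ℝ) = stdMarked X.n k₀ := starPt_one X.n k₀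
      simp only [ψ, this]
      exact X.circle_mem_cutsBoundary (stdMarked_mem_circle X.n k₀)
  have hψi : Function.Injective ψ := by
    intro s t hst
    by_cases hs : s = 1
    · rw [hs]
      exact ((hψb t).1 (hst ▸ (hψb s).2 hs)).symm
    · by_cases ht : t = 1
      · exact (hs ((hψb s).1 (hst.symm ▸ (hψb t).2 ht))).elim
      · have h2 := X.isPiece.injOn (X.star_mem k₀ (hlt s hs)) (X.star_mem k₀ (hlt t ht)) hst
        exact Subtype.ext (starPt_inj s.2.2 t.2.2 h2).1
  have hrange : Set.range ψ = e₀ := by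
    ext x
    constructor
    · rintro ⟨t, rfl⟩
      exact ⟨_, (mem_stdEdge_iff k₀ _).2 ⟨t, t.2.1, t.2.2, rfl⟩, rfl⟩
    · rintro ⟨y, hy, rfl⟩
      obtain ⟨l, h0, h1, rfl⟩ := (mem_stdEdge_iff k₀ y).1 hy
      exact ⟨⟨l, h0, h1⟩, rfl⟩
  have hex : ∀ t, ∃ s, ψ s = (g : S ≃ₜ S) (ψ t) := by
    intro t
    have : (g : S ≃ₜ S) (ψ t) ∈ Set.range ψ := by
      rw [hrange, ← h1, ← hrange]; exact ⟨_, ⟨t, rfl⟩, rfl⟩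
    exact this
  choose h hh using hex
  have hemb : Topology.IsClosedEmbedding ψ := hψc.isClosedEmbedding hψi
  have hc : Continuous h := by
    rw [hemb.isEmbedding.continuous_iff]
    have : ψ ∘ h = fun t => (g : S ≃ₜ S) (ψ t) := funext hh
    rw [this]
    exact (g : S ≃ₜ S).continuous.comp hψc
  have hinj : Function.Injective h := fun s t hst =>
    hψi ((g : S ≃ₜ S).injective (by rw [← hh, ← hh, hst]))
  have hsurj : Function.Surjective h := by
    intro s
    have : ψ s ∈ (g : S ≃ₜ S) '' e₀ := by rw [h1, ← hrange]; exact ⟨s, rfl⟩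
    rw [← hrange] at this
    obtain ⟨_, ⟨t, rfl⟩, ht⟩ := this
    exact ⟨t, hψi (by rw [hh, ht])⟩
  have hone : h 1 = 1 := by
    rw [← hψb, hh, mem_cutsBoundary_iff hg, hψb]
  have hmono : StrictMono h := by
    rcases hc.strictMono_of_inj_boundedOrder' hinj with h2 | h2
    · exact h2
    · have h3 := h2 (show (0 : unitInterval) < 1 from zero_lt_one)
      rw [hone] at h3
      exact (not_lt.2 (h 0).2.2 h3).elim
  have hzero : h 0 = 0 := by
    obtain ⟨t, ht⟩ := hsurj 0
    exact le_antisymm ((hmono.monotone t.2.1).trans_eq ht) (h 0).2.1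
  have := hh 0
  rw [hzero] at this
  exact this.symm

/-- A morphism that preserves a marking and a component lifts to the cell of the component, and its lift
fixes the vertices. -/
theorem Cell.exists_lift (X : Cell M κ W) (hW : W ∈ componentsOf (⋃₀ M.cuts)ᶜ) (hg : g • M = M)
    (hgW : (g : S ≃ₜ S) '' W = W) :
    ∃ (G : Disc ≃ₜ Disc) (F : ℝ → ℝ), (∀ z, X.Q (G z) = (g : S ≃ₜ S) (X.Q z)) ∧ Continuous F ∧ StrictMono F ∧
      (∀ τ, F (τ + 4 * X.n) = F τ + 4 * X.n) ∧ (∀ τ, G (rim X.n τ) = rim X.n (F τ)) ∧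
      ∀ τ, IsVertex τ → F τ = τ := by
  have hgW' : ∀ x, (g : S ≃ₜ S) x ∈ W ↔ x ∈ W := fun x => by
    conv_lhs => rw [← hgW]
    exact (g : S ≃ₜ S).injective.mem_set_image
  have hcell : ∀ x, ((g : S ≃ₜ S) x ∈ W ∧ (g : S ≃ₜ S) x ∉ ⋃₀ M.edges ∧ (g : S ≃ₜ S) x ∉ (𝓡∂ 2).boundary S) ↔
      (x ∈ W ∧ x ∉ ⋃₀ M.edges ∧ x ∉ (𝓡∂ 2).boundary S) := fun x => by
    rw [hgW', mem_sUnion_iff_of_image_eq (marked_edges hg), mem_boundary_iff]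
  obtain ⟨G, hGQ, hGn⟩ := exists_lift_disc_homeomorph X.continuous_Q X.finite_fibre
    (fun z w hz h => X.eq_of_norm_lt hz h) (g : S ≃ₜ S)
    (fun z hz => (X.exists_norm_lt_iff hW _).2 ((hcell _).2 ((X.exists_norm_lt_iff hW _).1 ⟨z, hz, rfl⟩)))
    (fun z hz => (X.exists_norm_lt_iff hW _).2 ((hcell _).1 (by
      rw [(g : S ≃ₜ S).apply_symm_apply]
      exact (X.exists_norm_lt_iff hW _).1 ⟨z, hz, rfl⟩)))
  obtain ⟨F, d, hF, hGF, hFd⟩ := exists_lift_rim X.one_le hGn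
  have hd := degree_eq_one_of_preservesOrientation X.continuous_Q (fun z w hz h => X.eq_of_norm_lt hz h) g.2.1 hGQ
    hGn X.one_le hF hGF hFd
  subst hd
  simp only [Int.cast_one, one_mul] at hFd
  have hmono := strictMono_of_degree_one X.one_le hF hGF hFd
  have hn' : (0 : ℝ) < X.n := by exact_mod_cast X.one_le
  have hsurj := surjective_of_add_eq hF (by positivity) hFd
  have hRF : ∀ τ, X.R (F τ) = (g : S ≃ₜ S) (X.R τ) := fun τ => by
    rw [Cell.R, ← hGF, hGQ, Cell.R]
  let k₀ : Fin X.n := ⟨0, X.one_le⟩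
  obtain ⟨hedge, hstar⟩ := X.map_star hW hg hgW (k₀ := k₀) rfl
  -- The parameters `4 * m + 2` belong to the centre of the star, a fixed point of `g`. So `F`
  -- permutes them, and being increasing it translates them by some `4 * l`.
  have hF2 : ∀ τ, (∃ m : ℤ, F τ = 4 * m + 2) ↔ ∃ m : ℤ, τ = 4 * m + 2 := by
    intro τ
    rw [← X.R_eq_star_iff hW k₀, ← X.R_eq_star_iff hW k₀, hRF]
    conv_lhs => rw [← hstar]
    exact (g : S ≃ₜ S).injective.eq_iff
  choose π hπ using fun m : ℤ => (hF2 (4 * m + 2)).2 ⟨m, rfl⟩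
  have hπm : StrictMono π := by
    intro a b hab
    have h1 : F (4 * a + 2) < F (4 * b + 2) := hmono (by
      have : (a : ℝ) < b := by exact_mod_cast hab
      linarith)
    rw [hπ, hπ] at h1
    have : (π a : ℝ) < π b := by linarith
    exact_mod_cast this
  have hπs : Function.Surjective π := by
    intro m
    obtain ⟨τ, hτ⟩ := hsurj (4 * m + 2)
    obtain ⟨j, rfl⟩ := (hF2 τ).1 ⟨m, hτ⟩
    refine ⟨j, ?_⟩
    rw [hπ] at hτ
    have : (π j : ℝ) = m := by linarith
    exact_mod_cast this
  set l := π 0 with hl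
  have hFl : ∀ m : ℤ, F (4 * m + 2) = 4 * m + 2 + 4 * l := by
    intro m
    rw [hπ, eq_add_of_strictMono_of_surjective hπm hπs m]
    push_cast
    ring
  obtain ⟨j, q, hjq, hj⟩ := X.exists_fin l
  -- Just before `2` the boundary runs along the distinguished edge, and just before `4 * l + 2`
  -- along the edge with index `l` modulo `n`. These agree as `g` preserves the distinguished edge.
  have hj0 : j = k₀ := by
    have h2 : F 2 = 4 * l + 2 := by have := hFl 0; norm_num at this; linarith
    have hev : ∀ᶠ r in nhdsWithin (2 : ℝ) (Set.Iio 2), 4 * l + 1 < F r ∧ 1 < r := by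
      refine Filter.Eventually.and ?_ ?_
      · exact nhdsWithin_le_nhds (hF.continuousAt.eventually (lt_mem_nhds (by rw [h2]; linarith)))
      · exact nhdsWithin_le_nhds (lt_mem_nhds (by norm_num))
    obtain ⟨r, ⟨hr1, hr2⟩, hr3⟩ := (hev.and self_mem_nhdsWithin).exists
    have hr3 : r < 2 := hr3
    have hr4 : F r < 4 * l + 2 := h2 ▸ hmono hr3
    have e1 : X.R r = X.χ (starPt X.n k₀ (2 - r)) := by
      have := X.R_star k₀ (r := r) (by rw [abs_of_pos] <;> linarith) (by rw [abs_of_pos] <;> linarith)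
      rw [abs_of_pos (by linarith)] at this
      rw [← this]
      congr 1
      simp [k₀]
    have e2 : X.R (F r) = X.χ (starPt X.n j (2 - (F r - 4 * l))) := by
      have := hj (F r - 4 * l)
      rw [add_sub_cancel] at this
      rw [this, X.R_star j (by rw [abs_of_pos] <;> linarith) (by rw [abs_of_pos] <;> linarith),
        abs_of_pos (by linarith)]
    have e3 : X.R (F r) ∈ X.χ '' stdEdge X.n k₀ := by
      rw [← hedge, hRF, e1]
      exact ⟨_, ⟨_, (mem_stdEdge_iff k₀ _).2 ⟨_, by linarith, by linarith, rfl⟩, rfl⟩, rfl⟩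
    obtain ⟨y, hy, hyr⟩ := e3
    obtain ⟨μ, h0, h1, rfl⟩ := (mem_stdEdge_iff k₀ y).1 hy
    rw [e2] at hyr
    have hjW := X.star_mem j (l := 2 - (F r - 4 * l)) (by linarith)
    have e4 := X.isPiece.injOn (show X.χ _ ∈ W from hyr ▸ hjW) hjW hyr
    obtain ⟨e5, e6⟩ := starPt_inj h1 (by linarith) e4
    rcases e6 with e6 | e6
    · linarith
    · exact e6.symm
  have hlq : (l : ℝ) = q * X.n := by
    rw [hj0] at hjq
    have : l = q * X.n := by simpa [k₀] using hjq
    exact_mod_cast this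
  -- Since `l` is a multiple of `n`, this lifts the same boundary map, and it fixes the points `4 *
  -- m + 2`.
  let F' : ℝ → ℝ := fun τ => F τ - 4 * l
  have hRF' : ∀ τ, X.R (F' τ) = (g : S ≃ₜ S) (X.R τ) := fun τ => by
    rw [← hRF, ← X.R_add (F' τ) q]
    congr 1
    simp only [F']
    rw [hlq]; ring
  have hmono' : StrictMono F' := fun a b hab => sub_lt_sub_right (hmono hab) _
  have hsurj' : Function.Surjective F' := fun y => by
    obtain ⟨x, hx⟩ := hsurj (y + 4 * l)
    exact ⟨x, by simp only [F']; linarith⟩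
  have hfix2 : ∀ m : ℤ, F' (4 * m + 2) = 4 * m + 2 := fun m => by simp only [F', hFl]; ring
  have hfix2' : ∀ m : ℤ, F' (4 * m - 2) = 4 * m - 2 := fun m => by
    have := hfix2 (m - 1)
    push_cast at this
    rw [show (4 : ℝ) * (m - 1) + 2 = 4 * m - 2 by ring] at this
    exact this
  have hcb : ∀ (m : ℤ) (r : ℝ), |r| ≤ 2 → (X.R (4 * m + r) ∈ cutsBoundary M ↔ |r| ≤ 1) := by
    intro m r hr
    obtain ⟨j, -, -, hj⟩ := X.exists_fin m
    rw [hj, X.R_mem_cutsBoundary_iff hW j hr]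
  have hbetween : ∀ (m : ℤ) (τ : ℝ), |τ - 4 * m| ≤ 2 ↔ |F' τ - 4 * m| ≤ 2 := by
    intro m τ
    rw [abs_le, abs_le]
    have h1 := hmono'.le_iff_le (a := 4 * m - 2) (b := τ)
    have h2 := hmono'.le_iff_le (a := τ) (b := 4 * m + 2)
    rw [hfix2'] at h1
    rw [hfix2] at h2
    constructor
    · rintro ⟨h3, h4⟩
      exact ⟨by linarith [h1.2 (by linarith)], by linarith [h2.2 (by linarith)]⟩
    · rintro ⟨h3, h4⟩
      exact ⟨by linarith [h1.1 (by linarith)], by linarith [h2.1 (by linarith)]⟩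
  -- Between consecutive fixed points the circular side is the part that lies on the cuts or the
  -- boundary, which `g` preserves. So `F'` preserves the side and fixes its ends.
  have hpres : ∀ (m : ℤ) (τ : ℝ), |τ - 4 * m| ≤ 1 ↔ |F' τ - 4 * m| ≤ 1 := by
    have key : ∀ (m : ℤ) (τ : ℝ), |τ - 4 * m| ≤ 2 → (|τ - 4 * m| ≤ 1 ↔ |F' τ - 4 * m| ≤ 1) := by
      intro m τ h
      rw [← hcb m _ h, ← hcb m _ ((hbetween m τ).1 h), add_sub_cancel, add_sub_cancel, hRF',
        mem_cutsBoundary_iff hg]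
    intro m τ
    constructor
    · exact fun h => (key m τ (by linarith)).1 h
    · exact fun h => (key m τ ((hbetween m τ).2 (by linarith))).2 h
  have hfix1 : ∀ m : ℤ, F' (4 * m + 1) = 4 * m + 1 := by
    intro m
    refine le_antisymm ?_ ?_
    · have := (hpres m (4 * m + 1)).1 (by norm_num)
      linarith [(abs_le.1 this).2]
    · obtain ⟨τ, hτ⟩ := hsurj' (4 * m + 1)
      have := (hpres m τ).2 (by rw [hτ]; norm_num)
      rw [← hτ]
      exact hmono'.monotone (by linarith [(abs_le.1 this).2])
  have hfix1' : ∀ m : ℤ, F' (4 * m - 1) = 4 * m - 1 := by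
    intro m
    refine le_antisymm ?_ ?_
    · obtain ⟨τ, hτ⟩ := hsurj' (4 * m - 1)
      have := (hpres m τ).2 (by rw [hτ]; norm_num)
      rw [← hτ]
      exact hmono'.monotone (by linarith [(abs_le.1 this).1])
    · have := (hpres m (4 * m - 1)).1 (by norm_num)
      linarith [(abs_le.1 this).1]
  refine ⟨G, F', hGQ, by fun_prop, hmono', fun τ => by simp only [F', hFd]; ring, fun τ => ?_, ?_⟩
  · rw [hGF, ← rim_add_mul X.one_le (F' τ) q]
    congr 1
    simp only [F']
    rw [hlq]; ring
  · rintro _ ⟨m, rfl, hm⟩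
    have hm4 : m % 4 = 1 ∨ m % 4 = 2 ∨ m % 4 = 3 := by omega
    rcases hm4 with h | h | h
    · have : m = 4 * (m / 4) + 1 := by omega
      rw [this]; push_cast; exact hfix1 _
    · have : m = 4 * (m / 4) + 2 := by omega
      rw [this]; push_cast; exact hfix2 _
    · have : m = 4 * (m / 4 + 1) - 1 := by omega
      rw [this]; exact_mod_cast hfix1' _

end CellMaps

/-! ### From one preserved component to all. -/

section Propagation

variable {S : Type*} [TopologicalSpace S] [ChartedSpace (EuclideanHalfSpace 2) S] [ESurface S]
  {M : Marking S} {κ : Set S → S → ℂ} {W : Set S} {g : Mor S}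

theorem image_mem_components (hg : g • M = M) (hW : W ∈ componentsOf (⋃₀ M.cuts)ᶜ) :
    (g : S ≃ₜ S) '' W ∈ componentsOf (⋃₀ M.cuts)ᶜ := by
  have := image_mem_componentsOf (g : S ≃ₜ S) hW
  rwa [image_compl_sUnion, marked_cuts hg] at this

/-- The component that contains the boundary circle is mapped to a component that meets it. -/
theorem exists_image_eq_of_boundary (hg : g • M = M) {α : Set S} (hα : α ∈ boundaryComponents S)
    (hgα : (g : S ≃ₜ S) '' α = α) : ∃ W ∈ componentsOf (⋃₀ M.cuts)ᶜ, (g : S ≃ₜ S) '' W = W := by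
  obtain ⟨x, hx, rfl⟩ := hα
  have hsub : (𝓡∂ 2).boundary S ⊆ (⋃₀ M.cuts)ᶜ := fun y hy => M.isCutSystem.notMem_of_mem_boundary hy
  have hW : connectedComponentIn (⋃₀ M.cuts)ᶜ x ∈ componentsOf (⋃₀ M.cuts)ᶜ := ⟨x, hsub hx, rfl⟩
  have hxα := mem_connectedComponentIn hx
  have hgx : (g : S ≃ₜ S) x ∈ connectedComponentIn ((𝓡∂ 2).boundary S) x := hgα ▸ ⟨x, hxα, rfl⟩
  exact ⟨_, hW, eq_of_mem_componentsOf (image_mem_components hg hW) hW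
    ⟨x, mem_connectedComponentIn (hsub hx), rfl⟩ (connectedComponentIn_mono x hsub hgx)⟩

/-- The compact image of `χ` contains the closure of `W`; a point of a cut can only come from a
circle over a cut, and cuts are disjoint. -/
theorem IsPiece.exists_circle_eq {C : Set (Set S)} {n : ℕ} {χ : StdSphere n → S} (h : IsPiece C W n χ)
    (hC : IsCutSystem C) (hW : W ∈ componentsOf (⋃₀ C)ᶜ) {x : S} (hx : x ∈ closure W) {c : Set S} (hc : c ∈ C)
    (hxc : x ∈ c) : ∃ k, χ '' stdCircle n k = c := by
  have hcl : closure W ⊆ Set.range χ :=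
    closure_minimal h.subset_range (isCompact_range h.continuous).isClosed
  obtain ⟨z, rfl⟩ := hcl hx
  have hz : ∃ k, z ∈ stdCircle n k := by
    by_contra hcon
    push Not at hcon
    exact notMem_of_mem_cut hW hc hxc (h.mem_of_notMem_circle z hcon)
  obtain ⟨k, hk⟩ := hz
  refine ⟨k, ?_⟩
  rcases h.image_circle k with h1 | h1
  · exact (notMem_of_mem_cut hW hc hxc (h.mem_of_boundary hC hW h1 hk).2).elim
  · exact hC.disjoint.elim_set h1 hc _ ⟨z, hk, rfl⟩ hxc

/-- A vertex on the cut is fixed by the lift, so the cut meets its image; different cuts are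
disjoint. -/
theorem Cell.image_cut_eq (X : Cell M κ W) (hW : W ∈ componentsOf (⋃₀ M.cuts)ᶜ) (hg : g • M = M)
    (hgW : (g : S ≃ₜ S) '' W = W) {k : Fin X.n} (hc : X.χ '' stdCircle X.n k ∈ M.cuts) :
    (g : S ≃ₜ S) '' (X.χ '' stdCircle X.n k) = X.χ '' stdCircle X.n k := by
  obtain ⟨G, F, hGQ, -, -, -, hGF, hfix⟩ := X.exists_lift hW hg hgW
  have h1 : X.R (4 * k + 1) ∈ X.χ '' stdCircle X.n k := X.R_mem_circle k (by norm_num)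
  have h2 : (g : S ≃ₜ S) (X.R (4 * k + 1)) = X.R (4 * k + 1) := by
    rw [Cell.R, ← hGQ, hGF, hfix _ (by exact_mod_cast isVertex_four_mul_add k (r := 1) (by norm_num))]
  have h3 : (g : S ≃ₜ S) '' (X.χ '' stdCircle X.n k) ∈ M.cuts := by
    rw [← marked_cuts hg]; exact ⟨_, hc, rfl⟩
  exact M.isCutSystem.disjoint.elim_set h3 hc _ ⟨_, h1, h2⟩ h1

/-- A morphism that preserves a marking and one component of the complement of the cuts preserves all of them. -/
theorem image_eq_of_mem_components [ConnectedSpace S] (X : ∀ i : componentsOf (⋃₀ M.cuts)ᶜ, Cell M κ i)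
    (hg : g • M = M) {W₀ : Set S} (hW₀ : W₀ ∈ componentsOf (⋃₀ M.cuts)ᶜ) (hgW₀ : (g : S ≃ₜ S) '' W₀ = W₀)
    (hW : W ∈ componentsOf (⋃₀ M.cuts)ᶜ) : (g : S ≃ₜ S) '' W = W := by
  have hC := M.isCutSystem
  have step : ∀ V ∈ componentsOf (⋃₀ M.cuts)ᶜ, ∀ V' ∈ componentsOf (⋃₀ M.cuts)ᶜ, ∀ x ∈ closure V, x ∈ closure V' →
      (g : S ≃ₜ S) '' V = V → (g : S ≃ₜ S) '' V' = V' := by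
    intro V hV V' hV' x hx hx' hgV
    by_cases hne : V = V'
    · rwa [← hne]
    by_cases hxC : x ∈ ⋃₀ M.cuts
    · obtain ⟨c, hc, hxc⟩ := hxC
      obtain ⟨k, hk⟩ := (X ⟨V, hV⟩).isPiece.exists_circle_eq hC hV hx hc hxc
      obtain ⟨k', hk'⟩ := (X ⟨V', hV'⟩).isPiece.exists_circle_eq hC hV' hx' hc hxc
      have hgc : (g : S ≃ₜ S) '' c = c := by
        rw [← hk]
        exact (X ⟨V, hV⟩).image_cut_eq hV hg hgV (hk.symm ▸ hc)
      have hp := (X ⟨V', hV'⟩).isPiece.image g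
      rw [marked_cuts hg] at hp
      -- The image of `V'` is again on a side of `c`, so it is `V` or `V'`; but `V` is already the
      -- image of `V`.
      have hadj : (g : S ≃ₜ S) '' V' ∈ adjacent M.cuts c :=
        ⟨image_mem_components hg hV', _, _, k', hp, by rw [Set.image_comp, hk', hgc]⟩
      rcases eq_or_eq_of_mem_adjacent hc ⟨hV, _, _, k, (X ⟨V, hV⟩).isPiece, hk⟩
        ⟨hV', _, _, k', (X ⟨V', hV'⟩).isPiece, hk'⟩ hadj hne with h | h
      · exact (hne ((g : S ≃ₜ S).injective.image_injective (hgV.trans h.symm))).elim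
      · exact h
    · exact (hne (eq_of_mem_componentsOf hV hV' (mem_componentsOf_of_mem_closure hV hx hxC)
        (mem_componentsOf_of_mem_closure hV' hx' hxC))).elim
  have hfin := hC.finite_components
  -- By `step` the closures of preserved components are disjoint from those of the others. Both
  -- unions are closed and together they cover `S`.
  let A : Set S := ⋃ V ∈ {V ∈ componentsOf (⋃₀ M.cuts)ᶜ | (g : S ≃ₜ S) '' V = V}, closure V
  let B : Set S := ⋃ V ∈ {V ∈ componentsOf (⋃₀ M.cuts)ᶜ | ¬ (g : S ≃ₜ S) '' V = V}, closure V
  have hA : IsClosed A := (hfin.subset (Set.sep_subset _ _)).isClosed_biUnion fun _ _ => isClosed_closure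
  have hB : IsClosed B := (hfin.subset (Set.sep_subset _ _)).isClosed_biUnion fun _ _ => isClosed_closure
  have hAB : Aᶜ = B := by
    ext x
    constructor
    · intro hx
      have h1 : x ∈ ⋃ V ∈ componentsOf (⋃₀ M.cuts)ᶜ, closure V := by
        rw [hC.iUnion_eq_univ fun V _ => ⟨isClosed_closure, subset_closure⟩]
        trivial
      obtain ⟨V, hV, hxV⟩ := Set.mem_iUnion₂.1 h1
      exact Set.mem_iUnion₂.2 ⟨V, ⟨hV, fun h => hx (Set.mem_iUnion₂.2 ⟨V, ⟨hV, h⟩, hxV⟩)⟩, hxV⟩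
    · intro hx hx'
      obtain ⟨V, hV, hxV⟩ := Set.mem_iUnion₂.1 hx'
      obtain ⟨V', hV', hxV'⟩ := Set.mem_iUnion₂.1 hx
      exact hV'.2 (step V hV.1 V' hV'.1 x hxV hxV' hV.2)
  obtain ⟨x₀, hx₀⟩ := nonempty_of_mem_componentsOf hW₀
  have hAu : A = Set.univ := by
    refine (isClopen_iff.1 ⟨hA, ?_⟩).resolve_left fun h => ?_
    · rw [← isClosed_compl_iff, hAB]
      exact hB
    · exact (h ▸ Set.mem_iUnion₂.2 ⟨W₀, ⟨hW₀, hgW₀⟩, subset_closure hx₀⟩ : x₀ ∈ (∅ : Set S))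
  by_contra hcon
  obtain ⟨x, hx⟩ := nonempty_of_mem_componentsOf hW
  have : x ∈ Aᶜ := hAB ▸ Set.mem_iUnion₂.2 ⟨W, ⟨hW, hcon⟩, subset_closure hx⟩
  exact this (hAu ▸ trivial)

end Propagation

/-! ### Compatible isotopies of the polygons descend to the surface. -/

section Gluing

theorem strictMono_combo {F : ℝ → ℝ} (hF : StrictMono F) (t : unitInterval) :
    StrictMono fun τ => (1 - (t : ℝ)) * F τ + t * τ := by
  intro a b hab
  have h1 := hF hab
  have h0 := t.2.1
  have h2 := t.2.2
  simp only
  rcases h2.lt_or_eq with h | h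
  · nlinarith [mul_nonneg h0 (sub_nonneg.2 hab.le), mul_pos (sub_pos.2 h) (sub_pos.2 h1)]
  · rw [h]; linarith

/-- Two lifts of the same map are conjugate along glued arcs. -/
theorem lift_eq_of_glues {S : Type*} {g : S → S} {R R' : ℝ → S} {F F' : ℝ → ℝ} (hF : StrictMono F) (hF' : StrictMono F')
    (hv : ∀ τ, IsVertex τ → F τ = τ) (hv' : ∀ τ, IsVertex τ → F' τ = τ) (hR : ∀ τ, R (F τ) = g (R τ))
    (hR' : ∀ τ, R' (F' τ) = g (R' τ)) {p q a ε : ℝ} (hε : ε = 1 ∨ ε = -1) (hp : IsVertex p) (hq : IsVertex q)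
    (hp' : IsVertex (ε * p + a)) (hq' : IsVertex (ε * q + a)) (hglue : ∀ r, p < r → r < q → R r = R' (ε * r + a))
    (hinj : Set.InjOn R (Set.Ioo p q)) {τ : ℝ} (h1 : p < τ) (h2 : τ < q) : F' (ε * τ + a) = ε * F τ + a := by
  have h3 : p < F τ := hv p hp ▸ hF h1
  have h4 : F τ < q := hv q hq ▸ hF h2
  have hεε : ε * ε = 1 := by rcases hε with rfl | rfl <;> norm_num
  -- Since the ends are fixed, `F τ` and the value brought back from the other side lie in the same
  -- arc. They give the same point of `S`, and the arc is embedded.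
  have h5 : p < ε * (F' (ε * τ + a) - a) ∧ ε * (F' (ε * τ + a) - a) < q := by
    rcases hε with rfl | rfl
    · have e1 := hF' (show 1 * p + a < 1 * τ + a by linarith)
      have e2 := hF' (show 1 * τ + a < 1 * q + a by linarith)
      rw [hv' _ hp'] at e1
      rw [hv' _ hq'] at e2
      constructor <;> linarith
    · have e1 := hF' (show -1 * τ + a < -1 * p + a by linarith)
      have e2 := hF' (show -1 * q + a < -1 * τ + a by linarith)
      rw [hv' _ hp'] at e1
      rw [hv' _ hq'] at e2
      constructor <;> linarith
  have h6 : R (ε * (F' (ε * τ + a) - a)) = R (F τ) := by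
    rw [hglue _ h5.1 h5.2, ← mul_assoc, hεε, one_mul, sub_add_cancel, hR', hR, hglue τ h1 h2]
  have h7 := hinj h5 ⟨h3, h4⟩ h6
  rw [← h7, ← mul_assoc, hεε]
  ring

variable {S : Type*} [TopologicalSpace S] [T2Space S] {ι : Type*} [Finite ι] {n : ι → ℕ}
  {Q : ι → Disc → S} {F : ι → ℝ → ℝ} {K : ι → unitInterval × Disc → Disc} {g : S → S}

/-- On glued arcs the lifts are conjugate by an affine map, which commutes with convex combinations,
and vertices do not move. So no identification is lost or created at time `t`. -/
theorem glued_of_combo {S : Type*} {g : S → S} {R R' : ℝ → S} {F F' : ℝ → ℝ} (hF : StrictMono F) (hF' : StrictMono F')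
    (hv : ∀ τ, IsVertex τ → F τ = τ) (hv' : ∀ τ, IsVertex τ → F' τ = τ) (hR : ∀ τ, R (F τ) = g (R τ))
    (hR' : ∀ τ, R' (F' τ) = g (R' τ))
    (hglue : ∀ τ σ, R τ = R' σ → (IsVertex τ ∧ IsVertex σ) ∨ GluesArc R R' τ σ) (t : unitInterval) (τ σ : ℝ) :
    R ((1 - t) * F τ + t * τ) = R' ((1 - t) * F' σ + t * σ) ↔ R τ = R' σ := by
  have hm := strictMono_combo hF t
  have hm' := strictMono_combo hF' t
  have hfix : ∀ τ, IsVertex τ → (1 - (t : ℝ)) * F τ + t * τ = τ := fun τ h => by rw [hv τ h]; ring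
  have hfix' : ∀ τ, IsVertex τ → (1 - (t : ℝ)) * F' τ + t * τ = τ := fun τ h => by rw [hv' τ h]; ring
  constructor
  · intro h
    rcases hglue _ _ h with ⟨h1, h2⟩ | ⟨p, q, a, ε, hε, hp, hq, hσ, vp, vq, vp', vq', harc, hinj⟩
    · rw [hm.injective (hfix _ h1), hm'.injective (hfix' _ h2)] at h
      exact h
    · have h1 : p < τ := hm.lt_iff_lt.1 (by simp only [hfix p vp]; exact hp)
      have h2 : τ < q := hm.lt_iff_lt.1 (by simp only [hfix q vq]; exact hq)
      have h3 := lift_eq_of_glues hF hF' hv hv' hR hR' hε vp vq vp' vq' harc hinj h1 h2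
      have h4 : σ = ε * τ + a := hm'.injective (by simp only [h3, hσ]; ring)
      rw [h4]
      exact harc τ h1 h2
  · intro h
    rcases hglue _ _ h with ⟨h1, h2⟩ | ⟨p, q, a, ε, hε, h1, h2, rfl, vp, vq, vp', vq', harc, hinj⟩
    · rwa [hfix _ h1, hfix' _ h2]
    · have h3 := lift_eq_of_glues hF hF' hv hv' hR hR' hε vp vq vp' vq' harc hinj h1 h2
      have h4 := hm h1
      have h5 := hm h2
      simp only [hfix p vp] at h4
      simp only [hfix q vq] at h5
      rw [harc _ h4 h5, h3]
      congr 1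
      ring

/-- A family of isotopies of discs that is compatible with the gluing of a space from the discs
descends to the space. -/
theorem exists_isotopy_of_cells (hn : ∀ i, 1 ≤ n i) (hQ : ∀ i, Continuous (Q i)) (hcover : ∀ x, ∃ i z, Q i z = x)
    (hcell : ∀ i j (z w : Disc), ‖(z : ℂ)‖ < 1 → Q i z = Q j w → i = j ∧ z = w)
    (hglue : ∀ i j τ σ, Q i (rim (n i) τ) = Q j (rim (n j) σ) → (IsVertex τ ∧ IsVertex σ) ∨
      GluesArc (fun τ => Q i (rim (n i) τ)) (fun τ => Q j (rim (n j) τ)) τ σ)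
    (hF : ∀ i, StrictMono (F i)) (hv : ∀ i τ, IsVertex τ → F i τ = τ)
    (hFg : ∀ i τ, Q i (rim (n i) (F i τ)) = g (Q i (rim (n i) τ)))
    (hK : ∀ i, Continuous (K i)) (hK0 : ∀ i z, Q i (K i (0, z)) = g (Q i z)) (hK1 : ∀ i z, K i (1, z) = z)
    (hKb : ∀ i t, Function.Bijective fun z => K i (t, z))
    (hKn : ∀ i t z, ‖(K i (t, z) : ℂ)‖ < 1 ↔ ‖(z : ℂ)‖ < 1)
    (hKr : ∀ i (t : unitInterval) τ, K i (t, rim (n i) τ) = rim (n i) ((1 - t) * F i τ + t * τ)) :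
    ∃ H : unitInterval × S → S, Continuous H ∧ (∀ x, H (0, x) = g x) ∧ (∀ x, H (1, x) = x) ∧
      (∀ t, Function.Bijective fun x => H (t, x)) ∧
      ∀ t i τ, IsVertex τ → H (t, Q i (rim (n i) τ)) = Q i (rim (n i) τ) := by
  -- Interior points of cells are not identified with any others, and boundary points are treated by
  -- `glued_of_combo`. One direction makes the maps on `S` well defined, the other makes them
  -- injective.
  have key : ∀ t i j z w, Q i (K i (t, z)) = Q j (K j (t, w)) ↔ Q i z = Q j w := by
    have h1 : ∀ t i j (z w : Disc), ‖(z : ℂ)‖ < 1 → (Q i (K i (t, z)) = Q j (K j (t, w)) ↔ Q i z = Q j w) := by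
      intro t i j z w hz
      constructor
      · intro h
        obtain ⟨rfl, h2⟩ := hcell i j _ _ ((hKn i t z).2 hz) h
        rw [(hKb i t).1 h2]
      · intro h
        obtain ⟨rfl, rfl⟩ := hcell i j _ _ hz h
        rfl
    intro t i j z w
    rcases z.norm_le.lt_or_eq with hz | hz
    · exact h1 t i j z w hz
    rcases w.norm_le.lt_or_eq with hw | hw
    · rw [eq_comm, h1 t j i w z hw, eq_comm]
    obtain ⟨τ, rfl⟩ := exists_rim_eq (hn i) hz
    obtain ⟨σ, rfl⟩ := exists_rim_eq (hn j) hw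
    rw [hKr, hKr]
    exact glued_of_combo (R := fun τ => Q i (rim (n i) τ)) (R' := fun τ => Q j (rim (n j) τ)) (hF i) (hF j) (hv i)
      (hv j) (hFg i) (hFg j) (hglue i j) t τ σ
  choose I Z hIZ using hcover
  let H : unitInterval × S → S := fun y => Q (I y.2) (K (I y.2) (y.1, Z y.2))
  have hH : ∀ t i z, H (t, Q i z) = Q i (K i (t, z)) := fun t i z => (key t _ _ _ _).2 (hIZ _)
  let _ : TopologicalSpace ι := ⊥
  have : DiscreteTopology ι := ⟨rfl⟩
  let π : ι × (unitInterval × Disc) → unitInterval × S := fun y => (y.2.1, Q y.1 y.2.2)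
  have hπ : Continuous π := by
    refine continuous_prod_of_discrete_left.2 fun i => ?_
    exact continuous_fst.prodMk ((hQ i).comp continuous_snd)
  have hπs : Function.Surjective π := fun y => ⟨(I y.2, y.1, Z y.2), Prod.ext rfl (hIZ _)⟩
  -- There are finitely many cells, so the source is compact and continuity can be tested on each
  -- cell.
  have hquot : Topology.IsQuotientMap π := hπ.isClosedMap.isQuotientMap hπ hπs
  refine ⟨H, ?_, fun x => ?_, fun x => ?_, fun t => ⟨fun x y hxy => ?_, fun x => ?_⟩, fun t i τ hτ => ?_⟩
  · rw [hquot.continuous_iff]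
    refine continuous_prod_of_discrete_left.2 fun i => ?_
    have : (fun y : unitInterval × Disc => (H ∘ π) (i, y)) = fun y => Q i (K i y) :=
      funext fun y => hH y.1 i y.2
    rw [this]
    exact (hQ i).comp (hK i)
  · simp only [H, hK0, hIZ]
  · simp only [H, hK1, hIZ]
  · have := (key t _ _ _ _).1 hxy
    rwa [hIZ, hIZ] at this
  · obtain ⟨z, hz⟩ := (hKb (I x) t).2 (Z x)
    refine ⟨Q (I x) z, ?_⟩
    simp only [hH]
    rw [show K (I x) (t, z) = Z x from hz, hIZ]
  · rw [hH, hKr, hv i τ hτ]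
    congr 2
    ring

end Gluing

/-! ### The isotopy runs through morphisms. -/

section Isotopy

variable {S : Type*} [TopologicalSpace S] [ChartedSpace (EuclideanHalfSpace 2) S]

/-- Around a boundary point all small loops have winding number zero. -/
theorem hasWinding_iff_of_mem_boundary {x : S} (hx : x ∈ (𝓡∂ 2).boundary S) {γ : C(unitInterval, S)}
    (hγ : ∀ t, γ t ∈ (chartAt (EuclideanHalfSpace 2) x).source ∧ γ t ≠ x) (h01 : γ 0 = γ 1) (k : ℤ) :
    HasWinding x γ k ↔ k = 0 := by
  have hx0 : (complexChart x x).re = 0 := by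
    have h3 : extChartAt (𝓡∂ 2) x x ∈ frontier (Set.range (𝓡∂ 2)) := hx
    rw [frontier_range_modelWithCornersEuclideanHalfSpace] at h3
    exact h3.symm
  have hne : ∀ t, complexChart x (γ t) - complexChart x x ≠ 0 := fun t h =>
    (hγ t).2 (injOn_complexChart x (hγ t).1 (mem_chart_source _ x) (sub_eq_zero.1 h))
  have hs : ∀ t, complexChart x (γ t) - complexChart x x ∈ Complex.slitPlane := by
    intro t
    have hre : 0 ≤ (complexChart x (γ t) - complexChart x x).re := by
      rw [Complex.sub_re, hx0, sub_zero]
      exact complexChart_re_nonneg x _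
    rcases hre.lt_or_eq with h | h
    · exact Or.inl h
    · exact Or.inr fun him => hne t (Complex.ext h.symm him)
  have hc : Continuous fun t => complexChart x (γ t) - complexChart x x :=
    ((continuousOn_complexChart x).comp_continuous γ.continuous fun t => (hγ t).1).sub continuous_const
  have h0 : HasWinding x γ 0 := by
    refine ⟨⟨fun t => Complex.log (complexChart x (γ t) - complexChart x x), hc.clog hs⟩,
      fun t => Complex.exp_log (hne t), ?_⟩
    simp [h01]
  exact ⟨fun h => h.unique h0, fun h => h ▸ h0⟩

/-- Invariance of domain; orientation is not assumed, since this is used to establish it. -/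
theorem mem_interior_of_homeomorph (f : S ≃ₜ S) {x : S} (hx : x ∈ (𝓡∂ 2).interior S) :
    f x ∈ (𝓡∂ 2).interior S := by
  obtain ⟨F, z, r, hr, hF, hinj, rfl, -⟩ := exists_parametrization hx Filter.univ_mem
  exact (image_mem_nhds_of_injOn (F := f ∘ F) (Metric.closedBall_mem_nhds z hr) (f.continuous.comp_continuousOn hF)
    (f.injective.comp_injOn hinj)).1

theorem mem_boundary_of_homeomorph (f : S ≃ₜ S) {x : S} (hx : x ∈ (𝓡∂ 2).boundary S) :
    f x ∈ (𝓡∂ 2).boundary S := by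
  rw [mem_boundary_iff_notMem_interior] at hx ⊢
  intro h
  exact hx (by simpa using mem_interior_of_homeomorph f.symm h)

variable [ESurface S]

/-- A homeomorphism that is isotopic to the identity preserves the orientation. -/
theorem preservesOrientation_of_isotopy {H : unitInterval × S → S} (hH : Continuous H) (h1 : ∀ x, H (1, x) = x)
    {f : unitInterval → S ≃ₜ S} (hf : ∀ t x, f t x = H (t, x)) (t : unitInterval) : PreservesOrientation (f t) := by
  intro x
  by_cases hx : x ∈ (𝓡∂ 2).interior S
  -- The local degree is constant along the isotopy, so time `t` can be compared with the identity
  -- at time `1`.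
  · obtain ⟨U, hU, h⟩ := exists_hasWinding_iff_of_homotopy hH (x := x)
      (fun s y hy => by rw [← hf, ← hf]; exact (f s).injective.ne hy)
      (fun s => by rw [← hf]; exact mem_interior_of_homeomorph _ hx) 1 t
    refine ⟨U, hU, fun γ hγ h01 k => ?_⟩
    have h2 := h γ hγ h01 k
    have e1 : (⟨fun s => H (1, γ s), by fun_prop⟩ : C(unitInterval, S)) = γ := by
      ext s; exact h1 _
    have e2 : (⟨fun s => H (t, γ s), by fun_prop⟩ : C(unitInterval, S)) = (f t : C(S, S)).comp γ := by
      ext s; exact (hf _ _).symm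
    rw [e1, e2, h1, ← hf] at h2
    exact h2
  · have hx := mem_boundary_iff_notMem_interior.2 hx
    refine ⟨(chartAt (EuclideanHalfSpace 2) x).source ∩ f t ⁻¹' (chartAt (EuclideanHalfSpace 2) (f t x)).source,
      Filter.inter_mem (chart_source_mem_nhds _ x)
        ((f t).continuous.continuousAt (chart_source_mem_nhds _ (f t x))), fun γ hγ h01 k => ?_⟩
    have hγ' := fun s => hγ ⟨s, rfl⟩
    rw [hasWinding_iff_of_mem_boundary hx (fun s => ⟨(hγ' s).1.1, (hγ' s).2⟩) h01,
      hasWinding_iff_of_mem_boundary (mem_boundary_of_homeomorph _ hx)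
        (γ := (f t : C(S, S)).comp γ) (fun s => ⟨(hγ' s).1.2, fun h => (hγ' s).2 ((f t).injective h)⟩)
        (congrArg (f t) h01)]

/-- By compactness each stage is a homeomorphism, its orientation is inherited along the isotopy,
and the marked points do not move; so every stage is a morphism. -/
theorem mem_isotopicToId_of_isotopy {H : unitInterval × S → S} (hH : Continuous H) (h1 : ∀ x, H (1, x) = x)
    (hb : ∀ t, Function.Bijective fun x => H (t, x)) (hm : ∀ t, ∀ x ∈ ESurface.marked, H (t, x) = x) {g : Mor S}
    (h0 : ∀ x, H (0, x) = (g : S ≃ₜ S) x) : g ∈ isotopicToId S := by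
  have hc : ∀ t, Continuous fun x => H (t, x) := fun t => by fun_prop
  let f : unitInterval → S ≃ₜ S := fun t =>
    Continuous.homeoOfEquivCompactToT2 (f := Equiv.ofBijective _ (hb t)) (hc t)
  have hf : ∀ t x, f t x = H (t, x) := fun t x => rfl
  have hmk : ∀ t, f t '' ESurface.marked = ESurface.marked := by
    intro t
    have : Set.EqOn (f t) id ESurface.marked := fun x hx => hm t x hx
    rw [this.image_eq, Set.image_id]
  refine ⟨⟨⟨⟨H, hH⟩, h0, h1⟩, fun t => ⟨⟨f t, preservesOrientation_of_isotopy hH h1 hf t, hmk t⟩, ?_⟩⟩⟩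
  ext x
  rfl

variable {M : Marking S} {κ : Set S → S → ℂ} {W : Set S}

/-- Marked points of the boundary are vertices of the cells. -/
theorem Cell.exists_vertex_of_mem_marked (X : Cell M κ W) (z : Disc) (hz : X.Q z ∈ ESurface.marked) :
    ∃ τ, IsVertex τ ∧ X.R τ = X.Q z := by
  have hb := ESurface.marked_subset hz
  have hk : ∃ k, X.P z ∈ stdCircle X.n k := by
    by_contra hcon
    push Not at hcon
    exact mem_boundary_iff_notMem_interior.1 hb (X.isPiece.mem_interior hcon)
  obtain ⟨k, hk⟩ := hk
  have hβ : X.χ '' stdCircle X.n k ∈ boundaryComponents S :=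
    (X.isPiece.image_circle k).resolve_right fun h =>
      M.isCutSystem.notMem_of_mem_boundary hb ⟨_, h, _, hk, rfl⟩
  have heq := (ESurface.existsUnique_marked _ hβ).unique
    ⟨⟨_, stdMarked_mem_circle X.n k, rfl⟩, X.isPiece.marked k hβ⟩ ⟨⟨_, hk, rfl⟩, hz⟩
  refine ⟨4 * k + 1, by exact_mod_cast isVertex_four_mul_add k (r := 1) (by norm_num), ?_⟩
  rw [X.R_star k (by norm_num) (by norm_num), abs_one, show (2 : ℝ) - 1 = 1 by norm_num, starPt_one]
  exact heq

/-- A morphism that preserves a marking and a boundary component is isotopic to the identity. -/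
theorem mem_isotopicToId_of_smul_eq [ConnectedSpace S] {g : Mor S} (hg : g • M = M) {α : Set S}
    (hα : α ∈ boundaryComponents S) (hgα : (g : S ≃ₜ S) '' α = α) : g ∈ isotopicToId S := by
  obtain ⟨b, hb⟩ := nonempty_of_mem_componentsOf hα
  have hb := boundary_subset_of_mem_boundaryComponents hα hb
  obtain ⟨κ, hκ⟩ := exists_isCutCoord M
  let X : ∀ i : componentsOf (⋃₀ M.cuts)ᶜ, Cell M κ i := fun i => (exists_cell hκ i.2 hb).some
  have : Finite (componentsOf (⋃₀ M.cuts)ᶜ) := M.isCutSystem.finite_components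
  obtain ⟨W₀, hW₀, hgW₀⟩ := exists_image_eq_of_boundary hg hα hgα
  choose G F hGQ hF hmono hFd hGF hfix using fun i : componentsOf (⋃₀ M.cuts)ᶜ =>
    (X i).exists_lift i.2 hg (image_eq_of_mem_components X hg hW₀ hgW₀ i.2)
  choose K hK hK0 hK1 hKb hKn hKr using fun i =>
    exists_disc_isotopy (X i).one_le (hF i) (hmono i) (hFd i) (hGF i)
  have hcover : ∀ x, ∃ i z, (X i).Q z = x := by
    intro x
    have h1 := M.isCutSystem.iUnion_eq_univ (R := closure) fun W _ => ⟨isClosed_closure, subset_closure⟩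
    obtain ⟨W, hW, hx⟩ := Set.mem_iUnion₂.1 (h1.symm ▸ Set.mem_univ x : x ∈ ⋃ W ∈ componentsOf (⋃₀ M.cuts)ᶜ, closure W)
    have h2 : closure W ⊆ Set.range (X ⟨W, hW⟩).Q := by
      refine closure_minimal (fun y hy => ?_) (isCompact_range (X ⟨W, hW⟩).continuous_Q).isClosed
      obtain ⟨u, rfl⟩ := (X ⟨W, hW⟩).isPiece.subset_range hy
      obtain ⟨z, rfl⟩ := (X ⟨W, hW⟩).isPolygon.surjective u
      exact ⟨z, rfl⟩
    obtain ⟨z, hz⟩ := h2 hx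
    exact ⟨⟨W, hW⟩, z, hz⟩
  obtain ⟨H, hH, h0, h1, hHb, hHv⟩ := exists_isotopy_of_cells (g := (g : S ≃ₜ S)) (n := fun i => (X i).n)
    (Q := fun i => (X i).Q) (F := F) (K := K)
    (fun i => (X i).one_le) (fun i => (X i).continuous_Q) hcover
    (fun i j z w hz h => by
      obtain ⟨h2, h3, h4⟩ := ((X i).exists_norm_lt_iff i.2 _).1 ⟨z, hz, rfl⟩
      have hj : (X j).Q w ∈ (j : Set S) :=
        (X j).isPiece.mem_of_notMem_cuts j.2 fun hcon => subset_of_mem_componentsOf i.2 h2 (h ▸ hcon)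
      have hij : i = j := Subtype.ext (eq_of_mem_componentsOf i.2 j.2 h2 (h ▸ hj))
      subst hij
      exact ⟨rfl, (X i).eq_of_norm_lt hz h⟩)
    (fun i j τ σ h => glue X hκ h) hmono hfix (fun i τ => by rw [← hGF, hGQ]) hK
    (fun i z => by rw [hK0, hGQ]) hK1 hKb hKn hKr
  -- Marked points are images of vertices, which the isotopy fixes.
  refine mem_isotopicToId_of_isotopy hH h1 hHb (fun t x hx => ?_) h0
  obtain ⟨i, z, rfl⟩ := hcover x
  obtain ⟨τ, hτ, hR⟩ := (X i).exists_vertex_of_mem_marked z hx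
  rw [← hR]
  exact hHv t i τ hτ

end Isotopy

end ESurf

end

/-- Rigidity: a mapping class of a connected e-surface that fixes the isotopy class of a marking and
a boundary component is the identity. -/
theorem mainTheorem7 {S : Type*} [TopologicalSpace S] [ChartedSpace (EuclideanHalfSpace 2) S]
    [ESurf.ESurface S] [ConnectedSpace S] (α : ESurf.boundaryComponents S)
    (M : ESurf.Marking S) (φ : ESurf.MappingClassGroup S)
    (hM : φ • M.toClass = M.toClass) (hα : φ • α = α) :
    φ = 1 := by
  induction φ using Quotient.inductionOn' with | h f => ?_
  -- Equality of the classes yields `i` isotopic to the identity with `i • M = f • M`; so `i⁻¹ * f`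
  -- preserves the marking itself and represents the same class.
  obtain ⟨i, hi⟩ := MulAction.orbitRel_apply.1 (Quotient.eq''.1 hM)
  have hi : (i : ESurf.Mor S) • M = f • M := hi
  have hfα : f • α = α := hα
  have hiα : (i : ESurf.Mor S) • α = α := Subtype.ext (ESurf.image_eq_of_mem_isotopicToId i.2 α.2)
  have hg : ((i : ESurf.Mor S)⁻¹ * f) • M = M := by
    rw [mul_smul, ← hi, inv_smul_smul]
  have hgα : ((i : ESurf.Mor S)⁻¹ * f) • α = α := by
    rw [mul_smul, hfα, inv_smul_eq_iff, hiα]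
  have hmem := ESurf.mem_isotopicToId_of_smul_eq hg α.2 (congrArg Subtype.val hgα)
  refine (QuotientGroup.eq_one_iff f).2 ?_
  have := (ESurf.isotopicToId S).mul_mem i.2 hmem
  rwa [mul_inv_cancel_left] at this
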